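/- Let $\Omega\subset\mathbb R^2$ be a bounded polygonal domain, $\omega\neq\emptyset$ a domain with $\overline\omega\subset\Omega$, let $\rho>0$ and $\varepsilon_0\ge 0$. Let $H^2_0(\Omega)$ be the closure of $C_c^\infty(\Omega)$ in $H^2(\Omega)$, $H^{-2}(\Omega)$ its dual, $(Bz)(v):=-\int_\Omega z\,\triangle v\,dx$ for $z\in L_2(\Omega)$, $v\in H^2_0(\Omega)$, and $Az:=(Bz,z|_\omega)\in H^{-2}(\Omega)\times L_2(\omega)$. Let $\mathcal T$ be a conforming triangulation of $\Omega$ into closed triangles $K$, each of which contains a disc of radius $\rho\,\mathrm{diam}(K)$. Let $X$ be the space of piecewise constants w.r.t. $\mathcal T$, and $Y$ the Morley space: piecewise quadratics that are continuous at the internal vertices and vanish at the boundary vertices, and whose normal derivatives are continuous at the midpoints $m_e$ of the internal edges $e$ and vanish at the midpoints of the boundary edges. Set $\|v\|_Y:=(\sum_K |v|^2_{H^2(K)})^{1/2}$, $\|f\|_{Y'}:=\sup_{0\ne v\in Y}|f(v)|/\|v\|_Y$, and $(B_{\mathcal T} z)(v):=-\sum_K\int_K z\,\triangle v\,dx$ for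 $v\in H^2_0(\Omega)+Y$. The HCT space consists of the $w\in H^2_0(\Omega)$ that on each $K\in\mathcal T$ are $C^1$ and are cubic on each of the three triangles obtained by connecting the centroid of $K$ with its vertices. For $v\in Y$ let $\widetilde E v$ be the HCT function with $(\widetilde Ev)(\nu)=v(\nu)$ and $\nabla(\widetilde Ev)(\nu)=\nabla (v|_{K_\nu})(\nu)$ at the internal vertices $\nu$, where $K_\nu\ni\nu$ is some selected triangle, and with $\partial_{n_e}\widetilde Ev(m_e)=\partial_{n_e}v(m_e)$ for the internal edges $e$. With $b_e$ the nodal HCT basis function of the degree of freedom $w\mapsto\partial_{n_e}w(m_e)$, the companion operator $E:Y\to H^2_0(\Omega)$ is $$Ev:=\widetilde Ev+\sum_{e\text{ internal}}\frac{\int_e\partial_{n_e}(v-\widetilde Ev)\,ds}{\int_e\partial_{n_e}b_e\,ds}\,b_e .$$ For $(\ell,q)\in H^{-2}(\Omega)\times L_2(\omega)$ define $\ell_{\mathcal T}\in Y'$ by $\ell_{\mathcal T}(v):=\ell(Ev)$, and for $0\le\varepsilon\le\varepsilon_0$ let $$u_\varepsilon:=\operatorname*{argmin}_{z\in X}\|B_{\mathcal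 T}z-\ell_{\mathcal T}\|_{Y'}^2+\|z|_\omega-q\|_{L_2(\omega)}^2+\varepsilon^2\|z\|_{L_2(\Omega)}^2 .$$ For $u\in L_2(\Omega)$ set $\mathcal E_{\rm data}:=\|Au-(\ell,q)\|_{H^{-2}(\Omega)\times L_2(\omega)}$ and $\mathcal E_{\rm appr}:=\min_{z\in X}\|u-z\|_{L_2(\Omega)}$. Then $E$ and $u_\varepsilon$ are well-defined, and there is a constant $C$, depending only on $\Omega,\omega,\rho,\varepsilon_0$, such that for all such $\mathcal T$, all selections $(K_\nu)_\nu$, and all $\ell,q,u$: (i) (consistency with zero oscillation term) for all $z\in X$, $$\sup_{0\ne v\in Y}\frac{|(B_{\mathcal T}z)(v-Ev)+\ell(Ev)-\ell_{\mathcal T}(v)|}{\|v\|_Y}\le C\big(\|\ell-Bu\|_{H^{-2}(\Omega)}+\|u-z\|_{L_2(\Omega)}\big);$$ (ii) for all $\varepsilon\in[0,\varepsilon_0]$, $$\|A(u-u_\varepsilon)\|_{H^{-2}(\Omega)\times L_2(\omega)}+\varepsilon\|u-u_\varepsilon\|_{L_2(\Omega)}\le C\big(\mathcal E_{\rm data}+\mathcal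 E_{\rm appr}+\varepsilon\|u\|_{L_2(\Omega)}\big).$$ (iii) Let moreover $G$ be a domain with $\omega\subseteq G$ and $\overline G\subset\Omega$. Call $\alpha\in(0,1]$ admissible if for some constant $C'$, $\|w\|_{L_2(G)}\le C'\|w\|_{L_2(\omega)}^\alpha\|w\|_{L_2(\Omega)}^{1-\alpha}$ for all harmonic $w\in L_2(\Omega)$. There is an admissible $\alpha<1$. For every admissible $\alpha$ and all $c_1,c_2>0$ there is a constant $C$, depending only on $\Omega,\omega,G,\alpha,\rho,\varepsilon_0,c_1,c_2$, such that whenever $0<\varepsilon\le\varepsilon_0$ and $c_1(\mathcal E_{\rm data}+\mathcal E_{\rm appr})\le\varepsilon\|u\|_{L_2(\Omega)}\le c_2(\mathcal E_{\rm data}+\mathcal E_{\rm appr})$, $$\|u-u_\varepsilon\|_{L_2(G)}\le C\big(\mathcal E_{\rm data}+\mathcal E_{\rm appr}\big)^\alpha\max\big(\mathcal E_{\rm data}+\mathcal E_{\rm appr},\|u\|_{L_2(\Omega)}\big)^{1-\alpha}.$$ -/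

import Mathlib

open MeasureTheory Set

noncomputable section

namespace MorleyUC

/-- The Euclidean plane `ℝ²`. -/
abbrev Plane : Type := EuclideanSpace ℝ (Fin 2)

/-- Order of smoothness of `C^∞` functions. -/
abbrev smooth : WithTop ℕ∞ := ((⊤ : ℕ∞) : WithTop ℕ∞)

/-- The Hilbert space `L₂(S)`. -/
abbrev L2 (S : Set Plane) : Type := Lp ℝ 2 (volume.restrict S)

/-- The `L₂(S)`-norm of a function. -/
def normL2 (S : Set Plane) (f : Plane → ℝ) : ℝ :=
  (eLpNorm f 2 (volume.restrict S)).toReal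

/-! ### The Sobolev space `H²₀(Ω)` -/

/-- Index set of the partial derivatives of order `0`, `1` and `2`. -/
abbrev JetIdx : Type := Unit ⊕ (Fin 2 ⊕ (Fin 2 × Fin 2))

/-- The partial derivative `∂ᵢ f`. -/
def partialD (i : Fin 2) (f : Plane → ℝ) : Plane → ℝ :=
  fun x => fderiv ℝ f x (EuclideanSpace.single i 1)

/-- The partial derivatives of order at most two of a smooth function. -/
def derivOf (f : Plane → ℝ) : JetIdx → Plane → ℝ
  | Sum.inl _ => f
  | Sum.inr (Sum.inl i) => partialD i f
  | Sum.inr (Sum.inr (i, j)) => partialD i (partialD j f)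

/-- Families `(w, ∂ᵢ w, ∂ᵢ∂ⱼ w)` of `L₂(Ω)`-functions, with the `H²`-norm
`(‖w‖² + ∑ᵢ ‖∂ᵢ w‖² + ∑ᵢⱼ ‖∂ᵢ∂ⱼ w‖²)^{1/2}`.  Elements of `H²₀(Ω)` and, more generally, functions
that are only piecewise `H²` (with their elementwise derivatives) are seen inside this space. -/
abbrev JetSpace (Ω : Set Plane) : Type := PiLp 2 (fun _ : JetIdx => L2 Ω)

/-- `φ` is a test function, `φ ∈ C_c^∞(Ω)`. -/
def IsTest (Ω : Set Plane) (φ : Plane → ℝ) : Prop :=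
  ContDiff ℝ smooth φ ∧ HasCompactSupport φ ∧ tsupport φ ⊆ Ω

theorem partialD_contDiff {f : Plane → ℝ} (hf : ContDiff ℝ smooth f) (i : Fin 2) :
    ContDiff ℝ smooth (partialD i f) :=
  (hf.fderiv_right (m := smooth) (by simp)).clm_apply contDiff_const

theorem partialD_add {f g : Plane → ℝ} (hf : ContDiff ℝ smooth f) (hg : ContDiff ℝ smooth g) (i : Fin 2) :
    partialD i (f + g) = partialD i f + partialD i g := by
  funext x
  simp only [partialD, Pi.add_apply]
  rw [fderiv_add (hf.differentiable (by simp) x) (hg.differentiable (by simp) x)]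
  rfl

theorem partialD_smul {f : Plane → ℝ} (hf : ContDiff ℝ smooth f) (c : ℝ) (i : Fin 2) :
    partialD i (c • f) = c • partialD i f := by
  funext x
  simp only [partialD, Pi.smul_apply]
  rw [fderiv_const_smul (hf.differentiable (by simp) x)]
  rfl

theorem derivOf_add {f g : Plane → ℝ} (hf : ContDiff ℝ smooth f) (hg : ContDiff ℝ smooth g) (j : JetIdx) :
    derivOf (f + g) j = derivOf f j + derivOf g j := by
  rcases j with _ | i | ⟨i, j⟩
  · rfl
  · exact partialD_add hf hg i
  · simp only [derivOf]
    rw [partialD_add hf hg, partialD_add (partialD_contDiff hf j) (partialD_contDiff hg j)]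

theorem derivOf_smul {f : Plane → ℝ} (hf : ContDiff ℝ smooth f) (c : ℝ) (j : JetIdx) :
    derivOf (c • f) j = c • derivOf f j := by
  rcases j with _ | i | ⟨i, j⟩
  · rfl
  · exact partialD_smul hf c i
  · simp only [derivOf]
    rw [partialD_smul hf, partialD_smul (partialD_contDiff hf j)]

/-- The image of `C_c^∞(Ω)` in `JetSpace Ω`. -/
def testJets (Ω : Set Plane) : Submodule ℝ (JetSpace Ω) where
  carrier := {w | ∃ φ : Plane → ℝ, IsTest Ω φ ∧
    ∀ j, (w j : Plane → ℝ) =ᵐ[volume.restrict Ω] derivOf φ j}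
  zero_mem' := by
    refine ⟨0, ⟨contDiff_const, HasCompactSupport.zero, by simp [tsupport]⟩, fun j => ?_⟩
    have h0 : derivOf (0 : Plane → ℝ) j = 0 := by
      have := derivOf_smul (f := (0 : Plane → ℝ)) contDiff_const 0 j
      simpa using this
    rw [h0]
    exact Lp.coeFn_zero _ _ _
  add_mem' := by
    rintro a b ⟨φ, ⟨h1, h2, h3⟩, h⟩ ⟨ψ, ⟨k1, k2, k3⟩, k⟩
    refine ⟨φ + ψ, ⟨h1.add k1, h2.add k2, ?_⟩, fun j => ?_⟩
    · exact (tsupport_add φ ψ).trans (union_subset h3 k3)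
    · rw [derivOf_add h1 k1]
      exact (Lp.coeFn_add (a j) (b j)).trans ((h j).add (k j))
  smul_mem' := by
    rintro c a ⟨φ, ⟨h1, h2, h3⟩, h⟩
    refine ⟨c • φ, ⟨h1.const_smul c, h2.smul_left (f := fun _ => c), ?_⟩, fun j => ?_⟩
    · exact (tsupport_smul_subset_right (fun _ => c) φ).trans h3
    · rw [derivOf_smul h1]
      exact (Lp.coeFn_smul c (a j)).trans ((h j).const_smul c)

/-- `H²₀(Ω)`, the closure of `C_c^∞(Ω)` with respect to the `H²(Ω)`-norm. -/
def H20 (Ω : Set Plane) : Submodule ℝ (JetSpace Ω) := (testJets Ω).topologicalClosure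

/-- `H⁻²(Ω)`, the dual of `H²₀(Ω)`, with the dual norm. -/
abbrev HNeg2 (Ω : Set Plane) : Type := H20 Ω →L[ℝ] ℝ

/-- The function underlying an element of `JetSpace Ω`. -/
def JetSpace.fn {Ω : Set Plane} (w : JetSpace Ω) : Plane → ℝ := (w (Sum.inl ()) : Plane → ℝ)

/-- The (elementwise, weak) Laplacian `∑ᵢ ∂ᵢ∂ᵢ w`. -/
def lap (Ω : Set Plane) : JetSpace Ω →L[ℝ] L2 Ω :=
  ∑ i : Fin 2, PiLp.proj (𝕜 := ℝ) 2 (fun _ : JetIdx => L2 Ω) (Sum.inr (Sum.inr (i, i)))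

/-- `B : L₂(Ω) → H⁻²(Ω)`, `(B z)(v) = -∫_Ω z Δv`. -/
def opB (Ω : Set Plane) (z : L2 Ω) : HNeg2 Ω :=
  -((innerSL ℝ z).comp ((lap Ω).comp (H20 Ω).subtypeL))

theorem opB_apply (Ω : Set Plane) (z : L2 Ω) (v : H20 Ω) :
    opB Ω z v = -∫ x in Ω, z x * lap Ω v x := by
  simp only [opB, neg_apply, ContinuousLinearMap.comp_apply,
    innerSL_apply_apply, Submodule.subtypeL_apply, L2.inner_def]
  simp [mul_comm]

/-! ### Triangulations -/

/-- The closed triangle (or edge) with the given vertices. -/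
def hull (K : Finset Plane) : Set Plane := convexHull ℝ (K : Set Plane)

/-- A conforming triangulation of the polygon `Ω`: finitely many nondegenerate closed triangles,
given by their vertex sets, two of which intersect in their common face, and whose union is the
closed polygon. -/
structure Triangulation (Ω : Set Plane) where
  cells : Finset (Finset Plane)
  card_eq : ∀ K ∈ cells, K.card = 3
  indep : ∀ K ∈ cells, AffineIndependent ℝ ((↑) : K → Plane)
  conforming : ∀ K ∈ cells, ∀ L ∈ cells,
    hull K ∩ hull L = convexHull ℝ ((K : Set Plane) ∩ (L : Set Plane))
  cover : interior (⋃ K ∈ cells, hull K) = Ω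

/-- Shape regularity: each triangle contains a disc of radius `ρ` times its diameter. -/
def Triangulation.ShapeRegular {Ω : Set Plane} (T : Triangulation Ω) (ρ : ℝ) : Prop :=
  ∀ K ∈ T.cells, ∃ x, Metric.closedBall x (ρ * Metric.diam (hull K)) ⊆ hull K

/-- The midpoint `m_e` of an edge. -/
def mid (e : Finset Plane) : Plane := (1 / 2 : ℝ) • ∑ x ∈ e, x

/-- The centroid of a triangle. -/
def bary (K : Finset Plane) : Plane := (1 / 3 : ℝ) • ∑ x ∈ K, x

/-- `n` is orthogonal to the edge `e`. -/
def IsNormal (e : Finset Plane) (n : Plane) : Prop :=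
  ∀ a ∈ e, ∀ b ∈ e, inner ℝ n (a - b) = 0

open Classical in
/-- The set of edges. -/
def Triangulation.edges {Ω : Set Plane} (T : Triangulation Ω) : Finset (Finset Plane) :=
  T.cells.biUnion (Finset.powersetCard 2)

open Classical in
/-- The set of internal edges; by conformity an edge is contained in `∂Ω` unless its midpoint
is in `Ω`. -/
def Triangulation.intEdges {Ω : Set Plane} (T : Triangulation Ω) : Finset (Finset Plane) :=
  T.edges.filter (fun e => mid e ∈ Ω)

/-- `n e` is a unit normal of `e` for every edge `e`. The orientations are arbitrary. -/
def Triangulation.IsNormalField {Ω : Set Plane} (T : Triangulation Ω)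
    (n : Finset Plane → Plane) : Prop :=
  ∀ e ∈ T.edges, ‖n e‖ = 1 ∧ IsNormal e (n e)

/-- `sel` selects for every internal vertex a triangle that contains it. -/
def Triangulation.IsSelection {Ω : Set Plane} (T : Triangulation Ω)
    (sel : Plane → Finset Plane) : Prop :=
  ∀ K ∈ T.cells, ∀ ν ∈ K, ν ∈ Ω → sel ν ∈ T.cells ∧ ν ∈ sel ν

/-- The line integral `∫_e g ds` over the segment `e` from `a` to `b`. -/
def segInt (a b : Plane) (g : Plane → ℝ) : ℝ :=
  ‖b - a‖ * ∫ t in (0 : ℝ)..1, g (AffineMap.lineMap a b t)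

/-! ### Piecewise polynomial spaces -/

/-- Polynomials in two variables. -/
abbrev Poly : Type := MvPolynomial (Fin 2) ℝ

/-- Value of a polynomial at a point. -/
def ev (p : Poly) (x : Plane) : ℝ := MvPolynomial.eval (fun i => x i) p

/-- The derivative of a polynomial at `x` in direction `n`. -/
def dirD (p : Poly) (x n : Plane) : ℝ := ∑ i, n i * ev (MvPolynomial.pderiv i p) x

/-- The partial derivatives of order at most two of a polynomial. -/
def polyDeriv (p : Poly) : JetIdx → Poly
  | Sum.inl _ => p
  | Sum.inr (Sum.inl i) => MvPolynomial.pderiv i p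
  | Sum.inr (Sum.inr (i, j)) => MvPolynomial.pderiv i (MvPolynomial.pderiv j p)

/-- The space `X` of piecewise constants. -/
def pwConst {Ω : Set Plane} (T : Triangulation Ω) : Submodule ℝ (L2 Ω) where
  carrier := {z | ∀ K ∈ T.cells, ∃ c : ℝ, ∀ᵐ x ∂(volume.restrict Ω), x ∈ hull K → z x = c}
  zero_mem' := by
    intro K _
    refine ⟨0, ?_⟩
    filter_upwards [Lp.coeFn_zero ℝ 2 (volume.restrict Ω)] with x hx _
    simpa using hx
  add_mem' := by
    intro a b ha hb K hK
    obtain ⟨c, hc⟩ := ha K hK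
    obtain ⟨d, hd⟩ := hb K hK
    refine ⟨c + d, ?_⟩
    filter_upwards [hc, hd, Lp.coeFn_add a b] with x h1 h2 h3 hx
    rw [h3, Pi.add_apply, h1 hx, h2 hx]
  smul_mem' := by
    intro r a ha K hK
    obtain ⟨c, hc⟩ := ha K hK
    refine ⟨r * c, ?_⟩
    filter_upwards [hc, Lp.coeFn_smul r a] with x h1 h3 hx
    rw [h3, Pi.smul_apply, h1 hx, smul_eq_mul]

theorem ev_zero (x : Plane) : ev 0 x = 0 := by simp [ev]
theorem ev_add (p q : Poly) (x : Plane) : ev (p + q) x = ev p x + ev q x := by simp [ev]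
theorem ev_smul (c : ℝ) (p : Poly) (x : Plane) : ev (c • p) x = c * ev p x := by
  simp [ev, MvPolynomial.smul_eval]
theorem dirD_zero (x n : Plane) : dirD 0 x n = 0 := by simp [dirD, ev_zero]
theorem dirD_add (p q : Poly) (x n : Plane) : dirD (p + q) x n = dirD p x n + dirD q x n := by
  simp only [dirD, map_add, ev_add, mul_add, Finset.sum_add_distrib]
theorem dirD_smul (c : ℝ) (p : Poly) (x n : Plane) : dirD (c • p) x n = c * dirD p x n := by
  simp [dirD, ev_smul]; ring

/-- The Morley space `Y`. The piece of `v` on the triangle `K` is the quadratic polynomial `v K`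
(and `v K = 0` if `K` is not one of the triangles). -/
def Morley {Ω : Set Plane} (T : Triangulation Ω) : Submodule ℝ (Finset Plane → Poly) where
  carrier := {v |
    (∀ K, K ∉ T.cells → v K = 0) ∧
    (∀ K, v K ∈ MvPolynomial.restrictTotalDegree (Fin 2) ℝ 2) ∧
    (∀ K ∈ T.cells, ∀ L ∈ T.cells, ∀ ν ∈ K, ν ∈ L → ev (v K) ν = ev (v L) ν) ∧
    (∀ K ∈ T.cells, ∀ ν ∈ K, ν ∉ Ω → ev (v K) ν = 0) ∧
    (∀ K ∈ T.cells, ∀ L ∈ T.cells, ∀ e ∈ T.edges, e ⊆ K → e ⊆ L → ∀ n, IsNormal e n →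
      dirD (v K) (mid e) n = dirD (v L) (mid e) n) ∧
    (∀ K ∈ T.cells, ∀ e ∈ T.edges, e ⊆ K → e ∉ T.intEdges → ∀ n, IsNormal e n →
      dirD (v K) (mid e) n = 0)}
  zero_mem' := by
    refine ⟨?_, ?_, ?_, ?_, ?_, ?_⟩ <;> intros <;>
      simp [ev_zero, dirD_zero]
  add_mem' := by
    rintro v w ⟨a1, a2, a3, a4, a5, a6⟩ ⟨b1, b2, b3, b4, b5, b6⟩
    refine ⟨?_, ?_, ?_, ?_, ?_, ?_⟩
    · intro K hK; simp [a1 K hK, b1 K hK]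
    · intro K; exact Submodule.add_mem _ (a2 K) (b2 K)
    · intro K hK L hL ν h1 h2
      simp only [Pi.add_apply, ev_add, a3 K hK L hL ν h1 h2, b3 K hK L hL ν h1 h2]
    · intro K hK ν h1 h2
      simp only [Pi.add_apply, ev_add, a4 K hK ν h1 h2, b4 K hK ν h1 h2, add_zero]
    · intro K hK L hL e he h1 h2 n hn
      simp only [Pi.add_apply, dirD_add, a5 K hK L hL e he h1 h2 n hn,
        b5 K hK L hL e he h1 h2 n hn]
    · intro K hK e he h1 h2 n hn
      simp only [Pi.add_apply, dirD_add, a6 K hK e he h1 h2 n hn, b6 K hK e he h1 h2 n hn,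
        add_zero]
  smul_mem' := by
    rintro c v ⟨a1, a2, a3, a4, a5, a6⟩
    refine ⟨?_, ?_, ?_, ?_, ?_, ?_⟩
    · intro K hK; simp [a1 K hK]
    · intro K; exact Submodule.smul_mem _ c (a2 K)
    · intro K hK L hL ν h1 h2
      simp only [Pi.smul_apply, ev_smul, a3 K hK L hL ν h1 h2]
    · intro K hK ν h1 h2
      simp only [Pi.smul_apply, ev_smul, a4 K hK ν h1 h2, mul_zero]
    · intro K hK L hL e he h1 h2 n hn
      simp only [Pi.smul_apply, dirD_smul, a5 K hK L hL e he h1 h2 n hn]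
    · intro K hK e he h1 h2 n hn
      simp only [Pi.smul_apply, dirD_smul, a6 K hK e he h1 h2 n hn, mul_zero]

/-- The norm on the Morley space, `‖v‖_Y² = ∑_K |v|²_{H²(K)}`. -/
def normY {Ω : Set Plane} (T : Triangulation Ω) (v : Morley T) : ℝ :=
  Real.sqrt (∑ K ∈ T.cells, ∫ x in hull K,
    ∑ i : Fin 2, ∑ j : Fin 2,
      (ev (MvPolynomial.pderiv i (MvPolynomial.pderiv j (v.1 K))) x) ^ 2)

theorem ev_memLp (Ω : Set Plane) (K : Finset Plane) (p : Poly) :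
    MemLp ((hull K).indicator (ev p)) 2 (volume.restrict Ω) := by
  have hK : IsCompact (hull K) := K.finite_toSet.isCompact_convexHull ℝ
  have hm : MeasurableSet (hull K) := hK.measurableSet
  have hc : Continuous (ev p) := by
    have h1 : Continuous fun x : Plane => (fun i => x i : Fin 2 → ℝ) := by fun_prop
    exact (MvPolynomial.continuous_eval p).comp h1
  obtain ⟨C, hC⟩ := hK.exists_bound_of_continuousOn hc.continuousOn
  rw [memLp_indicator_iff_restrict hm]
  have : IsFiniteMeasure ((volume.restrict Ω).restrict (hull K)) := by
    refine ⟨?_⟩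
    rw [Measure.restrict_apply_univ]
    exact (Measure.restrict_apply_le _ _).trans_lt hK.measure_lt_top
  refine MemLp.of_bound hc.aestronglyMeasurable C ?_
  filter_upwards [ae_restrict_mem hm] with x hx using hC x hx

/-- A Morley function with its elementwise first and second order derivatives. -/
def morleyJet {Ω : Set Plane} (T : Triangulation Ω) (v : Morley T) : JetSpace Ω :=
  WithLp.toLp 2 fun j => ∑ K ∈ T.cells, (ev_memLp Ω K (polyDeriv (v.1 K) j)).toLp

/-- `(B^δ z)(w) = -∑_K ∫_K z Δw` for a piecewise `H²` function `w`. -/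
def opBd {Ω : Set Plane} (T : Triangulation Ω) (z : L2 Ω) (w : JetSpace Ω) : ℝ :=
  -∑ K ∈ T.cells, ∫ x in hull K, z x * lap Ω w x

/-- The dual norm `‖f‖_{Y'} = sup_{0 ≠ v ∈ Y} |f(v)| / ‖v‖_Y`. -/
def dualNormY {Ω : Set Plane} (T : Triangulation Ω) (f : Morley T → ℝ) : ℝ :=
  sSup {r : ℝ | ∃ v : Morley T, v ≠ 0 ∧ r = |f v| / normY T v}

/-! ### The Hsieh–Clough–Tocher space and the companion operator -/

/-- `w` is in the HCT space: `w ∈ H²₀(Ω)`, `w` is `C¹` on each closed triangle `K`, and cubic on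
each of the three triangles spanned by an edge of `K` and the centroid of `K`. The function is
normalized to be zero outside `Ω`. -/
def IsHCT {Ω : Set Plane} (T : Triangulation Ω) (w : Plane → ℝ) : Prop :=
  (∃ W : H20 Ω, JetSpace.fn (W : JetSpace Ω) =ᵐ[volume.restrict Ω] w) ∧
  (∀ x, x ∉ Ω → w x = 0) ∧
  ∀ K ∈ T.cells, ContDiffOn ℝ 1 w (hull K) ∧
    ∀ a ∈ K, ∃ p ∈ MvPolynomial.restrictTotalDegree (Fin 2) ℝ 3,
      ∀ x ∈ convexHull ℝ (insert (bary K) ((K : Set Plane) \ {a})), w x = ev p x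

/-- `w` is the HCT function `Ẽ v`: its values at the internal vertices and its normal derivatives
at the midpoints of the internal edges are those of `v`, and its gradient at an internal vertex `ν`
is that of the piece of `v` on the selected triangle `sel ν`. -/
def IsPreCompanion {Ω : Set Plane} (T : Triangulation Ω) (sel : Plane → Finset Plane)
    (v : Morley T) (w : Plane → ℝ) : Prop :=
  IsHCT T w ∧
  (∀ K ∈ T.cells, ∀ ν ∈ K, ν ∈ Ω →
    w ν = ev (v.1 K) ν ∧ ∀ h, fderiv ℝ w ν h = dirD (v.1 (sel ν)) ν h) ∧
  (∀ K ∈ T.cells, ∀ e ∈ T.intEdges, e ⊆ K → ∀ n, IsNormal e n →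
    fderiv ℝ w (mid e) n = dirD (v.1 K) (mid e) n)

open Classical in
/-- `b` is the nodal HCT basis function `b_e` of the midpoint degree of freedom of `e`. -/
def IsEdgeBasis {Ω : Set Plane} (T : Triangulation Ω) (n : Finset Plane → Plane)
    (e : Finset Plane) (b : Plane → ℝ) : Prop :=
  IsHCT T b ∧
  (∀ K ∈ T.cells, ∀ ν ∈ K, ν ∈ Ω → b ν = 0 ∧ fderiv ℝ b ν = 0) ∧
  (∀ e' ∈ T.intEdges, fderiv ℝ b (mid e') (n e') = if e' = e then 1 else 0)

/-- `E` is the companion operator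
`E v = Ẽ v + ∑_e (∫_e ∂_n (v - Ẽ v) ds / ∫_e ∂_n b_e ds) b_e`, `e` running over the internal
edges. -/
def IsCompanion {Ω : Set Plane} (T : Triangulation Ω) (n : Finset Plane → Plane)
    (sel : Plane → Finset Plane) (E : Morley T →ₗ[ℝ] H20 Ω) : Prop :=
  ∃ (Et : Morley T → Plane → ℝ) (b : Finset Plane → Plane → ℝ)
    (c : Morley T → Finset Plane → ℝ),
    (∀ v, IsPreCompanion T sel v (Et v)) ∧
    (∀ e ∈ T.intEdges, IsEdgeBasis T n e (b e)) ∧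
    (∀ v, ∀ e ∈ T.intEdges, ∀ K ∈ T.cells, e ⊆ K → ∀ p q, (e : Set Plane) = {p, q} →
      c v e = segInt p q (fun x => dirD (v.1 K) x (n e) - fderiv ℝ (Et v) x (n e)) /
        segInt p q (fun x => fderiv ℝ (b e) x (n e))) ∧
    (∀ v, JetSpace.fn (E v : JetSpace Ω) =ᵐ[volume.restrict Ω]
      fun x => Et v x + ∑ e ∈ T.intEdges, c v e * b e x)

/-! ### The least squares method -/

/-- The consistency condition
`sup_{0 ≠ v ∈ Y} |(B^δ z)(v - E v) + ℓ(E v) - ℓ^δ(v)| / ‖v‖_Y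
  ≤ C (‖ℓ - B u‖_{H⁻²(Ω)} + ‖u - z‖_{L₂(Ω)} + osc)` for all piecewise constant `z`. -/
def Consistent {Ω : Set Plane} (T : Triangulation Ω) (E : Morley T →ₗ[ℝ] H20 Ω)
    (ℓ : HNeg2 Ω) (ℓd : Morley T → ℝ) (u : L2 Ω) (osc C : ℝ) : Prop :=
  ∀ z ∈ pwConst T, ∀ v : Morley T,
    |opBd T z (morleyJet T v - (E v : JetSpace Ω)) + ℓ (E v) - ℓd v| ≤
      C * (‖ℓ - opB Ω u‖ + ‖u - z‖ + osc) * normY T v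

/-- The regularized least squares functional
`‖B^δ z - ℓ^δ‖²_{Y'} + ‖z|_ω - q‖²_{L₂(ω)} + ε² ‖z‖²_{L₂(Ω)}`. -/
def lsFunctional {Ω : Set Plane} (ω : Set Plane) (T : Triangulation Ω) (ℓd : Morley T → ℝ)
    (q : L2 ω) (ε : ℝ) (z : L2 Ω) : ℝ :=
  dualNormY T (fun v => opBd T z (morleyJet T v) - ℓd v) ^ 2 +
    normL2 ω (fun x => z x - q x) ^ 2 + ε ^ 2 * ‖z‖ ^ 2

/-- `w` minimizes the regularized least squares functional over the piecewise constants. -/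
def IsLSSolution {Ω : Set Plane} (ω : Set Plane) (T : Triangulation Ω) (ℓd : Morley T → ℝ)
    (q : L2 ω) (ε : ℝ) (w : L2 Ω) : Prop :=
  w ∈ pwConst T ∧ ∀ z ∈ pwConst T, lsFunctional ω T ℓd q ε w ≤ lsFunctional ω T ℓd q ε z

/-- `‖A z‖_{H⁻²(Ω) × L₂(ω)}` where `A z = (B z, z|_ω)`. -/
def normA {Ω : Set Plane} (ω : Set Plane) (z : L2 Ω) : ℝ :=
  Real.sqrt (‖opB Ω z‖ ^ 2 + normL2 ω z ^ 2)

/-- The data error `‖A u - (ℓ, q)‖_{H⁻²(Ω) × L₂(ω)}`. -/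
def dataErr {Ω ω : Set Plane} (u : L2 Ω) (ℓ : HNeg2 Ω) (q : L2 ω) : ℝ :=
  Real.sqrt (‖opB Ω u - ℓ‖ ^ 2 + normL2 ω (fun x => u x - q x) ^ 2)

/-- The error of best approximation `min_{z ∈ X} ‖u - z‖_{L₂(Ω)}`. -/
def apprErr {Ω : Set Plane} (T : Triangulation Ω) (u : L2 Ω) : ℝ :=
  ⨅ z : pwConst T, ‖u - (z : L2 Ω)‖

/-- `α ∈ (0, 1]` is an exponent for which smallness of harmonic functions propagates from `ω`
to `G`: `‖w‖_{L₂(G)} ≲ ‖w‖_{L₂(ω)}^α ‖w‖_{L₂(Ω)}^{1-α}` for all harmonic `w ∈ L₂(Ω)`. -/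
def IsPropagationExponent (Ω ω G : Set Plane) (α : ℝ) : Prop :=
  0 < α ∧ α ≤ 1 ∧ ∃ C : ℝ, ∀ w : Plane → ℝ, MemLp w 2 (volume.restrict Ω) →
    InnerProductSpace.HarmonicOnNhd w Ω →
    normL2 G w ≤ C * normL2 ω w ^ α * normL2 Ω w ^ (1 - α)

end MorleyUC

end

open MorleyUC

noncomputable section

open MeasureTheory Set Filter Topology
namespace MorleyUC

/-! ### Mollification -/

/-- A radial bump function supported in the unit ball. -/
def radialBump (x : Plane) : ℝ := Real.smoothTransition (1 - ‖x‖ ^ 2)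

theorem radialBump_contDiff : ContDiff ℝ smooth radialBump := by
  unfold radialBump
  exact Real.smoothTransition.contDiff.comp (contDiff_const.sub (contDiff_norm_sq ℝ))

theorem radialBump_nonneg (x : Plane) : 0 ≤ radialBump x := Real.smoothTransition.nonneg _

theorem radialBump_eq_zero {x : Plane} (hx : 1 ≤ ‖x‖) : radialBump x = 0 :=
  Real.smoothTransition.zero_of_nonpos (by nlinarith)

theorem radialBump_hasCompactSupport : HasCompactSupport radialBump :=
  HasCompactSupport.intro (isCompact_closedBall (0 : Plane) 1) fun x hx => by
    apply radialBump_eq_zero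
    simpa using (not_le.mp (by simpa using hx : ¬ ‖x‖ ≤ 1)).le

theorem radialBump_integrable : Integrable radialBump :=
  radialBump_contDiff.continuous.integrable_of_hasCompactSupport radialBump_hasCompactSupport

theorem integral_radialBump_pos : 0 < ∫ x, radialBump x := by
  refine (integral_pos_iff_support_of_nonneg radialBump_nonneg radialBump_integrable).2 ?_
  refine (Continuous.isOpen_support radialBump_contDiff.continuous).measure_pos _ ⟨0, ?_⟩
  simp [radialBump, Real.smoothTransition.one_of_one_le]

/-- The standard radial mollifier at scale `δ`. -/
def moll (δ : ℝ) (x : Plane) : ℝ := (δ ^ 2 * ∫ y, radialBump y)⁻¹ * radialBump (δ⁻¹ • x)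

theorem moll_contDiff (δ : ℝ) : ContDiff ℝ smooth (moll δ) :=
  contDiff_const.mul (radialBump_contDiff.comp (contDiff_const_smul δ⁻¹))

theorem moll_nonneg (δ : ℝ) (x : Plane) : 0 ≤ moll δ x := by
  exact mul_nonneg (inv_nonneg.2 (mul_nonneg (sq_nonneg δ) integral_radialBump_pos.le))
    (radialBump_nonneg _)

theorem moll_eq_zero {δ : ℝ} (hδ : 0 < δ) {x : Plane} (hx : δ ≤ ‖x‖) : moll δ x = 0 := by
  unfold moll
  rw [radialBump_eq_zero, mul_zero]
  rw [norm_smul, norm_inv, Real.norm_of_nonneg hδ.le, inv_mul_eq_div, one_le_div hδ]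
  exact hx

theorem moll_neg (δ : ℝ) (x : Plane) : moll δ (-x) = moll δ x := by
  simp [moll, radialBump]

theorem moll_hasCompactSupport {δ : ℝ} (hδ : 0 < δ) : HasCompactSupport (moll δ) :=
  HasCompactSupport.intro (isCompact_closedBall (0 : Plane) δ) fun x hx => by
    apply moll_eq_zero hδ
    simpa using (not_le.mp (by simpa using hx : ¬ ‖x‖ ≤ δ)).le

theorem moll_integrable {δ : ℝ} (hδ : 0 < δ) : Integrable (moll δ) :=
  (moll_contDiff δ).continuous.integrable_of_hasCompactSupport (moll_hasCompactSupport hδ)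

theorem integral_comp_inv_smul {δ : ℝ} (hδ : 0 < δ) (f : Plane → ℝ) :
    ∫ x, f (δ⁻¹ • x) = δ ^ 2 * ∫ x, f x := by
  rw [Measure.integral_comp_inv_smul]
  simp [abs_of_pos hδ]

theorem integral_moll {δ : ℝ} (hδ : 0 < δ) : ∫ x, moll δ x = 1 := by
  unfold moll
  rw [integral_const_mul, integral_comp_inv_smul hδ]
  have := integral_radialBump_pos
  field_simp

/-- Convolution of two real functions on the plane. -/
def cv (f g : Plane → ℝ) (x : Plane) : ℝ := ∫ t, f t * g (x - t)

theorem cv_eq_convolution (f g : Plane → ℝ) :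
    cv f g = MeasureTheory.convolution f g (ContinuousLinearMap.lsmul ℝ ℝ) volume := by
  funext x; rw [convolution_def]; rfl

theorem cv_contDiff {f g : Plane → ℝ} (hf : LocallyIntegrable f) (hg : ContDiff ℝ smooth g)
    (hgc : HasCompactSupport g) : ContDiff ℝ smooth (cv f g) := by
  rw [cv_eq_convolution]
  exact hgc.contDiff_convolution_right _ hf hg

theorem partialD_hasCompactSupport {g : Plane → ℝ} (hgc : HasCompactSupport g) (i : Fin 2) :
    HasCompactSupport (partialD i g) :=
  HasCompactSupport.comp_left (g := fun L : Plane →L[ℝ] ℝ => L (EuclideanSpace.single i 1))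
    (hgc.fderiv (𝕜 := ℝ)) rfl

theorem tsupport_partialD_subset (g : Plane → ℝ) (i : Fin 2) :
    tsupport (partialD i g) ⊆ tsupport g := by
  refine subset_trans ?_ (tsupport_fderiv_subset ℝ (f := g))
  refine closure_mono fun x hx => ?_
  contrapose! hx
  simp only [Function.mem_support, ne_eq, not_not] at hx
  simp [partialD, hx]

theorem partialD_cv {f g : Plane → ℝ} (hf : LocallyIntegrable f) (hg : ContDiff ℝ smooth g)
    (hgc : HasCompactSupport g) (i : Fin 2) : partialD i (cv f g) = cv f (partialD i g) := by
  funext x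
  have h1 := hgc.hasFDerivAt_convolution_right (ContinuousLinearMap.lsmul ℝ ℝ) (μ := volume) hf
    (hg.of_le (by simp)) x
  rw [partialD, cv_eq_convolution, h1.fderiv,
    convolution_precompR_apply (ContinuousLinearMap.lsmul ℝ ℝ) hf (hgc.fderiv (𝕜 := ℝ))
      (hg.continuous_fderiv (by simp))]
  rfl

theorem cv_comm (f g : Plane → ℝ) : cv f g = cv g f := by
  funext x
  unfold cv
  rw [← integral_sub_left_eq_self _ volume x]
  refine integral_congr_ae (Eventually.of_forall fun t => ?_)
  simp [mul_comm]

/-- Pointwise bounds of a function on a ball are inherited by its mollification. -/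
theorem cv_moll_sub_le {f : Plane → ℝ} {δ : ℝ} (hδ : 0 < δ) (hf : LocallyIntegrable f)
    {x : Plane} {c B : ℝ} (hB : ∀ t, ‖x - t‖ < δ → |f t - c| ≤ B) :
    |cv f (moll δ) x - c| ≤ B := by
  have hi : Integrable fun t => moll δ (x - t) := (moll_integrable hδ).comp_sub_left x
  have h1 : ∫ t, moll δ (x - t) = 1 := by
    rw [integral_sub_left_eq_self (moll δ) volume x, integral_moll hδ]
  have hfi : Integrable fun t => f t * moll δ (x - t) := by
    have := (moll_hasCompactSupport hδ).convolutionExists_right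
      (ContinuousLinearMap.lsmul ℝ ℝ) (μ := volume) hf (moll_contDiff δ).continuous x
    exact this.integrable
  have h2 : cv f (moll δ) x - c = ∫ t, (f t - c) * moll δ (x - t) := by
    simp_rw [sub_mul]
    rw [integral_sub hfi (hi.const_mul c), integral_const_mul, h1, mul_one]
    rfl
  have hB0 : 0 ≤ B := (abs_nonneg _).trans (hB x (by simpa using hδ))
  rw [h2]
  calc |∫ t, (f t - c) * moll δ (x - t)| ≤ ∫ t, B * moll δ (x - t) := by
        rw [← Real.norm_eq_abs]
        refine norm_integral_le_of_norm_le (hi.const_mul B) (Eventually.of_forall fun t => ?_)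
        rw [norm_mul, Real.norm_of_nonneg (moll_nonneg δ _), Real.norm_eq_abs]
        by_cases ht : ‖x - t‖ < δ
        · exact mul_le_mul_of_nonneg_right (hB t ht) (moll_nonneg δ _)
        · rw [moll_eq_zero hδ (not_lt.mp ht)]; simp
    _ = B := by rw [integral_const_mul, h1, mul_one]

theorem partialD_moll {δ : ℝ} (i : Fin 2) (x : Plane) :
    partialD i (moll δ) x =
      (δ ^ 2 * ∫ y, radialBump y)⁻¹ * (δ⁻¹ * partialD i radialBump (δ⁻¹ • x)) := by
  have hd : DifferentiableAt ℝ radialBump (δ⁻¹ • x) :=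
    (radialBump_contDiff.differentiable (by simp)) _
  have h1 : HasFDerivAt (fun y : Plane => radialBump (δ⁻¹ • y))
      ((fderiv ℝ radialBump (δ⁻¹ • x)).comp (δ⁻¹ • ContinuousLinearMap.id ℝ Plane)) x :=
    hd.hasFDerivAt.comp x ((hasFDerivAt_id x).const_smul δ⁻¹)
  have h2 := h1.const_mul (δ ^ 2 * ∫ y, radialBump y)⁻¹
  unfold partialD
  rw [show moll δ = fun y => (δ ^ 2 * ∫ y, radialBump y)⁻¹ * radialBump (δ⁻¹ • y) from rfl,
    h2.fderiv]
  simp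

theorem partialD_partialD_moll {δ : ℝ} (i j : Fin 2) (x : Plane) :
    partialD i (partialD j (moll δ)) x =
      (δ ^ 2 * ∫ y, radialBump y)⁻¹ * (δ⁻¹ * (δ⁻¹ * partialD i (partialD j radialBump) (δ⁻¹ • x)))
    := by
  have hd : DifferentiableAt ℝ (partialD j radialBump) (δ⁻¹ • x) :=
    ((partialD_contDiff radialBump_contDiff j).differentiable (by simp)) _
  have h1 : HasFDerivAt (fun y : Plane => partialD j radialBump (δ⁻¹ • y))
      ((fderiv ℝ (partialD j radialBump) (δ⁻¹ • x)).comp (δ⁻¹ • ContinuousLinearMap.id ℝ Plane)) x :=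
    hd.hasFDerivAt.comp x ((hasFDerivAt_id x).const_smul δ⁻¹)
  have h2 := (h1.const_mul δ⁻¹).const_mul (δ ^ 2 * ∫ y, radialBump y)⁻¹
  rw [show partialD j (moll δ) = fun y => (δ ^ 2 * ∫ y, radialBump y)⁻¹ *
    (δ⁻¹ * partialD j radialBump (δ⁻¹ • y)) from funext fun y => partialD_moll j y]
  unfold partialD at h2 ⊢
  rw [h2.fderiv]
  simp

/-- The `L₁`-norms of the derivatives of the mollifier scale like negative powers of `δ`. -/
theorem exists_integral_abs_derivOf_moll_le : ∃ C : ℝ, 0 < C ∧ ∀ δ : ℝ, 0 < δ →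
    (∀ i, ∫ x, |partialD i (moll δ) x| ≤ C / δ) ∧
    ∀ i j, ∫ x, |partialD i (partialD j (moll δ)) x| ≤ C / δ ^ 2 := by
  have hI := integral_radialBump_pos
  set I := ∫ y, radialBump y
  refine ⟨1 + (∑ i, (∫ x, |partialD i radialBump x|) / I +
    ∑ i, ∑ j, (∫ x, |partialD i (partialD j radialBump) x|) / I), ?_, fun δ hδ => ⟨?_, ?_⟩⟩
  · have : ∀ f : Plane → ℝ, 0 ≤ ∫ x, |f x| := fun f => integral_nonneg fun x => abs_nonneg _
    have h1 : 0 ≤ ∑ i, (∫ x, |partialD i radialBump x|) / I :=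
      Finset.sum_nonneg fun i _ => div_nonneg (this _) hI.le
    have h2 : 0 ≤ ∑ i, ∑ j, (∫ x, |partialD i (partialD j radialBump) x|) / I :=
      Finset.sum_nonneg fun i _ => Finset.sum_nonneg fun i _ => div_nonneg (this _) hI.le
    linarith
  all_goals
    have h0 : ∀ f : Plane → ℝ, 0 ≤ ∫ x, |f x| := fun f => integral_nonneg fun x => abs_nonneg _
    have h1 : 0 ≤ ∑ i, (∫ x, |partialD i radialBump x|) / I :=
      Finset.sum_nonneg fun i _ => div_nonneg (h0 _) hI.le
    have h2 : 0 ≤ ∑ i, ∑ j, (∫ x, |partialD i (partialD j radialBump) x|) / I :=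
      Finset.sum_nonneg fun i _ => Finset.sum_nonneg fun i _ => div_nonneg (h0 _) hI.le
  · intro i
    have h3 : (∫ x, |partialD i radialBump x|) / I ≤ ∑ i, (∫ x, |partialD i radialBump x|) / I :=
      Finset.single_le_sum (f := fun i => (∫ x, |partialD i radialBump x|) / I)
        (fun i _ => div_nonneg (h0 _) hI.le) (Finset.mem_univ i)
    have h4 : ∫ x, |partialD i (moll δ) x| = ((∫ x, |partialD i radialBump x|) / I) / δ := by
      simp_rw [partialD_moll, abs_mul]
      rw [show (∫ y, radialBump y) = I from rfl]
      rw [integral_const_mul, integral_const_mul, integral_comp_inv_smul hδ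
        (fun x => |partialD i radialBump x|), abs_of_pos (by positivity), abs_of_pos (by positivity)]
      field_simp
    rw [h4]
    gcongr
    linarith
  · intro i j
    have h3 : (∫ x, |partialD i (partialD j radialBump) x|) / I ≤
        ∑ i, ∑ j, (∫ x, |partialD i (partialD j radialBump) x|) / I :=
      (Finset.single_le_sum (f := fun j => (∫ x, |partialD i (partialD j radialBump) x|) / I)
        (fun j _ => div_nonneg (h0 _) hI.le) (Finset.mem_univ j)).trans
      (Finset.single_le_sum (f := fun i => ∑ j, (∫ x, |partialD i (partialD j radialBump) x|) / I)
        (fun i _ => Finset.sum_nonneg fun j _ => div_nonneg (h0 _) hI.le) (Finset.mem_univ i))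
    have h4 : ∫ x, |partialD i (partialD j (moll δ)) x| =
        ((∫ x, |partialD i (partialD j radialBump) x|) / I) / δ ^ 2 := by
      simp_rw [partialD_partialD_moll, abs_mul]
      rw [show (∫ y, radialBump y) = I from rfl]
      rw [integral_const_mul, integral_const_mul, integral_const_mul, integral_comp_inv_smul hδ
        (fun x => |partialD i (partialD j radialBump) x|), abs_of_pos (by positivity),
        abs_of_pos (by positivity)]
      field_simp
    rw [h4]
    gcongr
    linarith

end MorleyUC
end

noncomputable section

open MeasureTheory Set Filter Topology
namespace MorleyUC

/-! ### Weak derivatives in `H²₀(Ω)` -/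

theorem memLp_of_continuous_hasCompactSupport {ψ : Plane → ℝ} (h : Continuous ψ)
    (hc : HasCompactSupport ψ) (Ω : Set Plane) : MemLp ψ 2 (volume.restrict Ω) :=
  (h.memLp_of_hasCompactSupport hc (μ := volume)).restrict Ω

theorem inner_toLp {Ω : Set Plane} (f : L2 Ω) {g : Plane → ℝ}
    (hg : MemLp g 2 (volume.restrict Ω)) :
    inner ℝ f (hg.toLp g) = ∫ x in Ω, f x * g x := by
  rw [L2.inner_def]
  refine integral_congr_ae ?_
  filter_upwards [hg.coeFn_toLp] with x hx
  simp [hx, mul_comm]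

theorem L2_inner_eq {Ω : Set Plane} (f g : L2 Ω) : inner ℝ f g = ∫ x in Ω, f x * g x := by
  rw [L2.inner_def]
  refine integral_congr_ae (Eventually.of_forall fun x => ?_)
  simp [mul_comm]

theorem L2_integrable_mul {Ω : Set Plane} (f g : L2 Ω) :
    Integrable (fun x => f x * g x) (volume.restrict Ω) := by
  have := L2.integrable_inner (𝕜 := ℝ) g f
  simpa using! this

/-- Integration by parts against a compactly supported function. -/
theorem integral_partialD_mul {f g : Plane → ℝ} (hf : ContDiff ℝ smooth f)
    (hg : ContDiff ℝ smooth g) (hgc : HasCompactSupport g) (i : Fin 2) :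
    ∫ x, partialD i f x * g x = -∫ x, f x * partialD i g x := by
  have h := integral_mul_fderiv_eq_neg_fderiv_mul_of_integrable (μ := (volume : Measure Plane))
    (f := f) (g := g) (v := EuclideanSpace.single i 1)
    (((partialD_contDiff hf i).continuous.mul hg.continuous).integrable_of_hasCompactSupport
      hgc.mul_left)
    ((hf.continuous.mul (partialD_contDiff hg i).continuous).integrable_of_hasCompactSupport
      (partialD_hasCompactSupport hgc i).mul_left)
    ((hf.continuous.mul hg.continuous).integrable_of_hasCompactSupport hgc.mul_left)
    (fun x _ => hf.differentiable (by simp) x) (fun x _ => hg.differentiable (by simp) x)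
  unfold partialD
  rw [h, neg_neg]

theorem derivOf_contDiff {f : Plane → ℝ} (hf : ContDiff ℝ smooth f) (j : JetIdx) :
    ContDiff ℝ smooth (derivOf f j) := by
  rcases j with _ | i | ⟨i, j⟩
  · exact hf
  · exact partialD_contDiff hf i
  · exact partialD_contDiff (partialD_contDiff hf j) i

theorem derivOf_hasCompactSupport {f : Plane → ℝ} (hf : HasCompactSupport f) (j : JetIdx) :
    HasCompactSupport (derivOf f j) := by
  rcases j with _ | i | ⟨i, j⟩
  · exact hf
  · exact partialD_hasCompactSupport hf i
  · exact partialD_hasCompactSupport (partialD_hasCompactSupport hf j) i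

theorem tsupport_derivOf_subset (f : Plane → ℝ) (j : JetIdx) :
    tsupport (derivOf f j) ⊆ tsupport f := by
  rcases j with _ | i | ⟨i, j⟩
  · exact Subset.rfl
  · exact tsupport_partialD_subset f i
  · exact (tsupport_partialD_subset _ i).trans (tsupport_partialD_subset f j)

theorem derivOf_eq_zero_off {Ω : Set Plane} {φ : Plane → ℝ} (h : tsupport φ ⊆ Ω) (j : JetIdx)
    {x : Plane} (hx : x ∉ Ω) : derivOf φ j x = 0 :=
  image_eq_zero_of_notMem_tsupport fun h' => hx (h (tsupport_derivOf_subset φ j h'))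

theorem derivOf_memLp {φ : Plane → ℝ} (hf : ContDiff ℝ smooth φ) (hc : HasCompactSupport φ)
    (Ω : Set Plane) (j : JetIdx) : MemLp (derivOf φ j) 2 (volume.restrict Ω) :=
  memLp_of_continuous_hasCompactSupport (derivOf_contDiff hf j).continuous
    (derivOf_hasCompactSupport hc j) Ω

/-- The element of `JetSpace Ω` of a smooth compactly supported function. -/
def jetOf (Ω : Set Plane) {φ : Plane → ℝ} (hf : ContDiff ℝ smooth φ) (hc : HasCompactSupport φ) :
    JetSpace Ω :=
  WithLp.toLp 2 fun j => (derivOf_memLp hf hc Ω j).toLp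

theorem jetOf_coe {Ω : Set Plane} {φ : Plane → ℝ} (hf : ContDiff ℝ smooth φ)
    (hc : HasCompactSupport φ) (j : JetIdx) :
    (jetOf Ω hf hc j : Plane → ℝ) =ᵐ[volume.restrict Ω] derivOf φ j :=
  (derivOf_memLp hf hc Ω j).coeFn_toLp

theorem jetOf_mem {Ω : Set Plane} {φ : Plane → ℝ} (h : IsTest Ω φ) :
    jetOf Ω h.1 h.2.1 ∈ H20 Ω :=
  (testJets Ω).le_topologicalClosure ⟨φ, h, fun j => jetOf_coe h.1 h.2.1 j⟩

/-- A closed condition that holds for the jets of test functions holds in `H²₀(Ω)`. -/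
theorem H20_induction {Ω : Set Plane} {P : JetSpace Ω → Prop} (hP : IsClosed {w | P w})
    (h : ∀ φ (hφ : IsTest Ω φ), P (jetOf Ω hφ.1 hφ.2.1)) {W : JetSpace Ω} (hW : W ∈ H20 Ω) :
    P W := by
  have : (testJets Ω : Set (JetSpace Ω)) ⊆ {w | P w} := by
    rintro w ⟨φ, hφ, hw⟩
    have : w = jetOf Ω hφ.1 hφ.2.1 := by
      ext1 j
      exact Lp.ext ((hw j).trans (jetOf_coe hφ.1 hφ.2.1 j).symm)
    rw [this]
    exact h φ hφ
  exact closure_minimal this hP hW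

theorem setIntegral_jetOf_mul {Ω : Set Plane} {φ : Plane → ℝ} (hφ : IsTest Ω φ) (j : JetIdx)
    (g : Plane → ℝ) :
    ∫ x in Ω, jetOf Ω hφ.1 hφ.2.1 j x * g x = ∫ x, derivOf φ j x * g x := by
  have h : ∫ x in Ω, jetOf Ω hφ.1 hφ.2.1 j x * g x = ∫ x in Ω, derivOf φ j x * g x := by
    refine integral_congr_ae ?_
    filter_upwards [jetOf_coe (Ω := Ω) hφ.1 hφ.2.1 j] with x hx
    rw [hx]
  rw [h]
  refine setIntegral_eq_integral_of_forall_compl_eq_zero fun x hx => ?_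
  rw [derivOf_eq_zero_off hφ.2.2 j hx, zero_mul]

theorem continuous_jet (Ω : Set Plane) (j : JetIdx) : Continuous fun w : JetSpace Ω => w j :=
  (PiLp.proj (𝕜 := ℝ) 2 (fun _ : JetIdx => L2 Ω) j).continuous

/-- The elements of `H²₀(Ω)` have weak second order derivatives on the whole plane. -/
theorem H20_weak_second {Ω : Set Plane} {W : JetSpace Ω} (hW : W ∈ H20 Ω)
    {ψ : Plane → ℝ} (hψ : ContDiff ℝ smooth ψ) (hc : HasCompactSupport ψ) (i j : Fin 2) :
    ∫ x in Ω, W (Sum.inr (Sum.inr (i, j))) x * ψ x =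
      ∫ x in Ω, W.fn x * partialD j (partialD i ψ) x := by
  have h1 : MemLp ψ 2 (volume.restrict Ω) := derivOf_memLp hψ hc Ω (Sum.inl ())
  have h2 : MemLp (partialD j (partialD i ψ)) 2 (volume.restrict Ω) :=
    derivOf_memLp hψ hc Ω (Sum.inr (Sum.inr (j, i)))
  unfold JetSpace.fn
  rw [← inner_toLp _ h1, ← inner_toLp _ h2]
  refine H20_induction (P := fun W => inner ℝ (W (Sum.inr (Sum.inr (i, j)))) (h1.toLp ψ) =
    inner ℝ (W (Sum.inl ())) (h2.toLp _)) ?_ ?_ hW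
  · exact isClosed_eq ((continuous_jet Ω _).inner continuous_const)
      ((continuous_jet Ω _).inner continuous_const)
  · intro φ hφ
    simp only [inner_toLp]
    rw [setIntegral_jetOf_mul hφ, setIntegral_jetOf_mul hφ]
    simp only [derivOf]
    rw [integral_partialD_mul (partialD_contDiff hφ.1 j) hψ hc,
      integral_partialD_mul hφ.1 (partialD_contDiff hψ i) (partialD_hasCompactSupport hc i), neg_neg]

theorem H20_weak_first {Ω : Set Plane} {W : JetSpace Ω} (hW : W ∈ H20 Ω)
    {ψ : Plane → ℝ} (hψ : ContDiff ℝ smooth ψ) (hc : HasCompactSupport ψ) (i : Fin 2) :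
    ∫ x in Ω, W (Sum.inr (Sum.inl i)) x * ψ x = -∫ x in Ω, W.fn x * partialD i ψ x := by
  have h1 : MemLp ψ 2 (volume.restrict Ω) := derivOf_memLp hψ hc Ω (Sum.inl ())
  have h2 : MemLp (partialD i ψ) 2 (volume.restrict Ω) :=
    derivOf_memLp hψ hc Ω (Sum.inr (Sum.inl i))
  unfold JetSpace.fn
  rw [← inner_toLp _ h1, ← inner_toLp _ h2]
  refine H20_induction (P := fun W => inner ℝ (W (Sum.inr (Sum.inl i))) (h1.toLp ψ) =
    -inner ℝ (W (Sum.inl ())) (h2.toLp _)) ?_ ?_ hW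
  · exact isClosed_eq ((continuous_jet Ω _).inner continuous_const)
      ((continuous_jet Ω _).inner continuous_const).neg
  · intro φ hφ
    simp only [inner_toLp]
    rw [setIntegral_jetOf_mul hφ, setIntegral_jetOf_mul hφ]
    simp only [derivOf]
    rw [integral_partialD_mul hφ.1 hψ hc]

theorem L2_locallyIntegrableOn {Ω U : Set Plane} (hUΩ : U ⊆ Ω) (f : L2 Ω) :
    LocallyIntegrableOn f U := by
  have h1 : MemLp f 2 (volume.restrict U) :=
    (Lp.memLp f).mono_measure (Measure.restrict_mono hUΩ le_rfl)
  have := h1.locallyIntegrable (by norm_num)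
  exact locallyIntegrableOn_of_locallyIntegrable_restrict this

/-- On an open set where an element of `H²₀(Ω)` is smooth, its second order components are the
classical derivatives. -/
theorem H20_second_ae_eq {Ω U : Set Plane} (hU : IsOpen U) (hUΩ : U ⊆ Ω)
    {W : JetSpace Ω} (hW : W ∈ H20 Ω) {f : Plane → ℝ} (hf : ContDiff ℝ smooth f)
    (hWf : ∀ᵐ x ∂volume, x ∈ U → W.fn x = f x) (i j : Fin 2) :
    ∀ᵐ x ∂volume, x ∈ U → W (Sum.inr (Sum.inr (i, j))) x = partialD i (partialD j f) x := by
  have hcont := (partialD_contDiff (partialD_contDiff hf j) i).continuous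
  have key := hU.ae_eq_zero_of_integral_contDiff_smul_eq_zero (μ := (volume : Measure Plane))
    (f := fun x => W (Sum.inr (Sum.inr (i, j))) x - partialD i (partialD j f) x)
    ((L2_locallyIntegrableOn hUΩ _).sub
      (hcont.locallyIntegrable.locallyIntegrableOn U)) ?_
  · filter_upwards [key] with x hx hxU
    linarith [hx hxU]
  intro g hg hgc hgU
  have h1 := H20_weak_second hW hg hgc i j
  have h3 : MemLp g 2 (volume.restrict Ω) := derivOf_memLp hg hgc Ω (Sum.inl ())
  have hInt : Integrable (fun x => W (Sum.inr (Sum.inr (i, j))) x * g x) (volume.restrict Ω) := by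
    have := (L2_integrable_mul (W (Sum.inr (Sum.inr (i, j)))) (h3.toLp g))
    refine this.congr ?_
    filter_upwards [h3.coeFn_toLp] with x hx
    rw [hx]
  have hg0 : ∀ x, x ∉ Ω → g x = 0 := fun x hx =>
    image_eq_zero_of_notMem_tsupport fun h => hx (hUΩ (hgU h))
  have e0 : ∫ x, g x • (W (Sum.inr (Sum.inr (i, j))) x - partialD i (partialD j f) x) =
      ∫ x in Ω, g x • (W (Sum.inr (Sum.inr (i, j))) x - partialD i (partialD j f) x) := by
    rw [setIntegral_eq_integral_of_forall_compl_eq_zero]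
    intro x hx; simp [hg0 x hx]
  have e1 : ∫ x in Ω, partialD i (partialD j f) x * g x = ∫ x, f x * partialD j (partialD i g) x := by
    rw [setIntegral_eq_integral_of_forall_compl_eq_zero,
      integral_partialD_mul (partialD_contDiff hf j) hg hgc,
      integral_partialD_mul hf (partialD_contDiff hg i) (partialD_hasCompactSupport hgc i), neg_neg]
    intro x hx; simp [hg0 x hx]
  have e2 : ∫ x in Ω, W.fn x * partialD j (partialD i g) x =
      ∫ x, f x * partialD j (partialD i g) x := by
    have hz : ∀ x, x ∉ U → partialD j (partialD i g) x = 0 := fun x hx =>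
      derivOf_eq_zero_off hgU (Sum.inr (Sum.inr (j, i))) hx
    rw [setIntegral_eq_integral_of_forall_compl_eq_zero]
    · refine integral_congr_ae ?_
      filter_upwards [hWf] with x hx
      by_cases hxU : x ∈ U
      · rw [hx hxU]
      · simp [hz x hxU]
    · intro x hx
      rw [hz x fun h => hx (hUΩ h), mul_zero]
  have hint2 : Integrable (fun x => partialD i (partialD j f) x * g x) (volume.restrict Ω) :=
    ((hcont.mul hg.continuous).integrable_of_hasCompactSupport hgc.mul_left).restrict
  rw [e0]
  simp only [smul_eq_mul, mul_sub]
  rw [integral_sub (by simpa [mul_comm] using hInt) (by simpa [mul_comm] using hint2)]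
  simp_rw [mul_comm (g _)]
  rw [h1, e1, e2, sub_self]

/-- An element of `H²₀(Ω)` is determined by its underlying function. -/
theorem H20_ext {Ω : Set Plane} (hΩ : IsOpen Ω) {V W : JetSpace Ω} (hV : V ∈ H20 Ω)
    (hW : W ∈ H20 Ω) (h : V.fn =ᵐ[volume.restrict Ω] W.fn) : V = W := by
  have hZ : V - W ∈ H20 Ω := (H20 Ω).sub_mem hV hW
  have hz : (V - W).fn =ᵐ[volume.restrict Ω] 0 := by
    have : ((V - W : JetSpace Ω).fn : Plane → ℝ) =ᵐ[volume.restrict Ω] V.fn - W.fn :=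
      Lp.coeFn_sub (V (Sum.inl ())) (W (Sum.inl ()))
    filter_upwards [this, h] with x h1 h2
    rw [h1, Pi.sub_apply, h2, sub_self, Pi.zero_apply]
  rw [← sub_eq_zero]
  set Z := V - W
  have main : ∀ j, (Z j : Plane → ℝ) =ᵐ[volume.restrict Ω] 0 := by
    intro j
    rcases j with _ | i | ⟨i, j⟩
    · exact hz
    · have key := hΩ.ae_eq_zero_of_integral_contDiff_smul_eq_zero (μ := (volume : Measure Plane))
        (f := fun x => Z (Sum.inr (Sum.inl i)) x)
        (L2_locallyIntegrableOn Subset.rfl _) ?_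
      · rw [Filter.EventuallyEq, ae_restrict_iff' hΩ.measurableSet]
        exact key
      · intro g hg hgc hgU
        rw [← setIntegral_eq_integral_of_forall_compl_eq_zero (s := Ω)]
        · simp only [smul_eq_mul]
          simp_rw [mul_comm (g _)]
          rw [H20_weak_first hZ hg hgc, neg_eq_zero]
          rw [integral_eq_zero_of_ae]
          filter_upwards [hz] with x hx
          rw [hx]; simp
        · intro x hx
          rw [image_eq_zero_of_notMem_tsupport fun h => hx (hgU h), zero_smul]
    · have := H20_second_ae_eq hΩ Subset.rfl hZ (f := fun _ => 0)
        contDiff_const (by rwa [Filter.EventuallyEq, ae_restrict_iff' hΩ.measurableSet] at hz) i j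
      rw [Filter.EventuallyEq, ae_restrict_iff' hΩ.measurableSet]
      filter_upwards [this] with x hx hxΩ
      rw [hx hxΩ]
      have h0 : partialD j (fun _ : Plane => (0 : ℝ)) = fun _ => 0 := by
        funext y; simp [partialD]
      rw [h0]; simp [partialD]
  ext1 j
  exact Lp.ext ((main j).trans (Lp.coeFn_zero ℝ 2 (volume.restrict Ω)).symm)

end MorleyUC
end

noncomputable section

open MeasureTheory Set Filter Topology
namespace MorleyUC

/-! ### Functions with Lipschitz gradients -/

/-- `w` is differentiable with `M`-Lipschitz derivative. -/
def IsC11 (M : ℝ) (w : Plane → ℝ) : Prop :=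
  Differentiable ℝ w ∧ ∀ x y, ‖fderiv ℝ w x - fderiv ℝ w y‖ ≤ M * ‖x - y‖

theorem IsC11.nonneg {M : ℝ} {w : Plane → ℝ} (h : IsC11 M w) : 0 ≤ M := by
  have := (norm_nonneg _).trans (h.2 (EuclideanSpace.single 0 1) 0)
  simpa using this

theorem IsC11.continuous_fderiv {M : ℝ} {w : Plane → ℝ} (h : IsC11 M w) :
    Continuous (fderiv ℝ w) := by
  have : LipschitzWith ⟨M, h.nonneg⟩ (fderiv ℝ w) := LipschitzWith.of_dist_le_mul fun x y => by
    rw [dist_eq_norm, dist_eq_norm]; exact h.2 x y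
  exact this.continuous

theorem IsC11.contDiff {M : ℝ} {w : Plane → ℝ} (h : IsC11 M w) : ContDiff ℝ 1 w :=
  contDiff_one_iff_fderiv.2 ⟨h.1, h.continuous_fderiv⟩

theorem IsC11.taylor {M : ℝ} {w : Plane → ℝ} (h : IsC11 M w) (x k : Plane) :
    |w (x + k) - w x - fderiv ℝ w x k| ≤ M * ‖k‖ ^ 2 := by
  have hd : ∀ y ∈ Metric.closedBall x ‖k‖,
      HasFDerivWithinAt (fun y => w y - fderiv ℝ w x y) (fderiv ℝ w y - fderiv ℝ w x)
        (Metric.closedBall x ‖k‖) y := fun y _ =>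
    ((h.1 y).hasFDerivAt.sub (fderiv ℝ w x).hasFDerivAt).hasFDerivWithinAt
  have := (convex_closedBall x ‖k‖).norm_image_sub_le_of_norm_hasFDerivWithin_le hd
    (C := M * ‖k‖) (fun y hy => (h.2 y x).trans (mul_le_mul_of_nonneg_left
      (by simpa [dist_eq_norm] using hy) h.nonneg)) (x := x) (y := x + k)
      (by simp) (by simp)
  simp only [add_sub_cancel_left, map_add, Real.norm_eq_abs] at this
  calc _ = |w (x + k) - (fderiv ℝ w x x + fderiv ℝ w x k) - (w x - fderiv ℝ w x x)| := by
        congr 1; ring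
    _ ≤ _ := this
    _ = _ := by ring

theorem IsC11.tendsto {M : ℝ} {f : ℕ → Plane → ℝ} {w : Plane → ℝ} (hf : ∀ n, IsC11 M (f n))
    (h : TendstoUniformly f w atTop) : IsC11 M w := by
  have hM := (hf 0).nonneg
  have key : ∀ n m x t η, 0 < t → (∀ y, |f n y - f m y| ≤ η) →
      ‖fderiv ℝ (f n) x - fderiv ℝ (f m) x‖ ≤ (2 * η + 2 * M * t ^ 2) / t := by
    intro n m x t η ht hη
    have hη0 : 0 ≤ η := (abs_nonneg _).trans (hη x)
    refine ContinuousLinearMap.opNorm_le_of_unit_norm (𝕜 := ℝ) (by positivity) fun k hk => ?_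
    have h1 := (hf n).taylor x (t • k)
    have h2 := (hf m).taylor x (t • k)
    have h3 := hη x
    have h4 := hη (x + t • k)
    rw [norm_smul, hk, mul_one, Real.norm_of_nonneg ht.le, map_smul, smul_eq_mul] at h1 h2
    rw [Real.norm_eq_abs, le_div_iff₀ ht, ← abs_of_pos ht, ← abs_mul, abs_of_pos ht]
    simp only [sub_apply]
    rw [abs_le] at *
    constructor <;> nlinarith
  have hu : UniformCauchySeqOn (fun n => fderiv ℝ (f n)) atTop univ := by
    rw [Metric.uniformCauchySeqOn_iff]
    intro ε hε
    set t := ε / (4 * (M + 1)) with ht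
    have ht0 : 0 < t := by positivity
    rw [Metric.tendstoUniformly_iff] at h
    obtain ⟨N, hN⟩ := eventually_atTop.1 (h (ε * t / 16) (by positivity))
    refine ⟨N, fun m hm n hn x _ => ?_⟩
    rw [dist_eq_norm]
    refine lt_of_le_of_lt (key m n x t (ε * t / 8) ht0 fun y => ?_) ?_
    · have h1 := hN m hm y
      have h2 := hN n hn y
      rw [Real.dist_eq, abs_lt] at h1 h2
      rw [abs_le]; constructor <;> linarith
    · rw [div_lt_iff₀ ht0]
      have : M * t ≤ ε / 4 := by
        rw [ht, mul_div_assoc', div_le_iff₀ (by positivity)]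
        nlinarith
      nlinarith
  have hlim : ∀ x, ∃ L, Tendsto (fun n => fderiv ℝ (f n) x) atTop (𝓝 L) := fun x =>
    cauchySeq_tendsto_of_complete (hu.cauchySeq (mem_univ x))
  choose g hg using hlim
  have hgu : TendstoUniformly (fun n => fderiv ℝ (f n)) g atTop := by
    rw [← tendstoUniformlyOn_univ]
    exact hu.tendstoUniformlyOn_of_tendsto fun x _ => hg x
  have hd : ∀ x, HasFDerivAt w (g x) x := fun x =>
    hasFDerivAt_of_tendstoUniformly hgu (fun n y => ((hf n).1 y).hasFDerivAt)
      (fun y => h.tendsto_at y) x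
  refine ⟨fun x => (hd x).differentiableAt, fun x y => ?_⟩
  rw [(hd x).fderiv, (hd y).fderiv]
  exact le_of_tendsto ((hg x).sub (hg y)).norm (Eventually.of_forall fun n => (hf n).2 x y)

theorem norm_dual_le (L : Plane →L[ℝ] ℝ) : ‖L‖ ≤ ∑ i, |L (EuclideanSpace.single i 1)| := by
  refine L.opNorm_le_bound (Finset.sum_nonneg fun i _ => abs_nonneg _) fun x => ?_
  have hx : x = ∑ i, x i • EuclideanSpace.single i (1 : ℝ) := by
    ext j; fin_cases j <;> simp [Fin.sum_univ_two]
  conv_lhs => rw [hx]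
  rw [map_sum, Finset.sum_mul]
  refine (norm_sum_le _ _).trans (Finset.sum_le_sum fun i _ => ?_)
  rw [map_smul, smul_eq_mul, norm_mul, mul_comm, Real.norm_eq_abs (L _)]
  exact mul_le_mul_of_nonneg_left (PiLp.norm_apply_le x i) (abs_nonneg _)

theorem isC11_of_partialD_le {f : Plane → ℝ} (hf : ContDiff ℝ smooth f) {M : ℝ}
    (h : ∀ i j x, |partialD i (partialD j f) x| ≤ M) : IsC11 (4 * M) f := by
  refine ⟨hf.differentiable (by simp), fun x y => ?_⟩
  have h1 : ∀ j, |partialD j f x - partialD j f y| ≤ 2 * M * ‖x - y‖ := by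
    intro j
    have := Convex.norm_image_sub_le_of_norm_fderiv_le (𝕜 := ℝ) (f := partialD j f) (s := univ)
      (C := 2 * M) (fun z _ => (partialD_contDiff hf j).differentiable (by simp) z) (fun z _ => by
        refine (norm_dual_le _).trans ?_
        rw [Fin.sum_univ_two, two_mul]
        exact add_le_add (h 0 j z) (h 1 j z)) convex_univ (mem_univ y) (mem_univ x)
    exact this
  refine (norm_dual_le _).trans ?_
  rw [Fin.sum_univ_two]
  have := h1 0
  have := h1 1
  simp only [partialD] at *
  simp only [sub_apply]
  linarith

theorem partialD_comp_sub_left (g : Plane → ℝ) (x : Plane) (i : Fin 2) :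
    partialD i (fun t => g (x - t)) = fun t => -partialD i g (x - t) := by
  funext t
  simp only [partialD]
  by_cases hd : DifferentiableAt ℝ g (x - t)
  · have : HasFDerivAt (fun t => g (x - t)) ((fderiv ℝ g (x - t)).comp
        (-ContinuousLinearMap.id ℝ Plane)) t :=
      hd.hasFDerivAt.comp t ((hasFDerivAt_id t).const_sub x)
    rw [this.fderiv]; simp
  · have hd' : ¬ DifferentiableAt ℝ (fun t => g (x - t)) t := fun h => hd (by
      have h' : DifferentiableAt ℝ (fun t => g (x - t)) (x - (x - t)) := by simpa using h
      have := h'.comp (x - t) ((differentiableAt_id).const_sub x)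
      simpa [Function.comp_def] using this)
    rw [fderiv_zero_of_not_differentiableAt hd, fderiv_zero_of_not_differentiableAt hd']; simp

/-- A continuous representative of an element of `H²₀(Ω)` with bounded second order derivatives
has a Lipschitz gradient. -/
theorem isC11_of_H20 {Ω : Set Plane} {w : Plane → ℝ} (hw : Continuous w)
    (hwc : HasCompactSupport w) (h0 : ∀ x, x ∉ Ω → w x = 0) {W : JetSpace Ω} (hW : W ∈ H20 Ω)
    (hWw : W.fn =ᵐ[volume.restrict Ω] w) {M : ℝ} (hM : 0 ≤ M)
    (hWM : ∀ i j, ∀ᵐ x ∂(volume.restrict Ω), |W (Sum.inr (Sum.inr (i, j))) x| ≤ M) :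
    IsC11 (4 * M) w := by
  have hli : LocallyIntegrable w := hw.locallyIntegrable
  set δ : ℕ → ℝ := fun n => 1 / ((n : ℝ) + 1)
  have hδ : ∀ n, 0 < δ n := fun n => by positivity
  refine IsC11.tendsto (f := fun n => cv w (moll (δ n))) (fun n => ?_) ?_
  · have hm := moll_contDiff (δ n)
    have hmc := moll_hasCompactSupport (hδ n)
    refine isC11_of_partialD_le (cv_contDiff hli hm hmc) fun i j x => ?_
    rw [partialD_cv hli hm hmc, partialD_cv hli (partialD_contDiff hm j)
      (partialD_hasCompactSupport hmc j)]
    set ψ : Plane → ℝ := fun t => moll (δ n) (x - t) with hψ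
    have hψs : ContDiff ℝ smooth ψ := hm.comp (contDiff_const.sub contDiff_id)
    have hψc : HasCompactSupport ψ := hmc.comp_homeomorph (Homeomorph.subLeft x)
    have e1 : partialD i (partialD j ψ) = fun t => partialD i (partialD j (moll (δ n))) (x - t) := by
      rw [hψ, partialD_comp_sub_left]
      have : (fun t => -partialD j (moll (δ n)) (x - t)) =
          (-1 : ℝ) • fun t => partialD j (moll (δ n)) (x - t) := by
        funext t; simp
      rw [this, partialD_smul, partialD_comp_sub_left]
      · funext t; simp
      · exact (partialD_contDiff hm j).comp (contDiff_const.sub contDiff_id)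
    have e2 : cv w (partialD i (partialD j (moll (δ n)))) x =
        ∫ t in Ω, W.fn t * partialD i (partialD j ψ) t := by
      rw [cv, e1, ← setIntegral_eq_integral_of_forall_compl_eq_zero (s := Ω)]
      · refine integral_congr_ae ?_
        filter_upwards [hWw] with t ht
        rw [ht]
      · intro t ht; rw [h0 t ht, zero_mul]
    rw [e2, ← H20_weak_second hW hψs hψc]
    have hψi : Integrable ψ := hψs.continuous.integrable_of_hasCompactSupport hψc
    have hψ0 : ∀ t, 0 ≤ ψ t := fun t => moll_nonneg _ _
    calc |∫ t in Ω, W (Sum.inr (Sum.inr (j, i))) t * ψ t| ≤ ∫ t in Ω, M * ψ t := by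
          rw [← Real.norm_eq_abs]
          refine norm_integral_le_of_norm_le (hψi.const_mul M).restrict ?_
          filter_upwards [hWM j i] with t ht
          rw [norm_mul, Real.norm_of_nonneg (hψ0 t)]
          exact mul_le_mul_of_nonneg_right ht (hψ0 t)
      _ ≤ ∫ t, M * ψ t := setIntegral_le_integral (hψi.const_mul M)
          (Eventually.of_forall fun t => mul_nonneg hM (hψ0 t))
      _ = M := by
          rw [integral_const_mul, hψ, integral_sub_left_eq_self (moll (δ n)) volume x,
            integral_moll (hδ n), mul_one]
  · have huc : UniformContinuous w := hwc.uniformContinuous_of_continuous hw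
    rw [Metric.tendstoUniformly_iff]
    intro ε hε
    obtain ⟨η, hη, hη'⟩ := Metric.uniformContinuous_iff.1 huc (ε / 2) (half_pos hε)
    obtain ⟨N, hN⟩ := exists_nat_one_div_lt hη
    filter_upwards [eventually_ge_atTop N] with n hn x
    have hδη : δ n < η := lt_of_le_of_lt (by
      simp only [δ]; gcongr) hN
    have := cv_moll_sub_le (hδ n) hli (x := x) (c := w x) (B := ε / 2) fun t ht => by
      rw [← Real.dist_eq]
      refine (hη' ?_).le
      rw [dist_eq_norm, norm_sub_rev]
      exact ht.trans hδη
    rw [dist_comm, Real.dist_eq]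
    linarith

theorem IsC11.fderiv_eq_zero_off {Ω : Set Plane} {M : ℝ} {w : Plane → ℝ} (h : IsC11 M w)
    (h0 : ∀ x, x ∉ Ω → w x = 0) (hΩ : Ωᶜ ⊆ closure (interior Ωᶜ)) {x : Plane} (hx : x ∉ Ω) :
    fderiv ℝ w x = 0 := by
  have hcl : IsClosed {x | fderiv ℝ w x = 0} := isClosed_eq h.continuous_fderiv continuous_const
  refine closure_minimal (s := interior Ωᶜ) (fun y hy => ?_) hcl (hΩ hx)
  have : w =ᶠ[𝓝 y] fun _ => 0 := by
    filter_upwards [isOpen_interior.mem_nhds hy] with z hz using h0 z (interior_subset hz)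
  rw [mem_ofPred_eq, this.fderiv_eq]
  simp

end MorleyUC
end

noncomputable section

open MeasureTheory Set Filter Topology
namespace MorleyUC

/-- Bounded sequences in a Hilbert space have weak cluster points. -/
theorem exists_weak_limit {H : Type*} [NormedAddCommGroup H] [InnerProductSpace ℝ H]
    [CompleteSpace H] {f : ℕ → H} {R : ℝ} (hf : ∀ n, ‖f n‖ ≤ R) :
    ∃ g : H, ∀ h : H, ∀ c : ℝ, Tendsto (fun n => inner ℝ (f n) h) atTop (𝓝 c) →
      inner ℝ g h = c := by
  have hcomp := WeakDual.isCompact_closedBall (𝕜 := ℝ) (E := H) 0 R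
  set F : ℕ → WeakDual ℝ H := fun n => StrongDual.toWeakDual (InnerProductSpace.toDual ℝ H (f n))
  have hF : ∀ n, F n ∈ WeakDual.toStrongDual ⁻¹' Metric.closedBall (0 : StrongDual ℝ H) R := by
    intro n
    simpa [F] using! hf n
  obtain ⟨G, -, hG⟩ := hcomp.exists_mapClusterPt (f := atTop) (u := F)
    (le_principal_iff.2 (mem_map.2 (Eventually.of_forall hF)))
  refine ⟨(InnerProductSpace.toDual ℝ H).symm (WeakDual.toStrongDual G), fun h c hc => ?_⟩
  have h1 : MapClusterPt (G h) atTop (fun n => F n h) :=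
    hG.continuousAt_comp (f := fun T : WeakDual ℝ H => T h) (WeakDual.eval_continuous h).continuousAt
  have h2 : (fun n => F n h) = fun n => inner ℝ (f n) h := by
    funext n; simp [F]
  rw [h2] at h1
  have h3 : G h = c := by
    have : ClusterPt (G h) (𝓝 c) := h1.clusterPt.mono hc
    exact eq_of_nhds_neBot this
  rw [InnerProductSpace.toDual_symm_apply]
  exact h3

theorem partialD_mul {f g : Plane → ℝ} (hf : ContDiff ℝ smooth f) (hg : ContDiff ℝ smooth g)
    (i : Fin 2) (x : Plane) :
    partialD i (fun x => f x * g x) x = partialD i f x * g x + f x * partialD i g x := by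
  have := (hf.differentiable (by simp) x).hasFDerivAt.mul
    (hg.differentiable (by simp) x).hasFDerivAt
  unfold partialD
  rw [show (fun x => f x * g x) = f * g from rfl, this.fderiv]
  simp; ring

theorem partialD_cv_of_contDiff_one {f g : Plane → ℝ} (hf : LocallyIntegrable f)
    (hg : ContDiff ℝ 1 g) (hgc : HasCompactSupport g) (i : Fin 2) :
    partialD i (cv f g) = cv f (partialD i g) := by
  funext x
  have h1 := hgc.hasFDerivAt_convolution_right (ContinuousLinearMap.lsmul ℝ ℝ) (μ := volume) hf
    hg x
  rw [partialD, cv_eq_convolution, h1.fderiv,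
    convolution_precompR_apply (ContinuousLinearMap.lsmul ℝ ℝ) hf (hgc.fderiv (𝕜 := ℝ))
      (hg.continuous_fderiv (by simp))]
  rfl

theorem abs_cv_le {f g : Plane → ℝ} (hf : ∀ x, |f x| ≤ 1) (hg : Continuous g)
    (hgc : HasCompactSupport g) (x : Plane) : |cv f g x| ≤ ∫ t, |g t| := by
  have hgi : Integrable g := hg.integrable_of_hasCompactSupport hgc
  unfold cv
  rw [← Real.norm_eq_abs, ← integral_sub_left_eq_self (fun t => |g t|) volume x]
  refine norm_integral_le_of_norm_le (hgi.abs.comp_sub_left x) (Eventually.of_forall fun t => ?_)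
  rw [norm_mul, Real.norm_eq_abs, Real.norm_eq_abs]
  exact mul_le_of_le_one_left (abs_nonneg _) (hf t)

/-- Smooth cut-off functions of an open set. -/
theorem exists_cutoff (Ω : Set Plane) :
    ∃ C : ℝ, 0 < C ∧ ∀ δ : ℝ, 0 < δ → ∃ χ : Plane → ℝ, ContDiff ℝ smooth χ ∧
      (∀ x, |χ x| ≤ 1) ∧ (∀ i x, |partialD i χ x| ≤ C / δ) ∧
      (∀ i j x, |partialD i (partialD j χ) x| ≤ C / δ ^ 2) ∧
      (∀ x, Metric.infDist x Ωᶜ < δ → χ x = 0) ∧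
      (∀ x, 3 * δ ≤ Metric.infDist x Ωᶜ → χ x = 1) := by
  obtain ⟨C, hC, hCδ⟩ := exists_integral_abs_derivOf_moll_le
  refine ⟨C, hC, fun δ hδ => ?_⟩
  set S : Set Plane := {x | 2 * δ ≤ Metric.infDist x Ωᶜ} with hS
  have hSm : MeasurableSet S :=
    (isClosed_le continuous_const (Metric.continuous_infDist_pt _)).measurableSet
  set f : Plane → ℝ := S.indicator fun _ => 1 with hf
  have hli : LocallyIntegrable f := (locallyIntegrable_const (1 : ℝ)).indicator hSm
  have hf1 : ∀ x, |f x| ≤ 1 := fun x => by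
    by_cases hx : x ∈ S <;> simp [hf, hx]
  have hm := moll_contDiff δ
  have hmc := moll_hasCompactSupport hδ
  have hlip : ∀ x t : Plane, |Metric.infDist x Ωᶜ - Metric.infDist t Ωᶜ| ≤ ‖x - t‖ := by
    intro x t
    have := (Metric.lipschitz_infDist_pt (Ωᶜ)).dist_le_mul x t
    simpa [Real.dist_eq, dist_eq_norm] using this
  refine ⟨cv f (moll δ), cv_contDiff hli hm hmc, fun x => ?_, fun i x => ?_, fun i j x => ?_,
    fun x hx => ?_, fun x hx => ?_⟩
  · refine (abs_cv_le hf1 hm.continuous hmc x).trans ?_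
    simp_rw [abs_of_nonneg (moll_nonneg δ _)]
    rw [integral_moll hδ]
  · rw [partialD_cv hli hm hmc]
    exact (abs_cv_le hf1 (partialD_contDiff hm i).continuous (partialD_hasCompactSupport hmc i)
      x).trans ((hCδ δ hδ).1 i)
  · rw [partialD_cv hli hm hmc, partialD_cv hli (partialD_contDiff hm j)
      (partialD_hasCompactSupport hmc j)]
    exact (abs_cv_le hf1 (partialD_contDiff (partialD_contDiff hm j) i).continuous
      (partialD_hasCompactSupport (partialD_hasCompactSupport hmc j) i) x).trans ((hCδ δ hδ).2 i j)
  · have := cv_moll_sub_le hδ hli (x := x) (c := 0) (B := 0) fun t ht => by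
      have h1 := abs_le.1 (hlip x t)
      have : t ∉ S := by
        simp only [hS, mem_ofPred_eq, not_le]; linarith
      simp [hf, this]
    simpa using this
  · have := cv_moll_sub_le hδ hli (x := x) (c := 1) (B := 0) fun t ht => by
      have h1 := abs_le.1 (hlip x t)
      have : t ∈ S := by
        simp only [hS, mem_ofPred_eq]; linarith
      simp [hf, this]
    have := abs_nonpos_iff.1 this
    linarith

/-- A `C^{1,1}`-function that vanishes with its gradient outside the bounded open set `Ω` can be
approximated by test functions that are bounded in `H²(Ω)`. -/
theorem exists_test_approx {Ω : Set Plane} (hΩ : IsOpen Ω) (hb : Bornology.IsBounded Ω)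
    {M : ℝ} {w : Plane → ℝ} (hw : IsC11 M w) (h0 : ∀ x, x ∉ Ω → w x = 0)
    (h1 : ∀ x, x ∉ Ω → fderiv ℝ w x = 0) :
    ∃ (B : ℝ) (f : ℕ → Plane → ℝ), (∀ n, IsTest Ω (f n)) ∧
      (∀ n j, ∀ x ∈ Ω, |derivOf (f n) j x| ≤ B) ∧
      ∀ x ∈ Ω, Tendsto (fun n => f n x) atTop (𝓝 (w x)) := by
  have hM := hw.nonneg
  have hcl : IsClosed Ωᶜ := hΩ.isClosed_compl
  have hne : (Ωᶜ).Nonempty := by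
    rw [nonempty_compl]
    rintro rfl
    exact NormedSpace.unbounded_univ ℝ Plane hb
  obtain ⟨y₀, hy₀⟩ := hne
  obtain ⟨R, hR⟩ := hb.subset_closedBall y₀
  set d : Plane → ℝ := fun x => Metric.infDist x Ωᶜ
  have hd0 : ∀ x, 0 ≤ d x := fun x => Metric.infDist_nonneg
  have hdR : ∀ x ∈ Ω, d x ≤ R := fun x hx => by
    refine (Metric.infDist_le_dist_of_mem hy₀).trans ?_
    simpa using hR hx
  have hdlip : ∀ x t : Plane, d t ≤ d x + ‖x - t‖ := by
    intro x t
    have := (Metric.lipschitz_infDist_pt (Ωᶜ)).dist_le_mul x t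
    rw [Real.dist_eq, dist_eq_norm] at this
    have := (abs_le.1 this).1
    simp only [NNReal.coe_one, one_mul, d] at *
    linarith
  have hdpos : ∀ x ∈ Ω, 0 < d x := fun x hx =>
    (hcl.notMem_iff_infDist_pos ⟨y₀, hy₀⟩).1 (by simpa using hx)
  have hwb : ∀ x, |w x| ≤ M * d x ^ 2 := by
    intro x
    obtain ⟨y, hy, hxy⟩ := hcl.exists_infDist_eq_dist ⟨y₀, hy₀⟩ x
    have := hw.taylor y (x - y)
    rw [h0 y hy, h1 y hy] at this
    simpa [d, hxy, dist_eq_norm] using this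
  have hgb : ∀ x, ‖fderiv ℝ w x‖ ≤ M * d x := by
    intro x
    obtain ⟨y, hy, hxy⟩ := hcl.exists_infDist_eq_dist ⟨y₀, hy₀⟩ x
    have := hw.2 x y
    rw [h1 y hy] at this
    simpa [d, hxy, dist_eq_norm] using this
  have hwc : HasCompactSupport w := HasCompactSupport.intro (hb.isCompact_closure) fun x hx =>
    h0 x fun h => hx (subset_closure h)
  have hwcont : Continuous w := hw.1.continuous
  have hli : LocallyIntegrable w := hwcont.locallyIntegrable
  have hpc : ∀ j, Continuous (partialD j w) := fun j =>
    hw.continuous_fderiv.clm_apply continuous_const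
  have hpl : ∀ j x y, |partialD j w x - partialD j w y| ≤ M * ‖x - y‖ := by
    intro j x y
    have := (fderiv ℝ w x - fderiv ℝ w y).le_opNorm (EuclideanSpace.single j 1)
    simp only [sub_apply, PiLp.norm_single, norm_one, mul_one] at this
    exact this.trans (hw.2 x y)
  have hpb : ∀ j x, |partialD j w x| ≤ M * d x := by
    intro j x
    have := (fderiv ℝ w x).le_opNorm (EuclideanSpace.single j 1)
    simp only [PiLp.norm_single, norm_one, mul_one] at this
    exact this.trans (hgb x)
  -- the mollifications of `w`
  have hmw : ∀ δ, 0 < δ → ∀ j, partialD j (cv w (moll δ)) = cv (partialD j w) (moll δ) := by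
    intro δ hδ j
    rw [cv_comm w, partialD_cv_of_contDiff_one (moll_contDiff δ).continuous.locallyIntegrable
      hw.contDiff hwc, cv_comm]
  have hw0 : ∀ δ, 0 < δ → ∀ x, |cv w (moll δ) x| ≤ M * (d x + δ) ^ 2 := by
    intro δ hδ x
    have := cv_moll_sub_le hδ hli (x := x) (c := 0) (B := M * (d x + δ) ^ 2) fun t ht => by
      rw [sub_zero]
      refine (hwb t).trans ?_
      have := hdlip x t
      have := hd0 t
      gcongr
      linarith
    simpa using this
  have hw1 : ∀ δ, 0 < δ → ∀ j x, |partialD j (cv w (moll δ)) x| ≤ M * (d x + δ) := by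
    intro δ hδ j x
    rw [hmw δ hδ]
    have := cv_moll_sub_le hδ (hpc j).locallyIntegrable (x := x) (c := 0) (B := M * (d x + δ))
      fun t ht => by
        rw [sub_zero]
        refine (hpb j t).trans ?_
        have := hdlip x t
        gcongr
        linarith
    simpa using this
  have hws : ∀ δ, 0 < δ → ContDiff ℝ smooth (cv w (moll δ)) := fun δ hδ =>
    cv_contDiff hli (moll_contDiff δ) (moll_hasCompactSupport hδ)
  have hw2 : ∀ δ, 0 < δ → ∀ i j x, |partialD i (partialD j (cv w (moll δ))) x| ≤ M := by
    intro δ hδ i j x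
    have hl : LipschitzWith ⟨M, hM⟩ (partialD j (cv w (moll δ))) := by
      refine LipschitzWith.of_dist_le_mul fun x y => ?_
      rw [hmw δ hδ, Real.dist_eq, dist_eq_norm, cv_comm]
      have hInt : ∀ x, Integrable fun t => moll δ t * partialD j w (x - t) := fun x =>
        ((moll_contDiff δ).continuous.mul ((hpc j).comp (continuous_const.sub continuous_id))
          ).integrable_of_hasCompactSupport (moll_hasCompactSupport hδ).mul_right
      unfold cv
      rw [← integral_sub (hInt x) (hInt y)]
      calc |∫ t, (moll δ t * partialD j w (x - t) - moll δ t * partialD j w (y - t))|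
          ≤ ∫ t, moll δ t * (M * ‖x - y‖) := by
            rw [← Real.norm_eq_abs]
            refine norm_integral_le_of_norm_le ((moll_integrable hδ).mul_const _)
              (Eventually.of_forall fun t => ?_)
            rw [← mul_sub, norm_mul, Real.norm_of_nonneg (moll_nonneg δ t), Real.norm_eq_abs]
            refine mul_le_mul_of_nonneg_left ((hpl j _ _).trans_eq ?_) (moll_nonneg δ t)
            congr 2; abel
        _ = M * ‖x - y‖ := by rw [integral_mul_const, integral_moll hδ, one_mul]
    have := (fderiv ℝ (partialD j (cv w (moll δ))) x).le_opNorm (EuclideanSpace.single i 1)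
    have h2 := norm_fderiv_le_of_lipschitz ℝ hl (x₀ := x)
    simp only [PiLp.norm_single, norm_one, mul_one] at this
    exact this.trans h2
  obtain ⟨C, hC, hχ⟩ := exists_cutoff Ω
  set δ : ℕ → ℝ := fun n => 1 / ((n : ℝ) + 1) with hδdef
  have hδ : ∀ n, 0 < δ n := fun n => by positivity
  have hδ1 : ∀ n, δ n ≤ 1 := fun n => by
    simp only [hδdef]
    rw [div_le_one (by positivity)]
    linarith [n.cast_nonneg (α := ℝ)]
  choose χ hχs hχb hχ1 hχ2 hχz hχo using fun n => hχ (δ n) (hδ n)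
  have hχ1' : ∀ n i x, 3 * δ n < d x → partialD i (χ n) x = 0 := by
    intro n i x hx
    have : χ n =ᶠ[𝓝 x] fun _ => 1 := by
      filter_upwards [(isOpen_lt continuous_const (Metric.continuous_infDist_pt _)).mem_nhds hx]
        with y hy using hχo n y (le_of_lt hy)
    rw [partialD, this.fderiv_eq]; simp
  have hχ2' : ∀ n i j x, 3 * δ n < d x → partialD i (partialD j (χ n)) x = 0 := by
    intro n i j x hx
    have : partialD j (χ n) =ᶠ[𝓝 x] fun _ => 0 := by
      filter_upwards [(isOpen_lt continuous_const (Metric.continuous_infDist_pt _)).mem_nhds hx]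
        with y hy using hχ1' n j y hy
    rw [partialD, this.fderiv_eq]; simp
  refine ⟨(M * (R + 1) ^ 2 + M * (R + 1)) + 16 * C * M + (24 * C * M + M),
    fun n x => χ n x * cv w (moll (δ n)) x, fun n => ⟨(hχs n).mul (hws _ (hδ n)), ?_, ?_⟩, ?_, ?_⟩
  · refine HasCompactSupport.intro hb.isCompact_closure fun x hx => ?_
    have : d x = 0 := Metric.infDist_zero_of_mem (fun h => hx (subset_closure h))
    have hz : χ n x = 0 := hχz n x (this.trans_lt (hδ n))
    simp [hz]
  · have hsub : tsupport (fun x => χ n x * cv w (moll (δ n)) x) ⊆ {x | δ n ≤ d x} := by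
      refine closure_minimal (fun x hx => ?_)
        (isClosed_le continuous_const (Metric.continuous_infDist_pt _))
      by_contra h
      exact hx (by simp [hχz n x (not_le.1 h)])
    refine hsub.trans fun x hx => ?_
    by_contra h
    have h3 : d x = 0 := Metric.infDist_zero_of_mem (by simpa using h)
    have h4 : δ n ≤ d x := hx
    rw [h3] at h4
    exact absurd (hδ n) (not_lt.2 h4)
  · intro n j x hx
    have hδn := hδ n
    have hδn1 := hδ1 n
    have hRx := hdR x hx
    have hdx := hd0 x
    have b0 := hw0 (δ n) hδn x
    have b1 := fun j => hw1 (δ n) hδn j x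
    have b2 := fun i j => hw2 (δ n) hδn i j x
    have c0 := hχb n x
    have hCM : 0 ≤ C * M := by positivity
    have near0 : |cv w (moll (δ n)) x| ≤ M * (R + 1) ^ 2 := b0.trans (by gcongr)
    have near1 : ∀ j, |partialD j (cv w (moll (δ n))) x| ≤ M * (R + 1) :=
      fun j => (b1 j).trans (by gcongr)
    have hMR : 0 ≤ M * (R + 1) ^ 2 := (abs_nonneg _).trans near0
    have hMR1 : 0 ≤ M * (R + 1) := (abs_nonneg _).trans (near1 0)
    -- bounds for the products with derivatives of the cut-off
    have p1 : ∀ i, |partialD i (χ n) x * cv w (moll (δ n)) x| ≤ 16 * C * M := by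
      intro i
      rcases lt_or_ge (3 * δ n) (d x) with h | h
      · rw [hχ1' n i x h]; simp; nlinarith
      · rw [abs_mul]
        calc _ ≤ C / δ n * (M * (4 * δ n) ^ 2) := by
              refine mul_le_mul (hχ1 n i x) (b0.trans ?_) (abs_nonneg _) (by positivity)
              gcongr; linarith
          _ = 16 * C * M * δ n := by field_simp; ring
          _ ≤ 16 * C * M * 1 := by gcongr
          _ = _ := by ring
    have p2 : ∀ i j, |partialD i (partialD j (χ n)) x * cv w (moll (δ n)) x| ≤ 16 * C * M := by
      intro i j
      rcases lt_or_ge (3 * δ n) (d x) with h | h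
      · rw [hχ2' n i j x h]; simp; nlinarith
      · rw [abs_mul]
        calc _ ≤ C / δ n ^ 2 * (M * (4 * δ n) ^ 2) := by
              refine mul_le_mul (hχ2 n i j x) (b0.trans ?_) (abs_nonneg _) (by positivity)
              gcongr; linarith
          _ = 16 * C * M := by field_simp; ring
    have p3 : ∀ i j, |partialD i (χ n) x * partialD j (cv w (moll (δ n))) x| ≤ 4 * C * M := by
      intro i j
      rcases lt_or_ge (3 * δ n) (d x) with h | h
      · rw [hχ1' n i x h]; simp; nlinarith
      · rw [abs_mul]
        calc _ ≤ C / δ n * (M * (4 * δ n)) := by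
              refine mul_le_mul (hχ1 n i x) ((b1 j).trans ?_) (abs_nonneg _) (by positivity)
              gcongr; linarith
          _ = 4 * C * M := by field_simp
    have q : ∀ a : ℝ, ∀ B : ℝ, |a| ≤ B → |χ n x * a| ≤ B := fun a B h => by
      rw [abs_mul]
      exact (mul_le_of_le_one_left (abs_nonneg _) c0).trans h
    rcases j with _ | i | ⟨i, j⟩
    · refine (q _ _ near0).trans ?_
      nlinarith
    · have e : derivOf (fun x => χ n x * cv w (moll (δ n)) x) (Sum.inr (Sum.inl i)) x =
          partialD i (χ n) x * cv w (moll (δ n)) x + χ n x * partialD i (cv w (moll (δ n))) x :=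
        partialD_mul (hχs n) (hws _ hδn) i x
      rw [e]
      refine (abs_add_le _ _).trans ?_
      have := p1 i
      have := q _ _ (near1 i)
      nlinarith
    · have e : derivOf (fun x => χ n x * cv w (moll (δ n)) x) (Sum.inr (Sum.inr (i, j))) x =
          (partialD i (partialD j (χ n)) x * cv w (moll (δ n)) x +
            partialD j (χ n) x * partialD i (cv w (moll (δ n))) x) +
          (partialD i (χ n) x * partialD j (cv w (moll (δ n))) x +
            χ n x * partialD i (partialD j (cv w (moll (δ n)))) x) := by
        simp only [derivOf]
        have e1 : partialD j (fun x => χ n x * cv w (moll (δ n)) x) =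
            (fun x => partialD j (χ n) x * cv w (moll (δ n)) x) +
            fun x => χ n x * partialD j (cv w (moll (δ n))) x := by
          funext y
          exact partialD_mul (hχs n) (hws _ hδn) j y
        rw [e1, partialD_add ((partialD_contDiff (hχs n) j).mul (hws _ hδn))
          ((hχs n).mul (partialD_contDiff (hws _ hδn) j)), Pi.add_apply,
          partialD_mul (partialD_contDiff (hχs n) j) (hws _ hδn),
          partialD_mul (hχs n) (partialD_contDiff (hws _ hδn) j)]
      rw [e]
      have := p2 i j
      have := p3 j i
      have := p3 i j
      have := q _ _ (b2 i j)
      refine (abs_add_le _ _).trans ((add_le_add (abs_add_le _ _) (abs_add_le _ _)).trans ?_)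
      nlinarith
  · intro x hx
    have hdx := hdpos x hx
    rw [Metric.tendsto_atTop]
    intro ε hε
    obtain ⟨η, hη, hη'⟩ := Metric.continuousAt_iff.1 hwcont.continuousAt (ε / 2) (half_pos hε)
    obtain ⟨N, hN⟩ := exists_nat_one_div_lt (lt_min hη (div_pos hdx three_pos))
    refine ⟨N, fun n hn => ?_⟩
    have hδη : δ n < min η (d x / 3) := lt_of_le_of_lt (by
      simp only [δ]; gcongr) hN
    have := cv_moll_sub_le (hδ n) hli (x := x) (c := w x) (B := ε / 2) fun t ht => by
      rw [← Real.dist_eq]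
      refine (hη' ?_).le
      rw [dist_eq_norm, norm_sub_rev]
      exact ht.trans (hδη.trans_le (min_le_left _ _))
    have h3 : 3 * δ n ≤ d x := by
      have := hδη.trans_le (min_le_right _ _)
      linarith
    have ho : χ n x = 1 := hχo n x h3
    simp only [ho, one_mul, Real.dist_eq]
    linarith

/-- A `C^{1,1}`-function that vanishes with its gradient outside `Ω` is in `H²₀(Ω)`. -/
theorem exists_H20_of_isC11 {Ω : Set Plane} (hΩ : IsOpen Ω) (hb : Bornology.IsBounded Ω)
    {M : ℝ} {w : Plane → ℝ} (hw : IsC11 M w) (h0 : ∀ x, x ∉ Ω → w x = 0)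
    (h1 : ∀ x, x ∉ Ω → fderiv ℝ w x = 0) :
    ∃ W : H20 Ω, JetSpace.fn (W : JetSpace Ω) =ᵐ[volume.restrict Ω] w := by
  obtain ⟨B, f, hf, hfB, hfw⟩ := exists_test_approx hΩ hb hw h0 h1
  have hfin : volume Ω ≠ ⊤ := hb.measure_lt_top.ne
  have : IsFiniteMeasure (volume.restrict Ω) := ⟨by simpa using hb.measure_lt_top⟩
  have hwc : HasCompactSupport w := HasCompactSupport.intro (hb.isCompact_closure) fun x hx =>
    h0 x fun h => hx (subset_closure h)
  have hwm : MemLp w 2 (volume.restrict Ω) :=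
    memLp_of_continuous_hasCompactSupport hw.1.continuous hwc Ω
  set F : ℕ → JetSpace Ω := fun n => jetOf Ω (hf n).1 (hf n).2.1
  have hFmem : ∀ n, F n ∈ H20 Ω := fun n => jetOf_mem (hf n)
  have hFB : ∀ n j, ∀ᵐ x ∂(volume.restrict Ω), |F n j x| ≤ B := by
    intro n j
    filter_upwards [jetOf_coe (Ω := Ω) (hf n).1 (hf n).2.1 j, ae_restrict_mem hΩ.measurableSet]
      with x hx hxΩ
    rw [hx]
    exact hfB n j x hxΩ
  have hFn : ∃ R, ∀ n, ‖F n‖ ≤ R := by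
    refine ⟨Real.sqrt (∑ j : JetIdx, ((volume.restrict Ω).real univ ^ (2 : ENNReal).toReal⁻¹ * |B|) ^ 2),
      fun n => ?_⟩
    rw [PiLp.norm_eq_of_L2]
    refine Real.sqrt_le_sqrt (Finset.sum_le_sum fun j _ => ?_)
    refine pow_le_pow_left₀ (norm_nonneg _) ?_ 2
    exact Lp.norm_le_of_ae_bound (abs_nonneg B) (by
      filter_upwards [hFB n j] with x hx using hx.trans (le_abs_self B))
  obtain ⟨R, hR⟩ := hFn
  obtain ⟨g, hg⟩ := exists_weak_limit hR
  have hgm : g ∈ H20 Ω := by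
    have hc : IsClosed (H20 Ω : Set (JetSpace Ω)) := Submodule.isClosed_topologicalClosure _
    have : (H20 Ω)ᗮᗮ = H20 Ω := by
      rw [Submodule.orthogonal_orthogonal_eq_closure]
      exact hc.submodule_topologicalClosure_eq
    rw [← this]
    intro h hh
    rw [real_inner_comm]
    refine hg h 0 ?_
    have : (fun n => inner ℝ (F n) h) = fun _ => (0 : ℝ) := by
      funext n
      exact hh (F n) (hFmem n)
    rw [this]
    exact tendsto_const_nhds
  refine ⟨⟨g, hgm⟩, ?_⟩
  have hkey : g (Sum.inl ()) = hwm.toLp w := by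
    refine ext_inner_right ℝ fun ψ => ?_
    have hs : ∀ u : JetSpace Ω,
        inner ℝ u (WithLp.toLp 2 (Pi.single (Sum.inl ()) ψ) : JetSpace Ω) =
          inner ℝ (u (Sum.inl ())) ψ := by
      intro u
      rw [PiLp.inner_apply, Finset.sum_eq_single (Sum.inl ())]
      · simp
      · intro j _ hj
        simp [Pi.single_eq_of_ne hj]
      · simp
    rw [← hs g]
    refine hg _ _ ?_
    simp_rw [hs]
    simp only [L2_inner_eq]
    have hψ : Integrable (fun x => ψ x) (volume.restrict Ω) :=
      (Lp.memLp ψ).integrable (by norm_num)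
    refine tendsto_integral_of_dominated_convergence (fun x => B * |ψ x|) (fun n => ?_)
      (hψ.abs.const_mul B) (fun n => ?_) ?_
    · exact (Lp.aestronglyMeasurable _).mul (Lp.aestronglyMeasurable _)
    · filter_upwards [hFB n (Sum.inl ())] with x hx
      rw [norm_mul, Real.norm_eq_abs, Real.norm_eq_abs]
      exact mul_le_mul_of_nonneg_right hx (abs_nonneg _)
    · have hall : ∀ᵐ x ∂(volume.restrict Ω), ∀ n, F n (Sum.inl ()) x = f n x :=
        ae_all_iff.2 fun n => jetOf_coe (Ω := Ω) (hf n).1 (hf n).2.1 (Sum.inl ())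
      filter_upwards [hall, hwm.coeFn_toLp, ae_restrict_mem hΩ.measurableSet] with x h2 h3 h4
      simp only [h2, h3]
      exact (hfw x h4).mul_const _
  change (g (Sum.inl ()) : Plane → ℝ) =ᵐ[volume.restrict Ω] w
  rw [hkey]
  exact hwm.coeFn_toLp

end MorleyUC
end

noncomputable section

open MeasureTheory Set Filter Topology
namespace MorleyUC

/-! ### The Poincaré inequality and the Laplacian on `H²₀(Ω)` -/

theorem partialD_comm {f : Plane → ℝ} (hf : ContDiff ℝ smooth f) (i j : Fin 2) :
    partialD i (partialD j f) = partialD j (partialD i f) := by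
  funext x
  have hd : DifferentiableAt ℝ (fderiv ℝ f) x :=
    (hf.fderiv_right (m := smooth) (by simp)).differentiable (by simp) x
  have h : ∀ i j, partialD i (partialD j f) x =
      fderiv ℝ (fderiv ℝ f) x (EuclideanSpace.single i 1) (EuclideanSpace.single j 1) := by
    intro i j
    have := hd.hasFDerivAt.clm_apply
      (hasFDerivAt_const (EuclideanSpace.single j (1 : ℝ)) x)
    unfold partialD
    rw [this.fderiv]
    simp
  rw [h, h]
  exact (hf.contDiffAt (x := x)).isSymmSndFDerivAt
    (by simp only [minSmoothness_of_isRCLikeNormedField]; exact WithTop.coe_le_coe.2 le_top) _ _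

theorem integral_sq_le {Ω : Set Plane} {R : ℝ} (hR : ∀ x ∈ Ω, |x 0| ≤ R) {f : Plane → ℝ}
    (hf : ContDiff ℝ smooth f) (hfc : HasCompactSupport f) (hfΩ : ∀ x, x ∉ Ω → f x = 0) :
    ∫ x, f x ^ 2 ≤ 4 * R ^ 2 * ∫ x, partialD 0 f x ^ 2 := by
  have hc : ContDiff ℝ smooth fun x : Plane => x 0 := by fun_prop
  have hone : partialD 0 (fun x : Plane => x 0) = fun _ => 1 := by
    funext x
    have : HasFDerivAt (fun x : Plane => x 0) (EuclideanSpace.proj (𝕜 := ℝ) (0 : Fin 2)) x :=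
      (EuclideanSpace.proj (𝕜 := ℝ) (0 : Fin 2)).hasFDerivAt
    rw [partialD, this.fderiv]
    simp
  have h1 := integral_partialD_mul hc (hf.mul hf) (hfc.mul_left) 0
  have hp : ∀ x, partialD 0 (fun x => f x * f x) x = 2 * f x * partialD 0 f x := fun x => by
    rw [partialD_mul hf hf 0 x]; ring
  have hi0 : Integrable fun x => f x ^ 2 :=
    (hf.continuous.pow 2).integrable_of_hasCompactSupport (by
      simpa [pow_two] using! (hfc.mul_left (f := f)))
  have hi1 : Integrable fun x => partialD 0 f x ^ 2 :=
    ((partialD_contDiff hf 0).continuous.pow 2).integrable_of_hasCompactSupport (by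
      simpa [pow_two] using!
        ((partialD_hasCompactSupport hfc 0).mul_left (f := partialD 0 f)))
  have hi2 : Integrable fun x : Plane => x 0 * (2 * f x * partialD 0 f x) := by
    refine (hc.continuous.mul ((continuous_const.mul hf.continuous).mul
      (partialD_contDiff hf 0).continuous)).integrable_of_hasCompactSupport ?_
    exact ((partialD_hasCompactSupport hfc 0).mul_left).mul_left
  have h2 : ∫ x, f x ^ 2 = -∫ x : Plane, x 0 * (2 * f x * partialD 0 f x) := by
    rw [hone] at h1
    simp only [hp, one_mul] at h1
    rw [← h1]
    exact integral_congr_ae (Eventually.of_forall fun x => by simp [pow_two])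
  have h3 : -∫ x : Plane, x 0 * (2 * f x * partialD 0 f x) ≤
      ∫ x, ((1 / 2) * f x ^ 2 + 2 * R ^ 2 * partialD 0 f x ^ 2) := by
    rw [← integral_neg]
    refine integral_mono hi2.neg ((hi0.const_mul _).add (hi1.const_mul _)) fun x => ?_
    by_cases hx : x ∈ Ω
    · have hRx := abs_le.1 (hR x hx)
      have hsq : (x 0) ^ 2 ≤ R ^ 2 := sq_le_sq' hRx.1 hRx.2
      have := mul_le_mul_of_nonneg_right hsq (sq_nonneg (partialD 0 f x))
      simp only
      nlinarith [sq_nonneg (f x + 2 * x 0 * partialD 0 f x)]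
    · simp only [hfΩ x hx]
      have : 0 ≤ 2 * R ^ 2 * partialD 0 f x ^ 2 := by positivity
      simpa using this
  rw [integral_add (hi0.const_mul _) (hi1.const_mul _), integral_const_mul, integral_const_mul,
    ← h2] at h3
  linarith

theorem norm_sq_jetOf {Ω : Set Plane} {φ : Plane → ℝ} (hφ : IsTest Ω φ) (j : JetIdx) :
    ‖jetOf Ω hφ.1 hφ.2.1 j‖ ^ 2 = ∫ x, derivOf φ j x ^ 2 := by
  rw [← real_inner_self_eq_norm_sq, L2_inner_eq, setIntegral_jetOf_mul hφ]
  rw [← setIntegral_eq_integral_of_forall_compl_eq_zero (s := Ω)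
    (f := fun x => derivOf φ j x ^ 2)]
  · rw [← setIntegral_eq_integral_of_forall_compl_eq_zero (s := Ω)]
    · refine integral_congr_ae ?_
      filter_upwards [jetOf_coe (Ω := Ω) hφ.1 hφ.2.1 j] with x hx
      rw [hx, pow_two]
    · intro x hx
      rw [derivOf_eq_zero_off hφ.2.2 j hx, zero_mul]
  · intro x hx
    rw [derivOf_eq_zero_off hφ.2.2 j hx]; simp

/-- The `H²`-seminorm, squared. -/
def semiSq {Ω : Set Plane} (W : JetSpace Ω) : ℝ :=
  ∑ i : Fin 2, ∑ j : Fin 2, ‖W (Sum.inr (Sum.inr (i, j)))‖ ^ 2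

theorem JetSpace.norm_sq {Ω : Set Plane} (W : JetSpace Ω) :
    ‖W‖ ^ 2 = ‖W (Sum.inl ())‖ ^ 2 + (∑ i : Fin 2, ‖W (Sum.inr (Sum.inl i))‖ ^ 2 + semiSq W) := by
  rw [PiLp.norm_sq_eq_of_L2, Fintype.sum_sum_type, Fintype.sum_sum_type, Fintype.sum_prod_type]
  simp [semiSq]

theorem continuous_semiSq (Ω : Set Plane) : Continuous (semiSq (Ω := Ω)) := by
  unfold semiSq
  refine continuous_finsetSum _ fun i _ => continuous_finsetSum _ fun j _ => ?_
  exact ((continuous_jet Ω _).norm).pow 2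

theorem exists_poincare {Ω : Set Plane} (hb : Bornology.IsBounded Ω) :
    ∃ C : ℝ, 0 < C ∧ ∀ W ∈ H20 Ω, ‖W‖ ^ 2 ≤ C * semiSq W := by
  obtain ⟨R, hR⟩ := hb.exists_norm_le
  have hR' : ∀ x ∈ Ω, |x 0| ≤ R := fun x hx => (PiLp.norm_apply_le x 0).trans (hR x hx)
  set P := 4 * R ^ 2
  have hP : 0 ≤ P := by positivity
  refine ⟨P ^ 2 + P + 1, by positivity, fun W hW => ?_⟩
  refine H20_induction (P := fun W => ‖W‖ ^ 2 ≤ (P ^ 2 + P + 1) * semiSq W)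
    (isClosed_le (continuous_norm.pow 2) ((continuous_semiSq Ω).const_mul _)) ?_ hW
  intro φ hφ
  have h1 : ∀ j, ‖jetOf Ω hφ.1 hφ.2.1 (Sum.inr (Sum.inl j))‖ ^ 2 ≤
      P * ‖jetOf Ω hφ.1 hφ.2.1 (Sum.inr (Sum.inr (0, j)))‖ ^ 2 := by
    intro j
    rw [norm_sq_jetOf hφ, norm_sq_jetOf hφ]
    exact integral_sq_le hR' (partialD_contDiff hφ.1 j) (partialD_hasCompactSupport hφ.2.1 j)
      fun x hx => derivOf_eq_zero_off hφ.2.2 (Sum.inr (Sum.inl j)) hx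
  have h0 : ‖jetOf Ω hφ.1 hφ.2.1 (Sum.inl ())‖ ^ 2 ≤
      P * ‖jetOf Ω hφ.1 hφ.2.1 (Sum.inr (Sum.inl 0))‖ ^ 2 := by
    rw [norm_sq_jetOf hφ, norm_sq_jetOf hφ]
    exact integral_sq_le hR' hφ.1 hφ.2.1
      fun x hx => derivOf_eq_zero_off hφ.2.2 (Sum.inl ()) hx
  rw [JetSpace.norm_sq]
  simp only [semiSq, Fin.sum_univ_two]
  have h10 := h1 0
  have h11 := h1 1
  set a := ‖jetOf Ω hφ.1 hφ.2.1 (Sum.inl ())‖ ^ 2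
  set b0 := ‖jetOf Ω hφ.1 hφ.2.1 (Sum.inr (Sum.inl 0))‖ ^ 2
  set b1 := ‖jetOf Ω hφ.1 hφ.2.1 (Sum.inr (Sum.inl 1))‖ ^ 2
  set c00 := ‖jetOf Ω hφ.1 hφ.2.1 (Sum.inr (Sum.inr (0, 0)))‖ ^ 2 with e00
  set c01 := ‖jetOf Ω hφ.1 hφ.2.1 (Sum.inr (Sum.inr (0, 1)))‖ ^ 2 with e01
  set c10 := ‖jetOf Ω hφ.1 hφ.2.1 (Sum.inr (Sum.inr (1, 0)))‖ ^ 2 with e10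
  set c11 := ‖jetOf Ω hφ.1 hφ.2.1 (Sum.inr (Sum.inr (1, 1)))‖ ^ 2 with e11
  have p00 : 0 ≤ c00 := sq_nonneg _
  have p01 : 0 ≤ c01 := sq_nonneg _
  have p10 : 0 ≤ c10 := sq_nonneg _
  have p11 : 0 ≤ c11 := sq_nonneg _
  have h2 : a ≤ P * (P * c00) := h0.trans (mul_le_mul_of_nonneg_left h10 hP)
  have q1 : 0 ≤ P * P * c01 := by positivity
  have q2 : 0 ≤ P * P * c10 := by positivity
  have q3 : 0 ≤ P * P * c11 := by positivity
  have q4 : 0 ≤ P * c10 := by positivity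
  have q5 : 0 ≤ P * c11 := by positivity
  nlinarith

theorem lap_apply {Ω : Set Plane} (W : JetSpace Ω) :
    lap Ω W = W (Sum.inr (Sum.inr (0, 0))) + W (Sum.inr (Sum.inr (1, 1))) := by
  simp [lap, Fin.sum_univ_two]

theorem semiSq_eq_lap {Ω : Set Plane} {W : JetSpace Ω} (hW : W ∈ H20 Ω) :
    semiSq W = ‖lap Ω W‖ ^ 2 := by
  refine H20_induction (P := fun W => semiSq W = ‖lap Ω W‖ ^ 2)
    (isClosed_eq (continuous_semiSq Ω) (((lap Ω).continuous.norm).pow 2)) ?_ hW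
  intro φ hφ
  have key : inner ℝ (jetOf Ω hφ.1 hφ.2.1 (Sum.inr (Sum.inr (0, 0))))
      (jetOf Ω hφ.1 hφ.2.1 (Sum.inr (Sum.inr (1, 1)))) =
      ‖jetOf Ω hφ.1 hφ.2.1 (Sum.inr (Sum.inr (0, 1)))‖ ^ 2 := by
    have d0 := partialD_contDiff hφ.1 0
    have d1 := partialD_contDiff hφ.1 1
    have e1 : inner ℝ (jetOf Ω hφ.1 hφ.2.1 (Sum.inr (Sum.inr (0, 0))))
        (jetOf Ω hφ.1 hφ.2.1 (Sum.inr (Sum.inr (1, 1)))) =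
        ∫ x, partialD 0 (partialD 0 φ) x * partialD 1 (partialD 1 φ) x := by
      have := inner_toLp (jetOf Ω hφ.1 hφ.2.1 (Sum.inr (Sum.inr (0, 0))))
        (derivOf_memLp hφ.1 hφ.2.1 Ω (Sum.inr (Sum.inr (1, 1))))
      rw [setIntegral_jetOf_mul hφ] at this
      exact this
    rw [e1, norm_sq_jetOf hφ, integral_partialD_mul d0 (partialD_contDiff d1 1)
      (partialD_hasCompactSupport (partialD_hasCompactSupport hφ.2.1 1) 1)]
    have e2 : ∫ x, derivOf φ (Sum.inr (Sum.inr (0, 1))) x ^ 2 =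
        ∫ x, partialD 1 (partialD 0 φ) x * partialD 0 (partialD 1 φ) x := by
      refine integral_congr_ae (Eventually.of_forall fun x => ?_)
      simp only [derivOf, pow_two]
      rw [partialD_comm hφ.1 0 1]
    rw [e2, integral_partialD_mul d0 (partialD_contDiff d1 0)
      (partialD_hasCompactSupport (partialD_hasCompactSupport hφ.2.1 1) 0), partialD_comm d1 0 1]
  have hsym : ‖jetOf Ω hφ.1 hφ.2.1 (Sum.inr (Sum.inr (1, 0)))‖ ^ 2 =
      ‖jetOf Ω hφ.1 hφ.2.1 (Sum.inr (Sum.inr (0, 1)))‖ ^ 2 := by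
    rw [norm_sq_jetOf hφ, norm_sq_jetOf hφ]
    simp only [derivOf]
    rw [partialD_comm hφ.1 0 1]
  rw [lap_apply, norm_add_sq_real, key]
  simp only [semiSq, Fin.sum_univ_two]
  rw [hsym]; ring

theorem exists_norm_le_lap {Ω : Set Plane} (hb : Bornology.IsBounded Ω) :
    ∃ C : ℝ, 0 < C ∧ ∀ W ∈ H20 Ω, ‖W‖ ≤ C * ‖lap Ω W‖ := by
  obtain ⟨C, hC, h⟩ := exists_poincare hb
  refine ⟨Real.sqrt C, Real.sqrt_pos.2 hC, fun W hW => ?_⟩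
  have := h W hW
  rw [semiSq_eq_lap hW] at this
  rw [← Real.sqrt_sq (norm_nonneg W), ← Real.sqrt_sq (norm_nonneg (lap Ω W)), ← Real.sqrt_mul hC.le]
  exact Real.sqrt_le_sqrt this

/-- Every `z ∈ L₂(Ω)` is the sum of a function that is controlled by `‖B z‖` and a weakly harmonic
function. -/
theorem exists_decomposition {Ω : Set Plane} (hb : Bornology.IsBounded Ω) :
    ∃ C : ℝ, 0 < C ∧ ∀ z : L2 Ω, ∃ z₀ h : L2 Ω, z = z₀ + h ∧ ‖z₀‖ ≤ C * ‖opB Ω z‖ ∧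
      opB Ω h = 0 := by
  obtain ⟨C, hC, hCW⟩ := exists_norm_le_lap hb
  refine ⟨C, hC, fun z => ?_⟩
  set T : H20 Ω →L[ℝ] L2 Ω := (lap Ω).comp (H20 Ω).subtypeL with hT
  have hTb : ∀ v : H20 Ω, ‖v‖ ≤ C * ‖T v‖ := fun v => hCW v v.2
  have hcomp : CompleteSpace (H20 Ω) :=
    (Submodule.isClosed_topologicalClosure (testJets Ω)).completeSpace_coe
  have hanti : AntilipschitzWith ⟨C, hC.le⟩ T :=
    ContinuousLinearMap.antilipschitz_of_bound T hTb
  have hcl : IsClosed (range T) := hanti.isClosed_range T.uniformContinuous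
  set S : Submodule ℝ (L2 Ω) := LinearMap.range (T : H20 Ω →ₗ[ℝ] L2 Ω) with hS
  have hScl : IsClosed (S : Set (L2 Ω)) := hcl
  have hSc : CompleteSpace S := hScl.completeSpace_coe
  have hB : ∀ (y : L2 Ω) (v : H20 Ω), opB Ω y v = -inner ℝ y (T v) := fun y v => by
    simp [opB, hT]
  refine ⟨S.starProjection z, z - S.starProjection z, by abel, ?_, ?_⟩
  · have hmem : S.starProjection z ∈ S := Submodule.starProjection_apply_mem S z
    obtain ⟨v, hv⟩ := LinearMap.mem_range.1 hmem
    have hv' : T v = S.starProjection z := hv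
    have h1 : ‖S.starProjection z‖ ^ 2 = -opB Ω z v := by
      rw [hB, neg_neg, hv', ← real_inner_self_eq_norm_sq]
      have : inner ℝ (z - S.starProjection z) (S.starProjection z) = 0 :=
        Submodule.starProjection_inner_eq_zero z _ hmem
      rw [inner_sub_left] at this
      linarith
    have h2 : ‖S.starProjection z‖ ^ 2 ≤ ‖opB Ω z‖ * (C * ‖S.starProjection z‖) := by
      rw [h1]
      refine (neg_le_abs _).trans (((opB Ω z).le_opNorm v).trans ?_)
      have := hTb v
      rw [hv'] at this
      exact mul_le_mul_of_nonneg_left this (opB Ω z).opNorm_nonneg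
    rcases eq_or_lt_of_le (norm_nonneg (S.starProjection z)) with h | h
    · rw [← h]; positivity
    · have : ‖S.starProjection z‖ * ‖S.starProjection z‖ ≤
          (C * ‖opB Ω z‖) * ‖S.starProjection z‖ := by nlinarith
      exact le_of_mul_le_mul_right this h
  · ext v
    rw [hB]
    have : inner ℝ (z - S.starProjection z) (T v) = 0 :=
      Submodule.starProjection_inner_eq_zero z _ (LinearMap.mem_range.2 ⟨v, rfl⟩)
    rw [this]; simp

end MorleyUC
end

noncomputable section

open MeasureTheory Set Filter Topology InnerProductSpace
namespace MorleyUC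

/-! ### Harmonic functions and Weyl's lemma -/

/-- The identification of `ℂ` with the plane. -/
def planeIso : ℂ ≃ₗᵢ[ℝ] Plane := Complex.orthonormalBasisOneI.repr

theorem laplacian_plane (f : Plane → ℝ) (x : Plane) :
    Laplacian.laplacian f x = ∑ i : Fin 2, iteratedFDeriv ℝ 2 f x
      ![EuclideanSpace.single i 1, EuclideanSpace.single i 1] := by
  rw [laplacian_eq_iteratedFDeriv_orthonormalBasis f (EuclideanSpace.basisFun (Fin 2) ℝ)]
  simp

theorem laplacian_eq_partialD {f : Plane → ℝ} (hf : ContDiff ℝ smooth f) (x : Plane) :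
    Laplacian.laplacian f x = ∑ i : Fin 2, partialD i (partialD i f) x := by
  rw [laplacian_plane]
  refine Finset.sum_congr rfl fun i _ => ?_
  have hd : DifferentiableAt ℝ (fderiv ℝ f) x :=
    (hf.fderiv_right (m := smooth) (by simp)).differentiable (by simp) x
  have := hd.hasFDerivAt.clm_apply (hasFDerivAt_const (EuclideanSpace.single i (1 : ℝ)) x)
  rw [iteratedFDeriv_two_apply]
  unfold partialD
  rw [this.fderiv]
  simp

theorem HarmonicAt.comp_planeIso {f : Plane → ℝ} {x : Plane} {z : ℂ}
    (h : HarmonicAt f (planeIso z + x)) : HarmonicAt (fun z => f (planeIso z + x)) z := by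
  have hc : ContDiff ℝ 2 fun z : ℂ => planeIso z + x := by
    fun_prop
  refine ⟨h.1.comp z hc.contDiffAt, ?_⟩
  have ht : Tendsto (fun z : ℂ => planeIso z + x) (𝓝 z) (𝓝 (planeIso z + x)) :=
    hc.continuous.tendsto z
  filter_upwards [ht.eventually h.2] with y hy
  have e1 : (fun z : ℂ => f (planeIso z + x)) = (fun u => f (u + x)) ∘ planeIso := rfl
  rw [laplacian_eq_iteratedFDeriv_orthonormalBasis _ Complex.orthonormalBasisOneI]
  rw [laplacian_eq_iteratedFDeriv_orthonormalBasis f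
    (Complex.orthonormalBasisOneI.map planeIso)] at hy
  refine Eq.trans (Finset.sum_congr rfl fun i _ => ?_) hy
  have h2 := ContinuousLinearEquiv.iteratedFDerivWithin_comp_right (𝕜 := ℝ) (s := univ)
    planeIso.toContinuousLinearEquiv (fun u => f (u + x)) uniqueDiffOn_univ (x := y) (mem_univ _) 2
  rw [preimage_univ, iteratedFDerivWithin_univ, iteratedFDerivWithin_univ] at h2
  have h3 : iteratedFDeriv ℝ 2 ((fun u => f (u + x)) ∘ planeIso) y = _ := h2
  rw [e1, h3, iteratedFDeriv_comp_add_right]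
  simp only [ContinuousMultilinearMap.compContinuousLinearMap_apply]
  congr 1
  funext j
  fin_cases j <;> simp

/-- The mean value property with respect to the radial mollifier. -/
theorem cv_moll_of_harmonic {f : Plane → ℝ} {x : Plane} {δ : ℝ} (hδ : 0 < δ)
    (h : HarmonicOnNhd f (Metric.closedBall x δ)) (hf : LocallyIntegrable f) :
    cv f (moll δ) x = f x := by
  have hi : Integrable fun t => moll δ (x - t) := (moll_integrable hδ).comp_sub_left x
  have h1 : ∫ t, moll δ (x - t) = 1 := by
    rw [integral_sub_left_eq_self (moll δ) volume x, integral_moll hδ]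
  have hfi : Integrable fun t => f t * moll δ (x - t) := by
    have := (moll_hasCompactSupport hδ).convolutionExists_right
      (ContinuousLinearMap.lsmul ℝ ℝ) (μ := volume) hf (moll_contDiff δ).continuous x
    exact this.integrable
  have h2 : cv f (moll δ) x - f x = ∫ t, (f t - f x) * moll δ (x - t) := by
    simp_rw [sub_mul]
    rw [integral_sub hfi (hi.const_mul _), integral_const_mul, h1, mul_one]
    rfl
  rw [← sub_eq_zero, h2]
  set m : ℝ → ℝ := fun r => (δ ^ 2 * ∫ y, radialBump y)⁻¹ *
    Real.smoothTransition (1 - (δ⁻¹ * r) ^ 2) with hm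
  have hmm : ∀ y : Plane, moll δ y = m ‖y‖ := fun y => by
    simp [moll, radialBump, hm, norm_smul, abs_of_pos hδ]
  set g : ℂ → ℝ := fun z => f (planeIso z + x) with hg
  have h3 : ∫ t, (f t - f x) * moll δ (x - t) = ∫ z : ℂ, (g z - g 0) * m ‖z‖ := by
    rw [← integral_add_right_eq_self (fun t => (f t - f x) * moll δ (x - t)) x,
      ← planeIso.measurePreserving.integral_comp planeIso.toHomeomorph.measurableEmbedding]
    refine integral_congr_ae (Eventually.of_forall fun z => ?_)
    simp only [hg, map_zero, zero_add]
    rw [show x - (planeIso z + x) = -planeIso z by abel, moll_neg, hmm, planeIso.norm_map]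
  have hgh : HarmonicOnNhd g (Metric.closedBall 0 δ) := fun z hz => by
    refine HarmonicAt.comp_planeIso (h _ ?_)
    simpa using hz
  rw [h3, ← Complex.integral_comp_polarCoord_symm]
  by_cases hInt : IntegrableOn (fun p : ℝ × ℝ => p.1 • ((g (Complex.polarCoord.symm p) - g 0) *
      m ‖Complex.polarCoord.symm p‖)) (Ioi 0 ×ˢ Ioo (-Real.pi) Real.pi) volume
  · rw [polarCoord_target, Measure.volume_eq_prod, setIntegral_prod _ hInt]
    refine setIntegral_eq_zero_of_forall_eq_zero fun r hr => ?_
    have hr0 : 0 < r := hr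
    have e2 : ∀ θ : ℝ, Complex.polarCoord.symm (r, θ) = circleMap 0 r θ := fun θ => by
      simp [Complex.polarCoord_symm_apply, circleMap, Complex.exp_mul_I]
    have e3 : ∀ θ : ℝ, r • ((g (Complex.polarCoord.symm (r, θ)) - g 0) *
        m ‖Complex.polarCoord.symm (r, θ)‖) = r * m r * (g (circleMap 0 r θ) - g 0) := fun θ => by
      rw [e2, norm_circleMap_zero, abs_of_pos hr0, smul_eq_mul]; ring
    simp_rw [e3]
    rw [integral_const_mul]
    rcases le_or_gt δ r with hrδ | hrδ
    · have : m r = 0 := by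
        have := hmm (EuclideanSpace.single 0 r)
        rw [moll_eq_zero hδ (by simpa using hrδ.trans (le_abs_self r))] at this
        simpa [abs_of_pos hr0] using this.symm
      rw [this]; simp
    · have hsub : HarmonicOnNhd g (Metric.closedBall 0 |r|) := hgh.mono
        (Metric.closedBall_subset_closedBall (by rw [abs_of_pos hr0]; exact hrδ.le))
      have hav := hsub.circleAverage_eq
      rw [Real.circleAverage_eq_integral_add (-Real.pi),
        intervalIntegral.integral_comp_add_right (fun θ => g (circleMap 0 r θ))] at hav
      have hcg : Continuous fun θ : ℝ => g (circleMap 0 r θ) := by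
        refine hsub.continuousOn.comp_continuous (continuous_circleMap 0 r) fun θ => ?_
        simp
      have e4 : ∫ θ in Ioo (-Real.pi) Real.pi, (g (circleMap 0 r θ) - g 0) =
          ∫ θ in (-Real.pi)..Real.pi, (g (circleMap 0 r θ) - g 0) := by
        rw [intervalIntegral.integral_of_le (by linarith [Real.pi_pos]), integral_Ioc_eq_integral_Ioo]
      rw [e4, intervalIntegral.integral_sub (hcg.intervalIntegrable _ _) (by simp)]
      simp only [intervalIntegral.integral_const, smul_eq_mul]
      have hpi := Real.pi_pos
      rw [smul_eq_mul, show (0 : ℝ) + -Real.pi = -Real.pi by ring,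
        show 2 * Real.pi + -Real.pi = Real.pi by ring] at hav
      rw [← hav]
      field_simp
      ring
  · rw [polarCoord_target]
    exact integral_undef hInt

theorem cv_assoc {f g k : Plane → ℝ} (hf : LocallyIntegrable f) (hg : Continuous g)
    (hgc : HasCompactSupport g) (hk : Continuous k) (hkc : HasCompactSupport k) (x : Plane) :
    cv (cv f g) k x = cv f (cv g k) x := by
  simp only [cv_eq_convolution]
  have hgk : Continuous (MeasureTheory.convolution (fun x => ‖g x‖) (fun x => ‖k x‖)
      (ContinuousLinearMap.mul ℝ ℝ) volume) :=
    hkc.norm.continuous_convolution_right _ hg.norm.locallyIntegrable hk.norm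
  refine convolution_assoc _ _ _ _ (fun a b c => by simp [mul_assoc]) hf.aestronglyMeasurable
    hg.aestronglyMeasurable hk.aestronglyMeasurable ?_ ?_ ?_
  · exact Eventually.of_forall fun y => hgc.convolutionExists_right _ hf hg y
  · exact Eventually.of_forall fun y =>
      hkc.norm.convolutionExists_right _ hg.norm.locallyIntegrable hk.norm y
  · have hfn : LocallyIntegrable (fun x => ‖f x‖) := fun y => (hf y).norm
    have hcs : HasCompactSupport (MeasureTheory.convolution (fun x => ‖g x‖) (fun x => ‖k x‖)
      (ContinuousLinearMap.mul ℝ ℝ) volume) := hgc.norm.convolution _ hkc.norm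
    exact hcs.convolutionExists_right (ContinuousLinearMap.mul ℝ ℝ) hfn hgk x

theorem exists_integral_mul_cv_moll_sub_le {u ψ : Plane → ℝ} (hui : Integrable u)
    (hψ : Continuous ψ) (hψc : HasCompactSupport ψ) {ε : ℝ} (hε : 0 < ε) :
    ∃ κ, 0 < κ ∧ ∀ δ, 0 < δ → δ ≤ κ → |∫ x, ψ x * (cv u (moll δ) x - u x)| ≤ ε := by
  have hul : LocallyIntegrable u := hui.locallyIntegrable
  have hψu : Integrable fun x => ψ x * u x := by
    obtain ⟨C, hC⟩ := hψ.bounded_above_of_compact_support hψc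
    exact hui.bdd_mul hψ.aestronglyMeasurable (Eventually.of_forall hC)
  obtain ⟨ψ', hψ'⟩ : ∃ ψ' : Plane → ℝ, ψ' = fun y => ψ (-y) := ⟨_, rfl⟩
  have hψ's : Continuous ψ' := by rw [hψ']; exact hψ.comp continuous_neg
  have hψ'c : HasCompactSupport ψ' := by
    rw [hψ']; exact hψc.comp_homeomorph (Homeomorph.neg Plane)
  have hψ'n : ∀ t, ψ' (-t) = ψ t := fun t => by simp [hψ']
  have e1 : ∀ δ, 0 < δ → ∫ x, ψ x * (cv u (moll δ) x - u x) =
      ∫ t, u t * (cv ψ' (moll δ) (-t) - ψ' (-t)) := by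
    intro δ hδ
    have hUψ : Integrable fun x => ψ x * cv u (moll δ) x :=
      (hψ.mul (cv_contDiff hul (moll_contDiff δ)
        (moll_hasCompactSupport hδ)).continuous).integrable_of_hasCompactSupport hψc.mul_right
    have a2 : ∫ x, ψ x * cv u (moll δ) x = ∫ t, u t * cv ψ' (moll δ) (-t) := by
      have h0 : ∫ x, ψ x * cv u (moll δ) x = cv (cv u (moll δ)) ψ' 0 := by
        rw [cv]
        refine integral_congr_ae (Eventually.of_forall fun x => ?_)
        simp [mul_comm, hψ'n]
      rw [h0, cv_assoc hul (moll_contDiff δ).continuous (moll_hasCompactSupport hδ) hψ's hψ'c,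
        cv_comm (moll δ), cv]
      simp
    have a3 : Integrable fun t => u t * cv ψ' (moll δ) (-t) := by
      have hcs : HasCompactSupport (cv ψ' (moll δ)) := by
        rw [cv_eq_convolution]
        exact hψ'c.convolution _ (moll_hasCompactSupport hδ)
      have hcc : Continuous (cv ψ' (moll δ)) :=
        (cv_contDiff hψ's.locallyIntegrable (moll_contDiff δ) (moll_hasCompactSupport hδ)).continuous
      obtain ⟨C, hC⟩ := hcc.bounded_above_of_compact_support hcs
      have := hui.bdd_mul (f := fun t => cv ψ' (moll δ) (-t))
        (hcc.comp continuous_neg).aestronglyMeasurable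
        (Eventually.of_forall fun t => hC (-t))
      simpa [mul_comm] using! this
    simp_rw [mul_sub, hψ'n]
    rw [integral_sub hUψ hψu, a2, integral_sub a3 (by simpa [mul_comm] using! hψu)]
    simp [mul_comm]
  have huc : UniformContinuous ψ' := hψ'c.uniformContinuous_of_continuous hψ's
  obtain ⟨A, hA⟩ : ∃ A, A = ∫ t, |u t| := ⟨_, rfl⟩
  have hA0 : 0 ≤ A := by rw [hA]; exact integral_nonneg fun t => abs_nonneg _
  obtain ⟨κ, hκ, hκ'⟩ := Metric.uniformContinuous_iff.1 huc (ε / (A + 1)) (by positivity)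
  refine ⟨κ, hκ, fun δ hδ hδκ => ?_⟩
  rw [e1 δ hδ]
  calc |∫ t, u t * (cv ψ' (moll δ) (-t) - ψ' (-t))| ≤ ∫ t, |u t| * (ε / (A + 1)) := by
        rw [← Real.norm_eq_abs]
        refine norm_integral_le_of_norm_le (hui.abs.mul_const _) (Eventually.of_forall fun t => ?_)
        rw [norm_mul, Real.norm_eq_abs, Real.norm_eq_abs]
        refine mul_le_mul_of_nonneg_left ?_ (abs_nonneg _)
        refine cv_moll_sub_le hδ hψ's.locallyIntegrable fun s hs => ?_
        rw [← Real.dist_eq]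
        refine (hκ' ?_).le
        rw [dist_comm, dist_eq_norm]
        exact hs.trans_le hδκ
    _ = A * (ε / (A + 1)) := by rw [integral_mul_const, hA]
    _ ≤ ε := by
        rw [mul_div_assoc', div_le_iff₀ (by positivity)]
        nlinarith

theorem opB_eq_zero_test {Ω : Set Plane} {h : L2 Ω} (hh : opB Ω h = 0) {ψ : Plane → ℝ}
    (hψ : IsTest Ω ψ) : ∑ i : Fin 2, ∫ x, Ω.indicator h x * partialD i (partialD i ψ) x = 0 := by
  have h1 : opB Ω h ⟨jetOf Ω hψ.1 hψ.2.1, jetOf_mem hψ⟩ = 0 := by rw [hh]; rfl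
  have h2 : inner ℝ h (lap Ω (jetOf Ω hψ.1 hψ.2.1)) = 0 := by
    simpa [opB] using h1
  rw [lap_apply, inner_add_right] at h2
  have h3 : ∀ i : Fin 2, inner ℝ h (jetOf Ω hψ.1 hψ.2.1 (Sum.inr (Sum.inr (i, i)))) =
      ∫ x, Ω.indicator h x * partialD i (partialD i ψ) x := by
    intro i
    rw [real_inner_comm, L2_inner_eq, setIntegral_jetOf_mul hψ]
    refine integral_congr_ae (Eventually.of_forall fun x => ?_)
    by_cases hx : x ∈ Ω
    · simp [hx, derivOf, mul_comm]
    · have := derivOf_eq_zero_off hψ.2.2 (Sum.inr (Sum.inr (i, i))) hx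
      simp [hx, this]
  rw [Fin.sum_univ_two, ← h3, ← h3, h2]

/-- **Weyl's lemma**: a weakly harmonic function in `L₂(Ω)` has a harmonic representative. -/
theorem exists_harmonic_of_opB_eq_zero {Ω : Set Plane} (hΩ : IsOpen Ω)
    (hb : Bornology.IsBounded Ω) {h : L2 Ω} (hh : opB Ω h = 0) :
    ∃ w : Plane → ℝ, HarmonicOnNhd w Ω ∧ (h : Plane → ℝ) =ᵐ[volume.restrict Ω] w := by
  have : IsFiniteMeasure (volume.restrict Ω) := ⟨by simpa using hb.measure_lt_top⟩
  have hne : (Ωᶜ).Nonempty := by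
    rw [nonempty_compl]
    rintro rfl
    exact NormedSpace.unbounded_univ ℝ Plane hb
  have hcl : IsClosed Ωᶜ := hΩ.isClosed_compl
  set u : Plane → ℝ := Ω.indicator h with hu
  have hui : Integrable u := by
    rw [hu, integrable_indicator_iff hΩ.measurableSet]
    exact (Lp.memLp h).integrable (by norm_num)
  have hul : LocallyIntegrable u := hui.locallyIntegrable
  set d : Plane → ℝ := fun x => Metric.infDist x Ωᶜ with hd
  have hdc : Continuous d := Metric.continuous_infDist_pt _
  have hdlip : ∀ x t : Plane, d x - ‖x - t‖ ≤ d t := by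
    intro x t
    have := (Metric.lipschitz_infDist_pt (Ωᶜ)).dist_le_mul x t
    rw [Real.dist_eq, dist_eq_norm] at this
    have := (abs_le.1 this).2
    simp only [NNReal.coe_one, one_mul, hd] at *
    linarith
  have hdpos : ∀ x, x ∈ Ω ↔ 0 < d x := fun x => by
    rw [← hcl.notMem_iff_infDist_pos hne]; simp
  set U : ℝ → Plane → ℝ := fun δ => cv u (moll δ) with hU
  have hUs : ∀ δ, 0 < δ → ContDiff ℝ smooth (U δ) := fun δ hδ =>
    cv_contDiff hul (moll_contDiff δ) (moll_hasCompactSupport hδ)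
  have hlap : ∀ δ, 0 < δ → ∀ x, δ < d x → Laplacian.laplacian (U δ) x = 0 := by
    intro δ hδ x hx
    have hm := moll_contDiff δ
    have hmc := moll_hasCompactSupport hδ
    rw [laplacian_eq_partialD (hUs δ hδ)]
    set ψ : Plane → ℝ := fun t => moll δ (x - t) with hψ
    have hψs : ContDiff ℝ smooth ψ := hm.comp (contDiff_const.sub contDiff_id)
    have hψt : IsTest Ω ψ := by
      have hsub : tsupport ψ ⊆ Metric.closedBall x δ := by
        refine closure_minimal (fun t ht => ?_) Metric.isClosed_closedBall
        by_contra hc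
        refine ht (moll_eq_zero hδ ?_)
        rw [Metric.mem_closedBall, dist_comm, dist_eq_norm, not_le] at hc
        exact hc.le
      refine ⟨hψs, HasCompactSupport.of_support_subset_isCompact (isCompact_closedBall x δ)
        (subset_closure.trans hsub), hsub.trans fun t ht => ?_⟩
      rw [hdpos]
      have := hdlip x t
      rw [Metric.mem_closedBall, dist_comm, dist_eq_norm] at ht
      linarith
    rw [← opB_eq_zero_test hh hψt]
    refine Finset.sum_congr rfl fun i _ => ?_
    simp only [hU]
    rw [partialD_cv hul hm hmc, partialD_cv hul (partialD_contDiff hm i)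
      (partialD_hasCompactSupport hmc i), cv]
    have e1 : partialD i (partialD i ψ) = fun t => partialD i (partialD i (moll δ)) (x - t) := by
      rw [hψ, partialD_comp_sub_left]
      have : (fun t => -partialD i (moll δ) (x - t)) =
          (-1 : ℝ) • fun t => partialD i (moll δ) (x - t) := by
        funext t; simp
      rw [this, partialD_smul, partialD_comp_sub_left]
      · funext t; simp
      · exact (partialD_contDiff hm i).comp (contDiff_const.sub contDiff_id)
    rw [e1]
  have hharm : ∀ δ, 0 < δ → ∀ x, δ < d x → HarmonicAt (U δ) x := by
    intro δ hδ x hx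
    refine ⟨((hUs δ hδ).contDiffAt).of_le (WithTop.coe_le_coe.2 le_top), ?_⟩
    filter_upwards [(isOpen_lt continuous_const hdc).mem_nhds hx] with y hy
    exact hlap δ hδ y hy
  have hindep' : ∀ δ r, 0 < δ → 0 < r → ∀ x, δ + r < d x → cv (U δ) (moll r) x = U δ x := by
    intro δ r hδ hr x hx
    refine cv_moll_of_harmonic hr (fun t ht => hharm δ hδ t ?_)
      (hUs δ hδ).continuous.locallyIntegrable
    have := hdlip x t
    rw [Metric.mem_closedBall, dist_comm, dist_eq_norm] at ht
    linarith
  have hindep : ∀ δ r, 0 < δ → 0 < r → ∀ x, δ + r < d x → U δ x = U r x := by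
    intro δ r hδ hr x hx
    rw [← hindep' δ r hδ hr x hx, ← hindep' r δ hr hδ x (by linarith)]
    simp only [hU]
    rw [cv_assoc hul (moll_contDiff δ).continuous (moll_hasCompactSupport hδ)
      (moll_contDiff r).continuous (moll_hasCompactSupport hr),
      cv_assoc hul (moll_contDiff r).continuous (moll_hasCompactSupport hr)
      (moll_contDiff δ).continuous (moll_hasCompactSupport hδ), cv_comm (moll δ)]
  set w : Plane → ℝ := fun x => U (d x / 3) x with hw
  have hwU : ∀ r, 0 < r → ∀ x, 3 / 2 * r < d x → w x = U r x := by
    intro r hr x hx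
    exact hindep _ _ (by linarith) hr x (by linarith)
  have hwh : HarmonicOnNhd w Ω := by
    intro x hx
    have hx0 := (hdpos x).1 hx
    have hr : 0 < d x / 4 := by linarith
    rw [harmonicAt_congr_nhds (f₂ := U (d x / 4))]
    · exact hharm _ hr x (by linarith)
    · filter_upwards [(isOpen_lt (continuous_const (y := 3 / 2 * (d x / 4))) hdc).mem_nhds
        (by simp only [mem_ofPred_eq]; linarith)] with y hy
      exact hwU _ hr y hy
  refine ⟨w, hwh, ?_⟩
  have key := hΩ.ae_eq_zero_of_integral_contDiff_smul_eq_zero (μ := (volume : Measure Plane))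
    (f := fun x => w x - u x) ((hwh.continuousOn.locallyIntegrableOn hΩ.measurableSet).sub
      (hul.locallyIntegrableOn Ω)) ?_
  · rw [Filter.EventuallyEq, ae_restrict_iff' hΩ.measurableSet]
    filter_upwards [key] with x hx hxΩ
    have := hx hxΩ
    simp only [hu, indicator_of_mem hxΩ] at this
    linarith
  intro ψ hψ hψc hψΩ
  obtain ⟨η, hη, hηd⟩ : ∃ η, 0 < η ∧ ∀ x ∈ tsupport ψ, η ≤ d x := by
    by_cases hn : (tsupport ψ).Nonempty
    · obtain ⟨x₀, hx₀, hmin⟩ := hψc.isCompact.exists_isMinOn hn hdc.continuousOn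
      exact ⟨d x₀, (hdpos _).1 (hψΩ hx₀), fun x hx => hmin hx⟩
    · exact ⟨1, one_pos, fun x hx => absurd ⟨x, hx⟩ hn⟩
  refine abs_nonpos_iff.1 (le_of_forall_pos_le_add fun ε hε => ?_)
  obtain ⟨κ, hκ, hκ'⟩ := exists_integral_mul_cv_moll_sub_le hui hψ.continuous hψc hε
  have hδ : 0 < min κ (η / 4) := lt_min hκ (by linarith)
  have hδη := min_le_right κ (η / 4)
  have a1 : ∫ x, ψ x • (w x - u x) = ∫ x, ψ x * (cv u (moll (min κ (η / 4))) x - u x) := by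
    refine integral_congr_ae (Eventually.of_forall fun x => ?_)
    by_cases hx : x ∈ tsupport ψ
    · simp only [smul_eq_mul]
      rw [hwU _ hδ x (by linarith [hηd x hx])]
    · simp [image_eq_zero_of_notMem_tsupport hx]
  rw [a1, zero_add]
  exact hκ' _ hδ (min_le_left _ _)

end MorleyUC
end

noncomputable section

open MeasureTheory Set Filter Topology InnerProductSpace
namespace MorleyUC

/-! ### Propagation of smallness for harmonic functions -/

theorem normL2_nonneg (S : Set Plane) (f : Plane → ℝ) : 0 ≤ normL2 S f := ENNReal.toReal_nonneg

theorem normL2_mono {S S' : Set Plane} (h : S ⊆ S') {f : Plane → ℝ}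
    (hf : MemLp f 2 (volume.restrict S')) : normL2 S f ≤ normL2 S' f :=
  ENNReal.toReal_mono hf.2.ne (eLpNorm_mono_measure _ (Measure.restrict_mono h le_rfl))

theorem normL2_coe {S : Set Plane} (f : L2 S) : normL2 S f = ‖f‖ := rfl

theorem exists_abs_le_normL2 {s : ℝ} (hs : 0 < s) : ∃ C : ℝ, 0 < C ∧ ∀ (S : Set Plane)
    (w : Plane → ℝ) (x : Plane), IsOpen S → Bornology.IsBounded S → HarmonicOnNhd w S →
    MemLp w 2 (volume.restrict S) → Metric.closedBall x s ⊆ S → |w x| ≤ C * normL2 S w := by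
  have hm : MemLp (moll s) 2 volume :=
    (moll_contDiff s).continuous.memLp_of_hasCompactSupport (moll_hasCompactSupport hs)
  refine ⟨(eLpNorm (moll s) 2 volume).toReal + 1, by positivity, ?_⟩
  intro S w x hS hSb hw hwm hx
  have : IsFiniteMeasure (volume.restrict S) := ⟨by simpa using hSb.measure_lt_top⟩
  have hi : Integrable (S.indicator w) := by
    rw [integrable_indicator_iff hS.measurableSet]
    exact hwm.integrable (by norm_num)
  have hxS : x ∈ S := hx (Metric.mem_closedBall_self hs.le)
  have hh : HarmonicOnNhd (S.indicator w) (Metric.closedBall x s) := by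
    intro y hy
    rw [harmonicAt_congr_nhds (f₂ := w)]
    · exact hw y (hx hy)
    · filter_upwards [hS.mem_nhds (hx hy)] with z hz using indicator_of_mem hz w
  have h1 := cv_moll_of_harmonic hs hh hi.locallyIntegrable
  rw [indicator_of_mem hxS] at h1
  have hk0 : MemLp (fun t => moll s (x - t)) 2 volume :=
    hm.comp_measurePreserving (Measure.measurePreserving_sub_left volume x)
  have hk : MemLp (fun t => moll s (x - t)) 2 (volume.restrict S) := hk0.restrict S
  have h2 : cv (S.indicator w) (moll s) x = inner ℝ (hwm.toLp w) (hk.toLp _) := by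
    rw [inner_toLp, cv, ← integral_indicator hS.measurableSet]
    have hae : ∀ᵐ t, t ∈ S → hwm.toLp w t = w t :=
      (ae_restrict_iff' hS.measurableSet).1 hwm.coeFn_toLp
    refine integral_congr_ae ?_
    filter_upwards [hae] with t ht
    by_cases hts : t ∈ S
    · simp [hts, ht hts]
    · simp [hts]
  rw [← h1, h2]
  refine (abs_real_inner_le_norm _ _).trans ?_
  rw [Lp.norm_toLp, Lp.norm_toLp, mul_comm]
  refine mul_le_mul_of_nonneg_right ?_ (normL2_nonneg S w)
  have h3 : eLpNorm (fun t => moll s (x - t)) 2 (volume.restrict S) ≤ eLpNorm (moll s) 2 volume := by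
    refine (eLpNorm_mono_measure _ Measure.restrict_le_self).trans ?_
    exact (eLpNorm_comp_measurePreserving hm.1 (Measure.measurePreserving_sub_left volume x)).le
  linarith [ENNReal.toReal_mono hm.2.ne h3]

/-- A two-constants estimate for harmonic functions on concentric discs. -/
theorem exists_three_balls {r R : ℝ} (hr : 0 < r) (hrR : r < R) :
    ∃ θ : ℝ, 0 < θ ∧ θ < 1 ∧ ∀ (g : ℂ → ℝ) (M η : ℝ), 0 < η → η ≤ M →
      HarmonicOnNhd g (Metric.ball 0 R) → (∀ z ∈ Metric.ball (0 : ℂ) R, |g z| ≤ M) →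
      (∀ z ∈ Metric.ball (0 : ℂ) r, |g z| ≤ η) →
      ∀ z ∈ Metric.ball (0 : ℂ) (R / 2), |g z| ≤ 13 * M * (η / M) ^ θ := by
  have hR : 0 < R := hr.trans hrR
  obtain ⟨l, hl⟩ : ∃ l, l = Real.log (r / 2) := ⟨_, rfl⟩
  obtain ⟨u, hu⟩ : ∃ u, u = Real.log (3 * R / 4) := ⟨_, rfl⟩
  have hlu : l < u := by
    rw [hl, hu]; exact Real.log_lt_log (by linarith) (by linarith)
  have hlR : l < Real.log (R / 2) := by
    rw [hl]; exact Real.log_lt_log (by linarith) (by linarith)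
  have hRu : Real.log (R / 2) < u := by
    rw [hu]; exact Real.log_lt_log (by linarith) (by linarith)
  obtain ⟨θ, hθ⟩ : ∃ θ, θ = 1 - (Real.log (R / 2) - l) / (u - l) := ⟨_, rfl⟩
  have hθ0 : 0 < θ := by
    rw [hθ, sub_pos, div_lt_one (by linarith)]; linarith
  have hθ1 : θ < 1 := by
    rw [hθ]; have := div_pos (sub_pos.2 hlR) (sub_pos.2 hlu); linarith
  refine ⟨θ, hθ0, hθ1, fun g M η hη hηM hg hM hgη => ?_⟩
  have hM0 : 0 < M := hη.trans_le hηM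
  obtain ⟨F, hFa, hFg⟩ := hg.exists_analyticOnNhd_ball_re_eq
  obtain ⟨f, hf⟩ : ∃ f : ℂ → ℂ, f = fun z => F z - Complex.I * (F 0).im := ⟨_, rfl⟩
  have hfd : DifferentiableOn ℂ f (Metric.ball 0 R) := by
    rw [hf]; exact hFa.differentiableOn.sub_const _
  have hfre : ∀ z ∈ Metric.ball (0 : ℂ) R, (f z).re = g z := by
    intro z hz
    simp only [hf, Complex.sub_re, Complex.mul_re, Complex.I_re, Complex.I_im, Complex.ofReal_re,
      Complex.ofReal_im]
    simpa using hFg hz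
  have hf0 : ‖f 0‖ = |g 0| := by
    have h0 : f 0 = (g 0 : ℂ) := by
      apply Complex.ext
      · simpa using hfre 0 (by simpa using hR)
      · simp [hf]
    rw [h0]; simp
  have hbig : ∀ z : ℂ, ‖z‖ ≤ 3 * R / 4 → ‖f z‖ ≤ 13 * M := by
    intro z hz
    have hzR : z ∈ Metric.ball (0 : ℂ) R := by
      rw [mem_ball_zero_iff]; linarith
    have h := Complex.borelCaratheodory hM0 hfd
      (fun y hy => by rw [mem_ofPred_eq, hfre y hy]; exact (abs_le.1 (hM y hy)).2) hR hzR
    have hden : R / 4 ≤ R - ‖z‖ := by linarith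
    have h0 : |g 0| ≤ M := hM 0 (by simpa using hR)
    refine h.trans ?_
    rw [hf0, ← add_div, div_le_iff₀ (by linarith)]
    nlinarith [norm_nonneg z, mul_le_mul_of_nonneg_right h0 (by positivity : 0 ≤ R + ‖z‖)]
  have hsmall : ∀ z : ℂ, ‖z‖ ≤ r / 2 → ‖f z‖ ≤ 5 * η := by
    intro z hz
    have hsub : Metric.ball (0 : ℂ) r ⊆ Metric.ball 0 R := Metric.ball_subset_ball hrR.le
    have hzr : z ∈ Metric.ball (0 : ℂ) r := by
      rw [mem_ball_zero_iff]; linarith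
    have h := Complex.borelCaratheodory hη (hfd.mono hsub)
      (fun y hy => by rw [mem_ofPred_eq, hfre y (hsub hy)]; exact (abs_le.1 (hgη y hy)).2) hr hzr
    have h0 : |g 0| ≤ η := hgη 0 (by simpa using hr)
    refine h.trans ?_
    rw [hf0, ← add_div, div_le_iff₀ (by linarith)]
    nlinarith [norm_nonneg z, mul_le_mul_of_nonneg_right h0 (by positivity : 0 ≤ r + ‖z‖)]
  have hq0 : 0 < η / M := div_pos hη hM0
  have hq1 : η / M ≤ 1 := (div_le_one hM0).2 hηM
  have hηq : η = M * (η / M) := by field_simp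
  intro z hz
  rw [mem_ball_zero_iff] at hz
  have hzR : z ∈ Metric.ball (0 : ℂ) R := by rw [mem_ball_zero_iff]; linarith
  rw [← hfre z hzR]
  refine (Complex.abs_re_le_norm _).trans ?_
  rcases le_or_gt ‖z‖ (r / 2) with hzr | hzr
  · refine (hsmall z hzr).trans ?_
    have : η / M ≤ (η / M) ^ θ := by
      conv_lhs => rw [← Real.rpow_one (η / M)]
      exact Real.rpow_le_rpow_of_exponent_ge hq0 hq1 hθ1.le
    have h2 : 5 * η ≤ 13 * M * (η / M) := by rw [mul_assoc, ← hηq]; linarith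
    exact h2.trans (by gcongr)
  · have hz0 : z ≠ 0 := by rintro rfl; simp at hzr; linarith
    have hexp : ∀ y : ℂ, ‖Complex.exp y‖ = Real.exp y.re := Complex.norm_exp
    have hel : Real.exp l = r / 2 := by rw [hl, Real.exp_log (by linarith)]
    have heu : Real.exp u = 3 * R / 4 := by rw [hu, Real.exp_log (by linarith)]
    have hstrip : ∀ y : ℂ, y.re ≤ u → ‖Complex.exp y‖ ≤ 3 * R / 4 := fun y hy => by
      rw [hexp, ← heu]; exact Real.exp_le_exp.2 hy
    have hlogre : (Complex.log z).re = Real.log ‖z‖ := Complex.log_re z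
    have hzl : l ≤ Real.log ‖z‖ := by rw [hl]; exact Real.log_le_log (by linarith) hzr.le
    have hzu : Real.log ‖z‖ ≤ Real.log (R / 2) :=
      Real.log_le_log (by linarith) hz.le
    have h3 := Complex.HadamardThreeLines.norm_le_interp_of_mem_verticalClosedStrip'
      (f := f ∘ Complex.exp) (z := Complex.log z) (a := 5 * η) (b := 13 * M) hlu ?_ ?_ ?_ ?_ ?_
    · rw [Function.comp_apply, Complex.exp_log hz0, hlogre] at h3
      obtain ⟨s, hs⟩ : ∃ s, s = (Real.log ‖z‖ - l) / (u - l) := ⟨_, rfl⟩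
      rw [← hs] at h3
      have hs0 : 0 ≤ s := by rw [hs]; exact div_nonneg (by linarith) (by linarith)
      have hsθ : θ ≤ 1 - s := by
        rw [hθ, hs]
        have := div_le_div_of_nonneg_right (sub_le_sub_right hzu l) (sub_pos.2 hlu).le
        linarith
      refine h3.trans ?_
      have h5 : (5 * η) ^ (1 - s) ≤ (13 * M * (η / M)) ^ (1 - s) := by
        refine Real.rpow_le_rpow (by positivity) ?_ (by linarith)
        rw [mul_assoc, ← hηq]; linarith
      calc (5 * η) ^ (1 - s) * (13 * M) ^ s ≤ (13 * M * (η / M)) ^ (1 - s) * (13 * M) ^ s := by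
            gcongr
        _ = 13 * M * (η / M) ^ (1 - s) := by
            rw [Real.mul_rpow (by positivity) hq0.le, mul_right_comm,
              ← Real.rpow_add (by positivity), sub_add_cancel, Real.rpow_one]
        _ ≤ 13 * M * (η / M) ^ θ := by
            refine mul_le_mul_of_nonneg_left ?_ (by positivity)
            exact Real.rpow_le_rpow_of_exponent_ge hq0 hq1 hsθ
    · change _ ∈ Icc l u
      rw [hlogre]; exact ⟨hzl, hzu.trans hRu.le⟩
    · have hmaps : ∀ y : ℂ, y.re ≤ u → Complex.exp y ∈ Metric.ball (0 : ℂ) R := fun y hy => by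
        rw [mem_ball_zero_iff]; linarith [hstrip y hy]
      have hdiff : ∀ y : ℂ, y.re ≤ u → DifferentiableAt ℂ (f ∘ Complex.exp) y := fun y hy =>
        ((hfd _ (hmaps y hy)).differentiableAt (Metric.isOpen_ball.mem_nhds (hmaps y hy))).comp y
          Complex.differentiable_exp.differentiableAt
      refine DifferentiableOn.diffContOnCl fun y hy => (hdiff y ?_).differentiableWithinAt
      have : closure (Complex.re ⁻¹' Ioo l u) ⊆ Complex.re ⁻¹' Icc l u :=
        closure_minimal (preimage_mono Ioo_subset_Icc_self)
          (isClosed_Icc.preimage Complex.continuous_re)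
      exact (this hy).2
    · refine ⟨13 * M, ?_⟩
      rintro _ ⟨y, hy, rfl⟩
      exact hbig _ (hstrip y hy.2)
    · intro y hy
      refine hsmall _ ?_
      rw [hexp, show y.re = l from hy, hel]
    · intro y hy
      exact hbig _ (hstrip y (le_of_eq hy))

/-- Harmonic functions that are bounded by one in `L₂(Ω)` and small on `ω` are small on `A`. -/
def PropagatesTo (Ω ω A : Set Plane) : Prop :=
  ∃ C θ : ℝ, 0 < C ∧ 0 < θ ∧ θ < 1 ∧ ∀ w : Plane → ℝ, HarmonicOnNhd w Ω →
    MemLp w 2 (volume.restrict Ω) → normL2 Ω w ≤ 1 → ∀ η, 0 < η → η ≤ 1 → normL2 ω w ≤ η →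
    ∀ y ∈ A, |w y| ≤ C * η ^ θ

theorem PropagatesTo.mono {Ω ω A B : Set Plane} (h : A ⊆ B) (hB : PropagatesTo Ω ω B) :
    PropagatesTo Ω ω A := by
  obtain ⟨C, θ, h1, h2, h3, h4⟩ := hB
  exact ⟨C, θ, h1, h2, h3, fun w a b c η d e f y hy => h4 w a b c η d e f y (h hy)⟩

theorem PropagatesTo.union {Ω ω A B : Set Plane} (hA : PropagatesTo Ω ω A)
    (hB : PropagatesTo Ω ω B) : PropagatesTo Ω ω (A ∪ B) := by
  obtain ⟨C, θ, h1, h2, h3, h4⟩ := hA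
  obtain ⟨C', θ', k1, k2, k3, k4⟩ := hB
  refine ⟨C + C', min θ θ', by positivity, lt_min h2 k2, min_lt_of_left_lt h3, ?_⟩
  intro w a b c η d e f y hy
  have e1 : η ^ θ ≤ η ^ min θ θ' := Real.rpow_le_rpow_of_exponent_ge d e (min_le_left _ _)
  have e2 : η ^ θ' ≤ η ^ min θ θ' := Real.rpow_le_rpow_of_exponent_ge d e (min_le_right _ _)
  have e3 : 0 ≤ η ^ min θ θ' := by positivity
  rcases hy with hy | hy
  · exact (h4 w a b c η d e f y hy).trans (mul_le_mul (by linarith) e1 (by positivity) (by positivity))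
  · exact (k4 w a b c η d e f y hy).trans (mul_le_mul (by linarith) e2 (by positivity) (by positivity))

theorem exists_propagatesTo_ball {Ω ω : Set Plane} (hΩ : IsOpen Ω) (hΩc : IsConnected Ω)
    (hb : Bornology.IsBounded Ω) (hω : IsOpen ω) (hωn : ω.Nonempty) (hωΩ : ω ⊆ Ω) :
    ∀ x ∈ Ω, ∃ r, 0 < r ∧ PropagatesTo Ω ω (Metric.ball x r) := by
  obtain ⟨S, hS⟩ : ∃ S : Set Plane, S = {x | ∃ r, 0 < r ∧ PropagatesTo Ω ω (Metric.ball x r)} :=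
    ⟨_, rfl⟩
  suffices Ω ⊆ S by intro x hx; have := this hx; rwa [hS] at this
  refine hΩc.isPreconnected.subset_of_closure_inter_subset ?_ ?_ ?_
  · rw [Metric.isOpen_iff]
    intro x hx
    rw [hS] at hx ⊢
    obtain ⟨r, hr, hP⟩ := hx
    refine ⟨r / 2, by linarith, fun y hy => ⟨r / 2, by linarith, hP.mono ?_⟩⟩
    refine Metric.ball_subset_ball' ?_
    rw [Metric.mem_ball] at hy
    linarith
  · obtain ⟨x, hx⟩ := hωn
    refine ⟨x, hωΩ hx, ?_⟩
    obtain ⟨s, hs, hsω⟩ := Metric.isOpen_iff.1 hω x hx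
    have hs3 : 0 < s / 3 := by linarith
    obtain ⟨C, hC, hCb⟩ := exists_abs_le_normL2 hs3
    rw [hS]
    refine ⟨s / 3, hs3, C, 1 / 2, hC, by norm_num, by norm_num, ?_⟩
    intro w hw hwm _ η hη hη1 hwη y hy
    have hsub : Metric.closedBall y (s / 3) ⊆ ω := by
      refine Subset.trans ?_ hsω
      intro z hz
      rw [Metric.mem_closedBall] at hz
      rw [Metric.mem_ball] at hy ⊢
      linarith [dist_triangle z y x]
    have h1 := hCb ω w y hω (hb.subset hωΩ) (hw.mono hωΩ)
      (hwm.mono_measure (Measure.restrict_mono hωΩ le_rfl)) hsub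
    have h2 : η ≤ η ^ (1 / 2 : ℝ) := by
      conv_lhs => rw [← Real.rpow_one η]
      exact Real.rpow_le_rpow_of_exponent_ge hη hη1 (by norm_num)
    exact h1.trans (mul_le_mul_of_nonneg_left (hwη.trans h2) hC.le)
  · rintro x ⟨hxS, hxΩ⟩
    obtain ⟨d', hd', hdΩ⟩ := Metric.isOpen_iff.1 hΩ x hxΩ
    obtain ⟨d, hdd⟩ : ∃ d, d = d' / 4 := ⟨_, rfl⟩
    have hd : 0 < d := by linarith
    obtain ⟨x', hx', hxx'⟩ := Metric.mem_closure_iff.1 hxS (d / 2) (by linarith)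
    rw [hS] at hx' ⊢
    obtain ⟨r, hr, C, θ, hC, hθ0, hθ1, hP⟩ := hx'
    obtain ⟨K, hK, hKb⟩ := exists_abs_le_normL2 hd
    have hr' : 0 < min r d := lt_min hr hd
    obtain ⟨τ, hτ0, hτ1, h3⟩ := exists_three_balls (r := min r d) (R := 2 * d) hr'
      ((min_le_right _ _).trans_lt (by linarith))
    obtain ⟨M, hMd⟩ : ∃ M, M = max K C := ⟨_, rfl⟩
    have hKM : K ≤ M := hMd ▸ le_max_left _ _
    have hCM : C ≤ M := hMd ▸ le_max_right _ _
    have hM : 0 < M := hC.trans_le hCM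
    refine ⟨d / 2, by linarith, 13 * M, θ * τ, by positivity, by positivity, by nlinarith, ?_⟩
    intro w hw hwm hw1 η hη hη1 hwη y hy
    have hηθ : 0 < η ^ θ := by positivity
    have hηθ1 : η ^ θ ≤ 1 := Real.rpow_le_one hη.le hη1 hθ0.le
    have hball : ∀ z : Plane, dist z x' < 2 * d → Metric.closedBall z d ⊆ Ω := by
      intro z hz p hp
      refine hdΩ ?_
      rw [Metric.mem_closedBall] at hp
      rw [Metric.mem_ball]
      have := dist_triangle p z x
      have := dist_triangle z x' x
      rw [dist_comm x' x] at this
      linarith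
    have hdist : ∀ z : ℂ, dist (planeIso z + x') x' = ‖z‖ := fun z => by
      rw [dist_eq_norm, add_sub_cancel_right, planeIso.norm_map]
    have h4 := h3 (fun z => w (planeIso z + x')) M (C * η ^ θ) (by positivity)
      ((mul_le_of_le_one_right hC.le hηθ1).trans hCM) ?_ ?_ ?_ (planeIso.symm (y - x')) ?_
    · simp only [LinearIsometryEquiv.apply_symm_apply, sub_add_cancel] at h4
      refine h4.trans ?_
      refine mul_le_mul_of_nonneg_left ?_ (by positivity)
      rw [Real.rpow_mul hη.le]
      refine Real.rpow_le_rpow (by positivity) ?_ hτ0.le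
      rw [div_le_iff₀ hM, mul_comm]
      exact mul_le_mul_of_nonneg_left hCM hηθ.le
    · intro z hz
      refine HarmonicAt.comp_planeIso (hw _ (hball _ ?_ (Metric.mem_closedBall_self hd.le)))
      rw [hdist]; simpa using hz
    · intro z hz
      have := hKb Ω w (planeIso z + x') hΩ hb hw hwm (hball _ (by rw [hdist]; simpa using hz))
      refine this.trans ?_
      nlinarith [normL2_nonneg Ω w]
    · intro z hz
      refine hP w hw hwm hw1 η hη hη1 hwη _ ?_
      rw [Metric.mem_ball, hdist]
      rw [mem_ball_zero_iff] at hz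
      exact hz.trans_le (min_le_left _ _)
    · rw [mem_ball_zero_iff, LinearIsometryEquiv.norm_map, ← dist_eq_norm]
      rw [Metric.mem_ball] at hy
      have := dist_triangle y x x'
      linarith

theorem propagatesTo_of_closure_subset {Ω ω G : Set Plane} (hΩ : IsOpen Ω) (hΩc : IsConnected Ω)
    (hb : Bornology.IsBounded Ω) (hω : IsOpen ω) (hωn : ω.Nonempty) (hωΩ : ω ⊆ Ω)
    (hG : closure G ⊆ Ω) : PropagatesTo Ω ω G := by
  have hc : IsCompact (closure G) :=
    Metric.isCompact_of_isClosed_isBounded isClosed_closure (hb.subset hG)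
  refine PropagatesTo.mono subset_closure ?_
  refine hc.induction_on ?_ (fun A B => PropagatesTo.mono) (fun A B => PropagatesTo.union) ?_
  · exact ⟨1, 1 / 2, one_pos, by norm_num, by norm_num, fun w _ _ _ η _ _ _ y hy => hy.elim⟩
  · intro x hx
    obtain ⟨r, hr, hP⟩ := exists_propagatesTo_ball hΩ hΩc hb hω hωn hωΩ x (hG hx)
    exact ⟨_, mem_nhdsWithin_of_mem_nhds (Metric.ball_mem_nhds x hr), hP⟩

theorem normL2_const_mul (S : Set Plane) (c : ℝ) (f : Plane → ℝ) :
    normL2 S (fun x => c * f x) = |c| * normL2 S f := by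
  have : (fun x => c * f x) = c • f := rfl
  rw [this, normL2, normL2, eLpNorm_const_smul, ENNReal.toReal_mul]
  simp

theorem PropagatesTo.bound {Ω ω A : Set Plane} (h : PropagatesTo Ω ω A) (hωΩ : ω ⊆ Ω) :
    ∃ C θ : ℝ, 0 < C ∧ 0 < θ ∧ θ < 1 ∧ ∀ w : Plane → ℝ, HarmonicOnNhd w Ω →
      MemLp w 2 (volume.restrict Ω) → 0 < normL2 Ω w →
      ∀ y ∈ A, |w y| ≤ C * normL2 ω w ^ θ * normL2 Ω w ^ (1 - θ) := by
  obtain ⟨C, θ, hC, h0, h1, hP⟩ := h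
  refine ⟨C, θ, hC, h0, h1, fun w hw hwm hN y hy => ?_⟩
  obtain ⟨N, hNd⟩ : ∃ N, N = normL2 Ω w := ⟨_, rfl⟩
  obtain ⟨e, hed⟩ : ∃ e, e = normL2 ω w := ⟨_, rfl⟩
  rw [← hNd] at hN
  rw [← hNd, ← hed]
  have he0 : 0 ≤ e := hed ▸ normL2_nonneg _ _
  have heN : e ≤ N := by rw [hed, hNd]; exact normL2_mono hωΩ hwm
  have key : ∀ η, 0 < η → η ≤ 1 → e / N ≤ η → |w y| ≤ N * (C * η ^ θ) := by
    intro η hη hη1 hle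
    have := hP (fun x => N⁻¹ * w x) ?_ (hwm.const_mul _) ?_ η hη hη1 ?_ y hy
    · rw [abs_mul, abs_of_pos (inv_pos.2 hN), inv_mul_le_iff₀ hN] at this
      exact this
    · exact hw.const_smul (c := N⁻¹)
    · rw [normL2_const_mul, abs_of_pos (inv_pos.2 hN), ← hNd, inv_mul_cancel₀ hN.ne']
    · rw [normL2_const_mul, abs_of_pos (inv_pos.2 hN), ← hed, inv_mul_eq_div]
      exact hle
  rcases he0.eq_or_lt with he | he
  · rw [← he, Real.zero_rpow h0.ne', mul_zero, zero_mul]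
    refine ge_of_tendsto (x := 𝓝[>] (0 : ℝ)) (f := fun η : ℝ => N * (C * η ^ θ)) ?_ ?_
    · have : Tendsto (fun η : ℝ => N * (C * η ^ θ)) (𝓝 0) (𝓝 (N * (C * 0 ^ θ))) :=
        ((Real.continuousAt_rpow_const 0 θ (Or.inr h0.le)).tendsto.const_mul C).const_mul N
      rw [Real.zero_rpow h0.ne', mul_zero, mul_zero] at this
      exact this.mono_left nhdsWithin_le_nhds
    · filter_upwards [Ioc_mem_nhdsGT (show (0 : ℝ) < 1 by norm_num)] with η hη
      refine key η hη.1 hη.2 ?_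
      rw [← he, zero_div]; exact hη.1.le
  · refine (key (e / N) (by positivity) ((div_le_one hN).2 heN) le_rfl).trans (le_of_eq ?_)
    rw [Real.div_rpow he0 hN.le, Real.rpow_sub hN, Real.rpow_one]
    field_simp

theorem exists_isPropagationExponent {Ω ω G : Set Plane} (hΩ : IsOpen Ω) (hΩc : IsConnected Ω)
    (hb : Bornology.IsBounded Ω) (hω : IsOpen ω) (hωn : ω.Nonempty) (hωΩ : ω ⊆ Ω)
    (hGo : IsOpen G) (hG : closure G ⊆ Ω) : ∃ α : ℝ, α < 1 ∧ IsPropagationExponent Ω ω G α := by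
  obtain ⟨C, θ, hC, h0, h1, hP⟩ :=
    (propagatesTo_of_closure_subset hΩ hΩc hb hω hωn hωΩ hG).bound hωΩ
  have hGΩ : G ⊆ Ω := subset_closure.trans hG
  have hGb : volume G ≠ ⊤ := (hb.subset hGΩ).measure_lt_top.ne
  refine ⟨θ, h1, h0, h1.le, (volume G).toReal ^ (1 / 2 : ℝ) * C, fun w hwm hw => ?_⟩
  rcases (normL2_nonneg Ω w).eq_or_lt with hN | hN
  · rw [← hN, Real.zero_rpow (by linarith), mul_zero, hN]
    exact normL2_mono hGΩ hwm
  · have hpt := hP w hw hwm hN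
    obtain ⟨B, hB⟩ : ∃ B, B = C * normL2 ω w ^ θ * normL2 Ω w ^ (1 - θ) := ⟨_, rfl⟩
    have hB0 : 0 ≤ B := by
      have := normL2_nonneg ω w
      rw [hB]; positivity
    have h3 := eLpNorm_le_of_ae_bound (p := 2) (μ := volume.restrict G) (f := w) (C := B) ?_
    · have h4 := ENNReal.toReal_mono ?_ h3
      · rw [Measure.restrict_apply_univ, ENNReal.toReal_mul, ENNReal.toReal_ofReal hB0,
          ← ENNReal.toReal_rpow] at h4
        refine h4.trans (le_of_eq ?_)
        rw [hB]
        norm_num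
        ring
      · rw [Measure.restrict_apply_univ]
        exact ENNReal.mul_ne_top (ENNReal.rpow_ne_top_of_nonneg (by norm_num) hGb)
          ENNReal.ofReal_ne_top
    · filter_upwards [ae_restrict_mem hGo.measurableSet] with y hy
      rw [hB]
      exact hpt y hy

/-- Unique continuation. -/
theorem normL2_eq_zero_of_harmonic {Ω ω : Set Plane} (hΩ : IsOpen Ω) (hΩc : IsConnected Ω)
    (hb : Bornology.IsBounded Ω) (hω : IsOpen ω) (hωn : ω.Nonempty) (hωΩ : ω ⊆ Ω)
    {w : Plane → ℝ} (hw : HarmonicOnNhd w Ω) (hwm : MemLp w 2 (volume.restrict Ω))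
    (h0 : normL2 ω w = 0) : ∀ x ∈ Ω, w x = 0 := by
  intro x hx
  obtain ⟨r, hr, hP⟩ := exists_propagatesTo_ball hΩ hΩc hb hω hωn hωΩ x hx
  rcases (normL2_nonneg Ω w).eq_or_lt with hN | hN
  · obtain ⟨s, hs, hsΩ⟩ := Metric.isOpen_iff.1 hΩ x hx
    obtain ⟨C, hC, hCb⟩ := exists_abs_le_normL2 (s := s / 2) (by linarith)
    have := hCb Ω w x hΩ hb hw hwm
      ((Metric.closedBall_subset_ball (by linarith)).trans hsΩ)
    rw [← hN, mul_zero] at this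
    exact abs_nonpos_iff.1 this
  · obtain ⟨C, θ, hC, hθ0, h1, hP'⟩ := hP.bound hωΩ
    have := hP' w hw hwm hN x (Metric.mem_ball_self hr)
    rw [h0, Real.zero_rpow hθ0.ne', mul_zero, zero_mul] at this
    exact abs_nonpos_iff.1 this

end MorleyUC
end

noncomputable section

open MeasureTheory Set Filter Topology
namespace MorleyUC

/-! ### Calculus of polynomials -/

/-- Polynomials of total degree at most `k`. -/
abbrev Deg (k : ℕ) : Submodule ℝ Poly := MvPolynomial.restrictTotalDegree (Fin 2) ℝ k

theorem mem_Deg {k : ℕ} {p : Poly} : p ∈ Deg k ↔ p.totalDegree ≤ k :=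
  MvPolynomial.mem_restrictTotalDegree _ _ _

theorem Deg_mono {k l : ℕ} (h : k ≤ l) {p : Poly} (hp : p ∈ Deg k) : p ∈ Deg l :=
  mem_Deg.2 ((mem_Deg.1 hp).trans h)

theorem mul_mem_Deg {k l : ℕ} {p q : Poly} (hp : p ∈ Deg k) (hq : q ∈ Deg l) :
    p * q ∈ Deg (k + l) :=
  mem_Deg.2 ((MvPolynomial.totalDegree_mul p q).trans (add_le_add (mem_Deg.1 hp) (mem_Deg.1 hq)))

theorem pderiv_mem_Deg {k : ℕ} {p : Poly} (hp : p ∈ Deg (k + 1)) (i : Fin 2) :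
    MvPolynomial.pderiv i p ∈ Deg k := by
  rw [p.as_sum, map_sum]
  refine Submodule.sum_mem _ fun s hs => ?_
  rw [MvPolynomial.pderiv_monomial]
  by_cases h0 : s i = 0
  · simp [h0]
  rw [mem_Deg]
  refine (MvPolynomial.totalDegree_monomial_le _ _).trans ?_
  have h1 := (MvPolynomial.le_totalDegree hs).trans (mem_Deg.1 hp)
  have h2 : (s - Finsupp.single i 1) + Finsupp.single i 1 = s :=
    tsub_add_cancel_of_le (by rw [Finsupp.single_le_iff]; omega)
  have h3 : (s.sum fun _ e => e) = ((s - Finsupp.single i 1).sum fun _ e => e) + 1 := by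
    conv_lhs => rw [← h2]
    rw [Finsupp.sum_add_index' (by simp) (by simp), Finsupp.sum_single_index rfl]
  have h4 : ((s - Finsupp.single i 1).sum fun _ => id) =
      (s - Finsupp.single i 1).sum fun _ e => e := rfl
  omega

theorem ev_mul (p q : Poly) (x : Plane) : ev (p * q) x = ev p x * ev q x := by simp [ev]
theorem ev_sub (p q : Poly) (x : Plane) : ev (p - q) x = ev p x - ev q x := by simp [ev]
theorem ev_C (c : ℝ) (x : Plane) : ev (MvPolynomial.C c) x = c := by simp [ev]
theorem ev_X (i : Fin 2) (x : Plane) : ev (MvPolynomial.X i) x = x i := by simp [ev]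
theorem ev_sum {ι : Type*} (s : Finset ι) (p : ι → Poly) (x : Plane) :
    ev (∑ i ∈ s, p i) x = ∑ i ∈ s, ev (p i) x := by simp [ev]

/-- The derivative of `p` in direction `n`, as a polynomial. -/
def dP (n : Plane) : Derivation ℝ Poly Poly := ∑ i, n i • MvPolynomial.pderiv i

theorem dP_apply (n : Plane) (p : Poly) : dP n p = ∑ i, n i • MvPolynomial.pderiv i p := by
  simp [dP, Fin.sum_univ_two]

theorem ev_dP (n : Plane) (p : Poly) (x : Plane) : ev (dP n p) x = dirD p x n := by
  simp only [dP_apply, dirD, ev_sum, ev_smul]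

theorem dP_mem_Deg {k : ℕ} {p : Poly} (hp : p ∈ Deg (k + 1)) (n : Plane) : dP n p ∈ Deg k := by
  rw [dP_apply]
  exact Submodule.sum_mem _ fun i _ => Submodule.smul_mem _ _ (pderiv_mem_Deg hp i)

theorem dirD_single (p : Poly) (x : Plane) (i : Fin 2) :
    dirD p x (EuclideanSpace.single i 1) = ev (MvPolynomial.pderiv i p) x := by
  fin_cases i <;> simp [dirD, Fin.sum_univ_two]

theorem dirD_sub (p q : Poly) (x n : Plane) : dirD (p - q) x n = dirD p x n - dirD q x n := by
  simp [← ev_dP, ev_sub]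

theorem dirD_mul (p q : Poly) (x n : Plane) :
    dirD (p * q) x n = ev p x * dirD q x n + ev q x * dirD p x n := by
  simp [← ev_dP, ev_add, ev_mul]

theorem dirD_C (c : ℝ) (x n : Plane) : dirD (MvPolynomial.C c) x n = 0 := by
  simp [dirD, ev_zero]

theorem dirD_sum {ι : Type*} (s : Finset ι) (p : ι → Poly) (x n : Plane) :
    dirD (∑ i ∈ s, p i) x n = ∑ i ∈ s, dirD (p i) x n := by
  simp [← ev_dP, ev_sum, map_sum]

/-- The derivative of a polynomial function. -/
def gradP (p : Poly) (x : Plane) : Plane →L[ℝ] ℝ :=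
  ∑ i, ev (MvPolynomial.pderiv i p) x • EuclideanSpace.proj i

theorem gradP_apply (p : Poly) (x n : Plane) : gradP p x n = dirD p x n := by
  simp [gradP, dirD, Fin.sum_univ_two, mul_comm]

theorem dirD_add_right (p : Poly) (x n m : Plane) : dirD p x (n + m) = dirD p x n + dirD p x m := by
  simp [← gradP_apply]
theorem dirD_sub_right (p : Poly) (x n m : Plane) : dirD p x (n - m) = dirD p x n - dirD p x m := by
  simp [← gradP_apply]
theorem dirD_smul_right (p : Poly) (x n : Plane) (c : ℝ) : dirD p x (c • n) = c * dirD p x n := by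
  simp [← gradP_apply]

theorem hasFDerivAt_ev (p : Poly) (x : Plane) : HasFDerivAt (ev p) (gradP p x) x := by
  induction p using MvPolynomial.induction_on with
  | C a =>
    have h1 : ev (MvPolynomial.C a) = fun _ => a := funext fun y => ev_C a y
    have h2 : gradP (MvPolynomial.C a) x = 0 := by
      ext n; simp [gradP, ev_zero]
    rw [h1, h2]; exact hasFDerivAt_const a x
  | add p q hp hq =>
    have h1 : ev (p + q) = ev p + ev q := funext fun y => ev_add p q y
    have h2 : gradP (p + q) x = gradP p x + gradP q x := by
      ext n; simp [gradP_apply, dirD_add]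
    rw [h1, h2]; exact hp.add hq
  | mul_X p i hp =>
    have h1 : ev (p * MvPolynomial.X i) = ev p * fun y : Plane => y i :=
      funext fun y => by simp [ev_mul, ev_X]
    have hi : HasFDerivAt (fun y : Plane => y i) (EuclideanSpace.proj (𝕜 := ℝ) i) x :=
      (EuclideanSpace.proj (𝕜 := ℝ) i).hasFDerivAt
    have h2 : gradP (p * MvPolynomial.X i) x =
        ev p x • EuclideanSpace.proj (𝕜 := ℝ) i + x i • gradP p x := by
      ext n
      have : dirD (MvPolynomial.X i) x n = n i := by
        fin_cases i <;> simp [dirD, Fin.sum_univ_two, ev, MvPolynomial.pderiv_X]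
      simp [gradP_apply, dirD_mul, this, ev_X]
    rw [h1, h2]
    exact hp.mul hi

theorem fderiv_ev (p : Poly) (x : Plane) : fderiv ℝ (ev p) x = gradP p x :=
  (hasFDerivAt_ev p x).fderiv

theorem partialD_ev (p : Poly) (i : Fin 2) : partialD i (ev p) = ev (MvPolynomial.pderiv i p) := by
  funext x
  rw [partialD, fderiv_ev, gradP_apply, dirD_single]

theorem ev_contDiff (p : Poly) : ContDiff ℝ smooth (ev p) := by
  induction p using MvPolynomial.induction_on with
  | C a => rw [show ev (MvPolynomial.C a) = fun _ => a from funext fun y => ev_C a y]; exact contDiff_const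
  | add p q hp hq => rw [show ev (p + q) = ev p + ev q from funext fun y => ev_add p q y]; exact hp.add hq
  | mul_X p i hp =>
    have hi : ContDiff ℝ smooth (fun y : Plane => y i) := by fun_prop
    rw [show ev (p * MvPolynomial.X i) = fun y => ev p y * y i from
      funext fun y => by simp [ev_mul, ev_X]]
    exact hp.mul hi

theorem ev_continuous (p : Poly) : Continuous (ev p) := (ev_contDiff p).continuous

theorem dirD_continuous (p : Poly) (n : Plane) : Continuous fun x => dirD p x n := by
  simp_rw [← ev_dP]; exact ev_continuous _

/-- The restriction of `p` to a line. -/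
def lineP (p : Poly) (x n : Plane) : Polynomial ℝ :=
  MvPolynomial.aeval (fun i => Polynomial.C (x i) + Polynomial.C (n i) * Polynomial.X) p

theorem eval_lineP (p : Poly) (x n : Plane) (τ : ℝ) :
    (lineP p x n).eval τ = ev p (x + τ • n) := by
  induction p using MvPolynomial.induction_on with
  | C a => simp [lineP, ev_C]
  | add p q hp hq => simp only [lineP, map_add, Polynomial.eval_add] at *; rw [hp, hq, ev_add]
  | mul_X p i hp =>
    simp only [lineP, map_mul, MvPolynomial.aeval_X, Polynomial.eval_mul] at *
    rw [hp, ev_mul, ev_X]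
    congr 1
    simp only [Polynomial.eval_add, Polynomial.eval_mul, Polynomial.eval_C, Polynomial.eval_X,
      PiLp.add_apply, PiLp.smul_apply, smul_eq_mul]
    ring

theorem exists_cubic {p : Poly} (hp : p ∈ Deg 3) (x n : Plane) :
    ∃ c₀ c₁ c₂ c₃ : ℝ, ∀ τ : ℝ, ev p (x + τ • n) = c₀ + c₁ * τ + c₂ * τ ^ 2 + c₃ * τ ^ 3 := by
  have h : (lineP p x n).natDegree < 4 := by
    have := MvPolynomial.aeval_natDegree_le p (mem_Deg.1 hp)
      (fun i => Polynomial.C (x i) + Polynomial.C (n i) * Polynomial.X) (n := 1)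
      (fun i => by compute_degree)
    exact Nat.lt_succ_of_le this
  refine ⟨(lineP p x n).coeff 0, (lineP p x n).coeff 1, (lineP p x n).coeff 2,
    (lineP p x n).coeff 3, fun τ => ?_⟩
  rw [← eval_lineP, Polynomial.eval_eq_sum_range' h]
  simp [Finset.sum_range_succ]

theorem exists_quadratic {p : Poly} (hp : p ∈ Deg 2) (x n : Plane) :
    ∃ c₀ c₁ c₂ : ℝ, ∀ τ : ℝ, ev p (x + τ • n) = c₀ + c₁ * τ + c₂ * τ ^ 2 := by
  have h : (lineP p x n).natDegree < 3 := by
    have := MvPolynomial.aeval_natDegree_le p (mem_Deg.1 hp)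
      (fun i => Polynomial.C (x i) + Polynomial.C (n i) * Polynomial.X) (n := 1)
      (fun i => by compute_degree)
    exact Nat.lt_succ_of_le this
  refine ⟨(lineP p x n).coeff 0, (lineP p x n).coeff 1, (lineP p x n).coeff 2, fun τ => ?_⟩
  rw [← eval_lineP, Polynomial.eval_eq_sum_range' h]
  simp [Finset.sum_range_succ]

theorem exists_linear {p : Poly} (hp : p ∈ Deg 1) (x n : Plane) :
    ∃ c₀ c₁ : ℝ, ∀ τ : ℝ, ev p (x + τ • n) = c₀ + c₁ * τ := by
  have h : (lineP p x n).natDegree < 2 := by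
    have := MvPolynomial.aeval_natDegree_le p (mem_Deg.1 hp)
      (fun i => Polynomial.C (x i) + Polynomial.C (n i) * Polynomial.X) (n := 1)
      (fun i => by compute_degree)
    exact Nat.lt_succ_of_le this
  refine ⟨(lineP p x n).coeff 0, (lineP p x n).coeff 1, fun τ => ?_⟩
  rw [← eval_lineP, Polynomial.eval_eq_sum_range' h]
  simp [Finset.sum_range_succ]

theorem hasDerivAt_ev_line (p : Poly) (x n : Plane) (τ : ℝ) :
    HasDerivAt (fun τ : ℝ => ev p (x + τ • n)) (dirD p (x + τ • n) n) τ := by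
  have h1 : HasDerivAt (fun τ : ℝ => x + τ • n) n τ := by
    simpa using ((hasDerivAt_id τ).smul_const n).const_add x
  have := (hasFDerivAt_ev p (x + τ • n)).comp_hasDerivAt τ h1
  rwa [gradP_apply] at this

/-- A cubic along a line together with its derivative. -/
theorem exists_cubic_deriv {p : Poly} (hp : p ∈ Deg 3) (x n : Plane) :
    ∃ c₀ c₁ c₂ c₃ : ℝ, (∀ τ : ℝ, ev p (x + τ • n) = c₀ + c₁ * τ + c₂ * τ ^ 2 + c₃ * τ ^ 3) ∧
      ∀ τ : ℝ, dirD p (x + τ • n) n = c₁ + 2 * c₂ * τ + 3 * c₃ * τ ^ 2 := by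
  obtain ⟨c₀, c₁, c₂, c₃, h⟩ := exists_cubic hp x n
  refine ⟨c₀, c₁, c₂, c₃, h, fun τ => ?_⟩
  refine (hasDerivAt_ev_line p x n τ).unique ?_
  have e : (fun τ : ℝ => ev p (x + τ • n)) = fun τ => c₀ + c₁ * τ + c₂ * τ ^ 2 + c₃ * τ ^ 3 :=
    funext h
  rw [e]
  have h1 := (hasDerivAt_id τ).const_mul c₁
  have h2 := ((hasDerivAt_id τ).pow 2).const_mul c₂
  have h3 := ((hasDerivAt_id τ).pow 3).const_mul c₃
  refine (((h1.const_add c₀).add h2).add h3).congr_deriv ?_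
  simp only [id, Nat.cast_ofNat]
  ring

/-- A cubic with double zeros at two points vanishes on the line through them. -/
theorem ev_eq_zero_on_line {p : Poly} (hp : p ∈ Deg 3) {a b : Plane} (ha : ev p a = 0)
    (hb : ev p b = 0) (ha' : dirD p a (b - a) = 0) (hb' : dirD p b (b - a) = 0) (τ : ℝ) :
    ev p (a + τ • (b - a)) = 0 := by
  obtain ⟨c₀, c₁, c₂, c₃, h, h'⟩ := exists_cubic_deriv hp a (b - a)
  have e0 := h 0
  have e1 := h 1
  have d0 := h' 0
  have d1 := h' 1
  simp only [zero_smul, add_zero, one_smul, add_sub_cancel, ha, hb, ha', hb'] at e0 e1 d0 d1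
  rw [h]
  have z0 : c₀ = 0 := by linarith
  have z1 : c₁ = 0 := by linarith
  have z3 : c₃ = 0 := by linarith
  have z2 : c₂ = 0 := by linarith
  simp [z0, z1, z2, z3]

/-- A quadratic with zeros at two points and at their midpoint vanishes on the line. -/
theorem ev_eq_zero_on_line_of_mid {p : Poly} (hp : p ∈ Deg 2) {a b : Plane} (ha : ev p a = 0)
    (hb : ev p b = 0) (hm : ev p (a + (1 / 2 : ℝ) • (b - a)) = 0) (τ : ℝ) :
    ev p (a + τ • (b - a)) = 0 := by
  obtain ⟨c₀, c₁, c₂, h⟩ := exists_quadratic hp a (b - a)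
  have e0 := h 0
  have e1 := h 1
  have e2 := h (1 / 2)
  simp only [zero_smul, add_zero, one_smul, add_sub_cancel, ha, hb, hm] at e0 e1 e2
  rw [h]
  have z0 : c₀ = 0 := by linarith
  have z1 : c₁ = 0 := by linarith
  have z2 : c₂ = 0 := by linarith
  simp [z0, z1, z2]

/-- The mean of `f` over the segment from `a` to `b`. -/
def avg (a b : Plane) (f : Plane → ℝ) : ℝ := ∫ τ in (0 : ℝ)..1, f (a + τ • (b - a))

theorem avg_comm (a b : Plane) (f : Plane → ℝ) : avg a b f = avg b a f := by
  have := intervalIntegral.integral_comp_sub_left (a := 0) (b := 1)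
    (fun τ : ℝ => f (b + τ • (a - b))) 1
  simp only [sub_zero, sub_self] at this
  rw [avg, avg, ← this]
  congr 1
  funext τ
  congr 1
  module

/-- Simpson's rule for quadratics. -/
theorem avg_simpson {p : Poly} (hp : p ∈ Deg 2) (a b : Plane) :
    avg a b (ev p) = (ev p a + 4 * ev p (a + (1 / 2 : ℝ) • (b - a)) + ev p b) / 6 := by
  obtain ⟨c₀, c₁, c₂, h⟩ := exists_quadratic hp a (b - a)
  have e0 := h 0
  have e1 := h 1
  have e2 := h (1 / 2)
  simp only [zero_smul, add_zero, one_smul, add_sub_cancel] at e0 e1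
  rw [e0, e1, e2, avg]
  simp_rw [h]
  rw [intervalIntegral.integral_add (Continuous.intervalIntegrable (by fun_prop) _ _)
      (Continuous.intervalIntegrable (by fun_prop) _ _),
    intervalIntegral.integral_add (Continuous.intervalIntegrable (by fun_prop) _ _)
      (Continuous.intervalIntegrable (by fun_prop) _ _)]
  have i1 : ∫ x in (0 : ℝ)..1, c₁ * x = c₁ * (1 / 2) := by
    rw [intervalIntegral.integral_const_mul, integral_id]; norm_num
  have i2 : ∫ x in (0 : ℝ)..1, c₂ * x ^ 2 = c₂ * (1 / 3) := by
    rw [intervalIntegral.integral_const_mul, integral_pow]; norm_num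
  rw [i1, i2, intervalIntegral.integral_const]
  simp only [smul_eq_mul]
  ring

/-- The midpoint rule for affine functions. -/
theorem avg_mid {p : Poly} (hp : p ∈ Deg 1) (a b : Plane) :
    avg a b (ev p) = ev p (a + (1 / 2 : ℝ) • (b - a)) := by
  obtain ⟨c₀, c₁, h⟩ := exists_linear hp a (b - a)
  have e0 := h 0
  have e1 := h 1
  simp only [zero_smul, add_zero, one_smul, add_sub_cancel] at e0 e1
  rw [avg_simpson (Deg_mono one_le_two hp), e0, e1, h]
  ring

theorem avg_sub {f g : Plane → ℝ} (hf : Continuous f) (hg : Continuous g) (a b : Plane) :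
    avg a b (fun x => f x - g x) = avg a b f - avg a b g :=
  intervalIntegral.integral_sub (Continuous.intervalIntegrable (by fun_prop) _ _)
    (Continuous.intervalIntegrable (by fun_prop) _ _)

theorem avg_fderiv {f : Plane → ℝ} (hf : ContDiff ℝ 1 f) (a b : Plane) :
    avg a b (fun x => fderiv ℝ f x (b - a)) = f b - f a := by
  have h1 : ∀ τ : ℝ, HasDerivAt (fun τ : ℝ => f (a + τ • (b - a)))
      (fderiv ℝ f (a + τ • (b - a)) (b - a)) τ := fun τ => by
    have h0 : HasDerivAt (fun τ : ℝ => a + τ • (b - a)) (b - a) τ := by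
      simpa using ((hasDerivAt_id τ).smul_const (b - a)).const_add a
    exact (hf.differentiable (by simp) _).hasFDerivAt.comp_hasDerivAt τ h0
  rw [avg, intervalIntegral.integral_eq_sub_of_hasDerivAt (fun τ _ => h1 τ)]
  · simp
  · refine Continuous.intervalIntegrable ?_ _ _
    exact ((hf.continuous_fderiv (by simp)).comp (by fun_prop)).clm_apply continuous_const

end MorleyUC
end

noncomputable section

open MeasureTheory Set Filter Topology
namespace MorleyUC

/-! ### Triangles -/

/-- The cross product in the plane. -/
def cross (u v : Plane) : ℝ := u 0 * v 1 - u 1 * v 0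

/-- Twice the signed area of a triangle. -/
def detT (t : Fin 3 → Plane) : ℝ := cross (t 1 - t 0) (t 2 - t 0)

/-- The barycentric coordinates. -/
def lam (t : Fin 3 → Plane) (i : Fin 3) (x : Plane) : ℝ :=
  cross (t (i + 1) - x) (t (i + 2) - x) / detT t

/-- The derivatives of the barycentric coordinates. -/
def gl (t : Fin 3 → Plane) (i : Fin 3) (n : Plane) : ℝ :=
  cross n (t (i + 1) - t (i + 2)) / detT t

theorem plane_ext {x y : Plane} (h0 : x 0 = y 0) (h1 : x 1 = y 1) : x = y := by
  ext i; fin_cases i <;> assumption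

theorem sum_lam {t : Fin 3 → Plane} (h : detT t ≠ 0) (x : Plane) : ∑ i, lam t i x = 1 := by
  simp only [lam, ← Finset.sum_div]
  rw [div_eq_one_iff_eq h, Fin.sum_univ_three]
  simp [cross, detT]; ring

theorem sum_lam_smul {t : Fin 3 → Plane} (h : detT t ≠ 0) (x : Plane) :
    ∑ i, lam t i x • t i = x := by
  have e : ∀ k : Fin 2, ∑ i, lam t i x * t i k = x k := by
    intro k
    simp only [lam, div_mul_eq_mul_div, ← Finset.sum_div]
    rw [div_eq_iff h, Fin.sum_univ_three]
    fin_cases k <;> simp [cross, detT] <;> ring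
  apply plane_ext
  · simpa using e 0
  · simpa using e 1

theorem lam_add (t : Fin 3 → Plane) (i : Fin 3) (x n : Plane) :
    lam t i (x + n) = lam t i x + gl t i n := by
  simp only [lam, gl, ← add_div]
  congr 1
  simp [cross]; ring

theorem gl_smul (t : Fin 3 → Plane) (i : Fin 3) (c : ℝ) (n : Plane) :
    gl t i (c • n) = c * gl t i n := by
  simp [gl, cross]; ring

theorem gl_add (t : Fin 3 → Plane) (i : Fin 3) (n m : Plane) :
    gl t i (n + m) = gl t i n + gl t i m := by
  simp [gl, cross]; ring

theorem gl_sub (t : Fin 3 → Plane) (i : Fin 3) (x y : Plane) :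
    gl t i (x - y) = lam t i x - lam t i y := by
  have := lam_add t i y (x - y)
  rw [add_sub_cancel] at this
  linarith

theorem sum_gl (t : Fin 3 → Plane) (n : Plane) : ∑ i, gl t i n = 0 := by
  simp only [gl, ← Finset.sum_div]
  rw [Fin.sum_univ_three]
  simp [cross]; ring_nf; simp

theorem lam_vertex {t : Fin 3 → Plane} (h : detT t ≠ 0) (i j : Fin 3) :
    lam t i (t j) = if i = j then 1 else 0 := by
  have e : cross (t (i + 1) - t j) (t (i + 2) - t j) = if i = j then detT t else 0 := by
    fin_cases i <;> fin_cases j <;> simp [cross, detT] <;> ring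
  rw [lam, e]
  split <;> simp [h]

theorem lam_self {t : Fin 3 → Plane} (h : detT t ≠ 0) (i : Fin 3) : lam t i (t i) = 1 := by
  simp [lam_vertex h]

theorem lam_ne {t : Fin 3 → Plane} (h : detT t ≠ 0) {i j : Fin 3} (hij : i ≠ j) :
    lam t i (t j) = 0 := by
  simp [lam_vertex h, hij]

theorem vertex_injective {t : Fin 3 → Plane} (h : detT t ≠ 0) : Function.Injective t := by
  intro i j hij
  by_contra hne
  have h1 := lam_self h i
  rw [hij, lam_ne h hne] at h1
  exact zero_ne_one h1

theorem lam_ext {t : Fin 3 → Plane} (h : detT t ≠ 0) {x y : Plane}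
    (hxy : ∀ i, lam t i x = lam t i y) : x = y := by
  rw [← sum_lam_smul h x, ← sum_lam_smul h y]
  simp [hxy]

theorem lam_combo (t : Fin 3 → Plane) (i : Fin 3) {a b : ℝ} (hab : a + b = 1) (x y : Plane) :
    lam t i (a • x + b • y) = a * lam t i x + b * lam t i y := by
  have h1 : a • x + b • y = x + b • (y - x) := by
    rw [← eq_sub_iff_add_eq] at hab
    rw [hab]; module
  rw [h1, lam_add, gl_smul, gl_sub]
  rw [← eq_sub_iff_add_eq] at hab
  rw [hab]; ring

theorem lam_line (t : Fin 3 → Plane) (i : Fin 3) (τ : ℝ) (x y : Plane) :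
    lam t i (x + τ • (y - x)) = (1 - τ) * lam t i x + τ * lam t i y := by
  rw [lam_add, gl_smul, gl_sub]; ring

theorem lam_continuous (t : Fin 3 → Plane) (i : Fin 3) : Continuous (lam t i) := by
  unfold lam cross
  simp only [PiLp.sub_apply]
  fun_prop

/-- The closed triangle and its faces in barycentric coordinates. -/
theorem convexHull_image_eq {t : Fin 3 → Plane} (h : detT t ≠ 0) (A : Set (Fin 3)) :
    convexHull ℝ (t '' A) = {x | (∀ i, 0 ≤ lam t i x) ∧ ∀ i, i ∉ A → lam t i x = 0} := by
  refine subset_antisymm (convexHull_min ?_ ?_) ?_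
  · rintro _ ⟨j, hj, rfl⟩
    refine ⟨fun i => ?_, fun i hi => lam_ne h (by rintro rfl; exact hi hj)⟩
    rw [lam_vertex h]; split <;> norm_num
  · intro x hx y hy a b ha hb hab
    refine ⟨fun i => ?_, fun i hi => ?_⟩
    · rw [lam_combo t i hab]
      exact add_nonneg (mul_nonneg ha (hx.1 i)) (mul_nonneg hb (hy.1 i))
    · rw [lam_combo t i hab, hx.2 i hi, hy.2 i hi]; simp
  · rintro x ⟨hx0, hxA⟩
    classical
    have h1 : ∑ i ∈ Finset.univ.filter (· ∈ A), lam t i x = 1 := by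
      rw [Finset.sum_filter, ← sum_lam h x]
      refine Finset.sum_congr rfl fun i _ => ?_
      split_ifs with hi
      · rfl
      · exact (hxA i hi).symm
    have h2 : ∑ i ∈ Finset.univ.filter (· ∈ A), lam t i x • t i = x := by
      conv_rhs => rw [← sum_lam_smul h x]
      rw [Finset.sum_filter]
      refine Finset.sum_congr rfl fun i _ => ?_
      split_ifs with hi
      · rfl
      · rw [hxA i hi, zero_smul]
    rw [← h2]
    refine (convex_convexHull ℝ _).sum_mem (fun i _ => hx0 i) h1 fun i hi => ?_
    exact subset_convexHull ℝ _ ⟨i, (Finset.mem_filter.1 hi).2, rfl⟩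

/-- The closed triangle with vertices `t`. -/
def tri (t : Fin 3 → Plane) : Set Plane := convexHull ℝ (range t)

theorem tri_eq {t : Fin 3 → Plane} (h : detT t ≠ 0) : tri t = {x | ∀ i, 0 ≤ lam t i x} := by
  rw [tri, ← image_univ, convexHull_image_eq h]
  simp

theorem mem_tri {t : Fin 3 → Plane} (h : detT t ≠ 0) {x : Plane} :
    x ∈ tri t ↔ ∀ i, 0 ≤ lam t i x := by
  rw [tri_eq h]; rfl

theorem tri_isCompact (t : Fin 3 → Plane) : IsCompact (tri t) :=
  (finite_range t).isCompact_convexHull ℝ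

theorem tri_measurableSet (t : Fin 3 → Plane) : MeasurableSet (tri t) :=
  (tri_isCompact t).measurableSet

theorem tri_convex (t : Fin 3 → Plane) : Convex ℝ (tri t) := convex_convexHull ℝ _

theorem mem_interior_tri {t : Fin 3 → Plane} (h : detT t ≠ 0) {x : Plane}
    (hx : ∀ i, 0 < lam t i x) : x ∈ interior (tri t) := by
  have ho : IsOpen (⋂ i, {x | 0 < lam t i x}) :=
    isOpen_iInter_of_finite fun i => isOpen_lt continuous_const (lam_continuous t i)
  refine mem_interior.2 ⟨_, ?_, ho, by simpa using hx⟩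
  intro y hy
  rw [mem_tri h]
  simp only [mem_iInter, mem_ofPred_eq] at hy
  exact fun i => (hy i).le

/-- The centroid. -/
def cen (t : Fin 3 → Plane) : Plane := (1 / 3 : ℝ) • ∑ i, t i

theorem lam_cen {t : Fin 3 → Plane} (h : detT t ≠ 0) (i : Fin 3) : lam t i (cen t) = 1 / 3 := by
  have e : 3 * cross (t (i + 1) - cen t) (t (i + 2) - cen t) = detT t := by
    fin_cases i <;> simp [cross, detT, cen, Fin.sum_univ_three] <;> ring
  rw [lam, div_eq_iff h]; linarith

/-- The triangle spanned by the centroid and the edge opposite to the vertex `i`. -/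
def subTri (t : Fin 3 → Plane) (i : Fin 3) : Fin 3 → Plane := Function.update t i (cen t)

theorem detT_sub (t : Fin 3 → Plane) (i : Fin 3) : detT (subTri t i) = detT t / 3 := by
  fin_cases i <;> simp [detT, subTri, cross, cen, Fin.sum_univ_three] <;> ring

theorem detT_sub_ne {t : Fin 3 → Plane} (h : detT t ≠ 0) (i : Fin 3) : detT (subTri t i) ≠ 0 := by
  rw [detT_sub]; exact div_ne_zero h (by norm_num)

theorem lam_sub_self {t : Fin 3 → Plane} (h : detT t ≠ 0) (i : Fin 3) (x : Plane) :
    lam (subTri t i) i x = 3 * lam t i x := by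
  rw [lam, lam, detT_sub]
  have : subTri t i (i + 1) = t (i + 1) ∧ subTri t i (i + 2) = t (i + 2) := by
    fin_cases i <;> simp [subTri]
  rw [this.1, this.2]; field_simp

theorem lam_sub_ne {t : Fin 3 → Plane} (h : detT t ≠ 0) {i j : Fin 3} (hij : j ≠ i) (x : Plane) :
    lam (subTri t i) j x = lam t j x - lam t i x := by
  rw [lam, lam, lam, detT_sub, ← sub_div, div_div_eq_mul_div, div_left_inj' h]
  fin_cases i <;> fin_cases j <;> simp at hij <;>
    simp [cross, subTri, cen, Fin.sum_univ_three] <;> ring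

theorem mem_tri_sub {t : Fin 3 → Plane} (h : detT t ≠ 0) {i : Fin 3} {x : Plane} :
    x ∈ tri (subTri t i) ↔ 0 ≤ lam t i x ∧ ∀ j, lam t i x ≤ lam t j x := by
  rw [mem_tri (detT_sub_ne h i)]
  constructor
  · intro hx
    refine ⟨by have := hx i; rw [lam_sub_self h] at this; linarith, fun j => ?_⟩
    rcases eq_or_ne j i with rfl | hj
    · exact le_rfl
    · have := hx j; rw [lam_sub_ne h hj] at this; linarith
  · rintro ⟨h0, h1⟩ j
    rcases eq_or_ne j i with rfl | hj
    · rw [lam_sub_self h]; linarith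
    · rw [lam_sub_ne h hj]; linarith [h1 j]

theorem tri_sub_subset {t : Fin 3 → Plane} (h : detT t ≠ 0) (i : Fin 3) :
    tri (subTri t i) ⊆ tri t := by
  intro x hx
  rw [mem_tri_sub h] at hx
  rw [mem_tri h]
  exact fun j => hx.1.trans (hx.2 j)

theorem exists_mem_tri_sub {t : Fin 3 → Plane} (h : detT t ≠ 0) {x : Plane} (hx : x ∈ tri t) :
    ∃ i, x ∈ tri (subTri t i) := by
  obtain ⟨i, -, hi⟩ := Finset.exists_min_image Finset.univ (fun i => lam t i x) ⟨0, by simp⟩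
  exact ⟨i, (mem_tri_sub h).2 ⟨(mem_tri h).1 hx i, fun j => hi j (by simp)⟩⟩

/-! ### Barycentric coordinates as polynomials -/

/-- The barycentric coordinates as polynomials. -/
def lamP (t : Fin 3 → Plane) (i : Fin 3) : Poly :=
  MvPolynomial.C (lam t i 0) + (gl t i (EuclideanSpace.single 0 1)) • MvPolynomial.X 0 +
    (gl t i (EuclideanSpace.single 1 1)) • MvPolynomial.X 1

theorem ev_lamP (t : Fin 3 → Plane) (i : Fin 3) (x : Plane) : ev (lamP t i) x = lam t i x := by
  have hx : x = 0 + (x 0 • EuclideanSpace.single 0 1 + x 1 • EuclideanSpace.single 1 1) := by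
    apply plane_ext <;> simp
  conv_rhs => rw [hx, lam_add, gl_add, gl_smul, gl_smul]
  simp only [lamP, ev_add, ev_smul, ev_C, ev_X]
  ring

theorem pderiv_lamP (t : Fin 3 → Plane) (i : Fin 3) (k : Fin 2) :
    MvPolynomial.pderiv k (lamP t i) = MvPolynomial.C (gl t i (EuclideanSpace.single k 1)) := by
  fin_cases k <;> simp [lamP, MvPolynomial.pderiv_X, MvPolynomial.smul_eq_C_mul]

theorem dirD_lamP (t : Fin 3 → Plane) (i : Fin 3) (x n : Plane) :
    dirD (lamP t i) x n = gl t i n := by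
  have hn : n = n 0 • EuclideanSpace.single 0 1 + n 1 • EuclideanSpace.single 1 1 := by
    apply plane_ext <;> simp
  simp only [dirD, pderiv_lamP, ev_C, Fin.sum_univ_two]
  conv_rhs => rw [hn, gl_add, gl_smul, gl_smul]

theorem lamP_mem (t : Fin 3 → Plane) (i : Fin 3) : lamP t i ∈ Deg 1 := by
  refine Submodule.add_mem _ (Submodule.add_mem _ ?_ ?_) ?_
  · rw [mem_Deg]; simp
  · refine Submodule.smul_mem _ _ (mem_Deg.2 ?_)
    simp
  · refine Submodule.smul_mem _ _ (mem_Deg.2 ?_)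
    simp

end MorleyUC
end

noncomputable section

open MeasureTheory Set Filter Topology
namespace MorleyUC

/-! ### Integration over triangles -/

/-- The linear part of the affine parametrization of a triangle. -/
def triLin (t : Fin 3 → Plane) : Plane →L[ℝ] Plane :=
  (EuclideanSpace.proj (𝕜 := ℝ) (0 : Fin 2)).smulRight (t 1 - t 0) +
    (EuclideanSpace.proj (𝕜 := ℝ) (1 : Fin 2)).smulRight (t 2 - t 0)

theorem triLin_apply (t : Fin 3 → Plane) (x : Plane) :
    triLin t x = x 0 • (t 1 - t 0) + x 1 • (t 2 - t 0) := by
  simp [triLin]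

theorem det_triLin (t : Fin 3 → Plane) : (triLin t).det = detT t := by
  have h := LinearMap.det_toMatrix (EuclideanSpace.basisFun (Fin 2) ℝ).toBasis
    (triLin t : Plane →ₗ[ℝ] Plane)
  rw [ContinuousLinearMap.det, ← h, Matrix.det_fin_two]
  simp [LinearMap.toMatrix_apply, triLin_apply, detT, cross]
  ring

theorem isClosed_simplex_plane : IsClosed {y : Plane | 0 ≤ y 0 ∧ 0 ≤ y 1 ∧ y 0 + y 1 ≤ 1} := by
  have c0 : Continuous fun y : Plane => y 0 := by fun_prop
  have c1 : Continuous fun y : Plane => y 1 := by fun_prop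
  exact (isClosed_le continuous_const c0).inter
    ((isClosed_le continuous_const c1).inter (isClosed_le (c0.add c1) continuous_const))

theorem isClosed_simplex_prod : IsClosed {p : ℝ × ℝ | 0 ≤ p.1 ∧ 0 ≤ p.2 ∧ p.1 + p.2 ≤ 1} :=
  (isClosed_le continuous_const continuous_fst).inter
    ((isClosed_le continuous_const continuous_snd).inter
      (isClosed_le (continuous_fst.add continuous_snd) continuous_const))

theorem setIntegral_tri {t : Fin 3 → Plane} (h : detT t ≠ 0) (f : Plane → ℝ) :
    ∫ x in tri t, f x = |detT t| * ∫ y in {y : Plane | 0 ≤ y 0 ∧ 0 ≤ y 1 ∧ y 0 + y 1 ≤ 1},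
      f (t 0 + triLin t y) := by
  obtain ⟨S, hS⟩ : ∃ S : Set Plane, S = {y : Plane | 0 ≤ y 0 ∧ 0 ≤ y 1 ∧ y 0 + y 1 ≤ 1} := ⟨_, rfl⟩
  have hSm : MeasurableSet S := by
    rw [hS]; exact isClosed_simplex_plane.measurableSet
  have hl : ∀ y : Plane, lam t 1 (t 0 + triLin t y) = y 0 ∧ lam t 2 (t 0 + triLin t y) = y 1 := by
    intro y
    rw [triLin_apply]
    constructor <;>
      · rw [lam_add, gl_add, gl_smul, gl_smul, gl_sub, gl_sub]
        simp [lam_vertex h]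
  have hl0 : ∀ y : Plane, lam t 0 (t 0 + triLin t y) = 1 - y 0 - y 1 := by
    intro y
    have := sum_lam h (t 0 + triLin t y)
    rw [Fin.sum_univ_three, (hl y).1, (hl y).2] at this
    linarith
  have himg : tri t = (fun y => t 0 + triLin t y) '' S := by
    ext x
    rw [mem_tri h, Fin.forall_fin_succ, Fin.forall_fin_two]
    constructor
    · rintro ⟨h0, h1, h2⟩
      have hs := sum_lam h x
      rw [Fin.sum_univ_three] at hs
      have hx : t 0 + triLin t !₂[lam t 1 x, lam t 2 x] = x := by
        refine lam_ext h fun i => ?_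
        fin_cases i
        · simp only [Fin.zero_eta, hl0]; simp; linarith
        · simp only [Fin.mk_one, (hl _).1]; simp
        · simp only [Fin.reduceFinMk, (hl _).2]; simp
      refine ⟨!₂[lam t 1 x, lam t 2 x], ?_, hx⟩
      rw [hS]
      simp only [mem_ofPred_eq, PiLp.toLp_apply, Matrix.cons_val_zero, Matrix.cons_val_one]
      exact ⟨h1, h2, by linarith⟩
    · rintro ⟨y, hy, rfl⟩
      rw [hS] at hy
      obtain ⟨a, b, c⟩ := hy
      refine ⟨by rw [hl0]; linarith, ?_, ?_⟩
      · exact (hl y).1.symm ▸ a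
      · exact (hl y).2.symm ▸ b
  rw [← hS, himg, integral_image_eq_integral_abs_det_fderiv_smul volume hSm
    (f' := fun _ => triLin t)]
  · simp only [det_triLin, smul_eq_mul]
    rw [integral_const_mul]
  · intro y _
    exact ((triLin t).hasFDerivAt.const_add (t 0)).hasFDerivWithinAt
  · intro y _ z _ hyz
    have e1 := (hl y)
    have e2 := (hl z)
    simp only at hyz
    rw [hyz] at e1
    exact plane_ext (e1.1.symm.trans e2.1) (e1.2.symm.trans e2.2)

theorem setIntegral_simplex {f : Plane → ℝ} (hf : Continuous f) :
    ∫ y in {y : Plane | 0 ≤ y 0 ∧ 0 ≤ y 1 ∧ y 0 + y 1 ≤ 1}, f y =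
      ∫ s in (0 : ℝ)..1, ∫ r in (0 : ℝ)..(1 - s), f !₂[s, r] := by
  obtain ⟨S, hS⟩ : ∃ S : Set (ℝ × ℝ), S = {p | 0 ≤ p.1 ∧ 0 ≤ p.2 ∧ p.1 + p.2 ≤ 1} := ⟨_, rfl⟩
  have hSm : MeasurableSet S := by
    rw [hS]; exact isClosed_simplex_prod.measurableSet
  have hmp : MeasurePreserving (fun p : ℝ × ℝ => (!₂[p.1, p.2] : Plane)) volume volume :=
    (PiLp.volume_preserving_toLp (Fin 2)).comp (volume_preserving_finTwoArrow ℝ).symm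
  have hme : MeasurableEmbedding (fun p : ℝ × ℝ => (!₂[p.1, p.2] : Plane)) :=
    (MeasurableEquiv.toLp 2 (Fin 2 → ℝ)).measurableEmbedding.comp
      (MeasurableEquiv.finTwoArrow (α := ℝ)).symm.measurableEmbedding
  have h1 := hmp.setIntegral_preimage_emb hme f {y : Plane | 0 ≤ y 0 ∧ 0 ≤ y 1 ∧ y 0 + y 1 ≤ 1}
  have hpre : (fun p : ℝ × ℝ => (!₂[p.1, p.2] : Plane)) ⁻¹'
      {y : Plane | 0 ≤ y 0 ∧ 0 ≤ y 1 ∧ y 0 + y 1 ≤ 1} = S := by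
    rw [hS]; ext p; simp
  rw [← h1, hpre]
  have hfc : Continuous fun p : ℝ × ℝ => f !₂[p.1, p.2] := by
    refine hf.comp ?_
    refine (PiLp.continuous_toLp 2 (fun _ : Fin 2 => ℝ)).comp ?_
    refine continuous_pi fun i => ?_
    fin_cases i
    · exact continuous_fst
    · exact continuous_snd
  have hSc : IsCompact S := by
    refine Metric.isCompact_of_isClosed_isBounded ?_ ?_
    · rw [hS]; exact isClosed_simplex_prod
    · refine (Metric.isBounded_Icc ((0 : ℝ), (0 : ℝ)) (1, 1)).subset ?_
      rintro ⟨a, b⟩ hp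
      rw [hS] at hp
      obtain ⟨h0, h1, h2⟩ := hp
      simp only at h0 h1 h2
      exact ⟨⟨h0, h1⟩, ⟨by simp only; linarith, by simp only; linarith⟩⟩
  have hInt : Integrable (S.indicator fun p : ℝ × ℝ => f !₂[p.1, p.2]) (volume.prod volume) := by
    rw [integrable_indicator_iff hSm]
    exact hfc.continuousOn.integrableOn_compact hSc
  rw [← integral_indicator hSm, Measure.volume_eq_prod, integral_prod _ hInt,
    intervalIntegral.integral_of_le zero_le_one, ← integral_Icc_eq_integral_Ioc,
    ← integral_indicator measurableSet_Icc]
  congr 1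
  funext s
  by_cases hs : s ∈ Icc (0 : ℝ) 1
  · rw [indicator_of_mem hs, intervalIntegral.integral_of_le (by linarith [hs.2]),
      ← integral_Icc_eq_integral_Ioc, ← integral_indicator measurableSet_Icc]
    congr 1
    funext r
    by_cases hr : r ∈ Icc (0 : ℝ) (1 - s)
    · rw [indicator_of_mem hr, indicator_of_mem]
      rw [hS]; exact ⟨hs.1, hr.1, by simp only; linarith [hr.2]⟩
    · rw [indicator_of_notMem hr, indicator_of_notMem]
      rw [hS]; rintro ⟨_, b, c⟩
      simp only at b c
      exact hr ⟨b, by linarith⟩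
  · rw [indicator_of_notMem hs, integral_eq_zero_of_ae]
    refine Eventually.of_forall fun r => ?_
    refine indicator_of_notMem ?_ _
    rw [hS]; rintro ⟨a, b, c⟩
    simp only at a b c
    exact hs ⟨a, by linarith⟩

/-- Green's formula for the derivative along an edge. -/
theorem setIntegral_fderiv_edge {t : Fin 3 → Plane} (h : detT t ≠ 0) {f : Plane → ℝ}
    (hf : ContDiff ℝ 1 f) :
    ∫ x in tri t, fderiv ℝ f x (t 2 - t 0) =
      |detT t| * (avg (t 1) (t 2) f - avg (t 0) (t 1) f) := by
  have hfd : Continuous (fderiv ℝ f) := hf.continuous_fderiv (by simp)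
  rw [setIntegral_tri h, setIntegral_simplex]
  · congr 1
    have key : ∀ s : ℝ, ∫ r in (0 : ℝ)..(1 - s), fderiv ℝ f (t 0 + triLin t !₂[s, r]) (t 2 - t 0) =
        f (t 2 + s • (t 1 - t 2)) - f (t 0 + s • (t 1 - t 0)) := by
      intro s
      have hd : ∀ r : ℝ, HasDerivAt (fun r : ℝ => f (t 0 + s • (t 1 - t 0) + r • (t 2 - t 0)))
          (fderiv ℝ f (t 0 + triLin t !₂[s, r]) (t 2 - t 0)) r := by
        intro r
        have h0 : HasDerivAt (fun r : ℝ => t 0 + s • (t 1 - t 0) + r • (t 2 - t 0))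
            (t 2 - t 0) r := by
          simpa using ((hasDerivAt_id r).smul_const (t 2 - t 0)).const_add (t 0 + s • (t 1 - t 0))
        have h1 : t 0 + triLin t !₂[s, r] = t 0 + s • (t 1 - t 0) + r • (t 2 - t 0) := by
          rw [triLin_apply]; simp [add_assoc]
        rw [h1]
        exact (hf.differentiable (by simp) _).hasFDerivAt.comp_hasDerivAt r h0
      rw [intervalIntegral.integral_eq_sub_of_hasDerivAt (fun r _ => hd r)]
      · congr 2
        · module
        · module
      · refine Continuous.intervalIntegrable ?_ _ _
        refine (hfd.comp ?_).clm_apply continuous_const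
        simp only [triLin_apply]
        simp only [PiLp.toLp_apply, Matrix.cons_val_zero, Matrix.cons_val_one]
        fun_prop
    simp_rw [key]
    rw [intervalIntegral.integral_sub]
    · rw [avg_comm (t 1) (t 2)]; rfl
    · exact Continuous.intervalIntegrable (hf.continuous.comp (by fun_prop)) _ _
    · exact Continuous.intervalIntegrable (hf.continuous.comp (by fun_prop)) _ _
  · exact (hfd.comp (by fun_prop)).clm_apply continuous_const

/-- The area of a triangle. -/
theorem volume_real_tri {t : Fin 3 → Plane} (h : detT t ≠ 0) :
    volume.real (tri t) = |detT t| / 2 := by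
  have h1 := setIntegral_fderiv_edge h (f := ev (lamP t 2)) ((ev_contDiff _).of_le
    (WithTop.coe_le_coe.2 le_top))
  simp only [fderiv_ev, gradP_apply, dirD_lamP] at h1
  rw [gl_sub, avg_mid (lamP_mem t 2), avg_mid (lamP_mem t 2), ev_lamP, ev_lamP, lam_line, lam_line]
    at h1
  simp [lam_vertex h] at h1
  rw [h1]; ring

theorem tri_comp (t : Fin 3 → Plane) (σ : Equiv.Perm (Fin 3)) : tri (t ∘ σ) = tri t := by
  rw [tri, tri, σ.surjective.range_comp]

/-- **Green's formula** on a triangle. -/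
theorem setIntegral_fderiv_tri {t : Fin 3 → Plane} (h : detT t ≠ 0) {f : Plane → ℝ}
    (hf : ContDiff ℝ 1 f) (n : Plane) :
    ∫ x in tri t, fderiv ℝ f x n =
      -|detT t| * ∑ i, gl t i n * avg (t (i + 1)) (t (i + 2)) f := by
  have h1 := setIntegral_fderiv_edge h hf
  have hperm : detT (t ∘ Equiv.swap 1 2) = -detT t := by
    simp [detT, cross, Equiv.swap_apply_def]; ring
  have h2 := setIntegral_fderiv_edge (t := t ∘ Equiv.swap 1 2) (by rw [hperm]; simpa using h) hf
  rw [tri_comp, hperm, abs_neg] at h2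
  have s0 : Equiv.swap (1 : Fin 3) 2 0 = 0 := by decide
  simp only [Function.comp_apply, Equiv.swap_apply_left, Equiv.swap_apply_right, s0] at h2
  have hfd : Continuous (fderiv ℝ f) := hf.continuous_fderiv (by simp)
  have hi : ∀ m : Plane, IntegrableOn (fun x => fderiv ℝ f x m) (tri t) := fun m =>
    (hfd.clm_apply continuous_const).continuousOn.integrableOn_compact (tri_isCompact t)
  have hn : n = gl t 1 n • (t 1 - t 0) + gl t 2 n • (t 2 - t 0) := by
    have hg : ∀ i, lam t i (t 0 + n) = lam t i (t 0 + (gl t 1 n • (t 1 - t 0) +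
        gl t 2 n • (t 2 - t 0))) := by
      intro i
      have hs := sum_gl t n
      rw [Fin.sum_univ_three] at hs
      rw [lam_add, lam_add, gl_add, gl_smul, gl_smul, gl_sub, gl_sub]
      fin_cases i <;> simp [lam_vertex h]
      linarith
    exact add_left_cancel (lam_ext h hg)
  have e : ∀ x, fderiv ℝ f x n =
      gl t 1 n * fderiv ℝ f x (t 1 - t 0) + gl t 2 n * fderiv ℝ f x (t 2 - t 0) := fun x => by
    conv_lhs => rw [hn]
    simp
  simp_rw [e]
  rw [integral_add ((hi _).const_mul _) ((hi _).const_mul _), integral_const_mul,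
    integral_const_mul, h1, h2]
  have hs := sum_gl t n
  rw [Fin.sum_univ_three] at hs ⊢
  have h0 : gl t 0 n = -gl t 1 n - gl t 2 n := by linarith
  have e1 : (1 : Fin 3) + 1 = 2 := rfl
  have e2 : (1 : Fin 3) + 2 = 0 := rfl
  have e3 : (2 : Fin 3) + 1 = 0 := rfl
  have e4 : (2 : Fin 3) + 2 = 1 := rfl
  rw [h0, e1, e2, e3, e4, zero_add, zero_add, avg_comm (t 2) (t 0), avg_comm (t 2) (t 1)]
  ring

end MorleyUC
end

noncomputable section

open MeasureTheory Set Filter Topology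
namespace MorleyUC

/-! ### The local Hsieh–Clough–Tocher element -/

/-- The midpoint of the edge opposite to the vertex `i`. -/
def midT (t : Fin 3 → Plane) (i : Fin 3) : Plane :=
  t (i + 1) + (1 / 2 : ℝ) • (t (i + 2) - t (i + 1))

/-- A normal vector of the edge opposite to the vertex `i`, of the length of that edge. -/
def norT (t : Fin 3 → Plane) (i : Fin 3) : Plane :=
  !₂[t (i + 1) 1 - t (i + 2) 1, t (i + 2) 0 - t (i + 1) 0]

theorem norm_sq_plane (x : Plane) : ‖x‖ ^ 2 = x 0 ^ 2 + x 1 ^ 2 := by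
  rw [EuclideanSpace.norm_sq_eq]; simp

theorem gl_norT (t : Fin 3 → Plane) (i : Fin 3) :
    gl t i (norT t i) = ‖t (i + 1) - t (i + 2)‖ ^ 2 / detT t := by
  rw [gl, norm_sq_plane]
  congr 1
  simp [cross, norT]; ring

theorem norm_norT (t : Fin 3 → Plane) (i : Fin 3) : ‖norT t i‖ = ‖t (i + 1) - t (i + 2)‖ := by
  rw [← sq_eq_sq₀ (norm_nonneg _) (norm_nonneg _), norm_sq_plane, norm_sq_plane]
  simp [norT]; ring

theorem fin3_succ_ne (i : Fin 3) : i + 1 ≠ i ∧ i + 2 ≠ i ∧ i + 1 ≠ i + 2 := by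
  fin_cases i <;> decide

theorem gl_norT_ne {t : Fin 3 → Plane} (h : detT t ≠ 0) (i : Fin 3) : gl t i (norT t i) ≠ 0 := by
  rw [gl_norT]
  refine div_ne_zero (pow_ne_zero 2 ?_) h
  rw [norm_ne_zero_iff, sub_ne_zero]
  exact fun e => (fin3_succ_ne i).2.2 (vertex_injective h e)

/-- A vector with vanishing `i`-th barycentric derivative is parallel to the `i`-th edge. -/
theorem eq_smul_of_gl_eq_zero {t : Fin 3 → Plane} (h : detT t ≠ 0) {i : Fin 3} {n : Plane}
    (hn : gl t i n = 0) : n = gl t (i + 2) n • (t (i + 2) - t (i + 1)) := by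
  have hg : ∀ j, lam t j (t 0 + n) = lam t j (t 0 + gl t (i + 2) n • (t (i + 2) - t (i + 1))) := by
    intro j
    have hs := sum_gl t n
    rw [Fin.sum_univ_three] at hs
    rw [lam_add, lam_add, gl_smul, gl_sub]
    fin_cases i <;> fin_cases j <;> simp [lam_vertex h] at hn ⊢ <;> linarith
  exact add_left_cancel (lam_ext h hg)

theorem cen_sub_vertex (t : Fin 3 → Plane) (k : Fin 3) :
    cen t - t k = (1 / 3 : ℝ) • ((t (k + 1) - t k) + (t (k + 2) - t k)) := by
  rw [cen]
  fin_cases k <;> simp [Fin.sum_univ_three] <;> module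

/-- Piecewise cubics on the three subtriangles of a triangle that are `C¹`. -/
structure LocalHCT (t : Fin 3 → Plane) (p : Fin 3 → Poly) : Prop where
  deg : ∀ i, p i ∈ Deg 3
  val : ∀ i j x, x ∈ tri (subTri t i) → x ∈ tri (subTri t j) → ev (p i) x = ev (p j) x
  grad : ∀ i j x, x ∈ tri (subTri t i) → x ∈ tri (subTri t j) →
    ∀ n, dirD (p i) x n = dirD (p j) x n

theorem LocalHCT.sub {t : Fin 3 → Plane} {p q : Fin 3 → Poly} (hp : LocalHCT t p)
    (hq : LocalHCT t q) : LocalHCT t (fun i => p i - q i) where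
  deg i := Submodule.sub_mem _ (hp.deg i) (hq.deg i)
  val i j x hi hj := by simp only [ev_sub, hp.val i j x hi hj, hq.val i j x hi hj]
  grad i j x hi hj n := by simp only [dirD_sub, hp.grad i j x hi hj, hq.grad i j x hi hj]

theorem LocalHCT.const {t : Fin 3 → Plane} {p : Poly} (hp : p ∈ Deg 3) :
    LocalHCT t (fun _ => p) where
  deg _ := hp
  val _ _ _ _ _ := rfl
  grad _ _ _ _ _ _ := rfl

theorem mem_tri_sub_ray {t : Fin 3 → Plane} (h : detT t ≠ 0) {i k : Fin 3} (hik : k ≠ i) {τ : ℝ}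
    (h0 : 0 ≤ τ) (h1 : τ ≤ 1) : t k + τ • (cen t - t k) ∈ tri (subTri t i) := by
  rw [mem_tri_sub h]
  refine ⟨?_, fun j => ?_⟩
  · rw [lam_line, lam_ne h hik.symm, lam_cen h]; linarith
  · rw [lam_line, lam_line, lam_ne h hik.symm, lam_cen h, lam_cen h, lam_vertex h]
    split <;> linarith

theorem dirD_edge_eq_zero {t : Fin 3 → Plane} (h : detT t ≠ 0) {p : Poly} (hp : p ∈ Deg 3)
    {i : Fin 3} (hv : ∀ k, k ≠ i → ev p (t k) = 0) (hg : ∀ k, k ≠ i → ∀ n, dirD p (t k) n = 0)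
    (hm : ∃ n, gl t i n ≠ 0 ∧ dirD p (midT t i) n = 0) (τ : ℝ) :
    ev p (t (i + 1) + τ • (t (i + 2) - t (i + 1))) = 0 ∧
      ∀ n, dirD p (t (i + 1) + τ • (t (i + 2) - t (i + 1))) n = 0 := by
  obtain ⟨h1, h2, -⟩ := fin3_succ_ne i
  have hz : ∀ τ : ℝ, ev p (t (i + 1) + τ • (t (i + 2) - t (i + 1))) = 0 := fun τ =>
    ev_eq_zero_on_line hp (hv _ h1) (hv _ h2) (hg _ h1 _) (hg _ h2 _) τ
  have ht : ∀ τ : ℝ, dirD p (t (i + 1) + τ • (t (i + 2) - t (i + 1))) (t (i + 2) - t (i + 1)) = 0 := by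
    intro τ
    refine (hasDerivAt_ev_line p _ _ τ).unique ?_
    rw [show (fun τ : ℝ => ev p (t (i + 1) + τ • (t (i + 2) - t (i + 1)))) = fun _ => 0 from
      funext hz]
    exact hasDerivAt_const τ 0
  refine ⟨hz τ, fun n => ?_⟩
  rw [← ev_dP]
  refine ev_eq_zero_on_line_of_mid (dP_mem_Deg (k := 2) hp n) ?_ ?_ ?_ τ
  · rw [ev_dP]; exact hg _ h1 n
  · rw [ev_dP]; exact hg _ h2 n
  · rw [ev_dP]
    obtain ⟨n₀, hn₀, hd⟩ := hm
    obtain ⟨c, hc⟩ : ∃ c, c = gl t i n / gl t i n₀ := ⟨_, rfl⟩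
    have h0 : gl t i (n + (-c) • n₀) = 0 := by
      rw [gl_add, gl_smul, hc]; field_simp; ring
    have h3 := eq_smul_of_gl_eq_zero h h0
    have h4 : n = c • n₀ + gl t (i + 2) (n + (-c) • n₀) • (t (i + 2) - t (i + 1)) := by
      rw [← h3]; module
    rw [h4, dirD_add_right, dirD_smul_right, dirD_smul_right, ht (1 / 2)]
    rw [midT] at hd
    rw [hd]; simp

/-- The cubic along a ray from the edge to a point where it is known. -/
theorem ev_ray {p : Poly} (hp : p ∈ Deg 3) {y c : Plane} (h0 : ev p y = 0)
    (h1 : dirD p y (c - y) = 0) :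
    (∀ τ : ℝ, ev p (y + τ • (c - y)) = (3 * ev p c - dirD p c (c - y)) * τ ^ 2 +
      (dirD p c (c - y) - 2 * ev p c) * τ ^ 3) ∧
    ∀ τ : ℝ, dirD p (y + τ • (c - y)) (c - y) = 2 * (3 * ev p c - dirD p c (c - y)) * τ +
      3 * (dirD p c (c - y) - 2 * ev p c) * τ ^ 2 := by
  obtain ⟨c₀, c₁, c₂, c₃, h, h'⟩ := exists_cubic_deriv hp y (c - y)
  have e0 := h 0
  have e1 := h 1
  have d0 := h' 0
  have d1 := h' 1
  simp only [zero_smul, add_zero, one_smul, add_sub_cancel, h0, h1] at e0 e1 d0 d1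
  have z0 : c₀ = 0 := by linarith
  have z1 : c₁ = 0 := by linarith
  have z3 : c₃ = dirD p c (c - y) - 2 * ev p c := by linarith
  have z2 : c₂ = 3 * ev p c - dirD p c (c - y) := by linarith
  refine ⟨fun τ => ?_, fun τ => ?_⟩
  · rw [h, z0, z1, z2, z3]; ring
  · rw [h', z1, z2, z3]; ring

theorem dirD_ray_edge {p : Poly} (hp : p ∈ Deg 3) {a e c : Plane}
    (hz : ∀ s : ℝ, ev p (a + s • e) = 0) (hd : ∀ (s : ℝ) n, dirD p (a + s • e) n = 0)
    (s τ : ℝ) (hτ : τ ≠ 1) :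
    dirD p ((a + s • e) + τ • (c - (a + s • e))) e = τ ^ 2 * dirD p c e := by
  have hf : ∀ s : ℝ, ev p ((a + τ • (c - a)) + s • ((1 - τ) • e)) =
      (3 * ev p c - dirD p c (c - a) + s * dirD p c e) * τ ^ 2 +
      (dirD p c (c - a) - s * dirD p c e - 2 * ev p c) * τ ^ 3 := by
    intro s
    have h1 := (ev_ray hp (c := c) (hz s) (hd s _)).1 τ
    have h2 : (a + s • e) + τ • (c - (a + s • e)) = (a + τ • (c - a)) + s • ((1 - τ) • e) := by
      module
    have h3 : c - (a + s • e) = (c - a) - s • e := by module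
    rw [h2, h3, dirD_sub_right, dirD_smul_right] at h1
    rw [h1]; ring
  have h4 := hasDerivAt_ev_line p (a + τ • (c - a)) ((1 - τ) • e) s
  rw [show (fun s : ℝ => ev p ((a + τ • (c - a)) + s • ((1 - τ) • e))) = _ from funext hf] at h4
  have h5 : HasDerivAt (fun s : ℝ => (3 * ev p c - dirD p c (c - a) + s * dirD p c e) * τ ^ 2 +
      (dirD p c (c - a) - s * dirD p c e - 2 * ev p c) * τ ^ 3)
      (dirD p c e * τ ^ 2 + (-dirD p c e) * τ ^ 3) s := by
    have g1 := ((hasDerivAt_id s).mul_const (dirD p c e))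
    have g2 := (g1.const_add (3 * ev p c - dirD p c (c - a))).mul_const (τ ^ 2)
    have g3 := ((g1.const_sub (dirD p c (c - a))).sub_const (2 * ev p c)).mul_const (τ ^ 3)
    refine (g2.add g3).congr_deriv ?_
    ring
  have h6 := h4.unique h5
  rw [dirD_smul_right] at h6
  have h7 : (a + s • e) + τ • (c - (a + s • e)) = (a + τ • (c - a)) + s • ((1 - τ) • e) := by
    module
  rw [h7]
  refine mul_left_cancel₀ (sub_ne_zero.2 hτ.symm) ?_
  rw [h6]; ring

/-- Unisolvence of the local degrees of freedom. -/
theorem LocalHCT.eq_zero {t : Fin 3 → Plane} (h : detT t ≠ 0) {p : Fin 3 → Poly}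
    (hp : LocalHCT t p) (hv : ∀ i k, k ≠ i → ev (p i) (t k) = 0)
    (hg : ∀ i k, k ≠ i → ∀ n, dirD (p i) (t k) n = 0)
    (hm : ∀ i, ∃ n, gl t i n ≠ 0 ∧ dirD (p i) (midT t i) n = 0) (i : Fin 3) : p i = 0 := by
  have hedge := fun i => dirD_edge_eq_zero h (hp.deg i) (hv i) (hg i) (hm i)
  obtain ⟨W, hW⟩ : ∃ W, W = ev (p 0) (cen t) := ⟨_, rfl⟩
  have hcmem : ∀ i, cen t ∈ tri (subTri t i) := fun i => by
    have := mem_tri_sub_ray h (fin3_succ_ne i).1 (τ := 1) zero_le_one le_rfl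
    simpa using this
  have hWi : ∀ i, ev (p i) (cen t) = W := fun i => by
    rw [hW]; exact hp.val i 0 _ (hcmem i) (hcmem 0)
  have hGi : ∀ i n, dirD (p i) (cen t) n = dirD (p 0) (cen t) n := fun i n =>
    hp.grad i 0 _ (hcmem i) (hcmem 0) n
  have hγ : ∀ k, dirD (p 0) (cen t) (cen t - t k) = 3 * W := by
    intro k
    obtain ⟨k1, k2, k12⟩ := fin3_succ_ne k
    obtain ⟨x, hx⟩ : ∃ x, x = t k + (1 / 2 : ℝ) • (cen t - t k) := ⟨_, rfl⟩
    have e11 : k + 1 + 1 = k + 2 := by fin_cases k <;> rfl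
    have e12 : k + 1 + 2 = k := by fin_cases k <;> rfl
    have e21 : k + 2 + 1 = k := by fin_cases k <;> rfl
    have e22 : k + 2 + 2 = k + 1 := by fin_cases k <;> rfl
    have hx1 : x ∈ tri (subTri t (k + 1)) := by
      rw [hx]; exact mem_tri_sub_ray h k1.symm (by norm_num) (by norm_num)
    have hx2 : x ∈ tri (subTri t (k + 2)) := by
      rw [hx]; exact mem_tri_sub_ray h k2.symm (by norm_num) (by norm_num)
    have a1 := dirD_ray_edge (hp.deg (k + 1)) (c := cen t) (fun s => (hedge (k + 1) s).1)
      (fun s => (hedge (k + 1) s).2) 1 (1 / 2) (by norm_num)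
    have a2 := dirD_ray_edge (hp.deg (k + 2)) (c := cen t) (fun s => (hedge (k + 2) s).1)
      (fun s => (hedge (k + 2) s).2) 0 (1 / 2) (by norm_num)
    rw [e11, e12, one_smul, add_sub_cancel, ← hx, hGi] at a1
    rw [e21, e22, zero_smul, add_zero, ← hx, hGi,
      hp.grad (k + 2) (k + 1) x hx2 hx1] at a2
    have a3 := (ev_ray (hp.deg (k + 1)) (c := cen t) (hv (k + 1) k k1.symm)
      (hg (k + 1) k k1.symm _)).2 (1 / 2)
    rw [← hx, hWi, hGi] at a3
    have hcs := cen_sub_vertex t k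
    have hs : cen t - t k = (1 / 3 : ℝ) • ((t (k + 1) - t k) - (t k - t (k + 2))) := by
      rw [hcs]; congr 1; abel
    have b1 : dirD (p (k + 1)) x (cen t - t k) =
        (1 / 2) ^ 2 * dirD (p 0) (cen t) (cen t - t k) := by
      rw [hs, dirD_smul_right, dirD_smul_right, dirD_sub_right _ x, dirD_sub_right _ (cen t), a1, a2]
      ring
    linarith
  have hW0 : W = 0 := by
    have h0 := hγ 0
    have h1 := hγ 1
    have h2 := hγ 2
    have hs : (cen t - t 0) + (cen t - t 1) + (cen t - t 2) = (0 : ℝ) • cen t := by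
      rw [cen, Fin.sum_univ_three]; module
    have h3 : dirD (p 0) (cen t) ((cen t - t 0) + (cen t - t 1) + (cen t - t 2)) = 0 := by
      rw [hs, dirD_smul_right, zero_mul]
    rw [dirD_add_right, dirD_add_right] at h3
    linarith
  have hline : ∀ s τ : ℝ, ev (p i) ((t (i + 1) + s • (t (i + 2) - t (i + 1))) +
      τ • (cen t - (t (i + 1) + s • (t (i + 2) - t (i + 1))))) = 0 := by
    intro s τ
    rw [(ev_ray (hp.deg i) (c := cen t) (hedge i s).1 ((hedge i s).2 _)).1 τ, hWi, hGi]
    have hs : cen t - (t (i + 1) + s • (t (i + 2) - t (i + 1))) =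
        (1 - s) • (cen t - t (i + 1)) + s • (cen t - t (i + 2)) := by module
    rw [hs, dirD_add_right, dirD_smul_right, dirD_smul_right, hγ, hγ, hW0]
    ring
  have hoff : ∀ x, lam t i x ≠ 1 / 3 → ev (p i) x = 0 := by
    intro x hx
    obtain ⟨τ, hτ⟩ : ∃ τ, τ = 3 * lam t i x := ⟨_, rfl⟩
    have hτ1 : 1 - τ ≠ 0 := by
      intro h0; exact hx (by linarith)
    obtain ⟨y, hy⟩ : ∃ y, y = (1 - τ)⁻¹ • (x - τ • cen t) := ⟨_, rfl⟩
    have hxy : y + τ • (cen t - y) = x := by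
      have : (1 - τ) • y = x - τ • cen t := by rw [hy, smul_inv_smul₀ hτ1]
      calc y + τ • (cen t - y) = (1 - τ) • y + τ • cen t := by module
        _ = x := by rw [this]; module
    have hly : lam t i y = 0 := by
      have := lam_line t i τ y (cen t)
      rw [hxy, lam_cen h, hτ] at this
      have h3 : (1 - τ) * lam t i y = 0 := by rw [hτ]; linarith
      exact (mul_eq_zero.1 h3).resolve_left hτ1
    have hyl : gl t i (y - t (i + 1)) = 0 := by
      rw [gl_sub, hly, lam_ne h (fin3_succ_ne i).1.symm, sub_zero]
    have h5 := eq_smul_of_gl_eq_zero h hyl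
    have h6 := hline (gl t (i + 2) (y - t (i + 1))) τ
    rw [← h5, add_sub_cancel, hxy] at h6
    exact h6
  have hall : ∀ x, ev (p i) x = 0 := by
    intro x
    by_cases hx : lam t i x = 1 / 3
    · obtain ⟨c₀, c₁, c₂, c₃, hc⟩ := exists_cubic (hp.deg i) x (t (i + 1) - cen t)
      have hz : ∀ τ : ℝ, τ ≠ 0 → c₀ + c₁ * τ + c₂ * τ ^ 2 + c₃ * τ ^ 3 = 0 := by
        intro τ hτ
        rw [← hc]
        refine hoff _ ?_
        rw [lam_add, gl_smul, gl_sub, lam_cen h, lam_ne h (fin3_succ_ne i).1.symm, hx]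
        intro h0
        exact hτ (by linarith)
      have z1 := hz 1 (by norm_num)
      have z2 := hz 2 (by norm_num)
      have z3 := hz 3 (by norm_num)
      have z4 := hz (-1) (by norm_num)
      have := hc 0
      simp only [zero_smul, add_zero] at this
      rw [this]; linarith
    · exact hoff x hx
  refine MvPolynomial.funext fun v => ?_
  have := hall (WithLp.toLp 2 v)
  simpa [ev] using this

/-- The `C¹` piecewise cubic with given data, on the subtriangle `i`. -/
def hctP (t : Fin 3 → Plane) (f : Fin 3 → ℝ) (d : Fin 3 → Fin 3 → ℝ) (m : Fin 3 → ℝ)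
    (i : Fin 3) : Poly :=
  ∑ a, (f a • (lamP t a * lamP t a * (MvPolynomial.C 3 - (2 : ℝ) • lamP t a)) +
    (d a (a + 1) • (lamP t a * lamP t a * lamP t (a + 1)) +
      d a (a + 2) • (lamP t a * lamP t a * lamP t (a + 2)))) +
  (m i • ((6 : ℝ) • (lamP t i * lamP t (i + 1) * lamP t (i + 2)) -
      (3 : ℝ) • (lamP t i * lamP t i * lamP t (i + 1)) -
      (3 : ℝ) • (lamP t i * lamP t i * lamP t (i + 2)) +
      (2 : ℝ) • (lamP t i * lamP t i * lamP t i)) +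
    m (i + 1) • ((3 : ℝ) • (lamP t i * lamP t i * lamP t (i + 2)) - lamP t i * lamP t i * lamP t i) +
    m (i + 2) • ((3 : ℝ) • (lamP t i * lamP t i * lamP t (i + 1)) - lamP t i * lamP t i * lamP t i))

theorem hctP_mem (t : Fin 3 → Plane) (f : Fin 3 → ℝ) (d : Fin 3 → Fin 3 → ℝ) (m : Fin 3 → ℝ)
    (i : Fin 3) : hctP t f d m i ∈ Deg 3 := by
  have h3 : ∀ a b c, lamP t a * lamP t b * lamP t c ∈ Deg 3 := fun a b c =>
    mul_mem_Deg (k := 2) (l := 1) (mul_mem_Deg (k := 1) (l := 1) (lamP_mem t a) (lamP_mem t b))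
      (lamP_mem t c)
  have h2 : ∀ a, lamP t a * lamP t a * (MvPolynomial.C 3 - (2 : ℝ) • lamP t a) ∈ Deg 3 := fun a =>
    mul_mem_Deg (k := 2) (l := 1) (mul_mem_Deg (k := 1) (l := 1) (lamP_mem t a) (lamP_mem t a))
      (Submodule.sub_mem _ (mem_Deg.2 (by simp)) (Submodule.smul_mem _ _ (lamP_mem t a)))
  have hs := fun (c : ℝ) (q : Poly) (hq : q ∈ Deg 3) => Submodule.smul_mem (Deg 3) c hq
  refine Submodule.add_mem _ (Submodule.sum_mem _ fun a _ => ?_) ?_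
  · exact Submodule.add_mem _ (hs _ _ (h2 a))
      (Submodule.add_mem _ (hs _ _ (h3 _ _ _)) (hs _ _ (h3 _ _ _)))
  · refine Submodule.add_mem _ (Submodule.add_mem _ (hs _ _ ?_) (hs _ _ ?_)) (hs _ _ ?_)
    · exact Submodule.add_mem _ (Submodule.sub_mem _ (Submodule.sub_mem _ (hs _ _ (h3 _ _ _))
        (hs _ _ (h3 _ _ _))) (hs _ _ (h3 _ _ _))) (hs _ _ (h3 _ _ _))
    · exact Submodule.sub_mem _ (hs _ _ (h3 _ _ _)) (h3 _ _ _)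
    · exact Submodule.sub_mem _ (hs _ _ (h3 _ _ _)) (h3 _ _ _)

theorem hctP_localHCT {t : Fin 3 → Plane} (h : detT t ≠ 0) (f : Fin 3 → ℝ)
    (d : Fin 3 → Fin 3 → ℝ) (m : Fin 3 → ℝ) : LocalHCT t (hctP t f d m) where
  deg := hctP_mem t f d m
  val i j x hi hj := by
    rcases eq_or_ne i j with rfl | hij
    · rfl
    have e : lam t i x = lam t j x :=
      le_antisymm (((mem_tri_sub h).1 hi).2 j) (((mem_tri_sub h).1 hj).2 i)
    simp only [hctP, ev_add, ev_sub, ev_smul, ev_mul, ev_lamP, ev_sum]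
    congr 1
    fin_cases i <;> fin_cases j <;> simp at hij e ⊢ <;> rw [e] <;> ring
  grad i j x hi hj n := by
    rcases eq_or_ne i j with rfl | hij
    · rfl
    have e : lam t i x = lam t j x :=
      le_antisymm (((mem_tri_sub h).1 hi).2 j) (((mem_tri_sub h).1 hj).2 i)
    simp only [hctP, ev_add, ev_sub, ev_smul, ev_mul, ev_lamP, dirD_sum, dirD_add, dirD_sub,
      dirD_smul, dirD_mul, dirD_lamP]
    congr 1
    fin_cases i <;> fin_cases j <;> simp at hij e ⊢ <;> rw [e] <;> ring

theorem ev_hctP_vertex {t : Fin 3 → Plane} (h : detT t ≠ 0) (f : Fin 3 → ℝ)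
    (d : Fin 3 → Fin 3 → ℝ) (m : Fin 3 → ℝ) {i k : Fin 3} (hik : k ≠ i) :
    ev (hctP t f d m i) (t k) = f k := by
  simp only [hctP, ev_add, ev_sub, ev_smul, ev_mul, ev_lamP, ev_sum, ev_C, Fin.sum_univ_three]
  fin_cases i <;> fin_cases k <;> simp at hik <;> simp [lam_vertex h] <;> ring

theorem dirD_hctP_vertex {t : Fin 3 → Plane} (h : detT t ≠ 0) (f : Fin 3 → ℝ)
    (d : Fin 3 → Fin 3 → ℝ) (m : Fin 3 → ℝ) {i k : Fin 3} (hik : k ≠ i) (n : Plane) :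
    dirD (hctP t f d m i) (t k) n =
      d k (k + 1) * gl t (k + 1) n + d k (k + 2) * gl t (k + 2) n := by
  simp only [hctP, ev_add, ev_sub, ev_smul, ev_mul, ev_lamP, ev_C, dirD_sum, dirD_add, dirD_sub,
    dirD_smul, dirD_mul, dirD_lamP, dirD_C, Fin.sum_univ_three]
  fin_cases i <;> fin_cases k <;> simp at hik <;> simp [lam_vertex h] <;> ring_nf <;> simp

theorem lam_midT {t : Fin 3 → Plane} (h : detT t ≠ 0) (i : Fin 3) :
    lam t i (midT t i) = 0 ∧ lam t (i + 1) (midT t i) = 1 / 2 ∧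
      lam t (i + 2) (midT t i) = 1 / 2 := by
  simp only [midT, lam_line]
  fin_cases i <;> simp [lam_vertex h] <;> norm_num

theorem dirD_hctP_midT {t : Fin 3 → Plane} (h : detT t ≠ 0) (f : Fin 3 → ℝ)
    (d : Fin 3 → Fin 3 → ℝ) (m : Fin 3 → ℝ) (i : Fin 3) (n : Plane) :
    dirD (hctP t f d m i) (midT t i) n =
      3 / 2 * (f (i + 1) * gl t (i + 1) n + f (i + 2) * gl t (i + 2) n) +
      d (i + 1) (i + 2) * (1 / 2 * gl t (i + 1) n + 1 / 4 * gl t (i + 2) n) +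
      d (i + 2) (i + 1) * (1 / 2 * gl t (i + 2) n + 1 / 4 * gl t (i + 1) n) +
      1 / 4 * (d (i + 1) i + d (i + 2) i) * gl t i n + 3 / 2 * m i * gl t i n := by
  obtain ⟨e0, e1, e2⟩ := lam_midT h i
  simp only [hctP, ev_add, ev_sub, ev_smul, ev_mul, ev_lamP, ev_C, dirD_sum, dirD_add, dirD_sub,
    dirD_smul, dirD_mul, dirD_lamP, dirD_C, Fin.sum_univ_three]
  fin_cases i <;> simp at e0 e1 e2 ⊢ <;> rw [e0, e1, e2] <;> ring

end MorleyUC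
end

noncomputable section

open MeasureTheory Set Filter Topology
namespace MorleyUC

theorem eq_sum_gl {t : Fin 3 → Plane} (h : detT t ≠ 0) (k : Fin 3) (n : Plane) :
    n = gl t (k + 1) n • (t (k + 1) - t k) + gl t (k + 2) n • (t (k + 2) - t k) := by
  have hg : ∀ i, lam t i (t 0 + n) = lam t i (t 0 + (gl t (k + 1) n • (t (k + 1) - t k) +
      gl t (k + 2) n • (t (k + 2) - t k))) := by
    intro i
    have hs := sum_gl t n
    rw [Fin.sum_univ_three] at hs
    rw [lam_add, lam_add, gl_add, gl_smul, gl_smul, gl_sub, gl_sub]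
    fin_cases i <;> fin_cases k <;> simp [lam_vertex h] <;> linarith
  exact add_left_cancel (lam_ext h hg)

/-- The Hermite coefficients belonging to gradients at the vertices. -/
def hermD (t : Fin 3 → Plane) (g : Fin 3 → Plane →L[ℝ] ℝ) (a b : Fin 3) : ℝ := g a (t b - t a)

theorem hermD_gl {t : Fin 3 → Plane} (h : detT t ≠ 0) (g : Fin 3 → Plane →L[ℝ] ℝ) (k : Fin 3)
    (n : Plane) : hermD t g k (k + 1) * gl t (k + 1) n + hermD t g k (k + 2) * gl t (k + 2) n =
      g k n := by
  conv_rhs => rw [eq_sum_gl h k n]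
  simp only [hermD, map_add, map_smul, smul_eq_mul]
  ring

/-- The normal derivative at the midpoint of the Hermite cubic. -/
def hermMid (t : Fin 3 → Plane) (f : Fin 3 → ℝ) (d : Fin 3 → Fin 3 → ℝ) (i : Fin 3) : ℝ :=
  3 / 2 * (f (i + 1) * gl t (i + 1) (norT t i) + f (i + 2) * gl t (i + 2) (norT t i)) +
  d (i + 1) (i + 2) * (1 / 2 * gl t (i + 1) (norT t i) + 1 / 4 * gl t (i + 2) (norT t i)) +
  d (i + 2) (i + 1) * (1 / 2 * gl t (i + 2) (norT t i) + 1 / 4 * gl t (i + 1) (norT t i)) +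
  1 / 4 * (d (i + 1) i + d (i + 2) i) * gl t i (norT t i)

/-- The coefficients of the edge functions. -/
def hctM (t : Fin 3 → Plane) (f : Fin 3 → ℝ) (g : Fin 3 → Plane →L[ℝ] ℝ) (μ : Fin 3 → ℝ)
    (i : Fin 3) : ℝ :=
  2 / 3 * ((μ i - hermMid t f (hermD t g) i) / gl t i (norT t i))

/-- The `C¹` piecewise cubic with values `f` and gradients `g` at the vertices and normal
derivatives `μ` at the midpoints. -/
def hctI (t : Fin 3 → Plane) (f : Fin 3 → ℝ) (g : Fin 3 → Plane →L[ℝ] ℝ) (μ : Fin 3 → ℝ) :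
    Fin 3 → Poly :=
  hctP t f (hermD t g) (hctM t f g μ)

theorem hctI_localHCT {t : Fin 3 → Plane} (h : detT t ≠ 0) (f : Fin 3 → ℝ)
    (g : Fin 3 → Plane →L[ℝ] ℝ) (μ : Fin 3 → ℝ) : LocalHCT t (hctI t f g μ) :=
  hctP_localHCT h _ _ _

theorem ev_hctI_vertex {t : Fin 3 → Plane} (h : detT t ≠ 0) (f : Fin 3 → ℝ)
    (g : Fin 3 → Plane →L[ℝ] ℝ) (μ : Fin 3 → ℝ) {i k : Fin 3} (hik : k ≠ i) :
    ev (hctI t f g μ i) (t k) = f k :=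
  ev_hctP_vertex h _ _ _ hik

theorem dirD_hctI_vertex {t : Fin 3 → Plane} (h : detT t ≠ 0) (f : Fin 3 → ℝ)
    (g : Fin 3 → Plane →L[ℝ] ℝ) (μ : Fin 3 → ℝ) {i k : Fin 3} (hik : k ≠ i) (n : Plane) :
    dirD (hctI t f g μ i) (t k) n = g k n := by
  rw [hctI, dirD_hctP_vertex h _ _ _ hik, hermD_gl h]

theorem dirD_hctI_midT {t : Fin 3 → Plane} (h : detT t ≠ 0) (f : Fin 3 → ℝ)
    (g : Fin 3 → Plane →L[ℝ] ℝ) (μ : Fin 3 → ℝ) (i : Fin 3) :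
    dirD (hctI t f g μ i) (midT t i) (norT t i) = μ i := by
  have h0 := gl_norT_ne h i
  rw [hctI, dirD_hctP_midT h]
  have : 3 / 2 * hctM t f g μ i * gl t i (norT t i) = μ i - hermMid t f (hermD t g) i := by
    rw [hctM]; field_simp
  rw [this, hermMid]; ring

/-- A local HCT function is determined by its degrees of freedom. -/
theorem LocalHCT.eq_hctI {t : Fin 3 → Plane} (h : detT t ≠ 0) {p : Fin 3 → Poly}
    (hp : LocalHCT t p) {f : Fin 3 → ℝ} {g : Fin 3 → Plane →L[ℝ] ℝ} {μ : Fin 3 → ℝ}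
    (hf : ∀ i k, k ≠ i → ev (p i) (t k) = f k)
    (hg : ∀ i k, k ≠ i → ∀ n, dirD (p i) (t k) n = g k n)
    (hμ : ∀ i, dirD (p i) (midT t i) (norT t i) = μ i) (i : Fin 3) : p i = hctI t f g μ i := by
  refine sub_eq_zero.1 ((hp.sub (hctI_localHCT h f g μ)).eq_zero h (fun i k hik => ?_)
    (fun i k hik n => ?_) (fun i => ⟨norT t i, gl_norT_ne h i, ?_⟩) i)
  · rw [ev_sub, hf i k hik, ev_hctI_vertex h f g μ hik, sub_self]
  · rw [dirD_sub, hg i k hik, dirD_hctI_vertex h f g μ hik, sub_self]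
  · rw [dirD_sub, hμ, dirD_hctI_midT h, sub_self]

theorem abs_cross_le (u v : Plane) : |cross u v| ≤ ‖u‖ * ‖v‖ := by
  refine abs_le_of_sq_le_sq ?_ (by positivity)
  rw [mul_pow, norm_sq_plane, norm_sq_plane, cross]
  nlinarith [sq_nonneg (u 0 * v 0 + u 1 * v 1)]

theorem abs_gl_le {t : Fin 3 → Plane} {H : ℝ} (hH : ∀ a b, ‖t a - t b‖ ≤ H) (i : Fin 3)
    (n : Plane) : |gl t i n| ≤ ‖n‖ * (H / |detT t|) := by
  rw [gl, abs_div, mul_div_assoc']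
  refine div_le_div_of_nonneg_right ?_ (abs_nonneg _)
  exact (abs_cross_le _ _).trans (mul_le_mul_of_nonneg_left (hH _ _) (norm_nonneg _))

theorem abs_detT_le {t : Fin 3 → Plane} {H : ℝ} (hH : ∀ a b, ‖t a - t b‖ ≤ H) (i : Fin 3) :
    |detT t| ≤ ‖t (i + 1) - t (i + 2)‖ * H := by
  have : detT t = cross (t (i + 1) - t (i + 2)) (t (i + 2) - t i) := by
    fin_cases i <;> simp [detT, cross] <;> ring
  rw [this]
  exact (abs_cross_le _ _).trans (mul_le_mul_of_nonneg_left (hH _ _) (norm_nonneg _))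

theorem lam_abs_le_one {t : Fin 3 → Plane} (h : detT t ≠ 0) {x : Plane} (hx : x ∈ tri t)
    (i : Fin 3) : |lam t i x| ≤ 1 := by
  have h0 := (mem_tri h).1 hx
  rw [abs_of_nonneg (h0 i), ← sum_lam h x]
  exact Finset.single_le_sum (fun j _ => h0 j) (Finset.mem_univ i)

theorem abs_second_deriv_triple_le {t : Fin 3 → Plane} (h : detT t ≠ 0) {G : ℝ}
    (hG : ∀ a (k : Fin 2), |gl t a (EuclideanSpace.single k 1)| ≤ G) {x : Plane} (hx : x ∈ tri t)
    (a b c : Fin 3) (k l : Fin 2) :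
    |ev (MvPolynomial.pderiv k (MvPolynomial.pderiv l (lamP t a * lamP t b * lamP t c))) x| ≤
      6 * G ^ 2 := by
  have hG0 : 0 ≤ G := (abs_nonneg _).trans (hG 0 0)
  have hgg : ∀ a b c, |lam t a x * gl t b (EuclideanSpace.single k 1) *
      gl t c (EuclideanSpace.single l 1)| ≤ G ^ 2 := by
    intro a b c
    rw [abs_mul, abs_mul]
    have h1 := mul_le_mul (mul_le_mul (lam_abs_le_one h hx a) (hG b k) (abs_nonneg _) zero_le_one)
      (hG c l) (abs_nonneg _) (by positivity)
    linarith
  have e : ev (MvPolynomial.pderiv k (MvPolynomial.pderiv l (lamP t a * lamP t b * lamP t c))) x =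
      lam t a x * gl t b (EuclideanSpace.single k 1) * gl t c (EuclideanSpace.single l 1) +
      lam t a x * gl t c (EuclideanSpace.single k 1) * gl t b (EuclideanSpace.single l 1) +
      lam t b x * gl t a (EuclideanSpace.single k 1) * gl t c (EuclideanSpace.single l 1) +
      lam t b x * gl t c (EuclideanSpace.single k 1) * gl t a (EuclideanSpace.single l 1) +
      lam t c x * gl t a (EuclideanSpace.single k 1) * gl t b (EuclideanSpace.single l 1) +
      lam t c x * gl t b (EuclideanSpace.single k 1) * gl t a (EuclideanSpace.single l 1) := by
    simp only [Derivation.leibniz, map_add, pderiv_lamP, smul_eq_mul, MvPolynomial.pderiv_C,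
      ev_add, ev_mul, ev_lamP, ev_C, ev_zero]
    ring
  rw [e]
  have h1 := abs_le.1 (hgg a b c)
  have h2 := abs_le.1 (hgg a c b)
  have h3 := abs_le.1 (hgg b a c)
  have h4 := abs_le.1 (hgg b c a)
  have h5 := abs_le.1 (hgg c a b)
  have h6 := abs_le.1 (hgg c b a)
  rw [abs_le]
  constructor <;> linarith [h1.1, h1.2, h2.1, h2.2, h3.1, h3.2, h4.1, h4.2, h5.1, h5.2, h6.1, h6.2]

theorem abs_second_deriv_hctP_le {t : Fin 3 → Plane} (h : detT t ≠ 0) {G d₀ m₀ : ℝ}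
    (hG : ∀ a (k : Fin 2), |gl t a (EuclideanSpace.single k 1)| ≤ G) {d : Fin 3 → Fin 3 → ℝ}
    {m : Fin 3 → ℝ} (hd : ∀ a b, |d a b| ≤ d₀) (hm : ∀ a, |m a| ≤ m₀)
    {x : Plane} (hx : x ∈ tri t) (i : Fin 3) (k l : Fin 2) :
    |ev (MvPolynomial.pderiv k (MvPolynomial.pderiv l (hctP t 0 d m i))) x| ≤
      (6 * d₀ + 22 * m₀) * (6 * G ^ 2) := by
  have T := fun a b c => abs_second_deriv_triple_le h hG hx a b c k l
  obtain ⟨S, hS⟩ : ∃ S : Fin 3 → Fin 3 → Fin 3 → ℝ, S = fun a b c =>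
    ev (MvPolynomial.pderiv k (MvPolynomial.pderiv l (lamP t a * lamP t b * lamP t c))) x := ⟨_, rfl⟩
  have T' : ∀ a b c, |S a b c| ≤ 6 * G ^ 2 := fun a b c => by rw [hS]; exact T a b c
  have hG0 : 0 ≤ 6 * G ^ 2 := by positivity
  have hmul : ∀ {u v A B : ℝ}, |u| ≤ A → |v| ≤ B → |u * v| ≤ A * B := fun hu hv => by
    rw [abs_mul]; exact mul_le_mul hu hv (abs_nonneg _) ((abs_nonneg _).trans hu)
  have e : ev (MvPolynomial.pderiv k (MvPolynomial.pderiv l (hctP t 0 d m i))) x =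
      ∑ a, (d a (a + 1) * S a a (a + 1) + d a (a + 2) * S a a (a + 2)) +
      (m i * (6 * S i (i + 1) (i + 2) - 3 * S i i (i + 1) - 3 * S i i (i + 2) + 2 * S i i i) +
        m (i + 1) * (3 * S i i (i + 2) - S i i i) + m (i + 2) * (3 * S i i (i + 1) - S i i i)) := by
    rw [hS]
    simp only [hctP, Pi.zero_apply, zero_smul, zero_add, map_add, map_sub, map_smul, map_sum,
      Derivation.map_smul, ev_add, ev_sub, ev_smul, ev_sum]
  rw [e]
  have a1 : ∀ a, |d a (a + 1) * S a a (a + 1) + d a (a + 2) * S a a (a + 2)| ≤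
      2 * d₀ * (6 * G ^ 2) := fun a => by
    refine (abs_add_le _ _).trans ?_
    linarith [hmul (hd a (a + 1)) (T' a a (a + 1)), hmul (hd a (a + 2)) (T' a a (a + 2))]
  have a2 : |∑ a, (d a (a + 1) * S a a (a + 1) + d a (a + 2) * S a a (a + 2))| ≤
      6 * d₀ * (6 * G ^ 2) := by
    refine (Finset.abs_sum_le_sum_abs _ _).trans ?_
    rw [Fin.sum_univ_three]
    linarith [a1 0, a1 1, a1 2]
  have b1 := abs_le.1 (T' i (i + 1) (i + 2))
  have b2 := abs_le.1 (T' i i (i + 1))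
  have b3 := abs_le.1 (T' i i (i + 2))
  have b4 := abs_le.1 (T' i i i)
  have c1 : |6 * S i (i + 1) (i + 2) - 3 * S i i (i + 1) - 3 * S i i (i + 2) + 2 * S i i i| ≤
      14 * (6 * G ^ 2) := by
    rw [abs_le]; constructor <;> linarith [b1.1, b1.2, b2.1, b2.2, b3.1, b3.2, b4.1, b4.2]
  have c2 : |3 * S i i (i + 2) - S i i i| ≤ 4 * (6 * G ^ 2) := by
    rw [abs_le]; constructor <;> linarith [b3.1, b3.2, b4.1, b4.2]
  have c3 : |3 * S i i (i + 1) - S i i i| ≤ 4 * (6 * G ^ 2) := by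
    rw [abs_le]; constructor <;> linarith [b2.1, b2.2, b4.1, b4.2]
  have d1 := abs_le.1 (hmul (hm i) c1)
  have d2 := abs_le.1 (hmul (hm (i + 1)) c2)
  have d3 := abs_le.1 (hmul (hm (i + 2)) c3)
  have d4 := abs_le.1 a2
  rw [abs_le]
  constructor <;> linarith [d1.1, d1.2, d2.1, d2.2, d3.1, d3.2, d4.1, d4.2]

/-- Second derivatives of a local HCT function that vanishes at the vertices and whose normal
derivatives have mean zero along the edges. -/
theorem LocalHCT.abs_second_deriv_le {t : Fin 3 → Plane} (h : detT t ≠ 0) {p : Fin 3 → Poly}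
    (hp : LocalHCT t p) {g : Fin 3 → Plane →L[ℝ] ℝ}
    (hf : ∀ i k, k ≠ i → ev (p i) (t k) = 0)
    (hg : ∀ i k, k ≠ i → ∀ n, dirD (p i) (t k) n = g k n)
    (hμ : ∀ i, 4 * dirD (p i) (midT t i) (norT t i) + (g (i + 1) (norT t i) + g (i + 2) (norT t i)) = 0)
    {γ H : ℝ} (hγ : ∀ k, ‖g k‖ ≤ γ) (hH : ∀ a b, ‖t a - t b‖ ≤ H)
    {x : Plane} (hx : x ∈ tri t) (i : Fin 3) (k l : Fin 2) :
    |ev (MvPolynomial.pderiv k (MvPolynomial.pderiv l (p i))) x| ≤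
      γ * H * (H / |detT t|) ^ 2 * (80 + 176 * (H * (H / |detT t|))) := by
  have hD : 0 < |detT t| := abs_pos.2 h
  have hH0 : 0 ≤ H := (norm_nonneg _).trans (hH 0 0)
  have hγ0 : 0 ≤ γ := (norm_nonneg _).trans (hγ 0)
  obtain ⟨G, hGd⟩ : ∃ G, G = H / |detT t| := ⟨_, rfl⟩
  have hG0 : 0 ≤ G := by rw [hGd]; positivity
  have hgl : ∀ a n, |gl t a n| ≤ ‖n‖ * G := fun a n => by rw [hGd]; exact abs_gl_le hH a n
  have hgn : ∀ a n, |g a n| ≤ γ * ‖n‖ := fun a n =>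
    ((g a).le_opNorm n).trans (mul_le_mul_of_nonneg_right (hγ a) (norm_nonneg _))
  have hd : ∀ a b, |hermD t g a b| ≤ γ * H := fun a b =>
    (hgn a _).trans (mul_le_mul_of_nonneg_left (hH b a) hγ0)
  obtain ⟨μ, hμd⟩ : ∃ μ : Fin 3 → ℝ, μ = fun i => dirD (p i) (midT t i) (norT t i) := ⟨_, rfl⟩
  rw [hp.eq_hctI h (f := 0) hf hg (μ := μ) (fun i => by rw [hμd]) i, hctI, ← hGd]
  have hmul : ∀ {u v A B : ℝ}, |u| ≤ A → |v| ≤ B → |u * v| ≤ A * B := fun hu hv => by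
    rw [abs_mul]; exact mul_le_mul hu hv (abs_nonneg _) ((abs_nonneg _).trans hu)
  have hm : ∀ a, |hctM t 0 g μ a| ≤ 2 / 3 * (H * γ * (1 / 2 + 2 * (H * G))) := by
    intro a
    obtain ⟨L, hL⟩ : ∃ L, L = ‖t (a + 1) - t (a + 2)‖ := ⟨_, rfl⟩
    have hL0 : 0 < L := by
      rw [hL, norm_pos_iff, sub_ne_zero]
      exact fun e => (fin3_succ_ne a).2.2 (vertex_injective h e)
    have hnL : ‖norT t a‖ = L := by rw [norm_norT, hL]
    have hgN : |gl t a (norT t a)| = L ^ 2 / |detT t| := by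
      rw [gl_norT, abs_div, ← hL, abs_of_nonneg (by positivity : 0 ≤ L ^ 2)]
    have m1 : |μ a| ≤ γ * L / 2 := by
      have h1 := abs_le.1 (hgn (a + 1) (norT t a))
      have h2 := abs_le.1 (hgn (a + 2) (norT t a))
      have h3 := hμ a
      rw [hnL] at h1 h2
      rw [hμd, abs_le]
      constructor <;> simp only <;> linarith [h1.1, h1.2, h2.1, h2.2]
    have m2 : |hermMid t 0 (hermD t g) a| ≤ 2 * (γ * H) * (L * G) := by
      have g0 := abs_le.1 (hgl a (norT t a))
      have g1 := abs_le.1 (hgl (a + 1) (norT t a))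
      have g2 := abs_le.1 (hgl (a + 2) (norT t a))
      rw [hnL] at g0 g1 g2
      have k1 : |1 / 2 * gl t (a + 1) (norT t a) + 1 / 4 * gl t (a + 2) (norT t a)| ≤
          3 / 4 * (L * G) := by
        rw [abs_le]; constructor <;> linarith [g1.1, g1.2, g2.1, g2.2]
      have k2 : |1 / 2 * gl t (a + 2) (norT t a) + 1 / 4 * gl t (a + 1) (norT t a)| ≤
          3 / 4 * (L * G) := by
        rw [abs_le]; constructor <;> linarith [g1.1, g1.2, g2.1, g2.2]
      have k3 : |1 / 4 * (hermD t g (a + 1) a + hermD t g (a + 2) a)| ≤ 1 / 2 * (γ * H) := by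
        have q1 := abs_le.1 (hd (a + 1) a)
        have q2 := abs_le.1 (hd (a + 2) a)
        rw [abs_le]; constructor <;> linarith [q1.1, q1.2, q2.1, q2.2]
      have r1 := abs_le.1 (hmul (hd (a + 1) (a + 2)) k1)
      have r2 := abs_le.1 (hmul (hd (a + 2) (a + 1)) k2)
      have r3 := abs_le.1 (hmul k3 (abs_le.2 g0))
      rw [hermMid, abs_le]
      simp only [Pi.zero_apply, zero_mul, add_zero, mul_zero, zero_add]
      constructor <;> linarith [r1.1, r1.2, r2.1, r2.2, r3.1, r3.2]
    have m3 : |μ a - hermMid t 0 (hermD t g) a| ≤ L * (γ * (1 / 2 + 2 * (H * G))) := by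
      have u1 := abs_le.1 m1
      have u2 := abs_le.1 m2
      rw [abs_le]; constructor <;> linarith [u1.1, u1.2, u2.1, u2.2]
    have hDL : |detT t| ≤ L * H := by rw [hL]; exact abs_detT_le hH a
    rw [hctM, abs_mul, abs_div _ (gl t a (norT t a)), hgN, abs_of_pos (by norm_num : (0 : ℝ) < 2 / 3)]
    refine mul_le_mul_of_nonneg_left ?_ (by norm_num)
    rw [div_div_eq_mul_div, div_le_iff₀ (by positivity)]
    calc |μ a - hermMid t 0 (hermD t g) a| * |detT t|
        ≤ (L * (γ * (1 / 2 + 2 * (H * G)))) * (L * H) :=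
          mul_le_mul m3 hDL (abs_nonneg _) (by positivity)
      _ = H * γ * (1 / 2 + 2 * (H * G)) * L ^ 2 := by ring
  refine (abs_second_deriv_hctP_le h (G := G) (fun a k => ?_) hd hm hx i k l).trans (le_of_eq ?_)
  · have := hgl a (EuclideanSpace.single k 1)
    simpa using this
  · ring

end MorleyUC
end

noncomputable section

open MeasureTheory Set Filter Topology
namespace MorleyUC

/-! ### Geometry of triangulations -/

theorem lam_eq_sum {t s : Fin 3 → Plane} (hs : detT s ≠ 0) (i : Fin 3) (x : Plane) :
    lam t i x = ∑ j, lam s j x * lam t i (s j) := by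
  have h1 := sum_lam hs x
  rw [Fin.sum_univ_three] at h1
  have hx : x = s 0 + (lam s 1 x • (s 1 - s 0) + lam s 2 x • (s 2 - s 0)) := by
    conv_lhs => rw [← sum_lam_smul hs x, Fin.sum_univ_three]
    rw [show lam s 0 x = 1 - lam s 1 x - lam s 2 x by linarith]
    module
  rw [Fin.sum_univ_three]
  conv_lhs => rw [hx, lam_add, gl_add, gl_smul, gl_smul, gl_sub, gl_sub]
  rw [show lam s 0 x = 1 - lam s 1 x - lam s 2 x by linarith]
  ring

theorem detT_ne_of_affineIndependent {t : Fin 3 → Plane} (h : AffineIndependent ℝ t) :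
    detT t ≠ 0 := by
  intro h0
  rw [affineIndependent_iff] at h
  have hinj : ∀ k : Fin 2, t 1 k = t 2 k ∧ t 2 k = t 0 k := by
    intro k
    have h1 := h Finset.univ (fun i => t (i + 1) k - t (i + 2) k)
      (by rw [Fin.sum_univ_three]; simp) ?_
    · have a := h1 0 (by simp)
      have b := h1 1 (by simp)
      simp at a b
      exact ⟨by linarith, by linarith⟩
    · rw [Fin.sum_univ_three]
      simp only [detT, cross, PiLp.sub_apply] at h0
      apply plane_ext <;> fin_cases k <;> simp <;> linarith
  have h12 : t 1 = t 2 := plane_ext (hinj 0).1 (hinj 1).1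
  have := h {1, 2} (fun i => if i = 1 then 1 else -1) (by simp) (by simp [h12]) 1 (by simp)
  simp at this

variable {Ω : Set Plane}

theorem Triangulation.exists_vert (T : Triangulation Ω) {K : Finset Plane} (hK : K ∈ T.cells) :
    ∃ t : Fin 3 → Plane, detT t ≠ 0 ∧ range t = K := by
  have hc : Fintype.card K = 3 := by rw [Fintype.card_coe]; exact T.card_eq K hK
  let e : Fin 3 ≃ K := (finCongr hc.symm).trans (Fintype.equivFin K).symm
  refine ⟨fun i => (e i : Plane), ?_, ?_⟩
  · exact detT_ne_of_affineIndependent ((T.indep K hK).comp_embedding e.toEmbedding)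
  · ext x
    constructor
    · rintro ⟨i, rfl⟩; exact (e i).2
    · intro hx; exact ⟨e.symm ⟨x, hx⟩, by simp⟩

open Classical in
/-- An enumeration of the vertices of a triangle. -/
def vert (K : Finset Plane) : Fin 3 → Plane :=
  if h : ∃ t : Fin 3 → Plane, detT t ≠ 0 ∧ range t = K then h.choose else 0

namespace Triangulation

variable (T : Triangulation Ω) {K L : Finset Plane}

theorem detT_vert (hK : K ∈ T.cells) : detT (vert K) ≠ 0 := by
  rw [vert, dif_pos (T.exists_vert hK)]; exact (T.exists_vert hK).choose_spec.1

theorem range_vert (hK : K ∈ T.cells) : range (vert K) = K := by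
  rw [vert, dif_pos (T.exists_vert hK)]; exact (T.exists_vert hK).choose_spec.2

theorem vert_mem (hK : K ∈ T.cells) (i : Fin 3) : vert K i ∈ K := by
  rw [← Finset.mem_coe, ← T.range_vert hK]; exact ⟨i, rfl⟩

theorem exists_vert_eq (hK : K ∈ T.cells) {ν : Plane} (hν : ν ∈ K) : ∃ i, vert K i = ν := by
  rwa [← Finset.mem_coe, ← T.range_vert hK] at hν

theorem hull_eq_tri (hK : K ∈ T.cells) : hull K = tri (vert K) := by
  rw [hull, tri, T.range_vert hK]

theorem mem_hull (hK : K ∈ T.cells) {x : Plane} :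
    x ∈ hull K ↔ ∀ i, 0 ≤ lam (vert K) i x := by
  rw [T.hull_eq_tri hK, mem_tri (T.detT_vert hK)]

theorem hull_isCompact (hK : K ∈ T.cells) : IsCompact (hull K) := by
  rw [T.hull_eq_tri hK]; exact tri_isCompact _

theorem sum_coe (hK : K ∈ T.cells) : ∑ x ∈ K, x = ∑ i, vert K i := by
  classical
  have : K = Finset.univ.image (vert K) := by
    ext x; rw [← Finset.mem_coe, ← T.range_vert hK]; simp
  conv_lhs => rw [this]
  rw [Finset.sum_image fun a _ b _ h => vertex_injective (T.detT_vert hK) h]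

theorem bary_eq (hK : K ∈ T.cells) : bary K = cen (vert K) := by
  rw [bary, cen, T.sum_coe hK]

theorem subTri_eq (hK : K ∈ T.cells) (i : Fin 3) :
    convexHull ℝ (insert (bary K) ((K : Set Plane) \ {vert K i})) = tri (subTri (vert K) i) := by
  rw [tri]
  congr 1
  rw [T.bary_eq hK, ← T.range_vert hK]
  ext x
  constructor
  · rintro (rfl | ⟨⟨j, rfl⟩, hj⟩)
    · exact ⟨i, by simp [subTri]⟩
    · refine ⟨j, ?_⟩
      have : j ≠ i := by rintro rfl; exact hj rfl
      simp [subTri, this]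
  · rintro ⟨j, rfl⟩
    rcases eq_or_ne j i with rfl | hj
    · left; simp [subTri]
    · right
      refine ⟨⟨j, by simp [subTri, hj]⟩, ?_⟩
      simp only [subTri, Function.update_of_ne hj, mem_singleton_iff]
      exact fun h => hj (vertex_injective (T.detT_vert hK) h)

theorem interior_hull_subset (hK : K ∈ T.cells) : interior (hull K) ⊆ Ω := by
  rw [← T.cover]
  exact interior_mono (subset_biUnion_of_mem (u := fun K => hull K) hK)

theorem subset_iUnion : Ω ⊆ ⋃ K ∈ T.cells, hull K := by
  conv_lhs => rw [← T.cover]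
  exact interior_subset

theorem exists_cell {x : Plane} (hx : x ∈ Ω) : ∃ K ∈ T.cells, x ∈ hull K := by
  simpa using T.subset_iUnion hx

theorem isOpen (T : Triangulation Ω) : IsOpen Ω := by rw [← T.cover]; exact isOpen_interior

theorem isClosed_iUnion : IsClosed (⋃ K ∈ T.cells, hull K) :=
  T.cells.finite_toSet.isClosed_biUnion fun _ hK => (T.hull_isCompact hK).isClosed

theorem compl_subset_closure (T : Triangulation Ω) : Ωᶜ ⊆ closure (interior Ωᶜ) := by
  have h1 : (⋃ K ∈ T.cells, hull K)ᶜ ⊆ interior Ωᶜ :=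
    interior_maximal (compl_subset_compl.2 T.subset_iUnion) T.isClosed_iUnion.isOpen_compl
  have h2 : Ωᶜ = closure (⋃ K ∈ T.cells, hull K)ᶜ := by
    rw [closure_compl, T.cover]
  rw [h2]
  exact closure_mono (h2 ▸ h1)

/-- A vertex of `K` with nonzero barycentric coordinate at a common point of `K` and `L` belongs
to `L`. -/
theorem vert_mem_of_lam_ne (hK : K ∈ T.cells) (hL : L ∈ T.cells) {x : Plane} (hxK : x ∈ hull K)
    (hxL : x ∈ hull L) {i : Fin 3} (hi : lam (vert K) i x ≠ 0) : vert K i ∈ L := by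
  have h1 : x ∈ convexHull ℝ ((K : Set Plane) ∩ L) := by
    rw [← T.conforming K hK L hL]; exact ⟨hxK, hxL⟩
  have h2 : (K : Set Plane) ∩ L = vert K '' {i | vert K i ∈ L} := by
    ext y
    rw [← T.range_vert hK]
    constructor
    · rintro ⟨⟨j, rfl⟩, hj⟩; exact ⟨j, hj, rfl⟩
    · rintro ⟨j, hj, rfl⟩; exact ⟨⟨j, rfl⟩, hj⟩
  rw [h2, convexHull_image_eq (T.detT_vert hK)] at h1
  by_contra hc
  exact hi (h1.2 i hc)

theorem eq_of_lam_pos (hK : K ∈ T.cells) (hL : L ∈ T.cells) {x : Plane} (hxL : x ∈ hull L)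
    (hx : ∀ i, 0 < lam (vert K) i x) : K = L := by
  have hxK : x ∈ hull K := (T.mem_hull hK).2 fun i => (hx i).le
  have h1 : K ⊆ L := by
    intro y hy
    obtain ⟨i, rfl⟩ := T.exists_vert_eq hK hy
    exact T.vert_mem_of_lam_ne hK hL hxK hxL (hx i).ne'
  exact Finset.eq_of_subset_of_card_le h1 (by rw [T.card_eq K hK, T.card_eq L hL])

end Triangulation

/-- The derivatives of the barycentric coordinates as linear maps. -/
def glLin (t : Fin 3 → Plane) (i : Fin 3) : Plane →ₗ[ℝ] ℝ where
  toFun := gl t i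
  map_add' := gl_add t i
  map_smul' c n := gl_smul t i c n

theorem volume_lam_eq_zero {t : Fin 3 → Plane} (h : detT t ≠ 0) (i : Fin 3) :
    volume {x | lam t i x = 0} = 0 := by
  have h1 : {x | lam t i x = 0} = (fun x => x - t (i + 1)) ⁻¹' (LinearMap.ker (glLin t i) : Set Plane) := by
    ext x
    simp only [mem_ofPred_eq, mem_preimage, SetLike.mem_coe, LinearMap.mem_ker]
    change _ ↔ gl t i (x - t (i + 1)) = 0
    rw [gl_sub, lam_ne h (fin3_succ_ne i).1.symm, sub_zero]
  have h2 : LinearMap.ker (glLin t i) ≠ ⊤ := by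
    intro h0
    have : norT t i ∈ LinearMap.ker (glLin t i) := by rw [h0]; trivial
    exact gl_norT_ne h i this
  rw [h1]
  simp_rw [sub_eq_add_neg]
  rw [measure_preimage_add_right]
  exact Measure.addHaar_submodule volume _ h2

theorem ae_lam_ne_zero {t : Fin 3 → Plane} (h : detT t ≠ 0) : ∀ᵐ x, ∀ i, lam t i x ≠ 0 := by
  rw [ae_all_iff]
  intro i
  rw [ae_iff]
  simpa using volume_lam_eq_zero h i

namespace Triangulation

variable (T : Triangulation Ω) {K L : Finset Plane}

theorem ae_lam_pos (hK : K ∈ T.cells) :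
    ∀ᵐ x, x ∈ hull K → ∀ i, 0 < lam (vert K) i x := by
  filter_upwards [ae_lam_ne_zero (T.detT_vert hK)] with x hx hxK i
  exact lt_of_le_of_ne ((T.mem_hull hK).1 hxK i) (hx i).symm

theorem ae_mem (hK : K ∈ T.cells) : ∀ᵐ x, x ∈ hull K → x ∈ Ω := by
  filter_upwards [T.ae_lam_pos hK] with x hx hxK
  refine T.interior_hull_subset hK ?_
  rw [T.hull_eq_tri hK]
  exact mem_interior_tri (T.detT_vert hK) (hx hxK)

theorem ae_unique (hK : K ∈ T.cells) (hL : L ∈ T.cells) (hKL : K ≠ L) :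
    ∀ᵐ x, x ∈ hull K → x ∉ hull L := by
  filter_upwards [T.ae_lam_pos hK] with x hx hxK hxL
  exact hKL (T.eq_of_lam_pos hK hL hxL (hx hxK))

theorem measurableSet_hull (hK : K ∈ T.cells) : MeasurableSet (hull K) :=
  (T.hull_isCompact hK).measurableSet

theorem aedisjoint : (T.cells : Set (Finset Plane)).Pairwise
    (Function.onFun (AEDisjoint volume) fun K => hull K) := by
  intro K hK L hL hKL
  have := T.ae_unique hK hL hKL
  rw [ae_iff] at this
  change volume (hull K ∩ hull L) = 0
  refine measure_mono_null (fun x hx => ?_) this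
  simpa using ⟨hx.1, hx.2⟩

theorem ae_restrict_hull {P : Plane → Prop} (h : ∀ᵐ x ∂(volume.restrict Ω), P x)
    (hK : K ∈ T.cells) : ∀ᵐ x ∂(volume.restrict (hull K)), P x := by
  rw [ae_restrict_iff' T.isOpen.measurableSet] at h
  rw [ae_restrict_iff' (T.measurableSet_hull hK)]
  filter_upwards [h, T.ae_mem hK] with x h1 h2 hx using h1 (h2 hx)

theorem restrict_iUnion : volume.restrict (⋃ K ∈ T.cells, hull K) = volume.restrict Ω := by
  refine Measure.restrict_congr_set ?_
  have : ∀ᵐ x, ∀ K ∈ T.cells, x ∈ hull K → x ∈ Ω :=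
    (ae_ball_iff T.cells.countable_toSet).2 fun K hK => T.ae_mem hK
  filter_upwards [this] with x hx
  refine propext ⟨fun h => ?_, fun h => T.subset_iUnion h⟩
  obtain ⟨K, hK, hxK⟩ := mem_iUnion₂.1 h
  exact hx K hK hxK

theorem integrableOn_hull {f : Plane → ℝ} (hf : IntegrableOn f Ω) (hK : K ∈ T.cells) :
    IntegrableOn f (hull K) := by
  have : IntegrableOn f (⋃ K ∈ T.cells, hull K) := by
    rw [IntegrableOn, T.restrict_iUnion]; exact hf
  exact this.mono_set (subset_biUnion_of_mem (u := fun K => hull K) hK)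

theorem setIntegral_eq_sum {f : Plane → ℝ} (hf : IntegrableOn f Ω) :
    ∫ x in Ω, f x = ∑ K ∈ T.cells, ∫ x in hull K, f x := by
  have h1 : ∀ᵐ x, ∀ K ∈ T.cells, ∀ L ∈ T.cells, K ≠ L → x ∈ hull K → x ∉ hull L := by
    refine (ae_ball_iff T.cells.countable_toSet).2 fun K hK =>
      (ae_ball_iff T.cells.countable_toSet).2 fun L hL => ?_
    by_cases hKL : K = L
    · exact Eventually.of_forall fun x h => absurd hKL h
    · filter_upwards [T.ae_unique hK hL hKL] with x hx _ using hx
  have h2 : ∀ᵐ x, ∀ K ∈ T.cells, x ∈ hull K → x ∈ Ω :=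
    (ae_ball_iff T.cells.countable_toSet).2 fun K hK => T.ae_mem hK
  calc ∫ x in Ω, f x = ∫ x, Ω.indicator f x := (integral_indicator T.isOpen.measurableSet).symm
    _ = ∫ x, ∑ K ∈ T.cells, (hull K).indicator f x := by
        refine integral_congr_ae ?_
        filter_upwards [h1, h2] with x hx1 hx2
        by_cases hx : x ∈ Ω
        · obtain ⟨K, hK, hxK⟩ := T.exists_cell hx
          rw [indicator_of_mem hx, Finset.sum_eq_single_of_mem K hK, indicator_of_mem hxK]
          intro L hL hLK
          exact indicator_of_notMem (hx1 K hK L hL hLK.symm hxK) f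
        · rw [indicator_of_notMem hx, Finset.sum_eq_zero]
          intro K hK
          exact indicator_of_notMem (fun h => hx (hx2 K hK h)) f
    _ = ∑ K ∈ T.cells, ∫ x, (hull K).indicator f x := by
        refine integral_finsetSum _ fun K hK => ?_
        rw [integrable_indicator_iff (T.measurableSet_hull hK)]
        exact T.integrableOn_hull hf hK
    _ = _ := Finset.sum_congr rfl fun K hK => integral_indicator (T.measurableSet_hull hK)

/-- The relative interior of the edge opposite to the `i`-th vertex. -/
def openEdge (K : Finset Plane) (i : Fin 3) : Set Plane :=
  {x | lam (vert K) i x = 0 ∧ 0 < lam (vert K) (i + 1) x ∧ 0 < lam (vert K) (i + 2) x}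

theorem openEdge_subset_hull (hK : K ∈ T.cells) (i : Fin 3) : openEdge K i ⊆ hull K := by
  rintro x ⟨h0, h1, h2⟩
  rw [T.mem_hull hK]
  intro j
  have : j = i ∨ j = i + 1 ∨ j = i + 2 := by
    fin_cases i <;> fin_cases j <;> decide
  rcases this with rfl | rfl | rfl
  · exact h0.ge
  · exact h1.le
  · exact h2.le

theorem midT_mem_openEdge (hK : K ∈ T.cells) (i : Fin 3) : midT (vert K) i ∈ openEdge K i := by
  obtain ⟨h0, h1, h2⟩ := lam_midT (T.detT_vert hK) i
  refine ⟨h0, ?_, ?_⟩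
  · rw [h1]; norm_num
  · rw [h2]; norm_num

theorem exists_nbr_of_mem (hK : K ∈ T.cells) {i : Fin 3} {x : Plane} (hx : x ∈ openEdge K i)
    (hxΩ : x ∈ Ω) : ∃ L ∈ T.cells, L ≠ K ∧ vert K (i + 1) ∈ L ∧ vert K (i + 2) ∈ L := by
  classical
  by_contra! hc
  have hxK := T.openEdge_subset_hull hK i hx
  have hC : IsClosed (⋃ L ∈ T.cells.erase K, hull L) :=
    (T.cells.erase K).finite_toSet.isClosed_biUnion fun L hL =>
      (T.hull_isCompact (Finset.mem_of_mem_erase hL)).isClosed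
  have hxC : x ∉ ⋃ L ∈ T.cells.erase K, hull L := by
    simp only [mem_iUnion, not_exists]
    intro L hL hxL
    have hL' := Finset.mem_of_mem_erase hL
    exact hc L hL' (Finset.ne_of_mem_erase hL) (T.vert_mem_of_lam_ne hK hL' hxK hxL hx.2.1.ne')
      (T.vert_mem_of_lam_ne hK hL' hxK hxL hx.2.2.ne')
  have hnh : Ω ∩ (⋃ L ∈ T.cells.erase K, hull L)ᶜ ∈ 𝓝 x :=
    inter_mem (T.isOpen.mem_nhds hxΩ) (hC.isOpen_compl.mem_nhds hxC)
  have ht : Tendsto (fun δ : ℝ => x + δ • (x - vert K i)) (𝓝[>] 0) (𝓝 x) := by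
    have : Continuous fun δ : ℝ => x + δ • (x - vert K i) := by fun_prop
    have h := this.tendsto 0
    simp only [zero_smul, add_zero] at h
    exact h.mono_left nhdsWithin_le_nhds
  obtain ⟨δ, hδ, hδ0⟩ := ((ht.eventually hnh).and self_mem_nhdsWithin).exists
  obtain ⟨L, hL, hyL⟩ := T.exists_cell hδ.1
  rcases eq_or_ne L K with rfl | hLK
  · have h1 := (T.mem_hull hL).1 hyL i
    rw [lam_add, gl_smul, gl_sub, hx.1, lam_self (T.detT_vert hL)] at h1
    have : (0 : ℝ) < δ := hδ0
    linarith
  · exact hδ.2 (mem_iUnion₂.2 ⟨L, Finset.mem_erase.2 ⟨hLK, hL⟩, hyL⟩)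

/-- Two triangles with a common edge cover a neighbourhood of the relative interior of the edge. -/
theorem union_mem_nhds (hK : K ∈ T.cells) (hL : L ∈ T.cells) (hLK : L ≠ K) {i : Fin 3}
    (h1 : vert K (i + 1) ∈ L) (h2 : vert K (i + 2) ∈ L) {x : Plane} (hx : x ∈ openEdge K i) :
    hull K ∪ hull L ∈ 𝓝 x := by
  obtain ⟨t, ht⟩ : ∃ t, t = vert K := ⟨_, rfl⟩
  obtain ⟨s, hs⟩ : ∃ s, s = vert L := ⟨_, rfl⟩
  have hDt : detT t ≠ 0 := ht ▸ T.detT_vert hK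
  have hDs : detT s ≠ 0 := hs ▸ T.detT_vert hL
  rw [← ht] at h1 h2
  obtain ⟨a, ha⟩ := T.exists_vert_eq hL h1
  obtain ⟨b, hb⟩ := T.exists_vert_eq hL h2
  rw [← hs] at ha hb
  have hab : a ≠ b := by
    rintro rfl
    exact (fin3_succ_ne i).2.2 (vertex_injective hDt (ha.symm.trans hb))
  obtain ⟨c, hca, hcb⟩ : ∃ c : Fin 3, c ≠ a ∧ c ≠ b := by
    fin_cases a <;> fin_cases b <;> simp at hab <;> decide
  have hall : ∀ j : Fin 3, j = a ∨ j = b ∨ j = c := by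
    intro j
    fin_cases a <;> fin_cases b <;> simp at hab <;> fin_cases c <;> simp at hca hcb <;>
      fin_cases j <;> simp
  have hsum : ∀ f : Fin 3 → ℝ, ∑ j, f j = f a + f b + f c := by
    intro f
    rw [Fin.sum_univ_three]
    fin_cases a <;> fin_cases b <;> simp at hab <;> fin_cases c <;> simp at hca hcb <;>
      simp only [Fin.zero_eta, Fin.mk_one, Fin.reduceFinMk] <;> ring
  have hrel : ∀ y, lam t i y = lam s c y * lam t i (s c) := by
    intro y
    rw [lam_eq_sum hDs i y, hsum, ha, hb, lam_ne hDt (fin3_succ_ne i).1.symm,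
      lam_ne hDt (fin3_succ_ne i).2.1.symm]
    ring
  have hne : lam t i (s c) ≠ 0 := by
    intro h0
    have := hrel (t i)
    rw [lam_self hDt, h0, mul_zero] at this
    exact one_ne_zero this
  have hcases : ∀ j : Fin 3, j = i ∨ j = i + 1 ∨ j = i + 2 := by
    intro j; fin_cases i <;> fin_cases j <;> decide
  have hneg : lam t i (s c) < 0 := by
    by_contra hpos
    have hpos : 0 < lam t i (s c) := lt_of_le_of_ne (not_lt.1 hpos) hne.symm
    have hcont : ∀ j, Continuous fun δ : ℝ => lam t j (midT t i + δ • (s c - midT t i)) :=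
      fun j => (lam_continuous t j).comp (by fun_prop)
    have hmid := lam_midT hDt i
    have ev1 : ∀ᶠ δ : ℝ in 𝓝[>] 0, 0 < lam t (i + 1) (midT t i + δ • (s c - midT t i)) := by
      refine ((hcont (i + 1)).tendsto 0).mono_left nhdsWithin_le_nhds |>.eventually
        (lt_mem_nhds ?_)
      rw [zero_smul, add_zero, hmid.2.1]; norm_num
    have ev2 : ∀ᶠ δ : ℝ in 𝓝[>] 0, 0 < lam t (i + 2) (midT t i + δ • (s c - midT t i)) := by
      refine ((hcont (i + 2)).tendsto 0).mono_left nhdsWithin_le_nhds |>.eventually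
        (lt_mem_nhds ?_)
      rw [zero_smul, add_zero, hmid.2.2]; norm_num
    obtain ⟨δ, ⟨hδ1, hδ2⟩, hδ0, hδl⟩ :=
      ((ev1.and ev2).and (Ioc_mem_nhdsGT (zero_lt_one' ℝ))).exists
    have hxL : midT t i + δ • (s c - midT t i) ∈ hull L := by
      rw [T.hull_eq_tri hL, ← hs]
      refine (tri_convex s).add_smul_sub_mem ?_ (subset_convexHull ℝ _ ⟨c, rfl⟩) ⟨hδ0.le, hδl⟩
      rw [midT]
      refine (tri_convex s).add_smul_sub_mem (subset_convexHull ℝ _ ⟨a, ha⟩)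
        (subset_convexHull ℝ _ ⟨b, hb⟩) ⟨by norm_num, by norm_num⟩
    refine hLK (T.eq_of_lam_pos hK hL hxL fun j => ?_).symm
    rw [← ht]
    rcases hcases j with rfl | rfl | rfl
    · rw [lam_line, hmid.1]; nlinarith
    · exact hδ1
    · exact hδ2
  have hx' := hx
  rw [openEdge, ← ht] at hx'
  obtain ⟨hx0, hx1, hx2⟩ := hx'
  have hsx : 0 < lam s a x ∧ 0 < lam s b x := by
    have e0 : lam s c x = 0 := by
      have := hrel x
      rw [hx0] at this
      exact (mul_eq_zero.1 this.symm).resolve_right hne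
    have f1 := lam_eq_sum (t := t) hDs (i + 1) x
    have f2 := lam_eq_sum (t := t) hDs (i + 2) x
    rw [hsum, e0, ha, hb, lam_self hDt, lam_ne hDt (fin3_succ_ne i).2.2] at f1
    rw [hsum, e0, ha, hb, lam_self hDt, lam_ne hDt (fin3_succ_ne i).2.2.symm] at f2
    constructor <;> linarith
  have n1 := (lam_continuous t (i + 1)).continuousAt.eventually (lt_mem_nhds hx1)
  have n2 := (lam_continuous t (i + 2)).continuousAt.eventually (lt_mem_nhds hx2)
  have n3 := (lam_continuous s a).continuousAt.eventually (lt_mem_nhds hsx.1)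
  have n4 := (lam_continuous s b).continuousAt.eventually (lt_mem_nhds hsx.2)
  filter_upwards [n1, n2, n3, n4] with y y1 y2 y3 y4
  rcases le_or_gt 0 (lam t i y) with hy | hy
  · left
    rw [T.hull_eq_tri hK, ← ht, mem_tri hDt]
    intro j
    rcases hcases j with rfl | rfl | rfl
    exacts [hy, y1.le, y2.le]
  · right
    rw [T.hull_eq_tri hL, ← hs, mem_tri hDs]
    intro j
    rcases hall j with rfl | rfl | rfl
    · exact y3.le
    · exact y4.le
    · have := hrel y
      by_contra hcn
      rw [not_le] at hcn
      nlinarith [mul_pos_of_neg_of_neg hcn hneg]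

theorem openEdge_subset (hK : K ∈ T.cells) {i : Fin 3} {x : Plane} (hx : x ∈ openEdge K i)
    (hxΩ : x ∈ Ω) : openEdge K i ⊆ Ω := by
  obtain ⟨L, hL, hLK, h1, h2⟩ := T.exists_nbr_of_mem hK hx hxΩ
  intro y hy
  rw [← T.cover, mem_interior_iff_mem_nhds]
  refine mem_of_superset (T.union_mem_nhds hK hL hLK h1 h2 hy) ?_
  exact union_subset (subset_biUnion_of_mem (u := fun K => hull K) hK)
    (subset_biUnion_of_mem (u := fun K => hull K) hL)

/-- The edges at a vertex in the interior are interior edges. -/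
theorem midT_mem_of_vert_mem (hK : K ∈ T.cells) {i k : Fin 3} (hik : k ≠ i) (hk : vert K k ∈ Ω) :
    midT (vert K) i ∈ Ω := by
  have hD := T.detT_vert hK
  obtain ⟨j, hj, hjk⟩ : ∃ j : Fin 3, j ≠ i ∧ j ≠ k := by
    fin_cases i <;> fin_cases k <;> simp at hik <;> decide
  have ht : Tendsto (fun δ : ℝ => vert K k + δ • (vert K j - vert K k)) (𝓝[>] 0) (𝓝 (vert K k)) := by
    have : Continuous fun δ : ℝ => vert K k + δ • (vert K j - vert K k) := by fun_prop
    have h := this.tendsto 0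
    simp only [zero_smul, add_zero] at h
    exact h.mono_left nhdsWithin_le_nhds
  obtain ⟨δ, hδ, hδ0, hδ1⟩ := ((ht.eventually (T.isOpen.mem_nhds hk)).and
    (Ioo_mem_nhdsGT (zero_lt_one' ℝ))).exists
  refine T.openEdge_subset hK (x := vert K k + δ • (vert K j - vert K k)) ?_ hδ
    (T.midT_mem_openEdge hK i)
  have hpos : ∀ l, l ≠ i → 0 < lam (vert K) l (vert K k + δ • (vert K j - vert K k)) := by
    intro l hl
    rw [lam_line, lam_vertex hD, lam_vertex hD]
    have : l = k ∨ l = j := by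
      fin_cases i <;> fin_cases k <;> simp at hik <;> fin_cases j <;> simp at hj hjk <;>
        fin_cases l <;> simp at hl ⊢
    rcases this with rfl | rfl
    · simp [hjk.symm]; linarith
    · simp [hjk]; linarith
  refine ⟨?_, hpos _ (fin3_succ_ne i).1, hpos _ (fin3_succ_ne i).2.1⟩
  rw [lam_line, lam_ne hD hik.symm, lam_ne hD hj.symm]; ring

end Triangulation
end MorleyUC
end

noncomputable section

open MeasureTheory Set Filter Topology
namespace MorleyUC

/-! ### The triangles at a vertex -/

namespace Triangulation

variable {Ω : Set Plane} (T : Triangulation Ω) {K L : Finset Plane}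

/-- The graph of the triangles at the vertex `ν`, adjacency being the existence of a common edge
that contains `ν`. -/
def vertexGraph (ν : Plane) : SimpleGraph {K : Finset Plane // K ∈ T.cells ∧ ν ∈ K} where
  Adj K L := K ≠ L ∧ ∃ b ∈ K.1, b ∈ L.1 ∧ b ≠ ν
  symm := ⟨fun _ _ h => ⟨h.1.symm, h.2.imp fun _ hb => ⟨hb.2.1, hb.1, hb.2.2⟩⟩⟩
  loopless := ⟨fun _ h => h.1 rfl⟩

/-- If all edges at `ν` of the triangles that can be reached from `K₀` are interior edges, then
these triangles form a neighbourhood of `ν`. -/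
theorem reachable_of_interior {ν : Plane} (K₀ : {K : Finset Plane // K ∈ T.cells ∧ ν ∈ K})
    (hInt : ∀ K, (T.vertexGraph ν).Reachable K₀ K → ∀ i, vert K.1 i ≠ ν → midT (vert K.1) i ∈ Ω) :
    ν ∈ Ω ∧ ∀ L, (T.vertexGraph ν).Reachable K₀ L := by
  obtain ⟨U, hU⟩ : ∃ U : Set Plane, U =
      ⋃ K ∈ {K | (T.vertexGraph ν).Reachable K₀ K}, hull K.1 := ⟨_, rfl⟩
  have : Finite {K : Finset Plane // K ∈ T.cells ∧ ν ∈ K} :=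
    (T.cells.finite_toSet.subset fun K hK => hK.1 : {K | K ∈ T.cells ∧ ν ∈ K}.Finite).to_subtype
  have hUc : IsClosed U := by
    rw [hU]
    exact (toFinite _).isClosed_biUnion fun K _ => (T.hull_isCompact K.2.1).isClosed
  have hmemU : ∀ {K x}, (T.vertexGraph ν).Reachable K₀ K → x ∈ hull K.1 → x ∈ U := by
    intro K x hK hx
    rw [hU]; exact mem_biUnion (show K ∈ {K | (T.vertexGraph ν).Reachable K₀ K} from hK) hx
  have hsubU : ∀ {K}, (T.vertexGraph ν).Reachable K₀ K → hull K.1 ⊆ U := fun hK x hx => hmemU hK hx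
  obtain ⟨r₀, hr₀, hball⟩ : ∃ r₀ > 0, ∀ x, dist x ν < r₀ → ∀ K ∈ T.cells, ∀ k, vert K k = ν →
      0 < lam (vert K) k x := by
    have : ∀ᶠ x in 𝓝 ν, ∀ K ∈ T.cells, ∀ k, vert K k = ν → 0 < lam (vert K) k x := by
      refine (Filter.eventually_all_finset _).2 fun K hK => Filter.eventually_all.2 fun k => ?_
      by_cases hk : vert K k = ν
      · have h1 : 0 < lam (vert K) k ν := by rw [← hk, lam_self (T.detT_vert hK)]; norm_num
        filter_upwards [(lam_continuous (vert K) k).continuousAt.eventually (lt_mem_nhds h1)]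
          with x hx _ using hx
      · exact Eventually.of_forall fun x h => absurd h hk
    obtain ⟨r₀, h0, h1⟩ := Metric.eventually_nhds_iff.1 this
    exact ⟨r₀, h0, fun x hx => h1 hx⟩
  have hopen : ∀ r, 0 < r → r < r₀ → Metric.sphere ν r ∩ U ⊆ interior U := by
    rintro r hr hrr x ⟨hxr, hxU⟩
    rw [hU] at hxU
    obtain ⟨K, hK, hxK⟩ := mem_iUnion₂.1 hxU
    obtain ⟨k, hk⟩ := T.exists_vert_eq K.2.1 K.2.2
    have hD := T.detT_vert K.2.1
    have hkpos := hball x (by rw [Metric.mem_sphere] at hxr; linarith) K.1 K.2.1 k hk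
    have hx0 := (T.mem_hull K.2.1).1 hxK
    have hcases : ∀ j : Fin 3, j = k ∨ j = k + 1 ∨ j = k + 2 := by
      intro j; fin_cases k <;> fin_cases j <;> decide
    have hnear : ∀ i, i ≠ k → x ∈ openEdge K.1 i → x ∈ interior U := by
      intro i hik hxe
      have hiν : vert K.1 i ≠ ν := fun h => hik (vertex_injective hD (h.trans hk.symm))
      obtain ⟨L, hL, hLK, h1, h2⟩ := T.exists_nbr_of_mem K.2.1 (T.midT_mem_openEdge K.2.1 i)
        (hInt K hK i hiν)
      have hνL : ν ∈ L := by
        rw [← hk]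
        have : k = i + 1 ∨ k = i + 2 := by
          fin_cases i <;> fin_cases k <;> simp at hik ⊢
        rcases this with h | h <;> rw [h] <;> assumption
      have hadj : (T.vertexGraph ν).Adj K ⟨L, hL, hνL⟩ := by
        refine ⟨fun h => hLK (congrArg Subtype.val h).symm, ?_⟩
        obtain ⟨j, hji, hjk⟩ : ∃ j : Fin 3, j ≠ i ∧ j ≠ k := by
          fin_cases i <;> fin_cases k <;> simp at hik <;> decide
        have hj : j = i + 1 ∨ j = i + 2 := by
          fin_cases i <;> fin_cases j <;> simp at hji ⊢
        refine ⟨vert K.1 j, T.vert_mem K.2.1 j, ?_, fun h => hjk (vertex_injective hD (h.trans hk.symm))⟩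
        rcases hj with h | h <;> rw [h] <;> assumption
      have hLr : (T.vertexGraph ν).Reachable K₀ ⟨L, hL, hνL⟩ := hK.trans hadj.reachable
      rw [mem_interior_iff_mem_nhds]
      exact mem_of_superset (T.union_mem_nhds K.2.1 hL hLK h1 h2 hxe)
        (union_subset (hsubU hK) (hsubU hLr))
    rcases (hx0 (k + 1)).eq_or_lt with e1 | e1
    · rcases (hx0 (k + 2)).eq_or_lt with e2 | e2
      · exfalso
        have : x = ν := by
          rw [← hk]
          refine lam_ext hD fun j => ?_
          have hs := sum_lam hD x
          have : ∑ j, lam (vert K.1) j x = lam (vert K.1) k x + lam (vert K.1) (k + 1) x +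
              lam (vert K.1) (k + 2) x := by
            rw [Fin.sum_univ_three]; fin_cases k <;> simp <;> ring
          obtain ⟨n1, n2, -⟩ := fin3_succ_ne k
          rcases hcases j with rfl | rfl | rfl
          · rw [lam_self hD]; linarith
          · rw [lam_ne hD n1]; exact e1.symm
          · rw [lam_ne hD n2]; exact e2.symm
        rw [this] at hxr
        simp at hxr
        linarith
      · refine hnear (k + 1) (fin3_succ_ne k).1 ⟨e1.symm, ?_, ?_⟩
        · rw [show k + 1 + 1 = k + 2 by fin_cases k <;> rfl]; exact e2
        · rw [show k + 1 + 2 = k by fin_cases k <;> rfl]; exact hkpos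
    · rcases (hx0 (k + 2)).eq_or_lt with e2 | e2
      · refine hnear (k + 2) (fin3_succ_ne k).2.1 ⟨e2.symm, ?_, ?_⟩
        · rw [show k + 2 + 1 = k by fin_cases k <;> rfl]; exact hkpos
        · rw [show k + 2 + 2 = k + 1 by fin_cases k <;> rfl]; exact e1
      · have : x ∈ interior (hull K.1) := by
          rw [T.hull_eq_tri K.2.1]
          refine mem_interior_tri hD fun j => ?_
          rcases hcases j with rfl | rfl | rfl <;> assumption
        exact interior_mono (hsubU hK) this
  have hsphere : ∀ r, 0 < r → r < r₀ → Metric.sphere ν r ⊆ U := by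
    intro r hr hrr
    have hpre : IsPreconnected (Metric.sphere ν r) :=
      (isConnected_sphere (by
        rw [← Module.finrank_eq_rank]; simp) ν hr.le).isPreconnected
    refine (hpre.subset_of_closure_inter_subset isOpen_interior ?_ ?_).trans interior_subset
    · obtain ⟨k, hk⟩ := T.exists_vert_eq K₀.2.1 K₀.2.2
      have hD := T.detT_vert K₀.2.1
      have hd : r₀ ≤ dist (vert K₀.1 (k + 1)) ν := by
        by_contra hc
        have := hball _ (not_le.1 hc) K₀.1 K₀.2.1 k hk
        rw [lam_ne hD (fin3_succ_ne k).1.symm] at this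
        exact lt_irrefl _ this
      have hd0 : 0 < dist (vert K₀.1 (k + 1)) ν := hr₀.trans_le hd
      obtain ⟨x, hx⟩ : ∃ x, x = ν + (r / dist (vert K₀.1 (k + 1)) ν) • (vert K₀.1 (k + 1) - ν) :=
        ⟨_, rfl⟩
      have hxs : x ∈ Metric.sphere ν r := by
        rw [hx, Metric.mem_sphere, dist_eq_norm, add_sub_cancel_left, norm_smul, ← dist_eq_norm,
          Real.norm_of_nonneg (by positivity), div_mul_cancel₀ _ hd0.ne']
      have hxK : x ∈ hull K₀.1 := by
        rw [hx]
        refine (convex_convexHull ℝ _).add_smul_sub_mem (subset_convexHull ℝ _ K₀.2.2)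
          (subset_convexHull ℝ _ (T.vert_mem K₀.2.1 _)) ⟨by positivity, ?_⟩
        rw [div_le_one hd0]; linarith
      exact ⟨x, hxs, hopen r hr hrr ⟨hxs, hmemU (SimpleGraph.Reachable.refl _) hxK⟩⟩
    · rintro x ⟨hx, hxs⟩
      exact hopen r hr hrr ⟨hxs, hUc.closure_interior_subset hx⟩
  have hν : Metric.ball ν r₀ ⊆ U := by
    intro x hx
    rcases eq_or_ne x ν with rfl | hne
    · exact hmemU (SimpleGraph.Reachable.refl _) (subset_convexHull ℝ _ K₀.2.2)
    · exact hsphere (dist x ν) (dist_pos.2 hne) hx rfl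
  have hUsub : U ⊆ ⋃ K ∈ T.cells, hull K := by
    rw [hU]
    exact iUnion₂_subset fun K _ => subset_biUnion_of_mem (u := fun K => hull K) K.2.1
  refine ⟨?_, fun L => ?_⟩
  · rw [← T.cover, mem_interior_iff_mem_nhds]
    exact mem_of_superset (Metric.ball_mem_nhds ν hr₀) (hν.trans hUsub)
  · obtain ⟨k, hk⟩ := T.exists_vert_eq L.2.1 L.2.2
    have hD := T.detT_vert L.2.1
    have ht : Tendsto (fun δ : ℝ => ν + δ • (cen (vert L.1) - ν)) (𝓝[>] 0) (𝓝 ν) := by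
      have : Continuous fun δ : ℝ => ν + δ • (cen (vert L.1) - ν) := by fun_prop
      have h := this.tendsto 0
      simp only [zero_smul, add_zero] at h
      exact h.mono_left nhdsWithin_le_nhds
    obtain ⟨δ, hδ, hδ0, hδ1⟩ := ((ht.eventually (Metric.ball_mem_nhds ν hr₀)).and
      (Ioo_mem_nhdsGT (zero_lt_one' ℝ))).exists
    have hxU := hν hδ
    rw [hU] at hxU
    obtain ⟨K, hK, hxK⟩ := mem_iUnion₂.1 hxU
    have : L.1 = K.1 := by
      refine T.eq_of_lam_pos L.2.1 K.2.1 hxK fun j => ?_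
      have hv := lam_vertex hD j k
      rw [hk] at hv
      rw [lam_line, lam_cen hD, hv]
      split <;> linarith
    rw [Subtype.ext this]; exact hK

/-- The number of triangles at a vertex is bounded. -/
theorem card_at_vertex_le {ρ : ℝ} (hρ : 0 < ρ) (hT : T.ShapeRegular ρ) (ν : Plane) [DecidableEq Plane] :
    ((T.cells.filter fun K => ν ∈ K).card : ℝ) * ρ ^ 2 ≤ 1 := by
  obtain ⟨S, hS⟩ : ∃ S, S = T.cells.filter fun K => ν ∈ K := ⟨_, rfl⟩
  rw [← hS]
  rcases S.eq_empty_or_nonempty with rfl | hne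
  · simp
  have hSc : ∀ K ∈ S, K ∈ T.cells ∧ ν ∈ K := fun K hK => by
    rw [hS] at hK; exact Finset.mem_filter.1 hK
  have hdiam : ∀ K ∈ S, 0 < Metric.diam (hull K) := by
    intro K hK
    have hb := (T.hull_isCompact (hSc K hK).1).isBounded
    refine lt_of_lt_of_le (dist_pos.2 ?_) (Metric.dist_le_diam_of_mem hb
      (subset_convexHull ℝ _ (T.vert_mem (hSc K hK).1 0))
      (subset_convexHull ℝ _ (T.vert_mem (hSc K hK).1 1)))
    intro h
    exact absurd (vertex_injective (T.detT_vert (hSc K hK).1) h) (by decide)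
  obtain ⟨K₁, hK₁, hmin⟩ := Finset.exists_min_image S (fun K => Metric.diam (hull K)) hne
  obtain ⟨s, hs⟩ : ∃ s, s = Metric.diam (hull K₁) := ⟨_, rfl⟩
  have hs0 : 0 < s := hs ▸ hdiam K₁ hK₁
  have hball : ∀ K ∈ S, ∃ y, Metric.closedBall y (ρ * s) ⊆ hull K ∩ Metric.closedBall ν s := by
    intro K hK
    obtain ⟨hKc, hνK⟩ := hSc K hK
    obtain ⟨x, hx⟩ := hT K hKc
    obtain ⟨h, hh⟩ : ∃ h, h = Metric.diam (hull K) := ⟨_, rfl⟩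
    have hh0 : 0 < h := hh ▸ hdiam K hK
    have hsh : s ≤ h := by rw [hs, hh]; exact hmin K hK
    rw [← hh] at hx
    have hνh : ν ∈ hull K := subset_convexHull ℝ _ hνK
    refine ⟨ν + (s / h) • (x - ν), fun z hz => ?_⟩
    obtain ⟨z', hz'⟩ : ∃ z', z' = ν + (h / s) • (z - ν) := ⟨_, rfl⟩
    have hzz : z = ν + (s / h) • (z' - ν) := by
      rw [hz', add_sub_cancel_left, smul_smul, div_mul_div_comm, mul_comm s h,
        div_self (by positivity), one_smul, add_sub_cancel]
    have hz'K : z' ∈ hull K := by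
      refine hx ?_
      rw [Metric.mem_closedBall, dist_eq_norm] at hz ⊢
      have e : z' - x = (h / s) • (z - (ν + (s / h) • (x - ν))) := by
        have e1 : (h / s) • (s / h) • (x - ν) = x - ν := by
          rw [smul_smul, div_mul_div_comm, mul_comm s h, div_self (by positivity), one_smul]
        rw [hz', ← sub_sub, smul_sub (h / s) (z - ν), e1]
        abel
      rw [e, norm_smul, Real.norm_of_nonneg (by positivity)]
      calc h / s * ‖z - (ν + (s / h) • (x - ν))‖ ≤ h / s * (ρ * s) :=
            mul_le_mul_of_nonneg_left hz (by positivity)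
        _ = ρ * h := by field_simp
    refine ⟨?_, ?_⟩
    · rw [hzz]
      exact (convex_convexHull ℝ _).add_smul_sub_mem hνh hz'K
        ⟨by positivity, (div_le_one hh0).2 hsh⟩
    · rw [Metric.mem_closedBall, dist_eq_norm, hzz, add_sub_cancel_left, norm_smul,
        Real.norm_of_nonneg (by positivity), ← dist_eq_norm]
      calc s / h * dist z' ν ≤ s / h * h := by
            refine mul_le_mul_of_nonneg_left ?_ (by positivity)
            rw [hh]
            exact Metric.dist_le_diam_of_mem (T.hull_isCompact hKc).isBounded hz'K hνh
        _ = s := by field_simp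
  choose! y hy using hball
  have hdisj : (S : Set (Finset Plane)).Pairwise
      (Function.onFun (AEDisjoint volume) fun K => Metric.closedBall (y K) (ρ * s)) := by
    intro K hK L hL hKL
    exact (T.aedisjoint (hSc K hK).1 (hSc L hL).1 hKL).mono (fun x hx => (hy K hK hx).1)
      (fun x hx => (hy L hL hx).1)
  have hvol := measure_biUnion_finset₀ hdisj
    (fun K _ => (Metric.isClosed_closedBall (x := y K) (ε := ρ * s)).nullMeasurableSet)
  have hle : volume (⋃ K ∈ S, Metric.closedBall (y K) (ρ * s)) ≤ volume (Metric.closedBall ν s) :=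
    measure_mono (iUnion₂_subset fun K hK x hx => (hy K hK hx).2)
  rw [hvol] at hle
  simp only [EuclideanSpace.volume_closedBall_fin_two, Finset.sum_const, nsmul_eq_mul] at hle
  have h2 := ENNReal.toReal_mono (by finiteness) hle
  simp only [ENNReal.toReal_mul, ENNReal.toReal_pow, ENNReal.toReal_natCast,
    ENNReal.toReal_ofReal hs0.le, ENNReal.toReal_ofReal (mul_pos hρ hs0).le] at h2
  have hpi : 0 < s ^ 2 * (ENNReal.ofReal Real.pi).toReal := by
    have := Real.pi_pos
    rw [ENNReal.toReal_ofReal this.le]; positivity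
  refine le_of_mul_le_mul_right ?_ hpi
  calc _ = (S.card : ℝ) * ((ρ * s) ^ 2 * (ENNReal.ofReal Real.pi).toReal) := by ring
    _ ≤ _ := h2
    _ = _ := by ring

theorem diam_sq_le {ρ : ℝ} (hρ : 0 < ρ) (hT : T.ShapeRegular ρ) (hK : K ∈ T.cells) :
    6 * ρ ^ 2 * Metric.diam (hull K) ^ 2 ≤ |detT (vert K)| := by
  obtain ⟨x, hx⟩ := hT K hK
  have h1 := measure_mono (μ := volume) hx
  rw [EuclideanSpace.volume_closedBall_fin_two] at h1
  have h2 := ENNReal.toReal_mono (T.hull_isCompact hK).measure_lt_top.ne h1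
  have h3 := volume_real_tri (T.detT_vert hK)
  rw [← T.hull_eq_tri hK, Measure.real] at h3
  rw [h3, ENNReal.toReal_mul, ENNReal.toReal_pow,
    ENNReal.toReal_ofReal (mul_nonneg hρ.le Metric.diam_nonneg)] at h2
  have hpi : (3 : ℝ) ≤ (ENNReal.ofReal Real.pi).toReal := by
    rw [ENNReal.toReal_ofReal Real.pi_pos.le]; exact Real.pi_gt_three.le
  nlinarith [mul_le_mul_of_nonneg_left hpi (sq_nonneg (ρ * Metric.diam (hull K)))]

theorem dist_vert_le (hK : K ∈ T.cells) (a b : Fin 3) :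
    ‖vert K a - vert K b‖ ≤ Metric.diam (hull K) := by
  rw [← dist_eq_norm]
  exact Metric.dist_le_diam_of_mem (T.hull_isCompact hK).isBounded
    (subset_convexHull ℝ _ (T.vert_mem hK a)) (subset_convexHull ℝ _ (T.vert_mem hK b))

theorem diam_pos (hK : K ∈ T.cells) : 0 < Metric.diam (hull K) := by
  refine lt_of_lt_of_le (norm_pos_iff.2 (sub_ne_zero.2 ?_)) (T.dist_vert_le hK 0 1)
  intro h
  exact absurd (vertex_injective (T.detT_vert hK) h) (by decide)

end Triangulation
end MorleyUC
end

noncomputable section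

open MeasureTheory Set Filter Topology
namespace MorleyUC

/-- A function which has first order Taylor expansions with quadratic remainder on each set of a
finite closed cover of the plane, with a common gradient field, is `C^{1,1}`. -/
theorem isC11_of_pieces {ι : Type*} [Finite ι] {S : ι → Set Plane} (hS : ∀ a, IsClosed (S a))
    (hcov : ∀ x, ∃ a, x ∈ S a) {w : Plane → ℝ} {g : Plane → Plane →L[ℝ] ℝ} {M : ℝ}
    (h1 : ∀ a, ∀ x ∈ S a, ∀ y ∈ S a, |w y - w x - g x (y - x)| ≤ M * ‖y - x‖ ^ 2)
    (h2 : ∀ a, ∀ x ∈ S a, ∀ y ∈ S a, ‖g y - g x‖ ≤ M * ‖y - x‖) :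
    IsC11 M w ∧ ∀ x, fderiv ℝ w x = g x := by
  have hloc : ∀ x, ∀ᶠ y in 𝓝 x, ∃ a, x ∈ S a ∧ y ∈ S a := by
    intro x
    have : ∀ᶠ y in 𝓝 x, ∀ a, x ∉ S a → y ∉ S a := by
      rw [eventually_all]
      intro a
      by_cases hx : x ∈ S a
      · exact Eventually.of_forall fun y h => absurd hx h
      · filter_upwards [(hS a).isOpen_compl.mem_nhds hx] with y hy _ using hy
    filter_upwards [this] with y hy
    obtain ⟨a, ha⟩ := hcov y
    exact ⟨a, by_contra fun h => hy a h ha, ha⟩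
  have hd : ∀ x, HasFDerivAt w (g x) x := by
    intro x
    rw [hasFDerivAt_iff_isLittleO]
    have hO : (fun y => w y - w x - g x (y - x)) =O[𝓝 x] fun y => ‖y - x‖ ^ 2 := by
      refine Asymptotics.IsBigO.of_bound M ?_
      filter_upwards [hloc x] with y ⟨a, hx, hy⟩
      have := h1 a x hx y hy
      simpa using this
    refine hO.trans_isLittleO ?_
    have := Asymptotics.isLittleO_pow_sub_sub x (m := 2) one_lt_two
    exact this
  have hg : ∀ x, ∀ᶠ y in 𝓝 x, ‖g y - g x‖ ≤ M * ‖y - x‖ := fun x => by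
    filter_upwards [hloc x] with y ⟨a, hx, hy⟩ using h2 a x hx y hy
  have hgc : Continuous g := by
    rw [continuous_iff_continuousAt]
    intro x
    rw [ContinuousAt, tendsto_iff_norm_sub_tendsto_zero]
    refine squeeze_zero' (Eventually.of_forall fun _ => norm_nonneg _) (hg x) ?_
    have : Continuous fun y => M * ‖y - x‖ := by fun_prop
    simpa using this.tendsto x
  refine ⟨⟨fun x => (hd x).differentiableAt, fun y x => ?_⟩, fun x => (hd x).fderiv⟩
  rw [(hd x).fderiv, (hd y).fderiv]
  set γ : ℝ → Plane := fun τ => x + τ • (y - x) with hγ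
  have hγc : Continuous γ := by fun_prop
  have key : Icc (0 : ℝ) 1 ⊆ {τ | ‖g (γ τ) - g x‖ ≤ M * (τ * ‖y - x‖)} := by
    refine IsClosed.Icc_subset_of_forall_exists_gt ?_ (by simp [hγ]) ?_
    · exact (isClosed_le (by fun_prop) (by fun_prop)).inter isClosed_Icc
    · rintro τ ⟨hτ, h0, h1⟩ σ hσ
      have e1 : ∀ᶠ s in 𝓝[>] τ, ‖g (γ s) - g (γ τ)‖ ≤ M * ‖γ s - γ τ‖ :=
        (hγc.continuousAt.tendsto.mono_left nhdsWithin_le_nhds).eventually (hg (γ τ))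
      obtain ⟨s, hs1, hs2⟩ := (e1.and (Ioc_mem_nhdsGT hσ)).exists
      refine ⟨s, ?_, hs2⟩
      have e2 : ‖γ s - γ τ‖ = (s - τ) * ‖y - x‖ := by
        rw [show γ s - γ τ = (s - τ) • (y - x) by simp only [hγ]; module, norm_smul,
          Real.norm_of_nonneg (sub_nonneg.2 hs2.1.le)]
      rw [e2] at hs1
      have e3 := norm_add_le (g (γ s) - g (γ τ)) (g (γ τ) - g x)
      rw [sub_add_sub_cancel] at e3
      rw [mem_ofPred_eq] at hτ ⊢
      nlinarith
  have := key (right_mem_Icc.2 zero_le_one)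
  simpa [hγ] using this

theorem exists_taylor_of_contDiff {f : Plane → ℝ} (hf : ContDiff ℝ smooth f) {S : Set Plane}
    (hS : IsCompact S) (hc : Convex ℝ S) : ∃ M, 0 ≤ M ∧ ∀ x ∈ S, ∀ y ∈ S,
      |f y - f x - fderiv ℝ f x (y - x)| ≤ M * ‖y - x‖ ^ 2 ∧
      ‖fderiv ℝ f y - fderiv ℝ f x‖ ≤ M * ‖y - x‖ := by
  have hf' : ContDiff ℝ smooth (fderiv ℝ f) := hf.fderiv_right (by simp)
  have hf'' : Continuous (fderiv ℝ (fderiv ℝ f)) := hf'.continuous_fderiv (by simp)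
  obtain ⟨M, hM⟩ := hS.exists_bound_of_continuousOn (f := fderiv ℝ (fderiv ℝ f)) hf''.continuousOn
  have key : ∀ x ∈ S, ∀ y ∈ S, ‖fderiv ℝ f y - fderiv ℝ f x‖ ≤ |M| * ‖y - x‖ := by
    intro x hx y hy
    exact hc.norm_image_sub_le_of_norm_fderiv_le (𝕜 := ℝ)
      (fun z _ => hf'.differentiable (by simp) z)
      (fun z hz => (hM z hz).trans (le_abs_self M)) hx hy
  refine ⟨|M|, abs_nonneg _, fun x hx y hy => ⟨?_, key x hx y hy⟩⟩
  have := (convex_segment x y).norm_image_sub_le_of_norm_fderiv_le' (𝕜 := ℝ) (f := f)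
    (φ := fderiv ℝ f x) (C := |M| * ‖y - x‖) (fun z _ => hf.differentiable (by simp) z)
    (fun z hz => ?_) (left_mem_segment ℝ x y) (right_mem_segment ℝ x y)
  · rw [Real.norm_eq_abs] at this
    nlinarith
  · refine (key x hx z (hc.segment_subset hx hy hz)).trans ?_
    gcongr
    obtain ⟨a, b, ha, hb, hab, rfl⟩ := hz
    have e : a • x + b • y - x = b • (y - x) := by
      rw [show a = 1 - b by linarith]; module
    rw [e, norm_smul, Real.norm_of_nonneg hb]
    exact mul_le_of_le_one_left (norm_nonneg _) (by linarith)

theorem tri_subset_closure_interior {t : Fin 3 → Plane} (h : detT t ≠ 0) :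
    tri t ⊆ closure (interior (tri t)) := by
  rw [(tri_convex t).closure_interior_eq_closure_of_nonempty_interior
    ⟨cen t, mem_interior_tri h fun i => by rw [lam_cen h]; norm_num⟩]
  exact subset_closure

variable {Ω : Set Plane} (T : Triangulation Ω) {K L : Finset Plane}

/-- Regularity and local description of an HCT function. -/
structure HCTPieces (w : Plane → ℝ) (P : Finset Plane → Fin 3 → Poly) : Prop where
  off : ∀ x, x ∉ Ω → w x = 0
  off' : ∀ x, x ∉ Ω → fderiv ℝ w x = 0
  c11 : ∃ M, IsC11 M w
  loc : ∀ K ∈ T.cells, LocalHCT (vert K) (P K)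
  val : ∀ K ∈ T.cells, ∀ i, ∀ x ∈ tri (subTri (vert K) i), w x = ev (P K i) x
  grad : ∀ K ∈ T.cells, ∀ i, ∀ x ∈ tri (subTri (vert K) i), fderiv ℝ w x = gradP (P K i) x

variable {T}

theorem interior_subTri_subset (hK : K ∈ T.cells) (i : Fin 3) :
    interior (tri (subTri (vert K) i)) ⊆ Ω := by
  refine subset_trans (interior_mono (tri_sub_subset (T.detT_vert hK) i)) ?_
  rw [← T.hull_eq_tri hK]; exact T.interior_hull_subset hK

theorem ae_mem_interior_subTri (hK : K ∈ T.cells) :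
    ∀ᵐ x, x ∈ hull K → ∃ i, x ∈ interior (tri (subTri (vert K) i)) := by
  have hD := T.detT_vert hK
  have : ∀ᵐ x, ∀ i j, lam (subTri (vert K) i) j x ≠ 0 := by
    rw [ae_all_iff]; intro i; exact ae_lam_ne_zero (detT_sub_ne hD i)
  filter_upwards [this] with x hx hxK
  rw [T.hull_eq_tri hK] at hxK
  obtain ⟨i, hi⟩ := exists_mem_tri_sub hD hxK
  refine ⟨i, mem_interior_tri (detT_sub_ne hD i) fun j => ?_⟩
  exact lt_of_le_of_ne ((mem_tri (detT_sub_ne hD i)).1 hi j) (hx i j).symm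

theorem ae_mem_cell (T : Triangulation Ω) : ∀ᵐ x ∂(volume.restrict Ω),
    ∃ K ∈ T.cells, ∃ i, x ∈ interior (tri (subTri (vert K) i)) := by
  rw [ae_restrict_iff' T.isOpen.measurableSet]
  have : ∀ᵐ x, ∀ K ∈ T.cells, x ∈ hull K → ∃ i, x ∈ interior (tri (subTri (vert K) i)) :=
    (ae_ball_iff T.cells.countable_toSet).2 fun K hK => ae_mem_interior_subTri hK
  filter_upwards [this] with x hx hxΩ
  obtain ⟨K, hK, hxK⟩ := T.exists_cell hxΩ
  exact ⟨K, hK, hx K hK hxK⟩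

theorem IsHCT.exists_pieces (hb : Bornology.IsBounded Ω) {w : Plane → ℝ} (hw : IsHCT T w) :
    ∃ P, HCTPieces T w P := by
  classical
  obtain ⟨⟨W, hW⟩, h0, hK⟩ := hw
  have hp : ∀ K : Finset Plane, ∀ i, ∃ p : Poly, K ∈ T.cells → p ∈ Deg 3 ∧
      ∀ x ∈ tri (subTri (vert K) i), w x = ev p x := by
    intro K i
    by_cases h : K ∈ T.cells
    · obtain ⟨p, hp, hpx⟩ := (hK K h).2 _ (T.vert_mem h i)
      rw [T.subTri_eq h i] at hpx
      exact ⟨p, fun _ => ⟨hp, hpx⟩⟩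
    · exact ⟨0, fun h' => absurd h' h⟩
  choose P hP using hp
  have hwc : Continuous w := by
    have hlf : LocallyFinite fun a : Option T.cells => a.elim Ωᶜ fun K => hull K.1 :=
      locallyFinite_of_finite _
    refine hlf.continuous ?_ ?_ ?_
    · rw [eq_univ_iff_forall]
      intro x
      rw [mem_iUnion]
      by_cases hx : x ∈ Ω
      · obtain ⟨K, hK, hxK⟩ := T.exists_cell hx
        exact ⟨some ⟨K, hK⟩, hxK⟩
      · exact ⟨none, hx⟩
    · rintro (_ | K)
      · exact T.isOpen.isClosed_compl
      · exact (T.hull_isCompact K.2).isClosed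
    · rintro (_ | K)
      · exact (continuousOn_const (c := (0 : ℝ))).congr fun x hx => h0 x hx
      · exact (hK K.1 K.2).1.continuousOn
  have hwcs : HasCompactSupport w := by
    refine HasCompactSupport.of_support_subset_isCompact hb.isCompact_closure fun x hx => ?_
    exact subset_closure (by_contra fun h => hx (h0 x h))
  have hbd : ∀ K i, ∃ M, 0 ≤ M ∧ ∀ k l, ∀ x ∈ tri (subTri (vert K) i),
      |ev (MvPolynomial.pderiv k (MvPolynomial.pderiv l (P K i))) x| ≤ M := by
    intro K i
    have : ∀ k l, ∃ M, ∀ x ∈ tri (subTri (vert K) i),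
        |ev (MvPolynomial.pderiv k (MvPolynomial.pderiv l (P K i))) x| ≤ M := fun k l =>
      (tri_isCompact _).exists_bound_of_continuousOn (ev_continuous _).continuousOn
    choose M hM using this
    refine ⟨∑ k, ∑ l, |M k l|, by positivity, fun k l x hx => ?_⟩
    calc _ ≤ |M k l| := (hM k l x hx).trans (le_abs_self _)
      _ ≤ ∑ l, |M k l| := Finset.single_le_sum (f := fun l => |M k l|)
          (fun _ _ => abs_nonneg _) (Finset.mem_univ l)
      _ ≤ _ := Finset.single_le_sum (f := fun k => ∑ l, |M k l|)
          (fun _ _ => Finset.sum_nonneg fun _ _ => abs_nonneg _) (Finset.mem_univ k)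
  choose M hM0 hM using hbd
  have hsec : ∀ K ∈ T.cells, ∀ i k l, ∀ᵐ x, x ∈ interior (tri (subTri (vert K) i)) →
      (W : JetSpace Ω) (Sum.inr (Sum.inr (k, l))) x =
        ev (MvPolynomial.pderiv k (MvPolynomial.pderiv l (P K i))) x := by
    intro K hK i k l
    have := H20_second_ae_eq isOpen_interior (interior_subTri_subset hK i) W.2
      (ev_contDiff (P K i)) ?_ k l
    · simpa only [partialD_ev] using this
    · rw [Filter.EventuallyEq, ae_restrict_iff' T.isOpen.measurableSet] at hW
      filter_upwards [hW] with x hx hxi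
      rw [hx (interior_subTri_subset hK i hxi), (hP K i hK).2 x (interior_subset hxi)]
  have hC : IsC11 (4 * ∑ K ∈ T.cells, ∑ i, M K i) w := by
    refine isC11_of_H20 hwc hwcs h0 W.2 hW
      (Finset.sum_nonneg fun _ _ => Finset.sum_nonneg fun _ _ => hM0 _ _) fun k l => ?_
    have h1 : ∀ᵐ x, ∀ K ∈ T.cells, ∀ i, x ∈ interior (tri (subTri (vert K) i)) →
        (W : JetSpace Ω) (Sum.inr (Sum.inr (k, l))) x =
          ev (MvPolynomial.pderiv k (MvPolynomial.pderiv l (P K i))) x :=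
      (ae_ball_iff T.cells.countable_toSet).2 fun K hK =>
        ae_all_iff.2 fun i => hsec K hK i k l
    filter_upwards [ae_mem_cell T, ae_restrict_of_ae h1] with x ⟨K, hK, i, hx⟩ h
    rw [h K hK i hx]
    calc _ ≤ M K i := hM K i k l x (interior_subset hx)
      _ ≤ ∑ i, M K i := Finset.single_le_sum (f := M K) (fun _ _ => hM0 _ _) (Finset.mem_univ i)
      _ ≤ _ := Finset.single_le_sum (f := fun K => ∑ i, M K i)
          (fun _ _ => Finset.sum_nonneg fun _ _ => hM0 _ _) hK
  have hgrad : ∀ K ∈ T.cells, ∀ i, ∀ x ∈ tri (subTri (vert K) i),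
      fderiv ℝ w x = gradP (P K i) x := by
    intro K hK i x hx
    have hcl : IsClosed {x | fderiv ℝ w x = fderiv ℝ (ev (P K i)) x} :=
      isClosed_eq hC.continuous_fderiv ((ev_contDiff _).continuous_fderiv (by simp))
    rw [← fderiv_ev]
    refine closure_minimal (fun y hy => ?_) hcl
      (tri_subset_closure_interior (detT_sub_ne (T.detT_vert hK) i) hx)
    refine Filter.EventuallyEq.fderiv_eq ?_
    filter_upwards [isOpen_interior.mem_nhds hy] with z hz using
      (hP K i hK).2 z (interior_subset hz)
  refine ⟨P, h0, fun x hx => hC.fderiv_eq_zero_off h0 T.compl_subset_closure hx, ⟨_, hC⟩,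
    fun K hK => ⟨fun i => (hP K i hK).1, fun i j x hi hj => ?_, fun i j x hi hj n => ?_⟩,
    fun K hK i => (hP K i hK).2, hgrad⟩
  · rw [← (hP K i hK).2 x hi, (hP K j hK).2 x hj]
  · rw [← gradP_apply, ← gradP_apply, ← hgrad K hK i x hi, hgrad K hK j x hj]

end MorleyUC
end

noncomputable section

open MeasureTheory Set Filter Topology
namespace MorleyUC

variable {Ω : Set Plane} {T : Triangulation Ω} {K L : Finset Plane}

theorem fin3_eq (i j : Fin 3) : j = i ∨ j = i + 1 ∨ j = i + 2 := by revert i j; decide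

theorem sum_fin3 {M : Type*} [AddCommMonoid M] (i : Fin 3) (f : Fin 3 → M) :
    ∑ j, f j = f i + f (i + 1) + f (i + 2) := by
  rw [Fin.sum_univ_three]
  fin_cases i <;> simp <;> abel

open Classical in
/-- The edge of the triangle `K` opposite to its vertex `i`. -/
def edgeOf (K : Finset Plane) (i : Fin 3) : Finset Plane := {vert K (i + 1), vert K (i + 2)}

theorem vert_succ_ne (hK : K ∈ T.cells) (i : Fin 3) : vert K (i + 1) ≠ vert K (i + 2) :=
  fun h => (fin3_succ_ne i).2.2 (vertex_injective (T.detT_vert hK) h)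

theorem mid_edgeOf (hK : K ∈ T.cells) (i : Fin 3) : mid (edgeOf K i) = midT (vert K) i := by
  rw [mid, edgeOf, Finset.sum_pair (vert_succ_ne hK i), midT]
  module

theorem edgeOf_subset (hK : K ∈ T.cells) (i : Fin 3) : edgeOf K i ⊆ K := by
  intro x hx
  rw [edgeOf, Finset.mem_insert, Finset.mem_singleton] at hx
  rcases hx with rfl | rfl <;> exact T.vert_mem hK _

theorem edgeOf_mem (hK : K ∈ T.cells) (i : Fin 3) : edgeOf K i ∈ T.edges := by
  classical
  rw [Triangulation.edges, Finset.mem_biUnion]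
  refine ⟨K, hK, Finset.mem_powersetCard.2 ⟨edgeOf_subset hK i, ?_⟩⟩
  rw [edgeOf, Finset.card_pair (vert_succ_ne hK i)]

theorem exists_eq_edgeOf (hK : K ∈ T.cells) {e : Finset Plane} (he : e.card = 2) (heK : e ⊆ K) :
    ∃ i, e = edgeOf K i := by
  classical
  obtain ⟨a, b, hab, rfl⟩ := Finset.card_eq_two.1 he
  obtain ⟨k, rfl⟩ := T.exists_vert_eq hK (heK (Finset.mem_insert_self _ _))
  obtain ⟨l, rfl⟩ := T.exists_vert_eq hK (heK (Finset.mem_insert_of_mem (Finset.mem_singleton_self _)))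
  have hkl : k ≠ l := fun h => hab (by rw [h])
  have : ∃ i : Fin 3, (k = i + 1 ∧ l = i + 2) ∨ (l = i + 1 ∧ k = i + 2) := by
    clear hab he heK
    revert k l
    decide
  obtain ⟨i, ⟨rfl, rfl⟩ | ⟨rfl, rfl⟩⟩ := this
  · exact ⟨i, by simp [edgeOf]⟩
  · exact ⟨i, by simp [edgeOf, Finset.pair_comm]⟩

theorem card_of_mem_edges {e : Finset Plane} (he : e ∈ T.edges) : e.card = 2 := by
  classical
  rw [Triangulation.edges, Finset.mem_biUnion] at he
  obtain ⟨K, hK, h⟩ := he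
  exact (Finset.mem_powersetCard.1 h).2

theorem exists_cell_of_mem_edges {e : Finset Plane} (he : e ∈ T.edges) :
    ∃ K ∈ T.cells, ∃ i, e = edgeOf K i := by
  classical
  have h2 := card_of_mem_edges he
  rw [Triangulation.edges, Finset.mem_biUnion] at he
  obtain ⟨K, hK, h⟩ := he
  exact ⟨K, hK, exists_eq_edgeOf hK h2 (Finset.mem_powersetCard.1 h).1⟩

theorem edgeOf_mem_intEdges (hK : K ∈ T.cells) {i : Fin 3} :
    edgeOf K i ∈ T.intEdges ↔ midT (vert K) i ∈ Ω := by
  classical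
  rw [Triangulation.intEdges, Finset.mem_filter, mid_edgeOf hK, and_iff_right (edgeOf_mem hK i)]

theorem inner_norT (t : Fin 3 → Plane) (i : Fin 3) :
    inner ℝ (norT t i) (t (i + 1) - t (i + 2)) = 0 := by
  simp [norT, PiLp.inner_apply, Fin.sum_univ_two]
  ring

theorem isNormal_norT (K : Finset Plane) (i : Fin 3) :
    IsNormal (edgeOf K i) (norT (vert K) i) := by
  have h := inner_norT (vert K) i
  intro a ha b hb
  rw [edgeOf, Finset.mem_insert, Finset.mem_singleton] at ha hb
  rcases ha with rfl | rfl <;> rcases hb with rfl | rfl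
  · simp
  · exact h
  · rw [← neg_sub, inner_neg_right, h, neg_zero]
  · simp

/-- Normals of an edge are multiples of each other. -/
theorem IsNormal.eq_smul (hK : K ∈ T.cells) {i : Fin 3} {n : Plane}
    (hn : IsNormal (edgeOf K i) n) : ∃ c : ℝ, n = c • norT (vert K) i := by
  have h1 := hn (vert K (i + 1)) (by simp [edgeOf]) (vert K (i + 2)) (by simp [edgeOf])
  have h2 : ‖vert K (i + 1) - vert K (i + 2)‖ ^ 2 ≠ 0 :=
    pow_ne_zero 2 (norm_ne_zero_iff.2 (sub_ne_zero.2 (vert_succ_ne hK i)))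
  rw [norm_sq_plane] at h2
  obtain ⟨d, hd⟩ : ∃ d, d = vert K (i + 1) - vert K (i + 2) := ⟨_, rfl⟩
  have hN : norT (vert K) i = !₂[d 1, - d 0] := by
    rw [hd]; refine plane_ext ?_ ?_ <;> simp [norT]
  rw [← hd] at h1 h2
  rw [hN]
  simp only [PiLp.inner_apply, Fin.sum_univ_two, RCLike.inner_apply, conj_trivial] at h1
  refine ⟨(n 0 * d 1 - n 1 * d 0) / (d 0 ^ 2 + d 1 ^ 2), plane_ext ?_ ?_⟩
  · simp only [PiLp.smul_apply, smul_eq_mul, Matrix.cons_val_zero]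
    field_simp
    linear_combination d 0 * h1
  · simp
    field_simp
    linear_combination d 1 * h1

theorem HCTPieces.isHCT (hb : Bornology.IsBounded Ω) {w : Plane → ℝ}
    {P : Finset Plane → Fin 3 → Poly} (h : HCTPieces T w P) : IsHCT T w := by
  obtain ⟨M, hM⟩ := h.c11
  refine ⟨exists_H20_of_isC11 T.isOpen hb hM h.off h.off', h.off, fun K hK =>
    ⟨hM.contDiff.contDiffOn, fun a ha => ?_⟩⟩
  obtain ⟨i, rfl⟩ := T.exists_vert_eq hK ha
  rw [T.subTri_eq hK]
  exact ⟨P K i, (h.loc K hK).deg i, h.val K hK i⟩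

/-- A boundary point of a triangle is a vertex or lies in an open edge. -/
theorem vertex_or_openEdge (hK : K ∈ T.cells) {x : Plane} (hx : x ∈ hull K) {i : Fin 3}
    (hi : lam (vert K) i x = 0) : (∃ k, k ≠ i ∧ x = vert K k) ∨ x ∈ Triangulation.openEdge K i := by
  have hD := T.detT_vert hK
  have hx' := (T.mem_hull hK).1 hx
  by_cases h1 : lam (vert K) (i + 1) x = 0
  · refine Or.inl ⟨i + 2, (fin3_succ_ne i).2.1, ?_⟩
    have hs1 := sum_lam hD x
    rw [sum_fin3 i, hi, h1, zero_add, zero_add] at hs1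
    refine lam_ext hD fun j => ?_
    rw [lam_vertex hD]
    have hj : j = i ∨ j = i + 1 ∨ j = i + 2 := fin3_eq i j
    obtain ⟨n1, n2, n3⟩ := fin3_succ_ne i
    rcases hj with rfl | rfl | rfl
    · rw [hi, if_neg n2.symm]
    · rw [h1, if_neg n3]
    · rw [hs1, if_pos rfl]
  by_cases h2 : lam (vert K) (i + 2) x = 0
  · refine Or.inl ⟨i + 1, (fin3_succ_ne i).1, ?_⟩
    have hs1 := sum_lam hD x
    rw [sum_fin3 i, hi, h2, zero_add, add_zero] at hs1
    refine lam_ext hD fun j => ?_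
    rw [lam_vertex hD]
    have hj : j = i ∨ j = i + 1 ∨ j = i + 2 := fin3_eq i j
    obtain ⟨n1, n2, n3⟩ := fin3_succ_ne i
    rcases hj with rfl | rfl | rfl
    · rw [hi, if_neg n1.symm]
    · rw [hs1, if_pos rfl]
    · rw [h2, if_neg n3.symm]
  · exact Or.inr ⟨hi, lt_of_le_of_ne (hx' _) (Ne.symm h1), lt_of_le_of_ne (hx' _) (Ne.symm h2)⟩

theorem exists_lam_eq_zero (hK : K ∈ T.cells) {x : Plane} (hx : x ∈ hull K)
    (h : x ∉ Ω ∨ ∃ L ∈ T.cells, L ≠ K ∧ x ∈ hull L) : ∃ i, lam (vert K) i x = 0 := by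
  by_contra! hc
  have hpos : ∀ i, 0 < lam (vert K) i x := fun i =>
    lt_of_le_of_ne ((T.mem_hull hK).1 hx i) (hc i).symm
  rcases h with h | ⟨L, hL, hLK, hxL⟩
  · refine h (T.interior_hull_subset hK ?_)
    rw [T.hull_eq_tri hK]; exact mem_interior_tri (T.detT_vert hK) hpos
  · exact hLK (T.eq_of_lam_pos hK hL hxL hpos).symm

theorem vert_mem_subTri (hK : K ∈ T.cells) {i k : Fin 3} (h : k ≠ i) :
    vert K k ∈ tri (subTri (vert K) i) := by
  have := mem_tri_sub_ray (T.detT_vert hK) h (le_refl (0 : ℝ)) zero_le_one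
  simpa using this

theorem midT_mem_subTri (hK : K ∈ T.cells) (i : Fin 3) :
    midT (vert K) i ∈ tri (subTri (vert K) i) := by
  obtain ⟨h0, h1, h2⟩ := lam_midT (T.detT_vert hK) i
  refine (mem_tri_sub (T.detT_vert hK)).2 ⟨h0.ge, fun j => ?_⟩
  have hj : j = i ∨ j = i + 1 ∨ j = i + 2 := fin3_eq i j
  rw [h0]
  rcases hj with rfl | rfl | rfl
  · exact h0.ge
  · rw [h1]; norm_num
  · rw [h2]; norm_num

theorem mem_subTri_of_lam_eq_zero (hK : K ∈ T.cells) {i : Fin 3} {x : Plane} (hx : x ∈ hull K)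
    (hi : lam (vert K) i x = 0) : x ∈ tri (subTri (vert K) i) :=
  (mem_tri_sub (T.detT_vert hK)).2 ⟨hi.ge, fun j => hi.le.trans ((T.mem_hull hK).1 hx j)⟩

theorem eq_line_of_lam_eq_zero (hK : K ∈ T.cells) {i : Fin 3} {x : Plane}
    (hi : lam (vert K) i x = 0) :
    x = vert K (i + 1) + lam (vert K) (i + 2) x • (vert K (i + 2) - vert K (i + 1)) := by
  have := eq_smul_of_gl_eq_zero (T.detT_vert hK) (i := i) (n := x - vert K (i + 1))
    (by rw [gl_sub, hi, lam_ne (T.detT_vert hK) (fin3_succ_ne i).1.symm, sub_zero])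
  rw [gl_sub, lam_ne (T.detT_vert hK) (fin3_succ_ne i).2.2.symm, sub_zero] at this
  rw [← this]; abel

section Existence

variable (f : Plane → ℝ) (g : Plane → Plane →L[ℝ] ℝ) (q : Finset Plane → Plane →L[ℝ] ℝ)

/-- The local HCT interpolant of vertex values `f`, vertex gradients `g`, and normal derivatives
`q` at the edge midpoints. -/
def hctLoc (K : Finset Plane) : Fin 3 → Poly :=
  hctI (vert K) (fun k => f (vert K k)) (fun k => g (vert K k))
    (fun i => q (edgeOf K i) (norT (vert K) i))

variable {f g q}

theorem ev_hctLoc_vertex (hK : K ∈ T.cells) {i k : Fin 3} (h : k ≠ i) :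
    ev (hctLoc f g q K i) (vert K k) = f (vert K k) :=
  ev_hctI_vertex (T.detT_vert hK) _ _ _ h

theorem dirD_hctLoc_vertex (hK : K ∈ T.cells) {i k : Fin 3} (h : k ≠ i) (n : Plane) :
    dirD (hctLoc f g q K i) (vert K k) n = g (vert K k) n :=
  dirD_hctI_vertex (T.detT_vert hK) _ _ _ h n

theorem dirD_hctLoc_midT (hK : K ∈ T.cells) (i : Fin 3) {n : Plane}
    (hn : IsNormal (edgeOf K i) n) :
    dirD (hctLoc f g q K i) (midT (vert K) i) n = q (edgeOf K i) n := by
  obtain ⟨c, rfl⟩ := hn.eq_smul hK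
  rw [dirD_smul_right, map_smul, smul_eq_mul]
  congr 1
  exact dirD_hctI_midT (T.detT_vert hK) _ _ _ i

theorem hctLoc_localHCT (hK : K ∈ T.cells) : LocalHCT (vert K) (hctLoc f g q K) :=
  hctI_localHCT (T.detT_vert hK) _ _ _

/-- On a point of the boundary of `K` outside of `Ω` the local interpolant of data that vanish
outside of `Ω` vanishes. -/
theorem hctLoc_eq_zero_off (hf : ∀ x, x ∉ Ω → f x = 0) (hg : ∀ x, x ∉ Ω → g x = 0)
    (hq : ∀ e, mid e ∉ Ω → q e = 0) (hK : K ∈ T.cells) {x : Plane} {i : Fin 3}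
    (hx : x ∈ tri (subTri (vert K) i)) (hxΩ : x ∉ Ω) :
    ev (hctLoc f g q K i) x = 0 ∧ ∀ n, dirD (hctLoc f g q K i) x n = 0 := by
  have hD := T.detT_vert hK
  have hxK : x ∈ hull K := by rw [T.hull_eq_tri hK]; exact tri_sub_subset hD i hx
  have hloc := hctLoc_localHCT (f := f) (g := g) (q := q) hK
  obtain ⟨j, hj⟩ := exists_lam_eq_zero hK hxK (Or.inl hxΩ)
  have hxj := mem_subTri_of_lam_eq_zero hK hxK hj
  rw [hloc.val i j x hx hxj]
  simp only [hloc.grad i j x hx hxj]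
  rcases vertex_or_openEdge hK hxK hj with ⟨k, hk, rfl⟩ | hxo
  · simp [ev_hctLoc_vertex hK hk, dirD_hctLoc_vertex hK hk, hf _ hxΩ, hg _ hxΩ]
  · have hm : midT (vert K) j ∉ Ω := fun h =>
      hxΩ (T.openEdge_subset hK (T.midT_mem_openEdge hK j) h hxo)
    have hv : ∀ k, k ≠ j → vert K k ∉ Ω := fun k hk h => hm (T.midT_mem_of_vert_mem hK hk h)
    rw [eq_line_of_lam_eq_zero hK hj]
    refine dirD_edge_eq_zero hD (hloc.deg j) (fun k hk => ?_) (fun k hk n => ?_)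
      ⟨norT (vert K) j, gl_norT_ne hD j, ?_⟩ _
    · rw [ev_hctLoc_vertex hK hk, hf _ (hv k hk)]
    · rw [dirD_hctLoc_vertex hK hk, hg _ (hv k hk)]; rfl
    · rw [dirD_hctLoc_midT hK j (isNormal_norT K j), hq _ (by rwa [mid_edgeOf hK])]; rfl

theorem hctLoc_agree (hK : K ∈ T.cells) (hL : L ∈ T.cells) {x : Plane} {i j : Fin 3}
    (hx : x ∈ tri (subTri (vert K) i)) (hxL : x ∈ tri (subTri (vert L) j)) :
    ev (hctLoc f g q K i) x = ev (hctLoc f g q L j) x ∧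
      ∀ n, dirD (hctLoc f g q K i) x n = dirD (hctLoc f g q L j) x n := by
  have hlK := hctLoc_localHCT (f := f) (g := g) (q := q) hK
  have hlL := hctLoc_localHCT (f := f) (g := g) (q := q) hL
  by_cases hKL : L = K
  · subst hKL
    exact ⟨hlK.val i j x hx hxL, hlK.grad i j x hx hxL⟩
  have hD := T.detT_vert hK
  have hxK' : x ∈ hull K := by rw [T.hull_eq_tri hK]; exact tri_sub_subset hD i hx
  have hxL' : x ∈ hull L := by
    rw [T.hull_eq_tri hL]; exact tri_sub_subset (T.detT_vert hL) j hxL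
  obtain ⟨a, ha⟩ := exists_lam_eq_zero hK hxK' (Or.inr ⟨L, hL, hKL, hxL'⟩)
  have hxa := mem_subTri_of_lam_eq_zero hK hxK' ha
  rw [hlK.val i a x hx hxa]
  simp only [hlK.grad i a x hx hxa]
  have hvx : ∀ k, k ≠ a → ∀ l, vert L l = vert K k → ∀ b, b ≠ l →
      ev (hctLoc f g q K a) (vert K k) = ev (hctLoc f g q L b) (vert K k) ∧
      ∀ n, dirD (hctLoc f g q K a) (vert K k) n = dirD (hctLoc f g q L b) (vert K k) n := by
    intro k hk l hl b hb
    rw [ev_hctLoc_vertex hK hk, ← hl, ev_hctLoc_vertex hL hb.symm]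
    refine ⟨rfl, fun n => ?_⟩
    rw [hl, dirD_hctLoc_vertex hK hk, ← hl, dirD_hctLoc_vertex hL hb.symm]
  rcases vertex_or_openEdge hK hxK' ha with ⟨k, hk, rfl⟩ | hxo
  · have hkL : vert K k ∈ L := T.vert_mem_of_lam_ne hK hL hxK' hxL'
      (by rw [lam_self hD]; exact one_ne_zero)
    obtain ⟨l, hl⟩ := T.exists_vert_eq hL hkL
    obtain ⟨b, hb⟩ : ∃ b : Fin 3, b ≠ l := ⟨l + 1, (fin3_succ_ne l).1⟩
    have hxb : vert K k ∈ tri (subTri (vert L) b) := hl ▸ vert_mem_subTri hL hb.symm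
    rw [← hlL.val b j _ hxb hxL]
    simp only [← hlL.grad b j _ hxb hxL]
    exact hvx k hk l hl b hb
  · have h1 : vert K (a + 1) ∈ L := T.vert_mem_of_lam_ne hK hL hxK' hxL' hxo.2.1.ne'
    have h2 : vert K (a + 2) ∈ L := T.vert_mem_of_lam_ne hK hL hxK' hxL' hxo.2.2.ne'
    have hsub : edgeOf K a ⊆ L := by
      intro y hy
      rw [edgeOf, Finset.mem_insert, Finset.mem_singleton] at hy
      rcases hy with rfl | rfl <;> assumption
    obtain ⟨b, hb⟩ := exists_eq_edgeOf hL (card_of_mem_edges (edgeOf_mem hK a)) hsub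
    have hmid : midT (vert K) a = midT (vert L) b := by
      rw [← mid_edgeOf hK, hb, mid_edgeOf hL]
    have hline := eq_line_of_lam_eq_zero hK ha
    have hLv : ∀ k, k ≠ a → ∃ l, vert L l = vert K k ∧ b ≠ l := by
      intro k hk
      have hk' : vert K k ∈ edgeOf L b := by
        rw [← hb, edgeOf, Finset.mem_insert, Finset.mem_singleton]
        have : k = a + 1 ∨ k = a + 2 := by clear hb hline ha hxa hxo h1 h2 hsub hmid hvx; revert k a; decide
        rcases this with rfl | rfl <;> simp
      rw [edgeOf, Finset.mem_insert, Finset.mem_singleton] at hk'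
      rcases hk' with h | h
      · exact ⟨_, h.symm, (fin3_succ_ne b).1.symm⟩
      · exact ⟨_, h.symm, (fin3_succ_ne b).2.1.symm⟩
    have hxb : x ∈ tri (subTri (vert L) b) := by
      refine mem_subTri_of_lam_eq_zero hL hxL' ?_
      obtain ⟨l1, hl1, hb1⟩ := hLv (a + 1) (fin3_succ_ne a).1
      obtain ⟨l2, hl2, hb2⟩ := hLv (a + 2) (fin3_succ_ne a).2.1
      rw [hline, lam_line, ← hl1, ← hl2, lam_ne (T.detT_vert hL) hb1,
        lam_ne (T.detT_vert hL) hb2]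
      ring
    rw [← hlL.val b j _ hxb hxL]
    simp only [← hlL.grad b j _ hxb hxL]
    have := dirD_edge_eq_zero hD (p := hctLoc f g q K a - hctLoc f g q L b) (i := a)
      (Submodule.sub_mem _ (hlK.deg a) (hlL.deg b)) (fun k hk => ?_) (fun k hk n => ?_)
      ⟨norT (vert K) a, gl_norT_ne hD a, ?_⟩ (lam (vert K) (a + 2) x)
    · rw [← hline] at this
      simpa only [ev_sub, dirD_sub, sub_eq_zero] using this
    · obtain ⟨l, hl, hbl⟩ := hLv k hk
      rw [ev_sub, (hvx k hk l hl b hbl).1, sub_self]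
    · obtain ⟨l, hl, hbl⟩ := hLv k hk
      rw [dirD_sub, (hvx k hk l hl b hbl).2, sub_self]
    · rw [dirD_sub, dirD_hctLoc_midT hK a (isNormal_norT K a), hmid,
        dirD_hctLoc_midT hL b (hb ▸ isNormal_norT K a), hb, sub_self]

/-- Existence of HCT functions with given degrees of freedom. -/
theorem exists_hctPieces (T : Triangulation Ω) (hf : ∀ x, x ∉ Ω → f x = 0) (hg : ∀ x, x ∉ Ω → g x = 0)
    (hq : ∀ e, mid e ∉ Ω → q e = 0) : ∃ w, HCTPieces T w (hctLoc f g q) := by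
  classical
  have hex : ∀ x, ∃ (v : ℝ) (d : Plane →L[ℝ] ℝ), (x ∉ Ω → v = 0 ∧ d = 0) ∧
      ∀ K ∈ T.cells, ∀ i, x ∈ tri (subTri (vert K) i) →
        v = ev (hctLoc f g q K i) x ∧ d = gradP (hctLoc f g q K i) x := by
    intro x
    by_cases hx : x ∈ Ω
    · obtain ⟨K, hK, hxK⟩ := T.exists_cell hx
      rw [T.hull_eq_tri hK] at hxK
      obtain ⟨i, hi⟩ := exists_mem_tri_sub (T.detT_vert hK) hxK
      refine ⟨ev (hctLoc f g q K i) x, gradP (hctLoc f g q K i) x, fun h => absurd hx h,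
        fun L hL j hj => ?_⟩
      obtain ⟨h1, h2⟩ := hctLoc_agree (f := f) (g := g) (q := q) hK hL hi hj
      exact ⟨h1, ContinuousLinearMap.ext fun n => by rw [gradP_apply, gradP_apply, h2]⟩
    · refine ⟨0, 0, fun _ => ⟨rfl, rfl⟩, fun K hK i hi => ?_⟩
      obtain ⟨h1, h2⟩ := hctLoc_eq_zero_off hf hg hq hK hi hx
      exact ⟨h1.symm, ContinuousLinearMap.ext fun n => by rw [gradP_apply, h2]; rfl⟩
  choose w d h0 hwd using hex
  have hM : ∀ a : T.cells × Fin 3, ∃ M, 0 ≤ M ∧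
      ∀ x ∈ tri (subTri (vert a.1.1) a.2), ∀ y ∈ tri (subTri (vert a.1.1) a.2),
      |w y - w x - d x (y - x)| ≤ M * ‖y - x‖ ^ 2 ∧ ‖d y - d x‖ ≤ M * ‖y - x‖ := by
    rintro ⟨⟨K, hK⟩, i⟩
    obtain ⟨M, hM0, hM⟩ := exists_taylor_of_contDiff (ev_contDiff (hctLoc f g q K i))
      (tri_isCompact (subTri (vert K) i)) (tri_convex _)
    refine ⟨M, hM0, fun x hx y hy => ?_⟩
    rw [(hwd x K hK i hx).1, (hwd x K hK i hx).2, (hwd y K hK i hy).1, (hwd y K hK i hy).2,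
      ← fderiv_ev, ← fderiv_ev]
    exact hM x hx y hy
  choose M hM0 hM using hM
  have hle : ∀ a, M a ≤ ∑ a, M a := fun a =>
    Finset.single_le_sum (f := M) (fun _ _ => hM0 _) (Finset.mem_univ a)
  obtain ⟨hC, hd⟩ := isC11_of_pieces (w := w) (g := d) (M := ∑ a, M a)
    (S := fun a : Option (T.cells × Fin 3) => a.elim Ωᶜ fun a => tri (subTri (vert a.1.1) a.2))
    (by
      rintro (_ | a)
      · exact T.isOpen.isClosed_compl
      · exact (tri_isCompact _).isClosed)
    (by
      intro x
      by_cases hx : x ∈ Ω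
      · obtain ⟨K, hK, hxK⟩ := T.exists_cell hx
        rw [T.hull_eq_tri hK] at hxK
        obtain ⟨i, hi⟩ := exists_mem_tri_sub (T.detT_vert hK) hxK
        exact ⟨some (⟨K, hK⟩, i), hi⟩
      · exact ⟨none, hx⟩)
    (by
      rintro (_ | a) x hx y hy
      · rw [(h0 x hx).1, (h0 x hx).2, (h0 y hy).1]
        simpa using mul_nonneg (Finset.sum_nonneg fun a _ => hM0 a) (sq_nonneg ‖y - x‖)
      · exact (hM a x hx y hy).1.trans (by gcongr; exact hle a))
    (by
      rintro (_ | a) x hx y hy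
      · rw [(h0 x hx).2, (h0 y hy).2]
        simpa using mul_nonneg (Finset.sum_nonneg fun a _ => hM0 a) (norm_nonneg (y - x))
      · exact (hM a x hx y hy).2.trans (by gcongr; exact hle a))
  refine ⟨w, fun x hx => (h0 x hx).1, fun x hx => by rw [hd, (h0 x hx).2], ⟨_, hC⟩,
    fun K hK => hctLoc_localHCT hK, fun K hK i x hx => (hwd x K hK i hx).1,
    fun K hK i x hx => by rw [hd, (hwd x K hK i hx).2]⟩

end Existence

end MorleyUC
end

noncomputable section

open MeasureTheory Set Filter Topology
namespace MorleyUC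

variable {Ω : Set Plane} {T : Triangulation Ω} {K L : Finset Plane}
  {w w' : Plane → ℝ} {P P' : Finset Plane → Fin 3 → Poly}

theorem avg_congr {a b : Plane} {f g : Plane → ℝ}
    (h : ∀ τ ∈ Icc (0 : ℝ) 1, f (a + τ • (b - a)) = g (a + τ • (b - a))) :
    avg a b f = avg a b g := by
  refine intervalIntegral.integral_congr fun τ hτ => ?_
  rw [uIcc_of_le zero_le_one] at hτ
  exact h τ hτ

theorem avg_const_mul (a b : Plane) (c : ℝ) (f : Plane → ℝ) :
    avg a b (fun x => c * f x) = c * avg a b f :=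
  intervalIntegral.integral_const_mul c _

theorem avg_add {f g : Plane → ℝ} (hf : Continuous f) (hg : Continuous g) (a b : Plane) :
    avg a b (fun x => f x + g x) = avg a b f + avg a b g :=
  intervalIntegral.integral_add (Continuous.intervalIntegrable (by fun_prop) _ _)
    (Continuous.intervalIntegrable (by fun_prop) _ _)

theorem segInt_eq (a b : Plane) (f : Plane → ℝ) : segInt a b f = ‖b - a‖ * avg a b f := by
  rw [segInt, avg]
  congr 2
  funext τ
  rw [AffineMap.lineMap_apply, vsub_eq_sub, vadd_eq_add, add_comm]

theorem edge_point_mem_subTri (hK : K ∈ T.cells) (i : Fin 3) {τ : ℝ} (hτ : τ ∈ Icc (0 : ℝ) 1) :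
    vert K (i + 1) + τ • (vert K (i + 2) - vert K (i + 1)) ∈ tri (subTri (vert K) i) := by
  obtain ⟨n1, n2, _⟩ := fin3_succ_ne i
  exact (tri_convex _).add_smul_sub_mem (vert_mem_subTri hK n1) (vert_mem_subTri hK n2) hτ

theorem avg_dirD_simpson {p : Poly} (hp : p ∈ Deg 3) (t : Fin 3 → Plane) (i : Fin 3) (n : Plane) :
    avg (t (i + 1)) (t (i + 2)) (fun x => dirD p x n) =
      (dirD p (t (i + 1)) n + 4 * dirD p (midT t i) n + dirD p (t (i + 2)) n) / 6 := by
  simp only [← ev_dP]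
  exact avg_simpson (dP_mem_Deg hp n) _ _

theorem avg_dirD_mid {p : Poly} (hp : p ∈ Deg 2) (t : Fin 3 → Plane) (i : Fin 3) (n : Plane) :
    avg (t (i + 1)) (t (i + 2)) (fun x => dirD p x n) = dirD p (midT t i) n := by
  simp only [← ev_dP]
  exact avg_mid (dP_mem_Deg hp n) _ _

namespace HCTPieces

theorem continuous_fderiv (h : HCTPieces T w P) (n : Plane) :
    Continuous fun x => fderiv ℝ w x n := by
  obtain ⟨M, hM⟩ := h.c11
  exact hM.continuous_fderiv.clm_apply continuous_const

theorem grad_apply (h : HCTPieces T w P) (hK : K ∈ T.cells) {i : Fin 3} {x : Plane}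
    (hx : x ∈ tri (subTri (vert K) i)) (n : Plane) : fderiv ℝ w x n = dirD (P K i) x n := by
  rw [h.grad K hK i x hx, gradP_apply]

theorem avg_eq (h : HCTPieces T w P) (hK : K ∈ T.cells) (i : Fin 3) (n : Plane) :
    avg (vert K (i + 1)) (vert K (i + 2)) (fun x => fderiv ℝ w x n) =
      avg (vert K (i + 1)) (vert K (i + 2)) (fun x => dirD (P K i) x n) :=
  avg_congr fun _ hτ => h.grad_apply hK (edge_point_mem_subTri hK i hτ) n

theorem simpson (h : HCTPieces T w P) (hK : K ∈ T.cells) (i : Fin 3) (n : Plane) :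
    avg (vert K (i + 1)) (vert K (i + 2)) (fun x => fderiv ℝ w x n) =
      (fderiv ℝ w (vert K (i + 1)) n + 4 * fderiv ℝ w (midT (vert K) i) n +
        fderiv ℝ w (vert K (i + 2)) n) / 6 := by
  obtain ⟨n1, n2, _⟩ := fin3_succ_ne i
  rw [h.avg_eq hK, avg_dirD_simpson ((h.loc K hK).deg i), h.grad_apply hK (vert_mem_subTri hK n1),
    h.grad_apply hK (vert_mem_subTri hK n2), h.grad_apply hK (midT_mem_subTri hK i)]

/-- An HCT function is determined by its degrees of freedom. -/
theorem eq_zero (h : HCTPieces T w P)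
    (hv : ∀ K ∈ T.cells, ∀ k, vert K k ∈ Ω → w (vert K k) = 0 ∧ fderiv ℝ w (vert K k) = 0)
    (hm : ∀ K ∈ T.cells, ∀ i, midT (vert K) i ∈ Ω →
      fderiv ℝ w (midT (vert K) i) (norT (vert K) i) = 0) (x : Plane) : w x = 0 := by
  by_cases hx : x ∈ Ω
  swap
  · exact h.off x hx
  obtain ⟨K, hK, hxK⟩ := T.exists_cell hx
  have hD := T.detT_vert hK
  rw [T.hull_eq_tri hK] at hxK
  obtain ⟨i, hi⟩ := exists_mem_tri_sub hD hxK
  have hv' : ∀ k, w (vert K k) = 0 ∧ fderiv ℝ w (vert K k) = 0 := fun k => by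
    by_cases hk : vert K k ∈ Ω
    · exact hv K hK k hk
    · exact ⟨h.off _ hk, h.off' _ hk⟩
  rw [h.val K hK i x hi, (h.loc K hK).eq_zero hD, ev_zero]
  · intro i k hk
    rw [← h.val K hK i _ (vert_mem_subTri hK hk), (hv' k).1]
  · intro i k hk n
    rw [← h.grad_apply hK (vert_mem_subTri hK hk), (hv' k).2]; rfl
  · intro i
    refine ⟨norT (vert K) i, gl_norT_ne hD i, ?_⟩
    rw [← h.grad_apply hK (midT_mem_subTri hK i)]
    by_cases hi : midT (vert K) i ∈ Ω
    · exact hm K hK i hi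
    · rw [h.off' _ hi]; rfl

theorem differentiable (h : HCTPieces T w P) : Differentiable ℝ w := by
  obtain ⟨M, hM⟩ := h.c11
  exact hM.1

theorem fderiv_add_smul (h : HCTPieces T w P) (h' : HCTPieces T w' P') (c : ℝ) (x : Plane) :
    fderiv ℝ (fun x => w x + c * w' x) x = fderiv ℝ w x + c • fderiv ℝ w' x :=
  ((h.differentiable x).hasFDerivAt.add ((h'.differentiable x).hasFDerivAt.const_mul c)).fderiv

theorem add_smul (h : HCTPieces T w P) (h' : HCTPieces T w' P') (c : ℝ) :
    HCTPieces T (fun x => w x + c * w' x) (fun K i => P K i + c • P' K i) := by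
  have hd := fderiv_add_smul h h' c
  obtain ⟨M, hM⟩ := h.c11
  obtain ⟨M', hM'⟩ := h'.c11
  refine ⟨fun x hx => by rw [h.off x hx, h'.off x hx]; ring,
    fun x hx => by rw [hd, h.off' x hx, h'.off' x hx]; simp,
    ⟨M + |c| * M', hM.1.add (hM'.1.const_mul c), fun x y => ?_⟩, fun K hK =>
    ⟨fun i => Submodule.add_mem _ ((h.loc K hK).deg i)
      (Submodule.smul_mem _ c ((h'.loc K hK).deg i)), fun i j x hi hj => ?_,
      fun i j x hi hj n => ?_⟩, fun K hK i x hx => ?_, fun K hK i x hx => ?_⟩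
  · rw [hd, hd, show fderiv ℝ w x + c • fderiv ℝ w' x - (fderiv ℝ w y + c • fderiv ℝ w' y) =
      (fderiv ℝ w x - fderiv ℝ w y) + c • (fderiv ℝ w' x - fderiv ℝ w' y) by module]
    refine (norm_add_le _ _).trans ?_
    rw [norm_smul, Real.norm_eq_abs, add_mul, mul_assoc]
    gcongr
    · exact hM.2 x y
    · exact hM'.2 x y
  · simp only [ev_add, ev_smul, (h.loc K hK).val i j x hi hj, (h'.loc K hK).val i j x hi hj]
  · simp only [dirD_add, dirD_smul, (h.loc K hK).grad i j x hi hj, (h'.loc K hK).grad i j x hi hj]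
  · rw [h.val K hK i x hx, h'.val K hK i x hx, ev_add, ev_smul]
  · rw [hd]
    ext n
    simp [h.grad_apply hK hx, h'.grad_apply hK hx, gradP_apply, dirD_add, dirD_smul]

theorem add_sum (h : HCTPieces T w P) {ι : Type*} (S : Finset ι) {b : ι → Plane → ℝ}
    (hb : ∀ e ∈ S, ∃ Q, HCTPieces T (b e) Q) (c : ι → ℝ) :
    (∃ Q, HCTPieces T (fun x => w x + ∑ e ∈ S, c e * b e x) Q) ∧
      ∀ x, fderiv ℝ (fun x => w x + ∑ e ∈ S, c e * b e x) x =
        fderiv ℝ w x + ∑ e ∈ S, c e • fderiv ℝ (b e) x := by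
  classical
  induction S using Finset.induction_on with
  | empty => simpa using ⟨_, h⟩
  | insert a S ha ih =>
    obtain ⟨⟨Q, hQ⟩, hd⟩ := ih fun e he => hb e (Finset.mem_insert_of_mem he)
    obtain ⟨R, hR⟩ := hb a (Finset.mem_insert_self _ _)
    have e1 : (fun x => w x + ∑ e ∈ insert a S, c e * b e x) =
        fun x => (w x + ∑ e ∈ S, c e * b e x) + c a * b a x := by
      funext x; rw [Finset.sum_insert ha]; ring
    rw [e1]
    refine ⟨⟨_, hQ.add_smul hR (c a)⟩, fun x => ?_⟩
    rw [fderiv_add_smul hQ hR, hd, Finset.sum_insert ha]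
    abel

end HCTPieces

/-- The properties that characterize the function `E v`. -/
structure IsCompanionFn (T : Triangulation Ω) (sel : Plane → Finset Plane) (v : Morley T)
    (w : Plane → ℝ) : Prop where
  pieces : ∃ P, HCTPieces T w P
  vertex : ∀ K ∈ T.cells, ∀ k, vert K k ∈ Ω → w (vert K k) = ev (v.1 K) (vert K k) ∧
    ∀ n, fderiv ℝ w (vert K k) n = dirD (v.1 (sel (vert K k))) (vert K k) n
  edge : ∀ K ∈ T.cells, ∀ i, midT (vert K) i ∈ Ω →
    avg (vert K (i + 1)) (vert K (i + 2)) (fun x => fderiv ℝ w x (norT (vert K) i)) =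
      dirD (v.1 K) (midT (vert K) i) (norT (vert K) i)

namespace IsCompanionFn

variable {sel : Plane → Finset Plane} {v v' : Morley T}

theorem add_smul (h : IsCompanionFn T sel v w) (h' : IsCompanionFn T sel v' w') (c : ℝ) :
    IsCompanionFn T sel (v + c • v') (fun x => w x + c * w' x) := by
  obtain ⟨P, hP⟩ := h.pieces
  obtain ⟨P', hP'⟩ := h'.pieces
  have hd := HCTPieces.fderiv_add_smul hP hP' c
  refine ⟨⟨_, hP.add_smul hP' c⟩, fun K hK k hk => ⟨?_, fun n => ?_⟩, fun K hK i hi => ?_⟩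
  · rw [(h.vertex K hK k hk).1, (h'.vertex K hK k hk).1]
    simp [ev_add, ev_smul]
  · rw [hd]
    simp [(h.vertex K hK k hk).2, (h'.vertex K hK k hk).2, dirD_add, dirD_smul]
  · simp only [hd, add_apply, smul_apply, smul_eq_mul]
    rw [avg_add (hP.continuous_fderiv _) ((hP'.continuous_fderiv _).const_mul c), avg_const_mul,
      h.edge K hK i hi, h'.edge K hK i hi]
    simp [dirD_add, dirD_smul]

theorem eq_zero (h : IsCompanionFn T sel 0 w) (x : Plane) : w x = 0 := by
  obtain ⟨P, hP⟩ := h.pieces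
  have hv : ∀ K ∈ T.cells, ∀ k, vert K k ∈ Ω → w (vert K k) = 0 ∧ fderiv ℝ w (vert K k) = 0 := by
    intro K hK k hk
    obtain ⟨h1, h2⟩ := h.vertex K hK k hk
    refine ⟨by simpa [ev_zero] using h1, ContinuousLinearMap.ext fun n => ?_⟩
    simpa [dirD_zero] using h2 n
  refine hP.eq_zero hv (fun K hK i hi => ?_) x
  have h1 := h.edge K hK i hi
  have hv' : ∀ k, fderiv ℝ w (vert K k) = 0 := fun k => by
    by_cases hk : vert K k ∈ Ω
    · exact (hv K hK k hk).2
    · exact hP.off' _ hk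
  rw [hP.simpson hK, hv', hv'] at h1
  simp [dirD_zero] at h1
  exact h1

theorem unique (h : IsCompanionFn T sel v w) (h' : IsCompanionFn T sel v w') : w = w' := by
  have := h.add_smul h' (-1)
  rw [show v + (-1 : ℝ) • v = 0 by module] at this
  funext x
  linarith [this.eq_zero x]

end IsCompanionFn

namespace MorleyMem

variable (v : Morley T)

theorem deg (K : Finset Plane) : v.1 K ∈ Deg 2 := v.2.2.1 K

theorem val_eq (hK : K ∈ T.cells) (hL : L ∈ T.cells) {ν : Plane} (h1 : ν ∈ K) (h2 : ν ∈ L) :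
    ev (v.1 K) ν = ev (v.1 L) ν := v.2.2.2.1 K hK L hL ν h1 h2

theorem val_off (hK : K ∈ T.cells) {ν : Plane} (h1 : ν ∈ K) (h2 : ν ∉ Ω) :
    ev (v.1 K) ν = 0 := v.2.2.2.2.1 K hK ν h1 h2

theorem normal_eq (hK : K ∈ T.cells) (hL : L ∈ T.cells) {e : Finset Plane} (he : e ∈ T.edges)
    (h1 : e ⊆ K) (h2 : e ⊆ L) {n : Plane} (hn : IsNormal e n) :
    dirD (v.1 K) (mid e) n = dirD (v.1 L) (mid e) n := v.2.2.2.2.2.1 K hK L hL e he h1 h2 n hn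

theorem normal_off (hK : K ∈ T.cells) {i : Fin 3} (h : midT (vert K) i ∉ Ω) {n : Plane}
    (hn : IsNormal (edgeOf K i) n) : dirD (v.1 K) (midT (vert K) i) n = 0 := by
  rw [← mid_edgeOf hK]
  exact v.2.2.2.2.2.2 K hK _ (edgeOf_mem hK i) (edgeOf_subset hK i)
    (fun h' => h ((edgeOf_mem_intEdges hK).1 h')) n hn

end MorleyMem

theorem mem_edges_of_mem_intEdges {e : Finset Plane} (he : e ∈ T.intEdges) :
    e ∈ T.edges ∧ mid e ∈ Ω := by
  classical
  exact Finset.mem_filter.1 he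

theorem exists_preCompanion (hb : Bornology.IsBounded Ω) {sel : Plane → Finset Plane}
    (hsel : T.IsSelection sel) (v : Morley T) : ∃ w, IsPreCompanion T sel v w := by
  classical
  have hcell : ∀ e : Finset Plane, ∃ K, e ∈ T.edges → K ∈ T.cells ∧ e ⊆ K := by
    intro e
    by_cases he : e ∈ T.edges
    · obtain ⟨K, hK, i, rfl⟩ := exists_cell_of_mem_edges he
      exact ⟨K, fun _ => ⟨hK, edgeOf_subset hK i⟩⟩
    · exact ⟨∅, fun h => absurd h he⟩
  choose cell hcell using hcell
  obtain ⟨w, hw⟩ := exists_hctPieces T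
    (f := fun x => if x ∈ Ω then ev (v.1 (sel x)) x else 0)
    (g := fun x => if x ∈ Ω then gradP (v.1 (sel x)) x else 0)
    (q := fun e => if mid e ∈ Ω then gradP (v.1 (cell e)) (mid e) else 0)
    (fun x hx => if_neg hx) (fun x hx => if_neg hx) (fun e he => if_neg he)
  refine ⟨w, hw.isHCT hb, fun K hK ν hν hνΩ => ?_, fun K hK e he heK n hn => ?_⟩
  · obtain ⟨k, rfl⟩ := T.exists_vert_eq hK hν
    have hm := vert_mem_subTri hK (fin3_succ_ne k).1.symm
    obtain ⟨h1, h2⟩ := hsel K hK _ hν hνΩ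
    constructor
    · rw [hw.val K hK _ _ hm, ev_hctLoc_vertex hK (fin3_succ_ne k).1.symm]
      rw [if_pos hνΩ, MorleyMem.val_eq v h1 hK h2 hν]
    · intro n
      rw [hw.grad_apply hK hm, dirD_hctLoc_vertex hK (fin3_succ_ne k).1.symm]
      rw [if_pos hνΩ, gradP_apply]
  · obtain ⟨heE, hm⟩ := mem_edges_of_mem_intEdges he
    obtain ⟨i, rfl⟩ := exists_eq_edgeOf hK (card_of_mem_edges heE) heK
    obtain ⟨h1, h2⟩ := hcell _ heE
    have h3 := hw.grad_apply hK (midT_mem_subTri hK i) n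
    rw [dirD_hctLoc_midT hK i hn] at h3
    rw [if_pos hm, gradP_apply, MorleyMem.normal_eq v h1 hK heE h2 heK hn] at h3
    rw [mid_edgeOf hK] at h3 ⊢
    exact h3

theorem exists_edgeBasis (hb : Bornology.IsBounded Ω) {n : Finset Plane → Plane}
    (hn : T.IsNormalField n) {e : Finset Plane} (he : e ∈ T.intEdges) :
    ∃ b, IsEdgeBasis T n e b := by
  classical
  obtain ⟨heE, hm⟩ := mem_edges_of_mem_intEdges he
  obtain ⟨w, hw⟩ := exists_hctPieces T (f := fun _ => 0) (g := fun _ => 0)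
    (q := fun e' => if e' = e then innerSL ℝ (n e) else 0)
    (fun _ _ => rfl) (fun _ _ => rfl) (fun e' he' => if_neg (by rintro rfl; exact he' hm))
  refine ⟨w, hw.isHCT hb, fun K hK ν hν _ => ?_, fun e' he' => ?_⟩
  · obtain ⟨k, rfl⟩ := T.exists_vert_eq hK hν
    have hm := vert_mem_subTri hK (fin3_succ_ne k).1.symm
    refine ⟨by rw [hw.val K hK _ _ hm, ev_hctLoc_vertex hK (fin3_succ_ne k).1.symm], ?_⟩
    ext n
    rw [hw.grad_apply hK hm, dirD_hctLoc_vertex hK (fin3_succ_ne k).1.symm]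
  · obtain ⟨heE', hm'⟩ := mem_edges_of_mem_intEdges he'
    obtain ⟨K, hK, i, rfl⟩ := exists_cell_of_mem_edges heE'
    have h3 := hw.grad_apply hK (midT_mem_subTri hK i) (n (edgeOf K i))
    rw [dirD_hctLoc_midT hK i (hn _ heE').2] at h3
    rw [mid_edgeOf hK, h3]
    split_ifs with h
    · rw [← h, innerSL_apply_apply, real_inner_self_eq_norm_sq, (hn _ heE').1]; norm_num
    · rfl

theorem coe_edgeOf (K : Finset Plane) (i : Fin 3) :
    (edgeOf K i : Set Plane) = {vert K (i + 1), vert K (i + 2)} := by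
  simp [edgeOf]

/-- The value of the quotient of line integrals in the definition of the companion operator. -/
theorem segInt_div_segInt (hK : K ∈ T.cells) (i : Fin 3) {p q : Plane}
    (h : (edgeOf K i : Set Plane) = {p, q}) (f g : Plane → ℝ) :
    segInt p q f / segInt p q g = avg (vert K (i + 1)) (vert K (i + 2)) f /
      avg (vert K (i + 1)) (vert K (i + 2)) g := by
  have hne : ‖vert K (i + 2) - vert K (i + 1)‖ ≠ 0 :=
    norm_ne_zero_iff.2 (sub_ne_zero.2 (vert_succ_ne hK i).symm)
  rw [coe_edgeOf, pair_eq_pair_iff] at h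
  rcases h with ⟨rfl, rfl⟩ | ⟨rfl, rfl⟩
  · rw [segInt_eq, segInt_eq, mul_div_mul_left _ _ hne]
  · rw [segInt_eq, segInt_eq, norm_sub_rev, mul_div_mul_left _ _ hne, avg_comm, avg_comm _ _ g]

theorem IsEdgeBasis.avg_eq (hb : Bornology.IsBounded Ω) {n : Finset Plane → Plane}
    {e : Finset Plane} {b : Plane → ℝ} (h : IsEdgeBasis T n e b) (hK : K ∈ T.cells) {i : Fin 3}
    (hi : edgeOf K i ∈ T.intEdges) [Decidable (edgeOf K i = e)] :
    avg (vert K (i + 1)) (vert K (i + 2)) (fun x => fderiv ℝ b x (n (edgeOf K i))) =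
      if edgeOf K i = e then 2 / 3 else 0 := by
  obtain ⟨P, hP⟩ := h.1.exists_pieces hb
  have hv : ∀ k, fderiv ℝ b (vert K k) = 0 := fun k => by
    by_cases hk : vert K k ∈ Ω
    · exact (h.2.1 K hK _ (T.vert_mem hK k) hk).2
    · exact hP.off' _ hk
  have h2 := h.2.2 _ hi
  rw [mid_edgeOf hK] at h2
  rw [hP.simpson hK, hv, hv, h2]
  split_ifs <;> simp
  norm_num

section Companion

variable {n : Finset Plane → Plane} {sel : Plane → Finset Plane}

theorem isCompanionFn_of (hb : Bornology.IsBounded Ω) (hn : T.IsNormalField n)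
    {v : Morley T} {Et : Plane → ℝ}
    {b : Finset Plane → Plane → ℝ} {c : Finset Plane → ℝ} (hEt : IsPreCompanion T sel v Et)
    (hbe : ∀ e ∈ T.intEdges, IsEdgeBasis T n e (b e))
    (hc : ∀ e ∈ T.intEdges, ∀ K ∈ T.cells, e ⊆ K → ∀ p q, (e : Set Plane) = {p, q} →
      c e = segInt p q (fun x => dirD (v.1 K) x (n e) - fderiv ℝ Et x (n e)) /
        segInt p q (fun x => fderiv ℝ (b e) x (n e))) :
    IsCompanionFn T sel v (fun x => Et x + ∑ e ∈ T.intEdges, c e * b e x) := by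
  classical
  obtain ⟨P, hP⟩ := hEt.1.exists_pieces hb
  have hbp : ∀ e ∈ T.intEdges, ∃ Q, HCTPieces T (b e) Q := fun e he =>
    (hbe e he).1.exists_pieces hb
  obtain ⟨hQ, hd⟩ := hP.add_sum T.intEdges hbp c
  refine ⟨hQ, fun K hK k hk => ⟨?_, fun m => ?_⟩, fun K hK i hi => ?_⟩
  · rw [(hEt.2.1 K hK _ (T.vert_mem hK k) hk).1, Finset.sum_eq_zero, add_zero]
    intro e he
    rw [((hbe e he).2.1 K hK _ (T.vert_mem hK k) hk).1, mul_zero]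
  · rw [hd, Finset.sum_eq_zero, add_zero, (hEt.2.1 K hK _ (T.vert_mem hK k) hk).2]
    intro e he
    rw [((hbe e he).2.1 K hK _ (T.vert_mem hK k) hk).2, smul_zero]
  · have hie := (edgeOf_mem_intEdges hK).2 hi
    obtain ⟨heE, hm⟩ := mem_edges_of_mem_intEdges hie
    obtain ⟨h1, hnor⟩ := hn _ heE
    obtain ⟨s, hs⟩ := hnor.eq_smul hK
    have hs0 : s ≠ 0 := by
      rintro rfl
      rw [zero_smul] at hs
      rw [hs, norm_zero] at h1
      exact zero_ne_one h1
    have key : avg (vert K (i + 1)) (vert K (i + 2)) (fun x =>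
        fderiv ℝ (fun x => Et x + ∑ e ∈ T.intEdges, c e * b e x) x (n (edgeOf K i))) =
        dirD (v.1 K) (midT (vert K) i) (n (edgeOf K i)) := by
      have hsum : avg (vert K (i + 1)) (vert K (i + 2)) (fun x =>
          ∑ e ∈ T.intEdges, c e * fderiv ℝ (b e) x (n (edgeOf K i))) =
          c (edgeOf K i) * (2 / 3) := by
        rw [avg, intervalIntegral.integral_finsetSum]
        · change ∑ e ∈ T.intEdges, avg (vert K (i + 1)) (vert K (i + 2))
            (fun x => c e * fderiv ℝ (b e) x (n (edgeOf K i))) = _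
          rw [Finset.sum_eq_single (edgeOf K i)]
          · rw [avg_const_mul, (hbe _ hie).avg_eq hb hK hie, if_pos rfl]
          · intro e he hne
            rw [avg_const_mul, (hbe _ he).avg_eq hb hK hie, if_neg (Ne.symm hne), mul_zero]
          · exact fun h => absurd hie h
        · intro e he
          obtain ⟨Q, hQ⟩ := hbp e he
          have := hQ.continuous_fderiv (n (edgeOf K i))
          exact Continuous.intervalIntegrable (by fun_prop) _ _
      have hcont : Continuous fun x => ∑ e ∈ T.intEdges, c e * fderiv ℝ (b e) x (n (edgeOf K i)) := by
        refine continuous_finsetSum _ fun e he => ?_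
        obtain ⟨Q, hQ⟩ := hbp e he
        exact (hQ.continuous_fderiv _).const_mul _
      simp only [hd, add_apply, FunLike.coe_sum, Finset.sum_apply, smul_apply, smul_eq_mul]
      rw [avg_add (hP.continuous_fderiv _) hcont, hsum,
        hc _ hie K hK (edgeOf_subset hK i) _ _ (coe_edgeOf K i),
        segInt_div_segInt hK i (coe_edgeOf K i), (hbe _ hie).avg_eq hb hK hie, if_pos rfl,
        avg_sub (dirD_continuous _ _) (hP.continuous_fderiv _), avg_dirD_mid (MorleyMem.deg v K)]
      ring
    rw [hs, dirD_smul_right] at key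
    simp only [map_smul, smul_eq_mul] at key
    rw [avg_const_mul] at key
    exact mul_left_cancel₀ hs0 key

theorem IsCompanion.exists_fn (hb : Bornology.IsBounded Ω) (hn : T.IsNormalField n)
    {E : Morley T →ₗ[ℝ] H20 Ω} (hE : IsCompanion T n sel E) (v : Morley T) :
    ∃ w, IsCompanionFn T sel v w ∧ JetSpace.fn (E v : JetSpace Ω) =ᵐ[volume.restrict Ω] w := by
  obtain ⟨Et, b, c, hEt, hbe, hc, hfn⟩ := hE
  exact ⟨_, isCompanionFn_of hb hn (hEt v) hbe (hc v), hfn v⟩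

/-- The companion operator is well-defined. -/
theorem existsUnique_companion (hb : Bornology.IsBounded Ω) (hn : T.IsNormalField n)
    (hsel : T.IsSelection sel) : ∃! E : Morley T →ₗ[ℝ] H20 Ω, IsCompanion T n sel E := by
  classical
  choose Et hEt using fun v : Morley T => exists_preCompanion hb hsel v
  have hbex : ∀ e, ∃ b, e ∈ T.intEdges → IsEdgeBasis T n e b := by
    intro e
    by_cases he : e ∈ T.intEdges
    · obtain ⟨b, h⟩ := exists_edgeBasis hb hn he
      exact ⟨b, fun _ => h⟩
    · exact ⟨0, fun h => absurd h he⟩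
  choose b hbe using hbex
  have hcex : ∀ (v : Morley T) e, ∃ c : ℝ, e ∈ T.intEdges → ∀ K ∈ T.cells, e ⊆ K →
      ∀ p q, (e : Set Plane) = {p, q} →
      c = segInt p q (fun x => dirD (v.1 K) x (n e) - fderiv ℝ (Et v) x (n e)) /
        segInt p q (fun x => fderiv ℝ (b e) x (n e)) := by
    intro v e
    by_cases he : e ∈ T.intEdges
    swap
    · exact ⟨0, fun h => absurd h he⟩
    obtain ⟨heE, hm⟩ := mem_edges_of_mem_intEdges he
    obtain ⟨K, hK, i, rfl⟩ := exists_cell_of_mem_edges heE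
    obtain ⟨P, hP⟩ := (hEt v).1.exists_pieces hb
    refine ⟨(dirD (v.1 K) (midT (vert K) i) (n (edgeOf K i)) -
      avg (vert K (i + 1)) (vert K (i + 2)) (fun x => fderiv ℝ (Et v) x (n (edgeOf K i)))) /
      avg (vert K (i + 1)) (vert K (i + 2)) (fun x => fderiv ℝ (b (edgeOf K i)) x (n (edgeOf K i))),
      fun _ L hL hKL p q hpq => ?_⟩
    rw [segInt_div_segInt hK i hpq, avg_sub (dirD_continuous _ _) (hP.continuous_fderiv _)]
    obtain ⟨j, hj⟩ := exists_eq_edgeOf hL (card_of_mem_edges heE) hKL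
    have hset := hj ▸ coe_edgeOf K i
    rw [coe_edgeOf, pair_eq_pair_iff] at hset
    have havg : ∀ f, avg (vert K (i + 1)) (vert K (i + 2)) f =
        avg (vert L (j + 1)) (vert L (j + 2)) f := by
      intro f
      rcases hset with ⟨h1, h2⟩ | ⟨h1, h2⟩
      · rw [h1, h2]
      · rw [h1, h2, avg_comm]
    have : avg (vert K (i + 1)) (vert K (i + 2)) (fun x => dirD (v.1 L) x (n (edgeOf K i))) =
        dirD (v.1 K) (midT (vert K) i) (n (edgeOf K i)) := by
      rw [havg, avg_dirD_mid (MorleyMem.deg v L), ← mid_edgeOf hL, ← mid_edgeOf hK, ← hj]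
      exact MorleyMem.normal_eq v hL hK heE hKL (edgeOf_subset hK i) (hn _ heE).2
    rw [this]
  choose c hc using hcex
  have hfn : ∀ v, IsCompanionFn T sel v (fun x => Et v x + ∑ e ∈ T.intEdges, c v e * b e x) :=
    fun v => isCompanionFn_of hb hn (hEt v) hbe (hc v)
  choose P hP using fun v => (hfn v).pieces
  choose W hW using fun v => ((hP v).isHCT hb).1
  have hext : ∀ V V' : H20 Ω, JetSpace.fn (V : JetSpace Ω) =ᵐ[volume.restrict Ω]
      JetSpace.fn (V' : JetSpace Ω) → V = V' := fun V V' h =>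
    Subtype.ext (H20_ext T.isOpen V.2 V'.2 h)
  have hlin : ∀ (v v' : Morley T) (r : ℝ), W (v + r • v') = W v + r • W v' := by
    intro v v' r
    apply hext
    have h1 : JetSpace.fn ((W v + r • W v' : H20 Ω) : JetSpace Ω) =ᵐ[volume.restrict Ω]
        fun x => (W v : JetSpace Ω).fn x + r * (W v' : JetSpace Ω).fn x := by
      have e1 := Lp.coeFn_add ((W v : JetSpace Ω) (Sum.inl ())) (r • (W v' : JetSpace Ω) (Sum.inl ()))
      have e2 := Lp.coeFn_smul r ((W v' : JetSpace Ω) (Sum.inl ()))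
      filter_upwards [e1, e2] with x h1 h2
      change ((W v : JetSpace Ω) (Sum.inl ()) + r • (W v' : JetSpace Ω) (Sum.inl ()) : L2 Ω) x = _
      rw [h1, Pi.add_apply, h2]
      rfl
    have h2 := congrFun ((hfn (v + r • v')).unique ((hfn v).add_smul (hfn v') r))
    filter_upwards [h1, hW v, hW v', hW (v + r • v')] with x e1 e2 e3 e4
    rw [e4, h2 x, e1, e2, e3]
  have hzero : W 0 = 0 := by
    have := hlin 0 0 1
    simpa using this
  let E : Morley T →ₗ[ℝ] H20 Ω :=
    { toFun := W
      map_add' := fun v v' => by simpa using hlin v v' 1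
      map_smul' := fun r v => by simpa [hzero] using hlin 0 v r }
  have hE : IsCompanion T n sel E := ⟨Et, b, c, hEt, hbe, hc, hW⟩
  refine ⟨E, hE, fun E' hE' => LinearMap.ext fun v => hext _ _ ?_⟩
  obtain ⟨w₁, h1, h1'⟩ := hE'.exists_fn hb hn v
  obtain ⟨w₂, h2, h2'⟩ := hE.exists_fn hb hn v
  rw [h1.unique h2] at h1'
  exact h1'.trans h2'.symm

end Companion

end MorleyUC
end

noncomputable section

open MeasureTheory Set Filter Topology
namespace MorleyUC

variable {Ω : Set Plane} {T : Triangulation Ω} {K L : Finset Plane}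
  {w : Plane → ℝ} {P : Finset Plane → Fin 3 → Poly}

theorem ae_mem_interior_tri {t : Fin 3 → Plane} (h : detT t ≠ 0) :
    ∀ᵐ x, x ∈ tri t → x ∈ interior (tri t) := by
  filter_upwards [ae_lam_ne_zero h] with x hx hxt
  exact mem_interior_tri h fun i => lt_of_le_of_ne ((mem_tri h).1 hxt i) (hx i).symm

theorem setIntegral_tri_eq_sum {t : Fin 3 → Plane} (h : detT t ≠ 0) {f : Plane → ℝ}
    (hf : IntegrableOn f (tri t)) : ∫ x in tri t, f x = ∑ i, ∫ x in tri (subTri t i), f x := by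
  have hU : tri t = ⋃ i, tri (subTri t i) := by
    ext x
    rw [mem_iUnion]
    exact ⟨fun hx => exists_mem_tri_sub h hx, fun ⟨i, hi⟩ => tri_sub_subset h i hi⟩
  have hd : Pairwise (Function.onFun (AEDisjoint volume) fun i => tri (subTri t i)) := by
    intro i j hij
    have h0 := ae_lam_ne_zero (detT_sub_ne h i)
    rw [ae_iff] at h0
    refine measure_mono_null (fun x hx => ?_) h0
    simp only [ne_eq, not_forall, not_not, mem_ofPred_eq]
    refine ⟨j, ?_⟩
    rw [lam_sub_ne h hij.symm]
    linarith [((mem_tri_sub h).1 hx.1).2 j, ((mem_tri_sub h).1 hx.2).2 i]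
  rw [hU] at hf
  rw [hU, integral_iUnion_ae (fun i => (tri_measurableSet _).nullMeasurableSet) hd hf,
    tsum_fintype]

namespace HCTPieces

theorem second_ae (h : HCTPieces T w P) {W : JetSpace Ω} (hW : W ∈ H20 Ω)
    (hfn : W.fn =ᵐ[volume.restrict Ω] w) (hK : K ∈ T.cells) (i : Fin 3) (k l : Fin 2) :
    ∀ᵐ x, x ∈ tri (subTri (vert K) i) → W (Sum.inr (Sum.inr (k, l))) x =
      ev (MvPolynomial.pderiv k (MvPolynomial.pderiv l (P K i))) x := by
  have := H20_second_ae_eq isOpen_interior (interior_subTri_subset hK i) hW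
    (ev_contDiff (P K i)) ?_ k l
  · simp only [partialD_ev] at this
    filter_upwards [this, ae_mem_interior_tri (detT_sub_ne (T.detT_vert hK) i)] with x h1 h2 hx
      using h1 (h2 hx)
  · rw [Filter.EventuallyEq, ae_restrict_iff' T.isOpen.measurableSet] at hfn
    filter_upwards [hfn] with x hx hxi
    rw [hx (interior_subTri_subset hK i hxi), h.val K hK i x (interior_subset hxi)]

end HCTPieces

theorem setIntegral_second_tri {t : Fin 3 → Plane} (h : detT t ≠ 0) (p : Poly) (k l : Fin 2) :
    ∫ x in tri t, ev (MvPolynomial.pderiv k (MvPolynomial.pderiv l p)) x =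
      -|detT t| * ∑ i, gl t i (EuclideanSpace.single k 1) * avg (t (i + 1)) (t (i + 2))
        (fun x => dirD p x (EuclideanSpace.single l 1)) := by
  have := setIntegral_fderiv_tri h (f := ev (MvPolynomial.pderiv l p))
    ((ev_contDiff _).of_le (WithTop.coe_le_coe.2 le_top)) (EuclideanSpace.single k 1)
  simp only [fderiv_ev, gradP_apply, dirD_single] at this
  simp only [dirD_single, this]

theorem vertex_mem_tri (t : Fin 3 → Plane) (i : Fin 3) : t i ∈ tri t :=
  subset_convexHull ℝ _ (mem_range_self i)

theorem setIntegral_second_subTri {g : Plane → ℝ} {t : Fin 3 → Plane} (h : detT t ≠ 0)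
    {p : Fin 3 → Poly} {l : Fin 2}
    (hg : ∀ i, ∀ x ∈ tri (subTri t i), g x = dirD (p i) x (EuclideanSpace.single l 1))
    (k : Fin 2) :
    ∑ i, ∫ x in tri (subTri t i), ev (MvPolynomial.pderiv k (MvPolynomial.pderiv l (p i))) x =
      -|detT t| * ∑ i, gl t i (EuclideanSpace.single k 1) * avg (t (i + 1)) (t (i + 2)) g := by
  have h1 : ∀ i, ∫ x in tri (subTri t i),
      ev (MvPolynomial.pderiv k (MvPolynomial.pderiv l (p i))) x = -(|detT t| / detT t) *
        ∑ j, cross (EuclideanSpace.single k 1) (subTri t i (j + 1) - subTri t i (j + 2)) *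
          avg (subTri t i (j + 1)) (subTri t i (j + 2)) g := by
    intro i
    rw [setIntegral_second_tri (detT_sub_ne h i), Finset.mul_sum, Finset.mul_sum]
    refine Finset.sum_congr rfl fun j _ => ?_
    rw [avg_congr (g := g) fun τ hτ => (hg i _ ((tri_convex _).add_smul_sub_mem
      (vertex_mem_tri _ _) (vertex_mem_tri _ _) hτ)).symm, gl, detT_sub, abs_div,
      abs_of_pos (by norm_num : (0 : ℝ) < 3)]
    field_simp
  have h2 : ∀ i, |detT t| * gl t i (EuclideanSpace.single k 1) =
      |detT t| / detT t * cross (EuclideanSpace.single k 1) (t (i + 1) - t (i + 2)) := by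
    intro i; rw [gl]; ring
  have ha : ∀ n a b : Plane, cross n (a - b) = -cross n (b - a) := by
    intro n a b; simp [cross]; ring
  rw [Finset.sum_congr rfl fun i _ => h1 i, neg_mul, Finset.mul_sum]
  simp only [← mul_assoc, h2]
  simp only [Fin.sum_univ_three, subTri, Fin.isValue, Fin.reduceAdd, Function.update, zero_add]
  simp
  rw [ha _ (cen t) (t 0), ha _ (cen t) (t 1), ha _ (cen t) (t 2), avg_comm (cen t) (t 0),
    avg_comm (cen t) (t 1), avg_comm (cen t) (t 2)]
  ring

theorem L2_integrableOn (hb : Bornology.IsBounded Ω) (f : L2 Ω) : IntegrableOn f Ω := by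
  have : IsFiniteMeasure (volume.restrict Ω) := ⟨by simpa using hb.measure_lt_top⟩
  exact (Lp.memLp f).integrable (by norm_num)

theorem HCTPieces.setIntegral_second (hb : Bornology.IsBounded Ω) (h : HCTPieces T w P)
    {W : JetSpace Ω} (hW : W ∈ H20 Ω) (hfn : W.fn =ᵐ[volume.restrict Ω] w) (hK : K ∈ T.cells)
    (k l : Fin 2) : ∫ x in hull K, W (Sum.inr (Sum.inr (k, l))) x =
      -|detT (vert K)| * ∑ i, gl (vert K) i (EuclideanSpace.single k 1) *
        avg (vert K (i + 1)) (vert K (i + 2))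
          (fun x => fderiv ℝ w x (EuclideanSpace.single l 1)) := by
  have hD := T.detT_vert hK
  have hInt := T.integrableOn_hull (L2_integrableOn hb (W (Sum.inr (Sum.inr (k, l))))) hK
  rw [T.hull_eq_tri hK] at hInt ⊢
  rw [setIntegral_tri_eq_sum hD hInt, ← setIntegral_second_subTri hD (p := P K)
    fun i x hx => h.grad_apply hK hx _]
  refine Finset.sum_congr rfl fun i _ => setIntegral_congr_ae (tri_measurableSet _) ?_
  exact h.second_ae hW hfn hK i k l

theorem morleyJet_ae (v : Morley T) (hK : K ∈ T.cells) (j : JetIdx) :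
    ∀ᵐ x ∂(volume.restrict (hull K)), morleyJet T v j x = ev (polyDeriv (v.1 K) j) x := by
  have h1 : ∀ᵐ x ∂(volume.restrict Ω), morleyJet T v j x =
      ∑ L ∈ T.cells, (hull L).indicator (ev (polyDeriv (v.1 L) j)) x := by
    have e1 := Lp.coeFn_finsetSum (p := 2) (μ := volume.restrict Ω) T.cells
      (fun L => (ev_memLp Ω L (polyDeriv (v.1 L) j)).toLp)
    have e2 : ∀ᵐ x ∂(volume.restrict Ω), ∀ L ∈ T.cells,
        (ev_memLp Ω L (polyDeriv (v.1 L) j)).toLp _ x =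
          (hull L).indicator (ev (polyDeriv (v.1 L) j)) x :=
      (ae_ball_iff T.cells.countable_toSet).2 fun L _ => MemLp.coeFn_toLp _
    filter_upwards [e1, e2] with x h1 h2
    rw [show morleyJet T v j = ∑ K ∈ T.cells, (ev_memLp Ω K (polyDeriv (v.1 K) j)).toLp from rfl,
      h1, Finset.sum_apply]
    exact Finset.sum_congr rfl fun L hL => h2 L hL
  have h2 : ∀ᵐ x, ∀ L ∈ T.cells, L ≠ K → x ∈ hull K → x ∉ hull L :=
    (ae_ball_iff T.cells.countable_toSet).2 fun L hL => by
      by_cases h : L = K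
      · exact Eventually.of_forall fun _ h' => absurd h h'
      · filter_upwards [T.ae_unique hK hL (Ne.symm h)] with x hx _ using hx
  filter_upwards [T.ae_restrict_hull h1 hK, ae_restrict_of_ae h2,
    ae_restrict_mem (T.measurableSet_hull hK)] with x e1 e2 hx
  rw [e1, Finset.sum_eq_single_of_mem K hK, indicator_of_mem hx]
  intro L hL hLK
  exact indicator_of_notMem (e2 L hL hLK hx) _

theorem lap_ae (W : JetSpace Ω) : ∀ᵐ x ∂(volume.restrict Ω), lap Ω W x =
    W (Sum.inr (Sum.inr (0, 0))) x + W (Sum.inr (Sum.inr (1, 1))) x := by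
  rw [lap_apply]
  exact Lp.coeFn_add _ _

theorem sum_gl_single (t : Fin 3 → Plane) (i : Fin 3) (f : Plane →L[ℝ] ℝ) :
    gl t i (EuclideanSpace.single 0 1) * f (EuclideanSpace.single 0 1) +
      gl t i (EuclideanSpace.single 1 1) * f (EuclideanSpace.single 1 1) =
      (1 / detT t) * f (norT t i) := by
  have hN : norT t i = (norT t i 0) • EuclideanSpace.single 0 1 +
      (norT t i 1) • EuclideanSpace.single 1 1 := by
    refine plane_ext ?_ ?_ <;> simp
  rw [hN, map_add, map_smul, map_smul]
  simp [gl, cross, norT]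
  ring

theorem setIntegral_lap (hb : Bornology.IsBounded Ω) (W : JetSpace Ω) (hK : K ∈ T.cells) :
    ∫ x in hull K, lap Ω W x = (∫ x in hull K, W (Sum.inr (Sum.inr (0, 0))) x) +
      ∫ x in hull K, W (Sum.inr (Sum.inr (1, 1))) x := by
  rw [← integral_add (T.integrableOn_hull (L2_integrableOn hb _) hK)
    (T.integrableOn_hull (L2_integrableOn hb _) hK)]
  exact integral_congr_ae (T.ae_restrict_hull (lap_ae W) hK)

theorem sum_green_eq {t : Fin 3 → Plane} {G : Plane → Plane →L[ℝ] ℝ}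
    (hG : ∀ n, Continuous fun x => G x n) :
    (-|detT t| * ∑ i, gl t i (EuclideanSpace.single 0 1) *
        avg (t (i + 1)) (t (i + 2)) (fun x => G x (EuclideanSpace.single 0 1))) +
      (-|detT t| * ∑ i, gl t i (EuclideanSpace.single 1 1) *
        avg (t (i + 1)) (t (i + 2)) (fun x => G x (EuclideanSpace.single 1 1))) =
      -|detT t| * ∑ i, 1 / detT t * avg (t (i + 1)) (t (i + 2)) (fun x => G x (norT t i)) := by
  rw [← mul_add, ← Finset.sum_add_distrib]
  congr 1
  refine Finset.sum_congr rfl fun i _ => ?_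
  rw [← avg_const_mul, ← avg_const_mul, ← avg_const_mul,
    ← avg_add ((hG _).const_mul _) ((hG _).const_mul _)]
  exact avg_congr fun τ _ => sum_gl_single t i _

variable {sel : Plane → Finset Plane} {v : Morley T}

/-- The mean values of the normal derivatives of `v` and `E v` on all edges agree. -/
theorem IsCompanionFn.edge_eq (h : IsCompanionFn T sel v w) (hK : K ∈ T.cells) (i : Fin 3) :
    avg (vert K (i + 1)) (vert K (i + 2)) (fun x => fderiv ℝ w x (norT (vert K) i)) =
      dirD (v.1 K) (midT (vert K) i) (norT (vert K) i) := by
  by_cases hi : midT (vert K) i ∈ Ω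
  · exact h.edge K hK i hi
  obtain ⟨P, hP⟩ := h.pieces
  have hv : ∀ k, k ≠ i → vert K k ∉ Ω := fun k hk h => hi (T.midT_mem_of_vert_mem hK hk h)
  rw [hP.simpson hK, hP.off' _ hi, hP.off' _ (hv _ (fin3_succ_ne i).1),
    hP.off' _ (hv _ (fin3_succ_ne i).2.1), MorleyMem.normal_off v hK hi (isNormal_norT K i)]
  simp

/-- The discrete operator does not see the difference of `v` and `E v`. -/
theorem opBd_sub_eq_zero (hb : Bornology.IsBounded Ω) (h : IsCompanionFn T sel v w)
    {W : JetSpace Ω} (hW : W ∈ H20 Ω) (hfn : W.fn =ᵐ[volume.restrict Ω] w) {z : L2 Ω}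
    (hz : z ∈ pwConst T) : opBd T z (morleyJet T v - W) = 0 := by
  obtain ⟨P, hP⟩ := h.pieces
  rw [opBd, neg_eq_zero]
  refine Finset.sum_eq_zero fun K hK => ?_
  obtain ⟨c, hc⟩ := hz K hK
  have h1 : ∫ x in hull K, z x * lap Ω (morleyJet T v - W) x =
      ∫ x in hull K, c * (lap Ω (morleyJet T v) x - lap Ω W x) := by
    refine integral_congr_ae ?_
    rw [map_sub]
    filter_upwards [T.ae_restrict_hull hc hK, T.ae_restrict_hull (Lp.coeFn_sub (lap Ω (morleyJet T v)) (lap Ω W)) hK,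
      ae_restrict_mem (T.measurableSet_hull hK)] with x e1 e2 hx
    rw [e1 hx, e2, Pi.sub_apply]
  rw [h1, integral_const_mul, integral_sub (T.integrableOn_hull (L2_integrableOn hb _) hK)
    (T.integrableOn_hull (L2_integrableOn hb _) hK)]
  refine mul_eq_zero_of_right c (sub_eq_zero.2 ?_)
  have h2 : ∀ k, ∫ x in hull K, morleyJet T v (Sum.inr (Sum.inr (k, k))) x =
      -|detT (vert K)| * ∑ i, gl (vert K) i (EuclideanSpace.single k 1) *
        avg (vert K (i + 1)) (vert K (i + 2))
          (fun x => gradP (v.1 K) x (EuclideanSpace.single k 1)) := by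
    intro k
    simp only [gradP_apply]
    rw [← setIntegral_second_tri (T.detT_vert hK), ← T.hull_eq_tri hK]
    exact integral_congr_ae (morleyJet_ae v hK _)
  rw [setIntegral_lap hb _ hK, setIntegral_lap hb _ hK, h2, h2,
    hP.setIntegral_second hb hW hfn hK, hP.setIntegral_second hb hW hfn hK,
    sum_green_eq fun n => ?_, sum_green_eq fun n => hP.continuous_fderiv n]
  · congr 1
    refine Finset.sum_congr rfl fun i _ => ?_
    simp only [gradP_apply]
    rw [avg_dirD_mid (MorleyMem.deg v K), h.edge_eq hK]
  · simp only [gradP_apply]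
    exact dirD_continuous _ _

end MorleyUC
end

noncomputable section

open MeasureTheory Set Filter Topology
namespace MorleyUC

variable {Ω : Set Plane} {T : Triangulation Ω} {K L : Finset Plane}
  {w : Plane → ℝ} {P : Finset Plane → Fin 3 → Poly}

/-- The square of the Frobenius norm of the Hessian of a polynomial (at the origin). -/
def hessSq (p : Poly) : ℝ :=
  ∑ i : Fin 2, ∑ j : Fin 2, ev (MvPolynomial.pderiv i (MvPolynomial.pderiv j p)) 0 ^ 2

theorem hessSq_nonneg (p : Poly) : 0 ≤ hessSq p :=
  Finset.sum_nonneg fun _ _ => Finset.sum_nonneg fun _ _ => sq_nonneg _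

theorem ev_eq_of_mem_Deg_zero {p : Poly} (hp : p ∈ Deg 0) (x : Plane) : ev p x = ev p 0 := by
  have h := MvPolynomial.totalDegree_eq_zero_iff_eq_C.1 (Nat.le_zero.1 (mem_Deg.1 hp))
  rw [h, ev_C, ev_C]

theorem ev_second_eq {p : Poly} (hp : p ∈ Deg 2) (i j : Fin 2) (x : Plane) :
    ev (MvPolynomial.pderiv i (MvPolynomial.pderiv j p)) x =
      ev (MvPolynomial.pderiv i (MvPolynomial.pderiv j p)) 0 :=
  ev_eq_of_mem_Deg_zero (pderiv_mem_Deg (pderiv_mem_Deg hp j) i) x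

theorem normY_sq (v : Morley T) :
    normY T v ^ 2 = ∑ K ∈ T.cells, |detT (vert K)| / 2 * hessSq (v.1 K) := by
  have h : ∀ K ∈ T.cells, ∫ x in hull K, ∑ i : Fin 2, ∑ j : Fin 2,
      (ev (MvPolynomial.pderiv i (MvPolynomial.pderiv j (v.1 K))) x) ^ 2 =
      |detT (vert K)| / 2 * hessSq (v.1 K) := by
    intro K hK
    simp only [ev_second_eq (MorleyMem.deg v K)]
    rw [setIntegral_const, T.hull_eq_tri hK, volume_real_tri (T.detT_vert hK)]
    rfl
  rw [normY, Finset.sum_congr rfl h, Real.sq_sqrt]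
  exact Finset.sum_nonneg fun K _ => mul_nonneg (by positivity) (hessSq_nonneg _)

theorem normY_nonneg (v : Morley T) : 0 ≤ normY T v := Real.sqrt_nonneg _

theorem avg_const (a b : Plane) (c : ℝ) : avg a b (fun _ => c) = c := by simp [avg]

theorem ev_sub_eq {p : Poly} (hp : p ∈ Deg 1) (x y : Plane) :
    ev p x - ev p y = ∑ k, (x - y) k * ev (MvPolynomial.pderiv k p) 0 := by
  rw [← avg_fderiv ((ev_contDiff p).of_le (WithTop.coe_le_coe.2 le_top)) y x,
    ← avg_const y x (∑ k, (x - y) k * ev (MvPolynomial.pderiv k p) 0)]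
  refine avg_congr fun τ _ => ?_
  rw [fderiv_ev, gradP_apply, dirD]
  exact Finset.sum_congr rfl fun k _ => by
    rw [ev_eq_of_mem_Deg_zero (pderiv_mem_Deg hp k) (y + τ • (x - y))]

theorem norm_gradP_sub_le {p : Poly} (hp : p ∈ Deg 2) (x y : Plane) :
    ‖gradP p x - gradP p y‖ ≤ √(hessSq p) * ‖x - y‖ := by
  refine ContinuousLinearMap.opNorm_le_bound _ (by positivity) fun n => ?_
  rw [sub_apply, gradP_apply, gradP_apply, dirD, dirD, ← Finset.sum_sub_distrib]
  simp only [← mul_sub, ev_sub_eq (pderiv_mem_Deg hp _) x y, Fin.sum_univ_two]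
  rw [Real.norm_eq_abs, mul_assoc]
  refine abs_le_of_sq_le_sq ?_ (by positivity)
  rw [mul_pow, mul_pow, Real.sq_sqrt (hessSq_nonneg p), norm_sq_plane, norm_sq_plane, hessSq]
  simp only [Fin.sum_univ_two]
  generalize ev (MvPolynomial.pderiv 0 (MvPolynomial.pderiv 0 p)) 0 = a
  generalize ev (MvPolynomial.pderiv 0 (MvPolynomial.pderiv 1 p)) 0 = b
  generalize ev (MvPolynomial.pderiv 1 (MvPolynomial.pderiv 0 p)) 0 = c
  generalize ev (MvPolynomial.pderiv 1 (MvPolynomial.pderiv 1 p)) 0 = d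
  generalize n 0 = n0
  generalize n 1 = n1
  generalize (x - y) 0 = d0
  generalize (x - y) 1 = d1
  have h : (n0 * (d0 * a + d1 * c) + n1 * (d0 * b + d1 * d)) ^ 2 ≤
      (n0 ^ 2 + n1 ^ 2) * ((d0 * a + d1 * c) ^ 2 + (d0 * b + d1 * d) ^ 2) := by
    nlinarith [sq_nonneg (n0 * (d0 * b + d1 * d) - n1 * (d0 * a + d1 * c))]
  have h1 : (d0 * a + d1 * c) ^ 2 ≤ (d0 ^ 2 + d1 ^ 2) * (a ^ 2 + c ^ 2) := by
    nlinarith [sq_nonneg (d0 * c - d1 * a)]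
  have h2 : (d0 * b + d1 * d) ^ 2 ≤ (d0 ^ 2 + d1 ^ 2) * (b ^ 2 + d ^ 2) := by
    nlinarith [sq_nonneg (d0 * d - d1 * b)]
  have h3 := mul_le_mul_of_nonneg_left (add_le_add h1 h2)
    (add_nonneg (sq_nonneg n0) (sq_nonneg n1))
  nlinarith

/-- The derivative of a quadratic at the midpoint of a segment in the direction of the segment. -/
theorem dirD_mid_eq {p : Poly} (hp : p ∈ Deg 2) (a b : Plane) :
    dirD p (a + (1 / 2 : ℝ) • (b - a)) (b - a) = ev p b - ev p a := by
  rw [← avg_fderiv ((ev_contDiff p).of_le (WithTop.coe_le_coe.2 le_top)) a b]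
  simp only [fderiv_ev, gradP_apply, ← ev_dP]
  rw [avg_mid (dP_mem_Deg hp _)]

theorem clm_eq_zero_of_edge {t : Fin 3 → Plane} (h : detT t ≠ 0) (i : Fin 3) {f : Plane →L[ℝ] ℝ}
    (h1 : f (norT t i) = 0) (h2 : f (t (i + 2) - t (i + 1)) = 0) : f = 0 := by
  ext n
  have hne := gl_norT_ne h i
  have h3 : gl t i (n + (-(gl t i n / gl t i (norT t i))) • norT t i) = 0 := by
    rw [gl_add, gl_smul]; field_simp; ring
  have h4 := congrArg f (eq_smul_of_gl_eq_zero h h3)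
  rw [map_add, map_smul, map_smul, h1, h2] at h4
  simpa using h4

section Jumps

variable (v : Morley T)

theorem gradP_mid_eq (hK : K ∈ T.cells) (hL : L ∈ T.cells) {i : Fin 3} (h : edgeOf K i ⊆ L) :
    gradP (v.1 K) (midT (vert K) i) = gradP (v.1 L) (midT (vert K) i) := by
  have h1 : vert K (i + 1) ∈ L := h (by simp [edgeOf])
  have h2 : vert K (i + 2) ∈ L := h (by simp [edgeOf])
  rw [← sub_eq_zero]
  refine clm_eq_zero_of_edge (T.detT_vert hK) i ?_ ?_
  · rw [sub_apply, gradP_apply, gradP_apply, ← mid_edgeOf hK, MorleyMem.normal_eq v hK hL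
      (edgeOf_mem hK i) (edgeOf_subset hK i) h (isNormal_norT K i), sub_self]
  · rw [sub_apply, gradP_apply, gradP_apply, midT, dirD_mid_eq (MorleyMem.deg v K),
      dirD_mid_eq (MorleyMem.deg v L), MorleyMem.val_eq v hK hL (T.vert_mem hK _) h1,
      MorleyMem.val_eq v hK hL (T.vert_mem hK _) h2, sub_self]

theorem gradP_mid_off (hK : K ∈ T.cells) {i : Fin 3} (h : midT (vert K) i ∉ Ω) :
    gradP (v.1 K) (midT (vert K) i) = 0 := by
  have hv : ∀ k, k ≠ i → vert K k ∉ Ω := fun k hk h' => h (T.midT_mem_of_vert_mem hK hk h')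
  refine clm_eq_zero_of_edge (T.detT_vert hK) i ?_ ?_
  · rw [gradP_apply, MorleyMem.normal_off v hK h (isNormal_norT K i)]
  · rw [gradP_apply, midT, dirD_mid_eq (MorleyMem.deg v K),
      MorleyMem.val_off v hK (T.vert_mem hK _) (hv _ (fin3_succ_ne i).1),
      MorleyMem.val_off v hK (T.vert_mem hK _) (hv _ (fin3_succ_ne i).2.1), sub_self]

/-- The variation of the gradient of the piece of `v` on `K` is at most `gradVar v K`. -/
def gradVar (K : Finset Plane) : ℝ := √(hessSq (v.1 K)) * Metric.diam (hull K)

theorem gradVar_nonneg (K : Finset Plane) : 0 ≤ gradVar v K := by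
  unfold gradVar; exact mul_nonneg (Real.sqrt_nonneg _) Metric.diam_nonneg

theorem norm_gradP_sub_le_gradVar (hK : K ∈ T.cells) {x y : Plane} (hx : x ∈ hull K)
    (hy : y ∈ hull K) : ‖gradP (v.1 K) x - gradP (v.1 K) y‖ ≤ gradVar v K := by
  refine (norm_gradP_sub_le (MorleyMem.deg v K) x y).trans ?_
  rw [gradVar, ← dist_eq_norm]
  gcongr
  exact Metric.dist_le_diam_of_mem (T.hull_isCompact hK).isBounded hx hy

theorem midT_mem_hull (hK : K ∈ T.cells) (i : Fin 3) : midT (vert K) i ∈ hull K :=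
  T.openEdge_subset_hull hK i (T.midT_mem_openEdge hK i)

theorem norm_jump_le_of_adj {ν : Plane} {K L : {K : Finset Plane // K ∈ T.cells ∧ ν ∈ K}}
    (h : (T.vertexGraph ν).Adj K L) :
    ‖gradP (v.1 K.1) ν - gradP (v.1 L.1) ν‖ ≤ gradVar v K.1 + gradVar v L.1 := by
  classical
  obtain ⟨hne, b, hbK, hbL, hbν⟩ := h
  have hc : ({ν, b} : Finset Plane).card = 2 := Finset.card_pair hbν.symm
  have hsubK : ({ν, b} : Finset Plane) ⊆ K.1 := by
    intro y hy
    rw [Finset.mem_insert, Finset.mem_singleton] at hy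
    rcases hy with rfl | rfl
    · exact K.2.2
    · exact hbK
  have hsubL : ({ν, b} : Finset Plane) ⊆ L.1 := by
    intro y hy
    rw [Finset.mem_insert, Finset.mem_singleton] at hy
    rcases hy with rfl | rfl
    · exact L.2.2
    · exact hbL
  obtain ⟨i, hi⟩ := exists_eq_edgeOf K.2.1 hc hsubK
  obtain ⟨j, hj⟩ := exists_eq_edgeOf L.2.1 hc hsubL
  have hm := gradP_mid_eq v K.2.1 L.2.1 (hi ▸ hsubL)
  have hmL : midT (vert K.1) i = midT (vert L.1) j := by
    rw [← mid_edgeOf K.2.1, ← hi, hj, mid_edgeOf L.2.1]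
  have h1 := norm_gradP_sub_le_gradVar v K.2.1 (subset_convexHull ℝ _ K.2.2)
    (midT_mem_hull K.2.1 i)
  have h2 := norm_gradP_sub_le_gradVar v L.2.1 (midT_mem_hull L.2.1 j)
    (subset_convexHull ℝ _ L.2.2)
  rw [← hmL, ← hm] at h2
  calc _ = ‖(gradP (v.1 K.1) ν - gradP (v.1 K.1) (midT (vert K.1) i)) +
      (gradP (v.1 K.1) (midT (vert K.1) i) - gradP (v.1 L.1) ν)‖ := by rw [sub_add_sub_cancel]
    _ ≤ _ := (norm_add_le _ _).trans (add_le_add h1 h2)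

open Classical in
/-- The sum of the variations of the gradients on the triangles at `ν`. -/
def vertVar (ν : Plane) : ℝ := ∑ K ∈ T.cells.filter (fun K => ν ∈ K), gradVar v K

theorem gradVar_le_vertVar {ν : Plane} (hK : K ∈ T.cells) (hν : ν ∈ K) :
    gradVar v K ≤ vertVar v ν := by
  classical
  exact Finset.single_le_sum (fun K _ => gradVar_nonneg v K) (Finset.mem_filter.2 ⟨hK, hν⟩)

theorem vertVar_nonneg (ν : Plane) : 0 ≤ vertVar v ν :=
  Finset.sum_nonneg fun K _ => gradVar_nonneg v K

theorem norm_jump_le_of_reachable {ρ : ℝ} (hρ : 0 < ρ) (hT : T.ShapeRegular ρ) {ν : Plane}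
    {K L : {K : Finset Plane // K ∈ T.cells ∧ ν ∈ K}} (h : (T.vertexGraph ν).Reachable K L) :
    ‖gradP (v.1 K.1) ν - gradP (v.1 L.1) ν‖ ≤ 2 / ρ ^ 2 * vertVar v ν := by
  classical
  obtain ⟨p, hp⟩ := h.exists_isPath
  have hw : ∀ {K L : {K : Finset Plane // K ∈ T.cells ∧ ν ∈ K}} (p : (T.vertexGraph ν).Walk K L),
      ‖gradP (v.1 K.1) ν - gradP (v.1 L.1) ν‖ ≤ p.length * (2 * vertVar v ν) := by
    intro K L p
    induction p with
    | nil => simp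
    | @cons K M L hadj p ih =>
      have h1 := norm_jump_le_of_adj v hadj
      have h2 := gradVar_le_vertVar v K.2.1 K.2.2
      have h3 := gradVar_le_vertVar v M.2.1 M.2.2
      have h4 := norm_add_le (gradP (v.1 K.1) ν - gradP (v.1 M.1) ν)
        (gradP (v.1 M.1) ν - gradP (v.1 L.1) ν)
      rw [sub_add_sub_cancel] at h4
      rw [SimpleGraph.Walk.length_cons]
      push_cast
      nlinarith
  have hfin : Fintype {K : Finset Plane // K ∈ T.cells ∧ ν ∈ K} :=
    Fintype.subtype (T.cells.filter fun K => ν ∈ K) (by simp)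
  have hcard : Fintype.card {K : Finset Plane // K ∈ T.cells ∧ ν ∈ K} =
      (T.cells.filter fun K => ν ∈ K).card := Fintype.card_of_subtype _ (by simp)
  have hlen : (p.length : ℝ) ≤ 1 / ρ ^ 2 := by
    have h1 := hp.length_lt
    rw [hcard] at h1
    have h2 := T.card_at_vertex_le hρ hT ν
    rw [le_div_iff₀ (by positivity)]
    refine le_trans ?_ h2
    gcongr
  refine (hw p).trans ?_
  calc _ ≤ 1 / ρ ^ 2 * (2 * vertVar v ν) := by
        have := vertVar_nonneg v ν
        gcongr
    _ = _ := by ring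

/-- The bound for the gradient jumps of Morley functions. -/
theorem norm_gradient_defect_le {ρ : ℝ} (hρ : 0 < ρ) (hT : T.ShapeRegular ρ)
    {sel : Plane → Finset Plane} (hsel : T.IsSelection sel) {w : Plane → ℝ}
    (h : IsCompanionFn T sel v w) (hK : K ∈ T.cells) (k : Fin 3) :
    ‖fderiv ℝ w (vert K k) - gradP (v.1 K) (vert K k)‖ ≤
      (2 / ρ ^ 2 + 1) * vertVar v (vert K k) := by
  have hA := vertVar_nonneg v (vert K k)
  have hνK := T.vert_mem hK k
  by_cases hν : vert K k ∈ Ω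
  · obtain ⟨hs1, hs2⟩ := hsel K hK _ hνK hν
    have hr := (T.reachable_of_interior (ν := vert K k) ⟨K, hK, hνK⟩ (fun L _ i hi => by
      obtain ⟨l, hl⟩ := T.exists_vert_eq L.2.1 L.2.2
      exact T.midT_mem_of_vert_mem L.2.1 (k := l) (fun h => hi (by rw [← h, hl]))
        (by rw [hl]; exact hν))).2
      ⟨sel (vert K k), hs1, hs2⟩
    have h1 := norm_jump_le_of_reachable v hρ hT hr
    have h2 : fderiv ℝ w (vert K k) = gradP (v.1 (sel (vert K k))) (vert K k) := by
      ext n; rw [(h.vertex K hK k hν).2, gradP_apply]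
    rw [h2, norm_sub_rev]
    refine h1.trans ?_
    nlinarith
  · obtain ⟨P, hP⟩ := h.pieces
    rw [hP.off' _ hν, zero_sub, norm_neg]
    by_contra hc
    refine hν (T.reachable_of_interior (ν := vert K k) ⟨K, hK, hνK⟩ (fun L hL i hi => ?_)).1
    by_contra hm
    apply hc
    have h1 := norm_jump_le_of_reachable v hρ hT hL
    have h2 := norm_gradP_sub_le_gradVar v L.2.1 (subset_convexHull ℝ _ L.2.2)
      (midT_mem_hull L.2.1 i)
    rw [gradP_mid_off v L.2.1 hm, sub_zero] at h2
    have h3 := gradVar_le_vertVar v L.2.1 L.2.2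
    have h4 := norm_add_le (gradP (v.1 K) (vert K k) - gradP (v.1 L.1) (vert K k))
      (gradP (v.1 L.1) (vert K k))
    rw [sub_add_cancel] at h4
    dsimp only at h1
    linarith

end Jumps

theorem sum_vertVar_sq_le {ρ : ℝ} (hρ : 0 < ρ) (hT : T.ShapeRegular ρ) (v : Morley T) :
    ∑ K ∈ T.cells, ∑ ν ∈ K, vertVar v ν ^ 2 ≤ 1 / ρ ^ 6 * normY T v ^ 2 := by
  classical
  have hN : ∀ ν, ((T.cells.filter fun K => ν ∈ K).card : ℝ) ≤ 1 / ρ ^ 2 := fun ν => by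
    rw [le_div_iff₀ (by positivity)]; exact T.card_at_vertex_le hρ hT ν
  set V : Finset Plane := T.cells.biUnion id
  have hV : ∀ {K ν}, K ∈ T.cells → ν ∈ K → ν ∈ V := fun hK hν =>
    Finset.mem_biUnion.2 ⟨_, hK, hν⟩
  have swap : ∀ f : Finset Plane → Plane → ℝ, ∑ K ∈ T.cells, ∑ ν ∈ K, f K ν =
      ∑ ν ∈ V, ∑ K ∈ T.cells.filter (fun K => ν ∈ K), f K ν := by
    intro f
    refine Finset.sum_comm' fun K ν => ?_
    rw [Finset.mem_filter]
    exact ⟨fun h => ⟨h, hV h.1 h.2⟩, fun h => h.1⟩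
  have h1 : ∑ K ∈ T.cells, ∑ ν ∈ K, vertVar v ν ^ 2 ≤
      1 / ρ ^ 2 * ∑ ν ∈ V, vertVar v ν ^ 2 := by
    rw [swap, Finset.mul_sum]
    refine Finset.sum_le_sum fun ν _ => ?_
    rw [Finset.sum_const, nsmul_eq_mul]
    exact mul_le_mul_of_nonneg_right (hN ν) (sq_nonneg _)
  have h2 : ∑ ν ∈ V, vertVar v ν ^ 2 ≤ 1 / ρ ^ 2 * ∑ K ∈ T.cells, ∑ ν ∈ K, gradVar v K ^ 2 := by
    rw [swap, Finset.mul_sum]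
    refine Finset.sum_le_sum fun ν _ => ?_
    refine (sq_sum_le_card_mul_sum_sq (s := T.cells.filter fun K => ν ∈ K)
      (f := fun K => gradVar v K)).trans ?_
    exact mul_le_mul_of_nonneg_right (hN ν) (Finset.sum_nonneg fun _ _ => sq_nonneg _)
  have h3 : ∑ K ∈ T.cells, ∑ ν ∈ K, gradVar v K ^ 2 ≤ 1 / ρ ^ 2 * normY T v ^ 2 := by
    rw [normY_sq, Finset.mul_sum]
    refine Finset.sum_le_sum fun K hK => ?_
    rw [Finset.sum_const, T.card_eq K hK, gradVar, mul_pow, Real.sq_sqrt (hessSq_nonneg _)]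
    have h4 := T.diam_sq_le hρ hT hK
    have h5 := mul_le_mul_of_nonneg_right h4 (hessSq_nonneg (v.1 K))
    rw [div_mul_eq_mul_div, one_mul, le_div_iff₀ (by positivity)]
    simp only [nsmul_eq_mul, Nat.cast_ofNat]
    nlinarith
  calc _ ≤ 1 / ρ ^ 2 * (1 / ρ ^ 2 * (1 / ρ ^ 2 * normY T v ^ 2)) := by
        refine h1.trans ?_
        gcongr
        refine h2.trans ?_
        gcongr
    _ = _ := by field_simp

end MorleyUC
end

noncomputable section

open MeasureTheory Set Filter Topology
namespace MorleyUC

variable {Ω : Set Plane} {T : Triangulation Ω} {K L : Finset Plane}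
  {w : Plane → ℝ} {P : Finset Plane → Fin 3 → Poly} {sel : Plane → Finset Plane} {v : Morley T}

/-- The constant in the local stability estimate of the companion operator. -/
def stabConst (ρ : ℝ) : ℝ :=
  (2 / ρ ^ 2 + 1) * ((1 / (6 * ρ ^ 2)) ^ 2 * (80 + 176 * (1 / (6 * ρ ^ 2))))

theorem IsCompanionFn.abs_second_sub_le {ρ : ℝ} (hρ : 0 < ρ) (hT : T.ShapeRegular ρ)
    (hsel : T.IsSelection sel) (h : IsCompanionFn T sel v w) (hP : HCTPieces T w P)
    (hK : K ∈ T.cells) {i : Fin 3} {x : Plane} (hx : x ∈ tri (subTri (vert K) i)) (k l : Fin 2) :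
    |ev (MvPolynomial.pderiv k (MvPolynomial.pderiv l (P K i))) x -
      ev (MvPolynomial.pderiv k (MvPolynomial.pderiv l (v.1 K))) x| * Metric.diam (hull K) ≤
      stabConst ρ * ∑ ν ∈ K, vertVar v ν := by
  have hD := T.detT_vert hK
  have hdeg := Deg_mono (by norm_num : 2 ≤ 3) (MorleyMem.deg v K)
  have hloc : LocalHCT (vert K) (fun i => P K i - v.1 K) := (hP.loc K hK).sub (LocalHCT.const hdeg)
  set g : Fin 3 → Plane →L[ℝ] ℝ := fun k => fderiv ℝ w (vert K k) - gradP (v.1 K) (vert K k)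
    with hg
  have hval : ∀ k, w (vert K k) = ev (v.1 K) (vert K k) := fun k => by
    by_cases hk : vert K k ∈ Ω
    · exact (h.vertex K hK k hk).1
    · rw [hP.off _ hk, MorleyMem.val_off v hK (T.vert_mem hK k) hk]
  have hA : 0 ≤ ∑ ν ∈ K, vertVar v ν := Finset.sum_nonneg fun ν _ => vertVar_nonneg v ν
  have key := hloc.abs_second_deriv_le hD (g := g)
    (γ := (2 / ρ ^ 2 + 1) * ∑ ν ∈ K, vertVar v ν) (H := Metric.diam (hull K)) ?_ ?_ ?_ ?_
    (T.dist_vert_le hK) (tri_sub_subset hD i hx) i k l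
  · rw [map_sub, map_sub, ev_sub] at key
    set H := Metric.diam (hull K) with hH
    have hH0 : 0 < H := T.diam_pos hK
    have hdet : 0 < |detT (vert K)| := abs_pos.2 hD
    have hκ : H * (H / |detT (vert K)|) ≤ 1 / (6 * ρ ^ 2) := by
      rw [← mul_div_assoc, div_le_div_iff₀ hdet (by positivity)]
      nlinarith [T.diam_sq_le hρ hT hK]
    have hκ0 : 0 ≤ H * (H / |detT (vert K)|) := by positivity
    calc _ ≤ (2 / ρ ^ 2 + 1) * (∑ ν ∈ K, vertVar v ν) * H * (H / |detT (vert K)|) ^ 2 *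
          (80 + 176 * (H * (H / |detT (vert K)|))) * H := by gcongr
      _ = (2 / ρ ^ 2 + 1) * ((H * (H / |detT (vert K)|)) ^ 2 *
          (80 + 176 * (H * (H / |detT (vert K)|)))) * ∑ ν ∈ K, vertVar v ν := by ring
      _ ≤ _ := by
        rw [stabConst]
        gcongr
  · intro i k hk
    rw [ev_sub, ← hP.val K hK i _ (vert_mem_subTri hK hk), hval, sub_self]
  · intro i k hk n
    rw [dirD_sub, ← hP.grad_apply hK (vert_mem_subTri hK hk), hg, sub_apply, gradP_apply]
  · intro i
    have h1 := h.edge_eq hK i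
    rw [hP.simpson hK] at h1
    have h2 : dirD (v.1 K) (vert K (i + 1)) (norT (vert K) i) +
        dirD (v.1 K) (vert K (i + 2)) (norT (vert K) i) =
        2 * dirD (v.1 K) (midT (vert K) i) (norT (vert K) i) := by
      have e1 := avg_dirD_mid (MorleyMem.deg v K) (vert K) i (norT (vert K) i)
      rw [avg_dirD_simpson hdeg] at e1
      linarith
    rw [dirD_sub, ← hP.grad_apply hK (midT_mem_subTri hK i), hg]
    simp only [sub_apply, gradP_apply]
    linarith
  · intro k
    refine (norm_gradient_defect_le v hρ hT hsel h hK k).trans ?_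
    gcongr
    exact Finset.single_le_sum (fun ν _ => vertVar_nonneg v ν) (T.vert_mem hK k)

theorem setIntegral_second_sq_le {ρ : ℝ} (hρ : 0 < ρ) (hT : T.ShapeRegular ρ)
    (hsel : T.IsSelection sel) (h : IsCompanionFn T sel v w) {W : JetSpace Ω} (hW : W ∈ H20 Ω)
    (hfn : W.fn =ᵐ[volume.restrict Ω] w) (hK : K ∈ T.cells) (k l : Fin 2) :
    ∫ x in hull K, W (Sum.inr (Sum.inr (k, l))) x * W (Sum.inr (Sum.inr (k, l))) x ≤
      |detT (vert K)| * ev (MvPolynomial.pderiv k (MvPolynomial.pderiv l (v.1 K))) 0 ^ 2 +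
      3 * stabConst ρ ^ 2 * ∑ ν ∈ K, vertVar v ν ^ 2 := by
  have hD := T.detT_vert hK
  obtain ⟨P, hP⟩ := h.pieces
  have hH0 : 0 < Metric.diam (hull K) := T.diam_pos hK
  have hdet : |detT (vert K)| ≤ Metric.diam (hull K) ^ 2 := by
    refine (abs_detT_le (T.dist_vert_le hK) 0).trans ?_
    rw [sq]
    gcongr
    exact T.dist_vert_le hK _ _
  obtain ⟨d, hd⟩ : ∃ d, d = ev (MvPolynomial.pderiv k (MvPolynomial.pderiv l (v.1 K))) 0 :=
    ⟨_, rfl⟩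
  rw [← hd]
  obtain ⟨B, hB⟩ : ∃ B, B = stabConst ρ * (∑ ν ∈ K, vertVar v ν) / Metric.diam (hull K) :=
    ⟨_, rfl⟩
  have hpt : ∀ᵐ x ∂(volume.restrict (hull K)),
      W (Sum.inr (Sum.inr (k, l))) x * W (Sum.inr (Sum.inr (k, l))) x ≤ 2 * d ^ 2 + 2 * B ^ 2 := by
    have h1 : ∀ᵐ x, ∀ i, x ∈ tri (subTri (vert K) i) → W (Sum.inr (Sum.inr (k, l))) x =
        ev (MvPolynomial.pderiv k (MvPolynomial.pderiv l (P K i))) x :=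
      ae_all_iff.2 fun i => hP.second_ae hW hfn hK i k l
    filter_upwards [ae_restrict_of_ae h1, ae_restrict_mem (T.measurableSet_hull hK)] with x hx hxK
    rw [T.hull_eq_tri hK] at hxK
    obtain ⟨i, hi⟩ := exists_mem_tri_sub hD hxK
    have h2 := h.abs_second_sub_le hρ hT hsel hP hK hi k l
    rw [← le_div_iff₀ hH0, ← hB, ev_second_eq (MorleyMem.deg v K), ← hd, ← hx i hi] at h2
    have h3 := sq_le_sq' (by linarith [abs_nonneg (W (Sum.inr (Sum.inr (k, l))) x - d)]) h2
    rw [sq_abs] at h3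
    nlinarith [sq_nonneg (W (Sum.inr (Sum.inr (k, l))) x - 2 * d)]
  have hfin : volume (hull K) ≠ ⊤ := (T.hull_isCompact hK).measure_lt_top.ne
  have h1 : ∫ x in hull K, W (Sum.inr (Sum.inr (k, l))) x * W (Sum.inr (Sum.inr (k, l))) x ≤
      ∫ x in hull K, (2 * d ^ 2 + 2 * B ^ 2) :=
    integral_mono_ae (T.integrableOn_hull (L2_integrable_mul _ _) hK) (integrableOn_const hfin) hpt
  refine h1.trans ?_
  rw [setIntegral_const, T.hull_eq_tri hK, volume_real_tri hD, smul_eq_mul]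
  have h2 : |detT (vert K)| * B ^ 2 ≤ 3 * stabConst ρ ^ 2 * ∑ ν ∈ K, vertVar v ν ^ 2 := by
    have h3 := sq_sum_le_card_mul_sum_sq (s := K) (f := fun ν => vertVar v ν)
    rw [T.card_eq K hK] at h3
    calc _ ≤ Metric.diam (hull K) ^ 2 * B ^ 2 := by gcongr
      _ = stabConst ρ ^ 2 * (∑ ν ∈ K, vertVar v ν) ^ 2 := by rw [hB]; field_simp
      _ ≤ stabConst ρ ^ 2 * ((3 : ℕ) * ∑ ν ∈ K, vertVar v ν ^ 2) := by gcongr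
      _ = _ := by push_cast; ring
  nlinarith

theorem norm_sq_eq_sum (T : Triangulation Ω) (f : L2 Ω) :
    ‖f‖ ^ 2 = ∑ K ∈ T.cells, ∫ x in hull K, f x * f x := by
  rw [← real_inner_self_eq_norm_sq, L2_inner_eq, T.setIntegral_eq_sum (L2_integrable_mul f f)]

/-- The companion operator is bounded, uniformly for shape regular triangulations. -/
theorem exists_companion_bound (hb : Bornology.IsBounded Ω) {ρ : ℝ} (hρ : 0 < ρ) :
    ∃ C : ℝ, 0 < C ∧ ∀ T : Triangulation Ω, T.ShapeRegular ρ → ∀ sel, T.IsSelection sel →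
      ∀ (v : Morley T) w, IsCompanionFn T sel v w → ∀ W ∈ H20 Ω,
        W.fn =ᵐ[volume.restrict Ω] w → ‖W‖ ≤ C * normY T v := by
  obtain ⟨C, hC, hCW⟩ := exists_poincare hb
  refine ⟨√(C * (2 + 12 * stabConst ρ ^ 2 / ρ ^ 6)), by positivity,
    fun T hT sel hsel v w h W hW hfn => ?_⟩
  have h1 : semiSq W ≤ (2 + 12 * stabConst ρ ^ 2 / ρ ^ 6) * normY T v ^ 2 := by
    have e : semiSq W = ∑ K ∈ T.cells, ∑ k, ∑ l, ∫ x in hull K,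
        W (Sum.inr (Sum.inr (k, l))) x * W (Sum.inr (Sum.inr (k, l))) x := by
      rw [semiSq, Finset.sum_comm]
      simp only [norm_sq_eq_sum T]
      simp only [Finset.sum_comm (s := T.cells)]
      exact Finset.sum_comm
    calc semiSq W ≤ ∑ K ∈ T.cells, ∑ k : Fin 2, ∑ l : Fin 2, (|detT (vert K)| *
          ev (MvPolynomial.pderiv k (MvPolynomial.pderiv l (v.1 K))) 0 ^ 2 +
          3 * stabConst ρ ^ 2 * ∑ ν ∈ K, vertVar v ν ^ 2) := by
          rw [e]
          exact Finset.sum_le_sum fun K hK => Finset.sum_le_sum fun k _ =>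
            Finset.sum_le_sum fun l _ => setIntegral_second_sq_le hρ hT hsel h hW hfn hK k l
      _ = 2 * normY T v ^ 2 + 12 * stabConst ρ ^ 2 *
          ∑ K ∈ T.cells, ∑ ν ∈ K, vertVar v ν ^ 2 := by
          rw [normY_sq, Finset.mul_sum, Finset.mul_sum, ← Finset.sum_add_distrib]
          refine Finset.sum_congr rfl fun K _ => ?_
          simp only [hessSq, Fin.sum_univ_two]
          ring
      _ ≤ 2 * normY T v ^ 2 + 12 * stabConst ρ ^ 2 * (1 / ρ ^ 6 * normY T v ^ 2) := by
          gcongr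
          exact sum_vertVar_sq_le hρ hT v
      _ = _ := by ring
  refine le_of_sq_le_sq ?_ (mul_nonneg (Real.sqrt_nonneg _) (normY_nonneg v))
  rw [mul_pow, Real.sq_sqrt (by positivity)]
  calc ‖W‖ ^ 2 ≤ C * semiSq W := hCW W hW
    _ ≤ C * ((2 + 12 * stabConst ρ ^ 2 / ρ ^ 6) * normY T v ^ 2) := by gcongr
    _ = _ := by ring

theorem eq_zero_of_normY_eq_zero (hb : Bornology.IsBounded Ω) {ρ : ℝ} (hρ : 0 < ρ)
    (hT : T.ShapeRegular ρ) (hsel : T.IsSelection sel) (h : IsCompanionFn T sel v w)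
    (h0 : normY T v = 0) : v = 0 := by
  obtain ⟨C, hC, hCb⟩ := exists_companion_bound hb hρ
  obtain ⟨P, hP⟩ := h.pieces
  obtain ⟨W, hW⟩ := (hP.isHCT hb).1
  have hWn : (W : JetSpace Ω) = 0 := by
    have := hCb T hT sel hsel v w h W W.2 hW
    rw [h0, mul_zero] at this
    exact norm_le_zero_iff.1 this
  have hw0 : w =ᵐ[volume.restrict Ω] fun _ => 0 := by
    refine hW.symm.trans ?_
    rw [hWn]
    exact Lp.coeFn_zero _ _ _
  have hwz : EqOn w (fun _ => 0) Ω :=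
    Measure.eqOn_open_of_ae_eq hw0 T.isOpen hP.differentiable.continuous.continuousOn
      continuousOn_const
  have hhess : ∀ K ∈ T.cells, hessSq (v.1 K) = 0 := by
    intro K hK
    have h1 := normY_sq v
    rw [h0, zero_pow two_ne_zero, eq_comm, Finset.sum_eq_zero_iff_of_nonneg fun K _ =>
      mul_nonneg (by positivity) (hessSq_nonneg _)] at h1
    have h2 := mul_eq_zero.1 (h1 K hK)
    have := T.detT_vert hK
    rcases h2 with h2 | h2
    · simp [this] at h2
    · exact h2
  refine Subtype.ext (funext fun K => ?_)
  by_cases hK : K ∈ T.cells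
  swap
  · exact v.2.1 K hK
  have hD := T.detT_vert hK
  have hval : ∀ k, ev (v.1 K) (vert K k) = 0 := fun k => by
    by_cases hk : vert K k ∈ Ω
    · rw [← (h.vertex K hK k hk).1, hwz hk]
    · exact MorleyMem.val_off v hK (T.vert_mem hK k) hk
  have hconst : ∀ x y, gradP (v.1 K) x = gradP (v.1 K) y := fun x y => by
    have := norm_gradP_sub_le (MorleyMem.deg v K) x y
    rw [hhess K hK, Real.sqrt_zero, zero_mul] at this
    exact sub_eq_zero.1 (norm_le_zero_iff.1 this)
  have htan : ∀ x i, gradP (v.1 K) x (vert K (i + 2) - vert K (i + 1)) = 0 := fun x i => by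
    rw [hconst x (vert K (i + 1) + (1 / 2 : ℝ) • (vert K (i + 2) - vert K (i + 1))), gradP_apply,
      dirD_mid_eq (MorleyMem.deg v K), hval, hval, sub_self]
  have hgrad : ∀ x n, dirD (v.1 K) x n = 0 := by
    intro x n
    rw [← gradP_apply, eq_sum_gl hD 0 n, map_add, map_smul, map_smul]
    have h1 := htan x 1
    have h2 := htan x 2
    rw [← neg_sub, map_neg, neg_eq_zero] at h1
    simp at h1 h2 ⊢
    rw [h1, h2]; simp
  exact (LocalHCT.const (t := vert K) (Deg_mono (by norm_num : 2 ≤ 3) (MorleyMem.deg v K))).eq_zero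
    hD (fun _ k _ => hval k) (fun _ k _ n => hgrad _ n)
    (fun i => ⟨norT (vert K) i, gl_norT_ne hD i, hgrad _ _⟩) 0

end MorleyUC
end

noncomputable section

open MeasureTheory Set Filter Topology
namespace MorleyUC

variable {Ω : Set Plane} {T : Triangulation Ω} {K L : Finset Plane} {φ : Plane → ℝ}

/-- The piece of the Morley interpolant on a triangle. -/
def interpP (φ : Plane → ℝ) (t : Fin 3 → Plane) : Poly :=
  ∑ i, (φ (t i) • lamP t i +
    (((∑ j, φ (t j) * gl t j (norT t i)) -
      avg (t (i + 1)) (t (i + 2)) (fun x => fderiv ℝ φ x (norT t i))) / gl t i (norT t i)) •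
      (lamP t i * (lamP t i - MvPolynomial.C 1)))

theorem interpP_mem (φ : Plane → ℝ) (t : Fin 3 → Plane) : interpP φ t ∈ Deg 2 := by
  refine Submodule.sum_mem _ fun i _ => Submodule.add_mem _ (Submodule.smul_mem _ _
    (Deg_mono one_le_two (lamP_mem t i))) (Submodule.smul_mem _ _ ?_)
  refine mul_mem_Deg (k := 1) (l := 1) (lamP_mem t i) (Submodule.sub_mem _ (lamP_mem t i) ?_)
  exact mem_Deg.2 (by simp)

theorem ev_interpP {t : Fin 3 → Plane} (h : detT t ≠ 0) (k : Fin 3) :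
    ev (interpP φ t) (t k) = φ (t k) := by
  rw [interpP, ev_sum, Finset.sum_eq_single_of_mem k (Finset.mem_univ k)]
  · simp only [ev_add, ev_smul, ev_mul, ev_sub, ev_lamP, ev_C, lam_self h]
    ring
  · intro i _ hik
    simp [ev_add, ev_smul, ev_mul, ev_lamP, lam_ne h hik]

theorem dirD_interpP {t : Fin 3 → Plane} (h : detT t ≠ 0) (i : Fin 3) :
    dirD (interpP φ t) (midT t i) (norT t i) =
      avg (t (i + 1)) (t (i + 2)) (fun x => fderiv ℝ φ x (norT t i)) := by
  obtain ⟨h0, h1, h2⟩ := lam_midT h i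
  have hne := gl_norT_ne h i
  rw [interpP, dirD_sum]
  simp only [dirD_add, dirD_smul, dirD_mul, dirD_sub, dirD_C, ev_sub, ev_lamP, ev_C, dirD_lamP,
    Finset.sum_add_distrib]
  rw [sum_fin3 i (fun j => _ / _ * _), h0, h1, h2]
  field_simp
  ring

theorem avg_fderiv_eq_interpP (hφ : ContDiff ℝ smooth φ) {t : Fin 3 → Plane} (h : detT t ≠ 0)
    (i : Fin 3) (n : Plane) :
    avg (t (i + 1)) (t (i + 2)) (fun x => fderiv ℝ φ x n) = dirD (interpP φ t) (midT t i) n := by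
  have hc : ∀ n, Continuous fun x => fderiv ℝ φ x n := fun n =>
    (hφ.continuous_fderiv (by simp)).clm_apply continuous_const
  let f : Plane →ₗ[ℝ] ℝ :=
    { toFun := fun n => avg (t (i + 1)) (t (i + 2)) (fun x => fderiv ℝ φ x n) -
        dirD (interpP φ t) (midT t i) n
      map_add' := fun n m => by
        simp only [map_add, dirD_add_right]
        rw [avg_add (hc n) (hc m)]; ring
      map_smul' := fun c n => by
        simp only [map_smul, smul_eq_mul, dirD_smul_right, RingHom.id_apply]
        rw [avg_const_mul]; ring }
  have hf : LinearMap.toContinuousLinearMap f = 0 := by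
    refine clm_eq_zero_of_edge h i ?_ ?_
    · change avg _ _ _ - _ = (0 : ℝ)
      rw [dirD_interpP h, sub_self]
    · change avg _ _ _ - _ = (0 : ℝ)
      rw [avg_fderiv (hφ.of_le (WithTop.coe_le_coe.2 le_top)), midT,
        dirD_mid_eq (interpP_mem φ t), ev_interpP h, ev_interpP h, sub_self]
  exact sub_eq_zero.1 (congrArg (fun F : Plane →L[ℝ] ℝ => F n) hf)

theorem setIntegral_second_interpP (hφ : ContDiff ℝ smooth φ) {t : Fin 3 → Plane}
    (h : detT t ≠ 0) (k l : Fin 2) :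
    ∫ x in tri t, derivOf φ (Sum.inr (Sum.inr (k, l))) x =
      ∫ x in tri t, ev (MvPolynomial.pderiv k (MvPolynomial.pderiv l (interpP φ t))) x := by
  rw [setIntegral_second_tri h]
  have := setIntegral_fderiv_tri h ((partialD_contDiff hφ l).of_le (WithTop.coe_le_coe.2 le_top))
    (EuclideanSpace.single k 1)
  refine this.trans ?_
  congr 1
  refine Finset.sum_congr rfl fun i _ => ?_
  rw [avg_dirD_mid (interpP_mem φ t), ← avg_fderiv_eq_interpP hφ h]
  rfl

theorem fderiv_eq_zero_off (hφ : IsTest Ω φ) {x : Plane} (hx : x ∉ Ω) : fderiv ℝ φ x = 0 :=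
  fderiv_of_notMem_tsupport (𝕜 := ℝ) fun h => hx (hφ.2.2 h)

/-- The Morley interpolant of a test function. -/
theorem interp_mem (hφ : IsTest Ω φ) [DecidablePred (· ∈ T.cells)] :
    (fun K => if K ∈ T.cells then interpP φ (vert K) else 0) ∈ Morley T := by
  have hnor : ∀ K ∈ T.cells, ∀ i n, dirD (interpP φ (vert K)) (midT (vert K) i) n =
      avg (vert K (i + 1)) (vert K (i + 2)) (fun x => fderiv ℝ φ x n) := fun K hK i n =>
    (avg_fderiv_eq_interpP hφ.1 (T.detT_vert hK) i n).symm
  have hev : ∀ K ∈ T.cells, ∀ ν ∈ K, ev (interpP φ (vert K)) ν = φ ν := by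
    intro K hK ν hν
    obtain ⟨k, rfl⟩ := T.exists_vert_eq hK hν
    exact ev_interpP (T.detT_vert hK) k
  refine ⟨fun K hK => if_neg hK, fun K => ?_, fun K hK L hL ν h1 h2 => ?_, fun K hK ν h1 h2 => ?_,
    fun K hK L hL e he h1 h2 n hn => ?_, fun K hK e he h1 h2 n hn => ?_⟩
  · dsimp only
    split_ifs
    · exact interpP_mem _ _
    · exact Submodule.zero_mem _
  · beta_reduce
    rw [if_pos hK, if_pos hL, hev K hK ν h1, hev L hL ν h2]
  · beta_reduce
    rw [if_pos hK, hev K hK ν h1]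
    exact image_eq_zero_of_notMem_tsupport fun h => h2 (hφ.2.2 h)
  · beta_reduce
    rw [if_pos hK, if_pos hL]
    obtain ⟨i, rfl⟩ := exists_eq_edgeOf hK (card_of_mem_edges he) h1
    obtain ⟨j, hj⟩ := exists_eq_edgeOf hL (card_of_mem_edges he) h2
    rw [mid_edgeOf hK, hnor K hK, ← mid_edgeOf hK, hj, mid_edgeOf hL, hnor L hL]
    have hset := hj ▸ coe_edgeOf K i
    rw [coe_edgeOf, pair_eq_pair_iff] at hset
    rcases hset with ⟨e1, e2⟩ | ⟨e1, e2⟩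
    · rw [e1, e2]
    · rw [e1, e2, avg_comm]
  · beta_reduce
    rw [if_pos hK]
    obtain ⟨i, rfl⟩ := exists_eq_edgeOf hK (card_of_mem_edges he) h1
    rw [edgeOf_mem_intEdges hK] at h2
    rw [mid_edgeOf hK, hnor K hK, ← avg_const (vert K (i + 1)) (vert K (i + 2)) 0]
    refine avg_congr fun τ hτ => ?_
    have hx := edge_point_mem_subTri hK i hτ
    have hxK : vert K (i + 1) + τ • (vert K (i + 2) - vert K (i + 1)) ∈ hull K := by
      rw [T.hull_eq_tri hK]; exact tri_sub_subset (T.detT_vert hK) i hx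
    have hl : lam (vert K) i (vert K (i + 1) + τ • (vert K (i + 2) - vert K (i + 1))) = 0 := by
      rw [lam_line, lam_ne (T.detT_vert hK) (fin3_succ_ne i).1.symm,
        lam_ne (T.detT_vert hK) (fin3_succ_ne i).2.1.symm]
      ring
    rw [fderiv_eq_zero_off hφ fun hxΩ => h2 ?_]
    · rfl
    rcases vertex_or_openEdge hK hxK hl with ⟨k, hk, hxk⟩ | hxo
    · exact T.midT_mem_of_vert_mem hK hk (hxk ▸ hxΩ)
    · exact T.openEdge_subset hK hxo hxΩ (T.midT_mem_openEdge hK i)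

/-- The Morley interpolant preserves the mean values of the second derivatives. -/
theorem exists_morley_interpolant (T : Triangulation Ω) (hφ : IsTest Ω φ) : ∃ v : Morley T,
    ∀ K ∈ T.cells, ∀ k l : Fin 2,
      ∫ x in hull K, jetOf Ω hφ.1 hφ.2.1 (Sum.inr (Sum.inr (k, l))) x =
        ∫ x in hull K, ev (MvPolynomial.pderiv k (MvPolynomial.pderiv l (v.1 K))) x := by
  classical
  refine ⟨⟨_, interp_mem hφ⟩, fun K hK k l => ?_⟩
  rw [integral_congr_ae (T.ae_restrict_hull (jetOf_coe hφ.1 hφ.2.1 _) hK)]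
  dsimp only
  rw [if_pos hK, T.hull_eq_tri hK]
  exact setIntegral_second_interpP hφ.1 (T.detT_vert hK) k l

/-- The inf-sup stability of the Morley space for piecewise constants. -/
theorem norm_opB_le (hb : Bornology.IsBounded Ω) {z : L2 Ω} (hz : z ∈ pwConst T) {D : ℝ}
    (hD : 0 ≤ D) (h : ∀ v : Morley T, |opBd T z (morleyJet T v)| ≤ D * normY T v) :
    ‖opB Ω z‖ ≤ D := by
  have key : ∀ W ∈ H20 Ω, |inner ℝ z (lap Ω W)| ≤ D * ‖W‖ := by
    intro W hW
    refine H20_induction (P := fun W => |inner ℝ z (lap Ω W)| ≤ D * ‖W‖)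
      (isClosed_le (by fun_prop) (by fun_prop)) (fun φ hφ => ?_) hW
    obtain ⟨v, hv⟩ := exists_morley_interpolant T hφ
    obtain ⟨W, hW⟩ : ∃ W, W = jetOf Ω hφ.1 hφ.2.1 := ⟨_, rfl⟩
    rw [← hW] at hv ⊢
    have h1 : opBd T z (morleyJet T v) = -inner ℝ z (lap Ω W) := by
      rw [L2_inner_eq, T.setIntegral_eq_sum (L2_integrable_mul z (lap Ω W)), opBd]
      congr 1
      refine Finset.sum_congr rfl fun K hK => ?_
      obtain ⟨c, hc⟩ := hz K hK
      have e1 : ∀ f : L2 Ω, ∫ x in hull K, z x * f x = c * ∫ x in hull K, f x := by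
        intro f
        rw [← integral_const_mul]
        refine integral_congr_ae ?_
        filter_upwards [T.ae_restrict_hull hc hK, ae_restrict_mem (T.measurableSet_hull hK)]
          with x e1 hx
        rw [e1 hx]
      rw [e1, e1, setIntegral_lap hb _ hK, setIntegral_lap hb _ hK, hv K hK, hv K hK,
        integral_congr_ae (morleyJet_ae v hK _), integral_congr_ae (morleyJet_ae v hK _)]
      rfl
    have h2 : normY T v ≤ ‖W‖ := by
      refine le_of_sq_le_sq ?_ (norm_nonneg _)
      have h3 : normY T v ^ 2 ≤ semiSq W := by
        rw [normY_sq, semiSq]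
        simp only [norm_sq_eq_sum T, hessSq, Finset.mul_sum]
        rw [Finset.sum_comm]
        refine Finset.sum_le_sum fun k _ => ?_
        rw [Finset.sum_comm]
        refine Finset.sum_le_sum fun l _ => Finset.sum_le_sum fun K hK => ?_
        have hvK := hv K hK k l
        simp only [ev_second_eq (MorleyMem.deg v K)] at hvK
        obtain ⟨d, hd⟩ : ∃ d, d = ev (MvPolynomial.pderiv k (MvPolynomial.pderiv l (v.1 K))) 0 :=
          ⟨_, rfl⟩
        obtain ⟨f, hf⟩ : ∃ f, f = W (Sum.inr (Sum.inr (k, l))) := ⟨_, rfl⟩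
        have hvol : volume.real (hull K) = |detT (vert K)| / 2 := by
          rw [T.hull_eq_tri hK, volume_real_tri (T.detT_vert hK)]
        rw [← hd, ← hf, setIntegral_const, hvol, smul_eq_mul] at hvK
        rw [← hd, ← hf]
        have i1 := T.integrableOn_hull (L2_integrable_mul f f) hK
        have i2 := T.integrableOn_hull (L2_integrableOn hb f) hK
        have hfin : volume (hull K) ≠ ⊤ := (T.hull_isCompact hK).measure_lt_top.ne
        have h4 : 0 ≤ ∫ x in hull K, (f x * f x + ((-2 * d) * f x + d ^ 2)) :=
          integral_nonneg fun x => by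
            change (0 : ℝ) ≤ _
            nlinarith [sq_nonneg (f x - d)]
        have i3 : IntegrableOn (fun _ => d ^ 2) (hull K) := integrableOn_const hfin
        have i4 : IntegrableOn (fun x => -2 * d * f x) (hull K) := i2.const_mul _
        have i5 : IntegrableOn (fun x => -2 * d * f x + d ^ 2) (hull K) := i4.add i3
        rw [integral_add i1 i5, integral_add i4 i3, integral_const_mul, hvK,
          setIntegral_const, hvol, smul_eq_mul] at h4
        linarith
      refine h3.trans ?_
      rw [JetSpace.norm_sq]
      have := Finset.sum_nonneg fun (i : Fin 2) (_ : i ∈ Finset.univ) =>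
        sq_nonneg ‖W (Sum.inr (Sum.inl i))‖
      nlinarith [sq_nonneg ‖W (Sum.inl ())‖]
    have h5 := h v
    rw [h1, abs_neg] at h5
    exact h5.trans (mul_le_mul_of_nonneg_left h2 hD)
  refine ContinuousLinearMap.opNorm_le_bound _ hD fun v => ?_
  have := key v v.2
  simpa [opB] using this

end MorleyUC
end

noncomputable section

open MeasureTheory Set Filter Topology
namespace MorleyUC

variable {Ω ω : Set Plane} {T : Triangulation Ω} {K L : Finset Plane}

/-! ### The dual norm -/

/-- The second derivatives of a Morley function, weighted such that the Euclidean norm is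
`‖·‖_Y`. -/
def hessMap (T : Triangulation Ω) :
    Morley T →ₗ[ℝ] EuclideanSpace ℝ (T.cells × Fin 2 × Fin 2) where
  toFun v := WithLp.toLp 2 fun a => √(|detT (vert a.1.1)| / 2) *
    ev (MvPolynomial.pderiv a.2.1 (MvPolynomial.pderiv a.2.2 (v.1 a.1.1))) 0
  map_add' v w := by
    ext a
    simp [ev_add, mul_add]
  map_smul' c v := by
    ext a
    simp [ev_smul]
    ring

theorem norm_hessMap (v : Morley T) : ‖hessMap T v‖ = normY T v := by
  refine (sq_eq_sq₀ (norm_nonneg _) (normY_nonneg v)).1 ?_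
  rw [EuclideanSpace.norm_sq_eq, normY_sq, Fintype.sum_prod_type,
    ← Finset.sum_coe_sort T.cells fun K => |detT (vert K)| / 2 * hessSq (v.1 K)]
  refine Finset.sum_congr rfl fun K _ => ?_
  rw [Fintype.sum_prod_type, hessSq, Finset.mul_sum]
  refine Finset.sum_congr rfl fun k _ => ?_
  rw [Finset.mul_sum]
  refine Finset.sum_congr rfl fun l _ => ?_
  simp only [hessMap, LinearMap.coe_mk, AddHom.coe_mk, norm_mul, mul_pow, Real.norm_eq_abs, sq_abs]
  rw [Real.sq_sqrt (by positivity)]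

theorem dualNormY_nonneg (f : Morley T → ℝ) : 0 ≤ dualNormY T f := by
  refine Real.sSup_nonneg ?_
  rintro r ⟨v, _, rfl⟩
  exact div_nonneg (abs_nonneg _) (normY_nonneg v)

theorem dualNormY_le {f : Morley T → ℝ} {D : ℝ} (hD : 0 ≤ D)
    (h : ∀ v, |f v| ≤ D * normY T v) : dualNormY T f ≤ D := by
  refine Real.sSup_le ?_ hD
  rintro r ⟨v, _, rfl⟩
  exact div_le_of_le_mul₀ (normY_nonneg v) hD (h v)

/-- A Riesz representation of the functionals on the Morley space. -/
theorem exists_riesz (h0 : ∀ v : Morley T, normY T v = 0 → v = 0) :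
    (∃ r : (Morley T →ₗ[ℝ] ℝ) →ₗ[ℝ] EuclideanSpace ℝ (T.cells × Fin 2 × Fin 2),
      ∀ f : Morley T →ₗ[ℝ] ℝ, ‖r f‖ = dualNormY T f) ∧
    ∀ (f : Morley T →ₗ[ℝ] ℝ) v, |f v| ≤ dualNormY T f * normY T v := by
  have hinj : Function.Injective (hessMap T) := by
    rw [← LinearMap.ker_eq_bot, LinearMap.ker_eq_bot']
    intro v hv
    refine h0 v ?_
    rw [← norm_hessMap, hv, norm_zero]
  obtain ⟨R, hR⟩ : ∃ R, R = LinearMap.range (hessMap T) := ⟨_, rfl⟩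
  obtain ⟨e, he⟩ : ∃ e : Morley T ≃ₗ[ℝ] R, ∀ v, ‖e v‖ = normY T v := by
    subst hR
    exact ⟨LinearEquiv.ofInjective _ hinj, fun v => norm_hessMap v⟩
  let F : (Morley T →ₗ[ℝ] ℝ) → R →L[ℝ] ℝ := fun f =>
    LinearMap.toContinuousLinearMap (f ∘ₗ e.symm.toLinearMap)
  have hF : ∀ f v, f v = F f (e v) := fun f v => by
    change f v = f (e.symm (e v))
    rw [e.symm_apply_apply]
  have hle : ∀ f v, |f v| ≤ ‖F f‖ * normY T v := fun f v => by
    rw [hF f v, ← he]; exact (F f).le_opNorm _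
  have hpos : ∀ v, v ≠ 0 → 0 < normY T v := fun v hv =>
    lt_of_le_of_ne (normY_nonneg v) fun h => hv (h0 v h.symm)
  have hge : ∀ (f : Morley T →ₗ[ℝ] ℝ) v, |f v| ≤ dualNormY T f * normY T v := by
    intro f v
    by_cases hv : v = 0
    · rw [hv, map_zero, abs_zero]
      exact mul_nonneg (dualNormY_nonneg _) (normY_nonneg _)
    · rw [← div_le_iff₀ (hpos v hv)]
      refine le_csSup ⟨‖F f‖, ?_⟩ ⟨v, hv, rfl⟩
      rintro r ⟨u, hu, rfl⟩
      rw [div_le_iff₀ (hpos u hu)]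
      exact hle f u
  have hnorm : ∀ f : Morley T →ₗ[ℝ] ℝ, ‖F f‖ = dualNormY T f := by
    intro f
    refine le_antisymm ?_ (dualNormY_le (F f).opNorm_nonneg (hle f))
    refine (F f).opNorm_le_bound (dualNormY_nonneg _) fun x => ?_
    obtain ⟨v, rfl⟩ := e.surjective x
    rw [← hF, he]
    exact hge f v
  refine ⟨⟨
    { toFun := fun f => (((InnerProductSpace.toDual ℝ R).symm (F f) : R) : EuclideanSpace ℝ _)
      map_add' := fun f g => by
        rw [show F (f + g) = F f + F g from rfl, map_add]; rfl
      map_smul' := fun c f => by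
        rw [show F (c • f) = c • F f from rfl, LinearIsometryEquiv.map_smulₛₗ]; rfl },
    fun f => ?_⟩, hge⟩
  change ‖(InnerProductSpace.toDual ℝ R).symm (F f)‖ = _
  rw [LinearIsometryEquiv.norm_map, hnorm]

/-! ### Linearity of the discrete operator -/

/-- The restriction of a polynomial to a triangle as element of `L₂(Ω)`. -/
def polyL2 (Ω : Set Plane) (K : Finset Plane) : Poly →ₗ[ℝ] L2 Ω where
  toFun p := (ev_memLp Ω K p).toLp
  map_add' p q := by
    rw [← MemLp.toLp_add]
    refine MemLp.toLp_congr _ _ (Eventually.of_forall fun x => ?_)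
    by_cases hx : x ∈ hull K <;> simp [hx, ev_add]
  map_smul' c p := by
    rw [RingHom.id_apply, ← MemLp.toLp_const_smul]
    refine MemLp.toLp_congr _ _ (Eventually.of_forall fun x => ?_)
    by_cases hx : x ∈ hull K <;> simp [hx, ev_smul]

theorem lap_morleyJet (v : Morley T) : lap Ω (morleyJet T v) = ∑ k : Fin 2, ∑ K ∈ T.cells,
    polyL2 Ω K (MvPolynomial.pderiv k (MvPolynomial.pderiv k (v.1 K))) := by
  rw [lap_apply, Fin.sum_univ_two]
  rfl

theorem opBd_eq_inner (z : L2 Ω) (W : JetSpace Ω) :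
    opBd T z W = -inner ℝ z (lap Ω W) := by
  rw [L2_inner_eq, T.setIntegral_eq_sum (L2_integrable_mul z (lap Ω W)), opBd]

/-- The functionals `v ↦ (B^δ z)(v)` on the Morley space. -/
def opBdLin (T : Triangulation Ω) : L2 Ω →ₗ[ℝ] Morley T →ₗ[ℝ] ℝ :=
  LinearMap.mk₂ ℝ (fun z v => -inner ℝ z (lap Ω (morleyJet T v)))
    (fun z z' v => by rw [inner_add_left]; ring)
    (fun c z v => by rw [inner_smul_left]; simp)
    (fun z v v' => by
      simp only [lap_morleyJet, Submodule.coe_add, Pi.add_apply, map_add, Finset.sum_add_distrib,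
        inner_add_right]
      ring)
    (fun c z v => by
      simp only [lap_morleyJet, Submodule.coe_smul, Pi.smul_apply, Derivation.map_smul,
        LinearMap.map_smul, ← Finset.smul_sum, inner_smul_right, smul_eq_mul]
      ring)

theorem opBdLin_apply (z : L2 Ω) (v : Morley T) :
    opBdLin T z v = opBd T z (morleyJet T v) := (opBd_eq_inner z _).symm

/-- The piecewise constants form a finite-dimensional space. -/
theorem finiteDimensional_pwConst (T : Triangulation Ω) : FiniteDimensional ℝ (pwConst T) := by
  classical
  let b : Finset Plane → L2 Ω := fun K => polyL2 Ω K (MvPolynomial.C 1)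
  have hle : pwConst T ≤ Submodule.span ℝ (b '' T.cells) := by
    intro z hz
    choose c hc using hz
    have hz' : z = ∑ K ∈ T.cells.attach, c K.1 K.2 • b K.1 := by
      refine Lp.ext ?_
      have e1 := Lp.coeFn_finsetSum (p := 2) (μ := volume.restrict Ω) T.cells.attach
        (fun K => c K.1 K.2 • b K.1)
      have e2 : ∀ᵐ x ∂(volume.restrict Ω), ∀ K : T.cells, (c K.1 K.2 • b K.1 : L2 Ω) x =
          c K.1 K.2 * (hull K.1).indicator (fun _ => 1) x := by
        rw [ae_all_iff]
        intro K
        filter_upwards [Lp.coeFn_smul (c K.1 K.2) (b K.1),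
          MemLp.coeFn_toLp (ev_memLp Ω K.1 (MvPolynomial.C 1))] with x h1 h2
        rw [h1, Pi.smul_apply, smul_eq_mul]
        congr 1
        refine h2.trans ?_
        by_cases hx : x ∈ hull K.1 <;> simp [hx, ev]
      have e3 : ∀ᵐ x ∂(volume.restrict Ω), ∀ K : T.cells, x ∈ hull K.1 → z x = c K.1 K.2 := by
        rw [ae_all_iff]; exact fun K => hc K.1 K.2
      have e4 : ∀ᵐ x ∂(volume.restrict Ω), ∀ K L : T.cells, K ≠ L → x ∈ hull K.1 →
          x ∉ hull L.1 := by
        refine ae_restrict_of_ae (ae_all_iff.2 fun K => ae_all_iff.2 fun L => ?_)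
        by_cases h : K = L
        · exact Eventually.of_forall fun _ h' => absurd h h'
        · filter_upwards [T.ae_unique K.2 L.2 fun h' => h (Subtype.ext h')] with x hx _ using hx
      filter_upwards [e1, e2, e3, e4, ae_restrict_mem T.isOpen.measurableSet] with x h1 h2 h3 h4 hx
      obtain ⟨K, hK, hxK⟩ := T.exists_cell hx
      rw [h1, Finset.sum_apply, Finset.sum_eq_single_of_mem ⟨K, hK⟩ (Finset.mem_attach _ _), h2,
        h3 ⟨K, hK⟩ hxK, indicator_of_mem hxK, mul_one]
      intro L _ hL
      rw [h2, indicator_of_notMem (h4 ⟨K, hK⟩ L hL.symm hxK), mul_zero]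
    rw [hz']
    exact Submodule.sum_mem _ fun K _ => Submodule.smul_mem _ _
      (Submodule.subset_span ⟨K.1, K.2, rfl⟩)
  have : FiniteDimensional ℝ (Submodule.span ℝ (b '' T.cells)) :=
    FiniteDimensional.span_of_finite ℝ (T.cells.finite_toSet.image b)
  exact Submodule.finiteDimensional_of_le hle

/-! ### Least squares -/

theorem existsUnique_leastSquares {V F : Type*} [AddCommGroup V] [Module ℝ V]
    [NormedAddCommGroup F] [InnerProductSpace ℝ F] (X : Submodule ℝ V) [FiniteDimensional ℝ X]
    (Φ : V →ₗ[ℝ] F) (hinj : ∀ z ∈ X, Φ z = 0 → z = 0) (d : F) :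
    ∃! w, w ∈ X ∧ ∀ z ∈ X, ‖Φ w - d‖ ≤ ‖Φ z - d‖ := by
  obtain ⟨p, hp⟩ : ∃ p, p = (X.map Φ).starProjection d := ⟨_, rfl⟩
  have hpS : p ∈ X.map Φ := hp ▸ Submodule.starProjection_apply_mem _ d
  obtain ⟨w, hwX, hwp⟩ := hpS
  have hpyth : ∀ z ∈ X, ‖Φ z - d‖ ^ 2 = ‖Φ z - p‖ ^ 2 + ‖p - d‖ ^ 2 := by
    intro z hz
    have h0 : inner ℝ (Φ z - p) (p - d) = (0 : ℝ) := by
      have := Submodule.starProjection_inner_eq_zero (K := X.map Φ) d (Φ z - p)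
        (Submodule.sub_mem _ (Submodule.mem_map_of_mem hz) ⟨w, hwX, hwp⟩)
      rw [← hp, ← neg_sub p d, inner_neg_left, neg_eq_zero] at this
      rw [real_inner_comm]; exact this
    have := norm_add_sq_real (Φ z - p) (p - d)
    rw [h0, sub_add_sub_cancel] at this
    linarith
  refine ⟨w, ⟨hwX, fun z hz => ?_⟩, fun w' ⟨hw'X, hw'⟩ => ?_⟩
  · refine le_of_sq_le_sq ?_ (norm_nonneg _)
    rw [hpyth z hz, hpyth w hwX, hwp, sub_self]
    nlinarith [sq_nonneg ‖Φ z - p‖, norm_zero (E := F)]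
  · have h1 := pow_le_pow_left₀ (norm_nonneg _) (hw' w hwX) 2
    rw [hpyth w hwX, hpyth w' hw'X, hwp, sub_self, norm_zero] at h1
    have h2 : ‖Φ w' - p‖ ^ 2 ≤ 0 := by linarith
    have h3 : Φ w' - p = 0 := norm_eq_zero.1 (pow_eq_zero_iff two_ne_zero |>.1
      (le_antisymm h2 (sq_nonneg _)))
    refine sub_eq_zero.1 (hinj _ (X.sub_mem hw'X hwX) ?_)
    rw [map_sub, hwp, h3]

/-- The restriction operator from `L₂(Ω)` to `L₂(ω)`. -/
def restrL2 (h : ω ⊆ Ω) : L2 Ω →ₗ[ℝ] L2 ω where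
  toFun z := ((Lp.memLp z).mono_measure (Measure.restrict_mono h le_rfl)).toLp
  map_add' z z' := by
    rw [← MemLp.toLp_add]
    exact MemLp.toLp_congr _ _ (ae_mono (Measure.restrict_mono h le_rfl) (Lp.coeFn_add z z'))
  map_smul' c z := by
    rw [RingHom.id_apply, ← MemLp.toLp_const_smul]
    exact MemLp.toLp_congr _ _ (ae_mono (Measure.restrict_mono h le_rfl) (Lp.coeFn_smul c z))

theorem normL2_congr {f g : Plane → ℝ} (h : f =ᵐ[volume.restrict ω] g) :
    normL2 ω f = normL2 ω g := by
  rw [normL2, normL2, eLpNorm_congr_ae h]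

theorem norm_restrL2 (h : ω ⊆ Ω) (z : L2 Ω) : ‖restrL2 h z‖ = normL2 ω z :=
  normL2_congr (MemLp.coeFn_toLp ((Lp.memLp z).mono_measure (Measure.restrict_mono h le_rfl)))

theorem norm_restrL2_sub (h : ω ⊆ Ω) (z : L2 Ω) (q : L2 ω) :
    ‖restrL2 h z - q‖ = normL2 ω (fun x => z x - q x) := by
  refine normL2_congr ?_
  filter_upwards [Lp.coeFn_sub (restrL2 h z) q,
    MemLp.coeFn_toLp ((Lp.memLp z).mono_measure (Measure.restrict_mono h le_rfl))] with x h1 h2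
  rw [h1, Pi.sub_apply]
  congr 1

theorem normL2_le (h : ω ⊆ Ω) (z : L2 Ω) : normL2 ω z ≤ ‖z‖ :=
  normL2_mono h (Lp.memLp z)

/-- The least squares functional is the squared distance of an element of a Hilbert space that
depends linearly on `z` to a fixed element. -/
theorem exists_lsFunctional_eq (h0 : ∀ v : Morley T, normY T v = 0 → v = 0) (hω : ω ⊆ Ω)
    (ℓd : Morley T →ₗ[ℝ] ℝ) (q : L2 ω) (ε : ℝ) :
    ∃ (Φ : L2 Ω →ₗ[ℝ] WithLp 2 (EuclideanSpace ℝ (T.cells × Fin 2 × Fin 2) ×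
        WithLp 2 (L2 ω × L2 Ω)))
      (d : WithLp 2 (EuclideanSpace ℝ (T.cells × Fin 2 × Fin 2) × WithLp 2 (L2 ω × L2 Ω))),
      (∀ z, lsFunctional ω T ℓd q ε z = ‖Φ z - d‖ ^ 2) ∧
      ∀ z, ‖Φ z‖ ^ 2 = dualNormY T (opBdLin T z) ^ 2 + normL2 ω z ^ 2 + ε ^ 2 * ‖z‖ ^ 2 := by
  obtain ⟨⟨r, hr⟩, -⟩ := exists_riesz h0
  let Φ : L2 Ω →ₗ[ℝ] WithLp 2 (EuclideanSpace ℝ (T.cells × Fin 2 × Fin 2) ×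
        WithLp 2 (L2 ω × L2 Ω)) :=
    (WithLp.linearEquiv 2 ℝ _).symm.toLinearMap ∘ₗ LinearMap.prod (r ∘ₗ opBdLin T)
      ((WithLp.linearEquiv 2 ℝ _).symm.toLinearMap ∘ₗ LinearMap.prod (restrL2 hω)
        (ε • LinearMap.id))
  refine ⟨Φ, WithLp.toLp 2 (r ℓd, WithLp.toLp 2 (q, 0)), fun z => ?_, fun z => ?_⟩
  · rw [WithLp.prod_norm_sq_eq_of_L2, WithLp.prod_norm_sq_eq_of_L2]
    change _ = ‖r (opBdLin T z) - r ℓd‖ ^ 2 + (‖restrL2 hω z - q‖ ^ 2 + ‖ε • z - 0‖ ^ 2)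
    rw [← map_sub, hr, norm_restrL2_sub, sub_zero, norm_smul, mul_pow, Real.norm_eq_abs, sq_abs,
      lsFunctional, add_assoc]
    congr 3
    funext v
    rw [LinearMap.sub_apply, opBdLin_apply]
  · rw [WithLp.prod_norm_sq_eq_of_L2, WithLp.prod_norm_sq_eq_of_L2]
    change ‖r (opBdLin T z)‖ ^ 2 + (‖restrL2 hω z‖ ^ 2 + ‖ε • z‖ ^ 2) = _
    rw [hr, norm_restrL2, norm_smul, mul_pow, Real.norm_eq_abs, sq_abs, add_assoc]

end MorleyUC
end

noncomputable section

open MeasureTheory Set Filter Topology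
namespace MorleyUC

variable {Ω ω : Set Plane} {T : Triangulation Ω}

theorem opB_eq_inner (z : L2 Ω) (v : H20 Ω) : opB Ω z v = -inner ℝ z (lap Ω v) := rfl

theorem opB_sub (z z' : L2 Ω) : opB Ω (z - z') = opB Ω z - opB Ω z' := by
  ext v
  rw [sub_apply, opB_eq_inner, opB_eq_inner, opB_eq_inner, inner_sub_left]
  ring

theorem norm_opB_le_norm (z : L2 Ω) : ‖opB Ω z‖ ≤ 2 * ‖z‖ := by
  refine ContinuousLinearMap.opNorm_le_bound _ (by positivity) fun v => ?_
  rw [opB_eq_inner, norm_neg]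
  have h1 : ‖lap Ω (v : JetSpace Ω)‖ ≤ 2 * ‖v‖ := by
    rw [lap_apply]
    refine (norm_add_le _ _).trans ?_
    have := PiLp.norm_apply_le (v : JetSpace Ω) (Sum.inr (Sum.inr (0, 0)))
    have := PiLp.norm_apply_le (v : JetSpace Ω) (Sum.inr (Sum.inr (1, 1)))
    rw [Submodule.coe_norm]
    linarith
  calc _ ≤ ‖z‖ * ‖lap Ω (v : JetSpace Ω)‖ := norm_inner_le_norm _ _
    _ ≤ ‖z‖ * (2 * ‖v‖) := by gcongr
    _ = _ := by ring

/-- A function in `L₂(Ω)` with `B z = 0` that vanishes on `ω` is zero. -/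
theorem eq_zero_of_opB_eq_zero (hΩ : IsOpen Ω) (hΩc : IsConnected Ω)
    (hb : Bornology.IsBounded Ω) (hω : IsOpen ω) (hωn : ω.Nonempty) (hωΩ : ω ⊆ Ω) {z : L2 Ω}
    (h1 : opB Ω z = 0) (h2 : normL2 ω z = 0) : z = 0 := by
  obtain ⟨f, hf, hzf⟩ := exists_harmonic_of_opB_eq_zero hΩ hb h1
  have h3 := normL2_eq_zero_of_harmonic hΩ hΩc hb hω hωn hωΩ hf ((memLp_congr_ae hzf).1 (Lp.memLp z))
    (by rw [← normL2_congr (ae_mono (Measure.restrict_mono hωΩ le_rfl) hzf), h2])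
  refine Lp.ext ?_
  filter_upwards [hzf, Lp.coeFn_zero ℝ 2 (volume.restrict Ω), ae_restrict_mem hΩ.measurableSet]
    with x e1 e2 hx
  rw [e1, e2, h3 x hx]; rfl

theorem norm_opB_le_dualNormY (hb : Bornology.IsBounded Ω)
    (h0 : ∀ v : Morley T, normY T v = 0 → v = 0) {z : L2 Ω} (hz : z ∈ pwConst T) :
    ‖opB Ω z‖ ≤ dualNormY T (opBdLin T z) :=
  norm_opB_le hb hz (dualNormY_nonneg _) fun v => by
    rw [← opBdLin_apply]; exact (exists_riesz h0).2 _ v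

theorem existsUnique_lsSolution (hΩc : IsConnected Ω) (hb : Bornology.IsBounded Ω)
    (hω : IsOpen ω) (hωn : ω.Nonempty) (hωΩ : ω ⊆ Ω)
    (h0 : ∀ v : Morley T, normY T v = 0 → v = 0) (ℓd : Morley T →ₗ[ℝ] ℝ) (q : L2 ω) (ε : ℝ) :
    ∃! w : L2 Ω, IsLSSolution ω T ℓd q ε w := by
  obtain ⟨Φ, d, hd, hΦ⟩ := exists_lsFunctional_eq h0 hωΩ ℓd q ε
  have := finiteDimensional_pwConst T
  have h := existsUnique_leastSquares (pwConst T) Φ (fun z hz hz0 => ?_) d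
  · refine (existsUnique_congr fun w => and_congr_right fun _ => forall₂_congr fun z _ => ?_).1 h
    rw [hd, hd, sq_le_sq₀ (norm_nonneg _) (norm_nonneg _)]
  · have h1 := hΦ z
    rw [hz0, norm_zero] at h1
    have e1 := sq_nonneg (dualNormY T (opBdLin T z))
    have e2 := sq_nonneg (normL2 ω z)
    have e3 : 0 ≤ ε ^ 2 * ‖z‖ ^ 2 := by positivity
    refine eq_zero_of_opB_eq_zero T.isOpen hΩc hb hω hωn hωΩ ?_
      (pow_eq_zero_iff two_ne_zero |>.1 (by linarith))
    have e4 : dualNormY T (opBdLin T z) = 0 := pow_eq_zero_iff two_ne_zero |>.1 (by linarith)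
    have e5 := norm_opB_le_dualNormY hb h0 hz
    rw [e4] at e5
    exact (norm_le_zero_iff (E := HNeg2 Ω)).1 e5

theorem le_dataErr (u : L2 Ω) (ℓ : HNeg2 Ω) (q : L2 ω) :
    ‖opB Ω u - ℓ‖ ≤ dataErr u ℓ q ∧ normL2 ω (fun x => u x - q x) ≤ dataErr u ℓ q := by
  constructor <;> refine Real.le_sqrt_of_sq_le ?_
  · linarith [sq_nonneg (normL2 ω (fun x => u x - q x))]
  · linarith [sq_nonneg ‖opB Ω u - ℓ‖]

theorem normA_le (z : L2 Ω) : normA ω z ≤ ‖opB Ω z‖ + normL2 ω z :=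
  Real.sqrt_le_iff.2 ⟨add_nonneg (opB Ω z).opNorm_nonneg (normL2_nonneg _ _), by
    nlinarith [mul_nonneg (opB Ω z).opNorm_nonneg (normL2_nonneg ω z)]⟩

theorem le_normA (z : L2 Ω) : ‖opB Ω z‖ ≤ normA ω z ∧ normL2 ω z ≤ normA ω z := by
  constructor <;> refine Real.le_sqrt_of_sq_le ?_
  · linarith [sq_nonneg (normL2 ω z)]
  · linarith [sq_nonneg ‖opB Ω z‖]

theorem normL2_add_le (h : ω ⊆ Ω) (z z' : L2 Ω) :
    normL2 ω (z + z' : L2 Ω) ≤ normL2 ω z + normL2 ω z' := by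
  simp only [← norm_restrL2 h, map_add]; exact norm_add_le _ _

theorem normL2_sub_le (h : ω ⊆ Ω) (z z' : L2 Ω) :
    normL2 ω (z - z' : L2 Ω) ≤ normL2 ω z + normL2 ω z' := by
  simp only [← norm_restrL2 h, map_sub]; exact norm_sub_le _ _

section Companion

variable {n : Finset Plane → Plane} {sel : Plane → Finset Plane} {E : Morley T →ₗ[ℝ] H20 Ω}

theorem IsCompanion.opBd_sub_eq_zero (hb : Bornology.IsBounded Ω) (hn : T.IsNormalField n)
    (hE : IsCompanion T n sel E) {z : L2 Ω} (hz : z ∈ pwConst T) (v : Morley T) :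
    opBd T z (morleyJet T v - (E v : JetSpace Ω)) = 0 := by
  obtain ⟨w, hw, hfn⟩ := hE.exists_fn hb hn v
  exact MorleyUC.opBd_sub_eq_zero hb hw (E v).2 hfn hz

theorem IsCompanion.opBd_eq (hb : Bornology.IsBounded Ω) (hn : T.IsNormalField n)
    (hE : IsCompanion T n sel E) {z : L2 Ω} (hz : z ∈ pwConst T) (v : Morley T) :
    opBd T z (morleyJet T v) = opB Ω z (E v) := by
  have h := hE.opBd_sub_eq_zero hb hn hz v
  rw [opBd_eq_inner, map_sub, inner_sub_right] at h
  rw [opBd_eq_inner, opB_eq_inner]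
  linarith

theorem IsCompanion.eq_zero_of_normY (hb : Bornology.IsBounded Ω) {ρ : ℝ} (hρ : 0 < ρ)
    (hT : T.ShapeRegular ρ) (hn : T.IsNormalField n) (hsel : T.IsSelection sel)
    (hE : IsCompanion T n sel E) (v : Morley T) (hv : normY T v = 0) : v = 0 := by
  obtain ⟨w, hw, -⟩ := hE.exists_fn hb hn v
  exact eq_zero_of_normY_eq_zero hb hρ hT hsel hw hv

theorem dist_lsSolution_le (hb : Bornology.IsBounded Ω) (hωΩ : ω ⊆ Ω)
    (h0 : ∀ v : Morley T, normY T v = 0 → v = 0) {ℓd : Morley T →ₗ[ℝ] ℝ} {q : L2 ω} {ε : ℝ}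
    (hε : 0 ≤ ε) {w z : L2 Ω} (hw : IsLSSolution ω T ℓd q ε w) (hz : z ∈ pwConst T) {R : ℝ}
    (hR : dualNormY T (fun v => opBd T z (morleyJet T v) - ℓd v) +
      normL2 ω (fun x => z x - q x) + ε * ‖z‖ ≤ R) :
    ‖opB Ω (w - z)‖ ≤ 2 * R ∧ normL2 ω (w - z : L2 Ω) ≤ 2 * R ∧ ε * ‖w - z‖ ≤ 2 * R := by
  obtain ⟨Φ, d, hd, hΦ⟩ := exists_lsFunctional_eq h0 hωΩ ℓd q ε
  have a1 := dualNormY_nonneg (fun v : Morley T => opBd T z (morleyJet T v) - ℓd v)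
  have a2 := normL2_nonneg ω (fun x => z x - q x)
  have a3 : 0 ≤ ε * ‖z‖ := by positivity
  have hR0 : 0 ≤ R := by linarith
  have h1 : ‖Φ z - d‖ ≤ R := by
    refine le_of_sq_le_sq ?_ hR0
    rw [← hd, lsFunctional]
    refine le_trans ?_ (pow_le_pow_left₀ (by positivity) hR 2)
    nlinarith [mul_nonneg a1 a2, mul_nonneg a1 a3, mul_nonneg a2 a3]
  have h2 : ‖Φ w - d‖ ≤ R := by
    refine le_trans (le_of_sq_le_sq ?_ (norm_nonneg _)) h1
    rw [← hd, ← hd]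
    exact hw.2 z hz
  have h3 : ‖Φ (w - z)‖ ^ 2 ≤ (2 * R) ^ 2 := by
    refine pow_le_pow_left₀ (norm_nonneg _) ?_ 2
    rw [map_sub, ← sub_sub_sub_cancel_right _ _ d]
    refine (norm_sub_le _ _).trans (by linarith)
  rw [hΦ] at h3
  have b1 := sq_nonneg (dualNormY T (opBdLin T (w - z)))
  have b2 := sq_nonneg (normL2 ω (w - z : L2 Ω))
  have b3 : 0 ≤ ε ^ 2 * ‖w - z‖ ^ 2 := by positivity
  refine ⟨?_, ?_, ?_⟩
  · refine (norm_opB_le_dualNormY hb h0 (Submodule.sub_mem _ hw.1 hz)).trans ?_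
    exact le_of_sq_le_sq (by linarith) (by positivity)
  · exact le_of_sq_le_sq (by linarith) (by positivity)
  · refine le_of_sq_le_sq ?_ (by positivity)
    rw [mul_pow]; linarith

end Companion

/-- The error estimate for the regularized least squares solution. -/
theorem exists_error_bound (hb : Bornology.IsBounded Ω) (hωΩ : ω ⊆ Ω) {ρ : ℝ} (hρ : 0 < ρ)
    (ε₀ : ℝ) : ∃ C : ℝ, 0 < C ∧ ∀ T : Triangulation Ω, T.ShapeRegular ρ →
      ∀ n, T.IsNormalField n → ∀ sel, T.IsSelection sel →
      ∀ E : Morley T →ₗ[ℝ] H20 Ω, IsCompanion T n sel E →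
      ∀ (ℓ : HNeg2 Ω) (q : L2 ω) (u : L2 Ω) (ε : ℝ), 0 ≤ ε → ε ≤ ε₀ →
      ∀ w : L2 Ω, IsLSSolution ω T (fun v => ℓ (E v)) q ε w →
        normA ω (u - w) + ε * ‖u - w‖ ≤ C * (dataErr u ℓ q + apprErr T u + ε * ‖u‖) := by
  obtain ⟨CE, hCE, hE⟩ := exists_companion_bound hb hρ
  obtain ⟨C₁, hC₁⟩ : ∃ C₁, C₁ = 2 * CE + 1 + |ε₀| := ⟨_, rfl⟩
  have hC₁0 : 0 < C₁ := by rw [hC₁]; positivity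
  refine ⟨3 + |ε₀| + 6 * C₁, by positivity,
    fun T hT n hn sel hsel E hEc ℓ q u ε hε hε₀ w hw => ?_⟩
  have hε' : ε ≤ |ε₀| := hε₀.trans (le_abs_self _)
  have h0 := hEc.eq_zero_of_normY hb hρ hT hn hsel
  obtain ⟨hD1, hD2⟩ := le_dataErr u ℓ q
  have hD0 : 0 ≤ dataErr u ℓ q := Real.sqrt_nonneg _
  obtain ⟨D, hD⟩ : ∃ D, D = dataErr u ℓ q := ⟨_, rfl⟩
  rw [← hD] at hD0 hD1 hD2 ⊢
  have key : ∀ z : pwConst T, normA ω (u - w) + ε * ‖u - w‖ ≤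
      (3 + |ε₀| + 6 * C₁) * (D + ‖u - (z : L2 Ω)‖ + ε * ‖u‖) := by
    rintro ⟨z, hz⟩
    dsimp only
    obtain ⟨A, hA⟩ : ∃ A, A = ‖u - z‖ := ⟨_, rfl⟩
    have hA0 : 0 ≤ A := hA ▸ norm_nonneg _
    have hu0 : 0 ≤ ε * ‖u‖ := by positivity
    have hεA : ε * A ≤ |ε₀| * A := by gcongr
    have e1 : dualNormY T (fun v => opBd T z (morleyJet T v) - ℓ (E v)) ≤ (2 * A + D) * CE := by
      refine dualNormY_le (by positivity) fun v => ?_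
      obtain ⟨f, hf, hfn⟩ := hEc.exists_fn hb hn v
      have h1 := hE T hT sel hsel v f hf (E v) (E v).2 hfn
      rw [hEc.opBd_eq hb hn hz, ← sub_apply]
      have h2 : ‖opB Ω z - ℓ‖ ≤ 2 * A + D := by
        have : opB Ω z - ℓ = opB Ω (z - u) + (opB Ω u - ℓ) := by rw [opB_sub]; abel
        rw [this]
        refine ((opB Ω (z - u)).opNorm_add_le _).trans (add_le_add ((norm_opB_le_norm _).trans ?_) hD1)
        rw [norm_sub_rev, hA]
      calc _ ≤ ‖opB Ω z - ℓ‖ * ‖E v‖ := (opB Ω z - ℓ).le_opNorm _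
        _ ≤ (2 * A + D) * (CE * normY T v) := by gcongr; exact h1
        _ = _ := by ring
    have e2 : normL2 ω (fun x => z x - q x) ≤ A + D := by
      rw [← norm_restrL2_sub hωΩ] at hD2 ⊢
      have : restrL2 hωΩ z - q = restrL2 hωΩ (z - u) + (restrL2 hωΩ u - q) := by
        rw [map_sub]; abel
      rw [this]
      refine (norm_add_le _ _).trans (add_le_add ?_ hD2)
      rw [norm_restrL2, hA, norm_sub_rev]
      exact normL2_le hωΩ _
    have e3 : ε * ‖z‖ ≤ ε * ‖u‖ + |ε₀| * A := by
      have : ‖z‖ ≤ ‖u‖ + A := by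
        rw [hA, norm_sub_rev]; exact norm_le_norm_add_norm_sub' z u
      nlinarith
    have e4 : dualNormY T (fun v => opBd T z (morleyJet T v) - ℓ (E v)) +
        normL2 ω (fun x => z x - q x) + ε * ‖z‖ ≤ C₁ * (D + A + ε * ‖u‖) := by
      rw [hC₁]
      nlinarith [mul_nonneg hCE.le hD0, mul_nonneg (abs_nonneg ε₀) hD0,
        mul_nonneg (abs_nonneg ε₀) hu0, mul_nonneg hCE.le hu0]
    obtain ⟨f1, f2, f3⟩ := dist_lsSolution_le (ℓd := (ℓ : H20 Ω →ₗ[ℝ] ℝ) ∘ₗ E) hb hωΩ h0 hε hw hz e4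
    have hsplit : u - w = (u - z) - (w - z) := by abel
    have g1 : ‖opB Ω (u - w)‖ ≤ 2 * A + 2 * (C₁ * (D + A + ε * ‖u‖)) := by
      rw [hsplit, opB_sub]
      refine (norm_sub_le (E := HNeg2 Ω) _ _).trans (add_le_add (a := ‖opB Ω (u - z)‖) ?_ f1)
      rw [hA]; exact norm_opB_le_norm _
    have g2 : normL2 ω (u - w : L2 Ω) ≤ A + 2 * (C₁ * (D + A + ε * ‖u‖)) := by
      rw [hsplit]
      refine (normL2_sub_le hωΩ _ _).trans (add_le_add ?_ f2)
      rw [hA]; exact normL2_le hωΩ _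
    have g3 : ε * ‖u - w‖ ≤ |ε₀| * A + 2 * (C₁ * (D + A + ε * ‖u‖)) := by
      have : ‖u - w‖ ≤ A + ‖w - z‖ := by rw [hsplit, hA]; exact norm_sub_le _ _
      nlinarith
    have g4 := normA_le (ω := ω) (u - w)
    rw [← hA]
    nlinarith [mul_nonneg (abs_nonneg ε₀) hD0, mul_nonneg (abs_nonneg ε₀) hu0]
  have hCpos : 0 < 3 + |ε₀| + 6 * C₁ := by positivity
  have h1 : (normA ω (u - w) + ε * ‖u - w‖) / (3 + |ε₀| + 6 * C₁) - D - ε * ‖u‖ ≤ apprErr T u := by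
    refine le_ciInf fun z => ?_
    have := (div_le_iff₀' hCpos).2 (key z)
    linarith
  rw [← div_le_iff₀' hCpos]
  linarith

/-- Local error bounds from the propagation of smallness of harmonic functions. -/
theorem exists_local_bound (hΩ : IsOpen Ω) (hb : Bornology.IsBounded Ω) {G : Set Plane}
    (hωG : ω ⊆ G) (hGΩ : G ⊆ Ω) {α : ℝ} (hα : IsPropagationExponent Ω ω G α) {a b : ℝ}
    (ha : 0 < a) (hb' : 0 < b) : ∃ C : ℝ, 0 < C ∧ ∀ (e : L2 Ω) (D M : ℝ), 0 ≤ D → D ≤ M →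
      normA ω e ≤ a * D → ‖e‖ ≤ b * M → normL2 G e ≤ C * D ^ α * M ^ (1 - α) := by
  obtain ⟨hα0, hα1, C₂, hC₂⟩ := hα
  obtain ⟨C₁, hC₁, hdec⟩ := exists_decomposition hb
  have hωΩ := hωG.trans hGΩ
  refine ⟨C₁ * a + |C₂| * (a + C₁ * a) ^ α * (b + C₁ * a) ^ (1 - α), by positivity,
    fun e D M hD hDM hA he => ?_⟩
  have hM : 0 ≤ M := hD.trans hDM
  obtain ⟨e₀, h, heq, he₀, hh⟩ := hdec e
  obtain ⟨f, hf, hhf⟩ := exists_harmonic_of_opB_eq_zero hΩ hb hh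
  have h1 : ‖e₀‖ ≤ C₁ * a * D := by
    refine he₀.trans ?_
    rw [mul_assoc]
    gcongr
    exact (le_normA e).1.trans hA
  have hsub : h = e - e₀ := by rw [heq]; abel
  have h2 : normL2 ω h ≤ (a + C₁ * a) * D := by
    rw [hsub]
    refine (normL2_sub_le hωΩ _ _).trans ?_
    have := (le_normA (ω := ω) e).2.trans hA
    have := (normL2_le hωΩ e₀).trans h1
    linarith
  have h3 : ‖h‖ ≤ (b + C₁ * a) * M := by
    rw [hsub]
    refine (norm_sub_le _ _).trans ?_
    have : C₁ * a * D ≤ C₁ * a * M := by gcongr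
    linarith
  have hcon : ∀ S ⊆ Ω, normL2 S h = normL2 S f := fun S hS =>
    normL2_congr (ae_mono (Measure.restrict_mono hS le_rfl) hhf)
  have h4 := hC₂ f ((memLp_congr_ae hhf).1 (Lp.memLp h)) hf
  rw [← hcon G hGΩ, ← hcon ω hωΩ, ← hcon Ω le_rfl, normL2_coe] at h4
  have hn := normL2_nonneg ω h
  have h5 : normL2 G h ≤ |C₂| * (a + C₁ * a) ^ α * (b + C₁ * a) ^ (1 - α) *
      (D ^ α * M ^ (1 - α)) := by
    calc _ ≤ |C₂| * normL2 ω h ^ α * ‖h‖ ^ (1 - α) := by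
          refine h4.trans ?_
          gcongr
          exact le_abs_self C₂
      _ ≤ |C₂| * ((a + C₁ * a) * D) ^ α * ((b + C₁ * a) * M) ^ (1 - α) := by
          have : 0 ≤ 1 - α := by linarith
          gcongr
      _ = _ := by
          rw [Real.mul_rpow (by positivity) hD, Real.mul_rpow (by positivity) hM]
          ring
  have h6 : D ≤ D ^ α * M ^ (1 - α) := by
    have h7 : D ^ (1 - α) ≤ M ^ (1 - α) := Real.rpow_le_rpow hD hDM (by linarith)
    calc D = D ^ α * D ^ (1 - α) := by
          rw [← Real.rpow_add' hD (by norm_num)]; norm_num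
      _ ≤ _ := by gcongr
  have h8 : normL2 G e ≤ normL2 G e₀ + normL2 G h := by
    conv_lhs => rw [heq]
    exact normL2_add_le hGΩ _ _
  have h9 : normL2 G e₀ ≤ C₁ * a * (D ^ α * M ^ (1 - α)) := by
    refine ((normL2_le hGΩ e₀).trans h1).trans ?_
    gcongr
  calc _ ≤ _ := h8
    _ ≤ C₁ * a * (D ^ α * M ^ (1 - α)) + |C₂| * (a + C₁ * a) ^ α * (b + C₁ * a) ^ (1 - α) *
      (D ^ α * M ^ (1 - α)) := add_le_add h9 h5
    _ = _ := by ring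

end MorleyUC
end

theorem theorem6p1 (Ω ω : Set Plane) (hΩ : IsOpen Ω) (hΩc : IsConnected Ω)
    (hΩb : Bornology.IsBounded Ω)
    (hω : IsOpen ω) (hωc : IsConnected ω) (hωΩ : closure ω ⊆ Ω)
    (ρ : ℝ) (hρ : 0 < ρ) (ε₀ : ℝ) :
    -- the companion operator is well-defined, the consistency condition without oscillation term,
    -- and the resulting error bound
    (∃ C : ℝ, 0 < C ∧ ∀ T : Triangulation Ω, T.ShapeRegular ρ →
      ∀ n, T.IsNormalField n → ∀ sel, T.IsSelection sel →
        (∃! E : Morley T →ₗ[ℝ] H20 Ω, IsCompanion T n sel E) ∧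
        ∀ E : Morley T →ₗ[ℝ] H20 Ω, IsCompanion T n sel E →
          ∀ (ℓ : HNeg2 Ω) (q : L2 ω) (u : L2 Ω),
            Consistent T E ℓ (fun v => ℓ (E v)) u 0 C ∧
            ∀ ε : ℝ, 0 ≤ ε → ε ≤ ε₀ →
              (∃! w : L2 Ω, IsLSSolution ω T (fun v => ℓ (E v)) q ε w) ∧
              ∀ w : L2 Ω, IsLSSolution ω T (fun v => ℓ (E v)) q ε w →
              normA ω (u - w) + ε * ‖u - w‖ ≤
                C * (dataErr u ℓ q + apprErr T u + ε * ‖u‖)) ∧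
    -- the local error bound on subdomains
    (∀ G : Set Plane, IsOpen G → IsConnected G → ω ⊆ G → closure G ⊆ Ω →
      (∃ α : ℝ, α < 1 ∧ IsPropagationExponent Ω ω G α) ∧
      ∀ α : ℝ, IsPropagationExponent Ω ω G α → ∀ c₁ c₂ : ℝ, 0 < c₁ → 0 < c₂ →
        ∃ C : ℝ, 0 < C ∧ ∀ T : Triangulation Ω, T.ShapeRegular ρ →
          ∀ n, T.IsNormalField n → ∀ sel, T.IsSelection sel →
          ∀ E : Morley T →ₗ[ℝ] H20 Ω, IsCompanion T n sel E →
          ∀ (ℓ : HNeg2 Ω) (q : L2 ω) (u : L2 Ω) (ε : ℝ), 0 < ε → ε ≤ ε₀ →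
            c₁ * (dataErr u ℓ q + apprErr T u) ≤ ε * ‖u‖ →
            ε * ‖u‖ ≤ c₂ * (dataErr u ℓ q + apprErr T u) →
            ∀ w : L2 Ω, IsLSSolution ω T (fun v => ℓ (E v)) q ε w →
              normL2 G (fun x => u x - w x) ≤
                C * (dataErr u ℓ q + apprErr T u) ^ α *
                  max (dataErr u ℓ q + apprErr T u) ‖u‖ ^ (1 - α)) := by
  have hωΩ' : ω ⊆ Ω := subset_closure.trans hωΩ
  obtain ⟨C, hC, hbound⟩ := exists_error_bound hΩb hωΩ' hρ ε₀
  refine ⟨⟨C, hC, fun T hT n hn sel hsel => ⟨existsUnique_companion hΩb hn hsel,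
    fun E hE ℓ q u => ⟨fun z hz v => ?_, fun ε hε hε₀ => ⟨?_, fun w hw => ?_⟩⟩⟩⟩,
    fun G hG hGc hωG hGΩ => ⟨?_, fun α hα c₁ c₂ hc₁ hc₂ => ?_⟩⟩
  · rw [hE.opBd_sub_eq_zero hΩb hn hz v, zero_add, sub_self, abs_zero]
    have := normY_nonneg v
    positivity
  · exact existsUnique_lsSolution hΩc hΩb hω hωc.nonempty hωΩ'
      (hE.eq_zero_of_normY hΩb hρ hT hn hsel) ((ℓ : H20 Ω →ₗ[ℝ] ℝ) ∘ₗ E) q ε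
  · exact hbound T hT n hn sel hsel E hE ℓ q u ε hε hε₀ w hw
  · exact exists_isPropagationExponent hΩ hΩc hΩb hω hωc.nonempty hωΩ' hG hGΩ
  · obtain ⟨C', hC', hloc⟩ := exists_local_bound hΩ hΩb hωG (subset_closure.trans hGΩ) hα
      (a := C * (1 + c₂)) (b := C * (1 / c₁ + 1)) (by positivity) (by positivity)
    refine ⟨C', hC', fun T hT n hn sel hsel E hE ℓ q u ε hε hε₀ h1 h2 w hw => ?_⟩
    have h3 := hbound T hT n hn sel hsel E hE ℓ q u ε hε.le hε₀ w hw
    have hD0 : 0 ≤ dataErr u ℓ q + apprErr T u :=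
      add_nonneg (Real.sqrt_nonneg _) (Real.iInf_nonneg fun _ => norm_nonneg _)
    obtain ⟨D, hD⟩ : ∃ D, D = dataErr u ℓ q + apprErr T u := ⟨_, rfl⟩
    rw [← hD] at h1 h2 h3 hD0 ⊢
    have hA0 : 0 ≤ normA ω (u - w) := Real.sqrt_nonneg _
    have hcoe : normL2 G (fun x => u x - w x) = normL2 G (u - w : L2 Ω) :=
      normL2_congr (ae_mono (Measure.restrict_mono (subset_closure.trans hGΩ) le_rfl)
        (Lp.coeFn_sub u w).symm)
    rw [hcoe]
    refine hloc (u - w) D _ hD0 (le_max_left _ _) ?_ ?_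
    · have : 0 ≤ ε * ‖u - w‖ := by positivity
      have h4 : C * (D + ε * ‖u‖) ≤ C * (D + c₂ * D) := by gcongr
      linarith
    · refine le_trans ?_ (mul_le_mul_of_nonneg_left (le_max_right D ‖u‖) (by positivity))
      have h5 : D ≤ ε * ‖u‖ / c₁ := by rw [le_div_iff₀ hc₁]; linarith
      have h6 : C * (D + ε * ‖u‖) ≤ C * (ε * ‖u‖ / c₁ + ε * ‖u‖) := by gcongr
      refine le_of_mul_le_mul_left (a := ε) ?_ hε
      calc ε * ‖u - w‖ ≤ C * (ε * ‖u‖ / c₁ + ε * ‖u‖) := by linarith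
        _ = _ := by ring
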